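/- **Setting.** $\kappa$ is the security parameter. All algorithms and adversaries have oracle access to a common hash oracle $H$, drawn at the start of every experiment from a distribution $\mathcal H_\kappa$, which is arbitrary (in particular a random oracle, or a fixed function). PPT means uniform probabilistic polynomial time: the running time is bounded by a polynomial in the size of the input, for all coins and all oracle replies (receiving a reply costs its size). "Negligible" means $o(\kappa^{-c})$ for all $c$. Algorithms receive $1^\kappa$ implicitly. **Tagging scheme** $\mathsf{TAG}=(\mathsf{TagSetup},\mathsf{TagKGen},\mathsf{TagEval})$: PPT algorithms, the last two deterministic and depending on $\mathsf{pp}\leftarrow\mathsf{TagSetup}(1^\kappa)$, that map a secret key $\mathsf{csk}\in\mathcal K=\{0,1\}^\kappa\times\{0,1\}^\kappa$ to a public key in $\mathcal P$ and a tag in $\mathcal T$, where $\mathcal P,\mathcal T$ are sets of bit strings of polynomial lengths depending on $\kappa$. It is *secure* if, for every PPT adversary, each of the following is negligible. *One-wayness:* the probability that, given $\mathsf{pp}$ and $\mathsf{tag}=\mathsf{TagEval}(\mathsf{csk})$, $\mathsf{cpk}=\mathsf{TagKGen}(\mathsf{csk})$ for a uniform $\mathsf{csk}\in\mathcal K$,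 it outputs $\mathsf{csk}^*\in\mathcal K$ with $\mathsf{TagEval}(\mathsf{csk}^*)=\mathsf{tag}$. *Collision resistance:* the probability that, given $\mathsf{pp}$, it outputs $\mathsf{csk}\ne\mathsf{csk}'$ in $\mathcal K$ with $\mathsf{TagKGen}(\mathsf{csk})=\mathsf{TagKGen}(\mathsf{csk}')$. *Pseudorandomness:* the advantage in distinguishing $(\mathsf{pp},\mathsf{TagEval}(\mathsf{csk}),\mathsf{TagKGen}(\mathsf{csk}))$, $\mathsf{csk}$ uniform, from $(\mathsf{pp},t,p)$ with $(t,p)$ uniform in $\mathcal T\times\mathcal P$. **Merkle tree** $\mathsf{MT}=(\mathsf{Init},\mathsf{Prove},\mathsf{Verify})$ over $\mathcal P$: deterministic polynomial-time algorithms with a set $\mathcal N$ of supported list lengths that contains all powers of $2$; $\mathsf{Init}$ maps a list to a root and may answer $\bot$ to lists that are not lists over $\mathcal P$ of a length in $\mathcal N$. It is *secure* if it is correct (on every list that $\mathsf{Init}$ accepts, honest paths verify) and no PPT adversary outputs, except with negligible probability, a list $(x_i)_{i=1}^n$ accepted by $\mathsf{Init}$ and $(j,x,\mathsf{path})$ with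 $\mathsf{Verify}(j,x,\mathsf{Init}((x_i)_i),\mathsf{path})=1$ although $x$ is not the $j$-th element of the list. **zk-SNARK** $\Pi=(\mathsf{Setup},\mathsf{Prove},\mathsf{Verify})$ with PPT algorithms, for the circuit $C_{\mathsf{fixed}}$ determined by $\mathsf{pp}\leftarrow\mathsf{TagSetup}(1^\kappa)$, whose relation consists of the pairs $(\mathsf{st},\mathsf{tag},m);(i,\mathsf{csk},\mathsf{path})$ with $m\in\mathcal M$, $\mathsf{csk}\in\mathcal K$, $\mathsf{MT.Verify}(i,\mathsf{TagKGen}(\mathsf{csk}),\mathsf{st},\mathsf{path})=1$, $\mathsf{tag}=\mathsf{TagEval}(\mathsf{csk})$; $\mathcal M=\{0,1\}^{\ell(\kappa)}$ is the message space, where $1^{\ell(\kappa)}$ is computable from $1^\kappa$ in polynomial time. $\Pi$ is *secure* if it is perfectly complete and there is a PPT simulator $(\mathsf{SimSetup},\mathsf{SimProve})$, where $\mathsf{SimSetup}(1^\kappa,C_{\mathsf{fixed}})$ outputs simulated keys and a trapdoor $\tau$, such that both of the following hold. *Zero knowledge:* no PPT adversary given $\mathsf{pp}$ distinguishes with non-negligible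 advantage real keys and an oracle for honest proofs from simulated keys and an oracle for simulated proofs, where both oracles take $(\mathsf{stmt},\mathsf{wit})$ and answer $\bot$ if the pair is not in the relation. *Simulation extractability:* for every PPT $\mathcal A$ there is a PPT extractor $\mathcal X$ such that, when $\mathcal A$ is run on $\mathsf{pp}$ and simulated keys with an oracle for simulated proofs of arbitrary statements and outputs $(\mathsf{stmt},\pi)$, the probability is negligible that $\pi$ verifies, $\mathsf{stmt}$ was not asked to the oracle, and the output of $\mathcal X$ on $\mathsf{pp}$, the keys and the transcript of $\mathcal A$ (its coins and the oracle replies) is not a witness of $\mathsf{stmt}$. **Construction** $\mathsf{DTL}_{\mathsf{fixed}}$, with a fixed data item $\mathsf{data}_{\mathsf{fixed}}$. $\mathsf{Setup}$: $\mathsf{pp}\leftarrow\mathsf{TagSetup}(1^\kappa)$, $(\mathsf{prvK},\mathsf{vrfyK})\leftarrow\Pi.\mathsf{Setup}(1^\kappa,C_{\mathsf{fixed}})$; output $(\mathsf{prvK},\mathsf{vrfyK},\mathsf{pp},\mathsf{data}_{\mathsf{fixed}})$. $\mathsf{Create}$ (the data argument is ignored): $\mathsf{csk}$ uniform in $\mathcal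 K$, $\mathsf{cpk}=\mathsf{TagKGen}(\mathsf{csk})$. $\mathsf{Accumulate}(L)=\mathsf{MT.Init}(L)$. $\mathsf{Redeem}(L,\mathsf{csk},m)$: $\bot$ if $\mathsf{TagKGen}(\mathsf{csk})\notin L$ or $\mathsf{Accumulate}(L)=\bot$; otherwise, with $j$ the (first) position of $\mathsf{TagKGen}(\mathsf{csk})$ in $L$, output $\mathsf{tag}=\mathsf{TagEval}(\mathsf{csk})$ and $\pi\leftarrow\Pi.\mathsf{Prove}(\mathsf{prvK},(\mathsf{Accumulate}(L),\mathsf{tag},m),(j,\mathsf{csk},\mathsf{path}_j))$, $\mathsf{path}_j$ being the honest Merkle proof. $\mathsf{Verify}(\mathsf{st},\mathsf{tag},\pi,m)=\Pi.\mathsf{Verify}(\mathsf{vrfyK},(\mathsf{st},\mathsf{tag},m),\pi)$. **Oracles.** $\mathsf{Create}\mathcal O(\mathsf{data})$ runs $\mathsf{Create}$, stores $(\mathsf{cpk},\mathsf{csk})$ in $C$ and returns $\mathsf{cpk}$. $\mathsf{Redeem}\mathcal O(L,i,m)$, for $m\in\mathcal M$, looks up a pair $(\mathsf{cpk}^*,\mathsf{csk}^*)\in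 C$ with $\mathsf{cpk}^*=L_i$, runs $\mathsf{Redeem}(L,\mathsf{csk}^*,m)$, stores $(\mathsf{Accumulate}(L),\mathsf{cpk}^*,\mathsf{tag},\pi,m)$ in $R$ and returns $(\mathsf{tag},\pi)$; it returns $\bot$ where this is not defined. **Theorem.** If $\Pi$, $\mathsf{MT}$ and $\mathsf{TAG}$ are secure as above, then $\mathsf{DTL}_{\mathsf{fixed}}$ satisfies: 1. *Correctness.* For all $\kappa$, $n\in\mathcal N$, all data $\mathsf{data}_1,\dots,\mathsf{data}_n$ and $m\in\mathcal M$: if $n$ key pairs are created for the data and each key is redeemed with message $m$ from the list of the $n$ public keys, then all the redemptions verify, with probability $1$. 2. *No one-more redeeming.* Every PPT adversary, given the public parameters of $\mathsf{DTL}_{\mathsf{fixed}}$, outputs only with negligible probability a list $L$ of $n$ public keys (any $n$) and $n+1$ triples $(\mathsf{tag}_j,\pi_j,m_j)$ with pairwise distinct tags that all verify for $\mathsf{Accumulate}(L)$. 3. *Theft prevention.* Every PPT adversary with the public parameters and both oracles outputs only with negligible probability $(L,\mathsf{tag},\pi,m)$ such that $\mathsf{Verify}(\mathsf{st},\mathsf{tag},\pi,m)=1$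 for $\mathsf{st}=\mathsf{Accumulate}(L)$, every key of $L$ occurs in $C$, and $(\mathsf{st},\cdot,\mathsf{tag},\cdot,m)\notin R$. 4. *Non-slanderability.* Every PPT adversary with the public parameters and both oracles outputs only with negligible probability $(\mathsf{cpk},\mathsf{cpk}^*),(\mathsf{tag}^*,\pi^*,m^*)$ such that, for $\mathsf{st}=\mathsf{Accumulate}((\mathsf{cpk},\mathsf{cpk}^*))$, a uniform $m\in\mathcal M$ and $(\mathsf{tag},\pi)\leftarrow\mathsf{Redeem}\mathcal O((\mathsf{cpk},\mathsf{cpk}^*),1,m)$: $\mathsf{cpk}$ occurs in $C$, $\mathsf{tag}=\mathsf{tag}^*$, $\mathsf{Verify}(\mathsf{st},\mathsf{tag}^*,\pi^*,m^*)=1$, and $(\mathsf{st},\cdot,\mathsf{tag},\cdot,m^*)\notin R$. 5. *Unlinkability.* For every two-stage PPT adversary, $|\Pr[\text{success}]-\frac12|$ is negligible in this experiment: given the public parameters and a uniform $m\in\mathcal M$, the first stage chooses $\mathsf{data}_0,\mathsf{data}_1$; key pairs $(\mathsf{cpk}_0,\mathsf{csk}_0),(\mathsf{cpk}_1,\mathsf{csk}_1)$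 are created (not through the oracle) and both are redeemed from $(\mathsf{cpk}_0,\mathsf{cpk}_1)$ with message $m$, giving $\rho_0,\rho_1$; for a uniform bit $b$ the second stage, which has both oracles, gets $\mathsf{cpk}_0,\mathsf{cpk}_1,\rho_{b},\rho_{1-b}$ and outputs a bit; success means that this bit is $b$ and that $R$ has no entry with public key $\mathsf{cpk}_0$ or $\mathsf{cpk}_1$. -/

import Mathlib

/-! Uniform probabilistic polynomial time, cryptographic primitives, the data tumbling layer and its
security experiments. -/

namespace Tumbling

noncomputable section

/-! ## Data values -/

/-- Data values: binary trees. Every tree is also a list of trees (its right spine), see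
`Val.toList` and `Val.ofList`. -/
inductive Val : Type
  | nil : Val
  | cons : Val → Val → Val
  deriving DecidableEq

namespace Val

/-- Number of nodes. -/
def size : Val → ℕ
  | nil => 1
  | cons a b => a.size + b.size + 1

def fst : Val → Val
  | nil => nil
  | cons a _ => a

def snd : Val → Val
  | nil => nil
  | cons _ b => b

def toList : Val → List Val
  | nil => []
  | cons a b => a :: b.toList

def ofList : List Val → Val
  | [] => nil
  | a :: l => cons a (ofList l)

/-- The unary numeral `1ⁿ`. -/
def unary (n : ℕ) : Val := ofList (List.replicate n nil)

/-- The number denoted by a unary numeral. -/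
def toNat (v : Val) : ℕ := v.toList.length

/-- The `i`-th component (counted from `0`) of a tuple, `nil` if there is none. -/
def get (v : Val) (i : ℕ) : Val := v.toList.getD i nil

def ofBool : Bool → Val
  | false => nil
  | true => cons nil nil

/-- `nil` plays the role of `⊥`. -/
def toOption : Val → Option Val
  | nil => none
  | cons a b => some (cons a b)

/-- What is delivered of a value into a buffer of size `n`. -/
def fit (n : ℕ) (v : Val) : Val := if v.size ≤ n then v else nil

end Val

open Val

/-- Bit strings of length `n`. -/
def bitStrings (n : ℕ) : Set Val :=
  {v | ∃ f : Fin n → Bool, v = ofList ((List.ofFn f).map ofBool)}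

/-- A uniformly random bit string of length `n`. -/
def uniformBits (n : ℕ) : PMF Val :=
  (PMF.uniformOfFintype (Fin n → Bool)).map fun f => ofList ((List.ofFn f).map ofBool)

/-- A fair coin. -/
def coin : PMF Bool := PMF.uniformOfFintype Bool

/-! ## Interactive randomized computations -/

/-- A computation that tosses coins and puts questions to an oracle; `query n q k` asks `q` and
continues with `k` on the reply, which is received in a buffer of size `n`. -/
inductive Comp (α : Type) : Type
  | ret : α → Comp α
  | flip : (Bool → Comp α) → Comp α
  | query : ℕ → Val → (Val → Comp α) → Comp α

namespace Comp

def bind {α β : Type} : Comp α → (α → Comp β) → Comp β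
  | ret a, f => f a
  | flip k, f => flip fun b => (k b).bind f
  | query n q k, f => query n q fun r => (k r).bind f

/-- `P` holds for the result, for all outcomes of the coins and all replies of the oracle. -/
def All {α : Type} (P : α → Prop) : Comp α → Prop
  | ret a => P a
  | flip k => ∀ b, (k b).All P
  | query n _ k => ∀ r, (k (fit n r)).All P

/-- Execution with a stateful randomized oracle. The outcome consists of the result, the final state
of the oracle, and the transcript: all coins tossed and all replies received, in order. -/
def run {α σ : Type} (O : σ → Val → PMF (Val × σ)) : Comp α → σ → PMF (α × σ × List Val)
  | ret a, s => pure (a, s, [])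
  | flip k, s => do
      let b ← coin
      let (a, s', l) ← (k b).run O s
      pure (a, s', ofBool b :: l)
  | query n q k, s => do
      let (r, s') ← O s q
      let (a, s'', l) ← (k (fit n r)).run O s'
      pure (a, s'', fit n r :: l)

/-- The result of a computation that tosses no coins and asks no questions. -/
def value {α : Type} : Comp α → α
  | ret a => a
  | flip k => (k false).value
  | query _ _ k => (k nil).value

end Comp

/-! ## Programs and their running time -/

/-- The hash oracle: a function that every program may call. -/
abbrev Hash := Val → Val

/-- For each security parameter, the distribution of the hash oracle: for instance a random oracle
(a uniformly random function on the inputs up to some length), or a fixed function. -/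
abbrev HashModel := ℕ → PMF Hash

/-- Programs that transform a data value. All loops are bounded by a list, so that every program
halts. -/
inductive Code : Type
  | id : Code
  | nil : Code
  | fst : Code
  | snd : Code
  | pair : Code → Code → Code
  | comp : Code → Code → Code
  | ite : Code → Code → Code → Code
  | eq : Code
  | fold : Code → Code
  | flip : Code
  | hash : Code
  | query : Code

namespace Code

/-- A loop over a list, with state `x` and the total running time of the iterations. -/
def iterate (body : Val → Comp (Val × ℕ)) : List Val → Val → Comp (Val × ℕ)
  | [], x => .ret (x, 0)
  | a :: l, x => (body (cons a x)).bind fun r =>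
      (iterate body l r.1).bind fun r' => .ret (r'.1, r.2 + r'.2)

/-- Result and running time of a program with hash oracle `H` on an input. Each instruction costs
`1` plus the size of its input, in addition to the cost of the instructions nested in it. In `hash`
and `query` the input `cons b q` consists of the question `q` and a buffer `b`: a reply larger than
`b` is not delivered, so that a reply has to be paid for. -/
def eval (H : Hash) : Code → Val → Comp (Val × ℕ)
  | id, v => .ret (v, 1 + v.size)
  | nil, v => .ret (.nil, 1 + v.size)
  | fst, v => .ret (v.fst, 1 + v.size)
  | snd, v => .ret (v.snd, 1 + v.size)
  | pair f g, v => (f.eval H v).bind fun r => (g.eval H v).bind fun s =>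
      .ret (cons r.1 s.1, 1 + v.size + r.2 + s.2)
  | comp g f, v => (f.eval H v).bind fun r => (g.eval H r.1).bind fun s =>
      .ret (s.1, 1 + v.size + r.2 + s.2)
  | ite c f g, v => (c.eval H v).bind fun r =>
      (if r.1 = Val.nil then g.eval H v else f.eval H v).bind fun s =>
        .ret (s.1, 1 + v.size + r.2 + s.2)
  | eq, v => .ret (if v.fst = v.snd then ofBool true else ofBool false, 1 + v.size)
  | fold f, v => (iterate (f.eval H) v.fst.toList v.snd).bind fun r => .ret (r.1, 1 + v.size + r.2)
  | flip, v => .flip fun b => .ret (ofBool b, 1 + v.size)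
  | hash, v => .ret (fit v.fst.size (H v.snd), 1 + v.size)
  | query, v => .query v.fst.size v.snd fun r => .ret (r, 1 + v.size)

/-- The program runs in polynomial time: for some polynomial in the size of the input, whatever the
hash oracle, the coins and the replies of the oracle. -/
def PPT (c : Code) : Prop :=
  ∃ p : Polynomial ℕ, ∀ (H : Hash) (v : Val), (c.eval H v).All fun r => r.2 ≤ p.eval v.size

/-- The program tosses no coins and asks no questions (other than to the hash oracle). -/
def Det : Code → Prop
  | pair f g => f.Det ∧ g.Det
  | comp g f => g.Det ∧ f.Det
  | ite c f g => c.Det ∧ f.Det ∧ g.Det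
  | fold f => f.Det
  | flip => False
  | query => False
  | _ => True

/-- The function computed by a deterministic program. -/
def fn (c : Code) (H : Hash) (v : Val) : Val := (c.eval H v).value.1

/-- Execution of a program with an oracle: output, final state of the oracle, transcript. -/
def play {σ : Type} (c : Code) (H : Hash) (O : σ → Val → PMF (Val × σ)) (s : σ) (v : Val) :
    PMF (Val × σ × List Val) :=
  ((c.eval H v).run O s).map fun r => (r.1.1, r.2)

/-- The output distribution of a program that has only the hash oracle. -/
def dist (c : Code) (H : Hash) (v : Val) : PMF Val :=
  (c.play H (fun (_ : Unit) _ => pure (.nil, ())) () v).map fun r => r.1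

end Code

/-- The input of an algorithm: the security parameter in unary and the arguments. -/
def inp (κ : ℕ) (l : List Val) : Val := ofList (unary κ :: l)

/-- A polynomially bounded length: `1^(ℓ κ)` is computed from `1^κ` in polynomial time. -/
def PolyLength (ℓ : ℕ → ℕ) : Prop :=
  ∃ c : Code, c.Det ∧ c.PPT ∧ ∀ H κ, c.fn H (unary κ) = unary (ℓ κ)

/-- The probability that an experiment succeeds. -/
def prob (e : PMF Prop) : ℝ := (e True).toReal

def Negligible (f : ℕ → ℝ) : Prop :=
  Asymptotics.SuperpolynomialDecay Filter.atTop (fun n : ℕ => (n : ℝ)) f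

/-! ## Tagging schemes -/

/-- The secret key space `{0,1}^κ × {0,1}^κ`. -/
def keySpace (κ : ℕ) : Set Val :=
  {v | ∃ k ∈ bitStrings κ, ∃ r ∈ bitStrings κ, v = cons k r}

/-- A uniformly random secret key. -/
def sampleKey (κ : ℕ) : PMF Val := do
  let k ← uniformBits κ
  let r ← uniformBits κ
  pure (cons k r)

/-- A tagging scheme with public key space `{0,1}^(pkLen κ)` and tag space `{0,1}^(tagLen κ)`. Key
generation and tag evaluation are deterministic and take the public parameters as input. -/
structure TaggingScheme (𝓗 : HashModel) where
  setup : Code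
  keyGen : Code
  tagEval : Code
  pkLen : ℕ → ℕ
  tagLen : ℕ → ℕ
  setup_ppt : setup.PPT
  keyGen_ppt : keyGen.PPT
  tagEval_ppt : tagEval.PPT
  keyGen_det : keyGen.Det
  tagEval_det : tagEval.Det
  pkLen_poly : PolyLength pkLen
  tagLen_poly : PolyLength tagLen
  keyGen_mem : ∀ κ, ∀ H ∈ (𝓗 κ).support, ∀ pp ∈ (setup.dist H (inp κ [])).support,
    ∀ csk ∈ keySpace κ, keyGen.fn H (inp κ [pp, csk]) ∈ bitStrings (pkLen κ)
  tagEval_mem : ∀ κ, ∀ H ∈ (𝓗 κ).support, ∀ pp ∈ (setup.dist H (inp κ [])).support,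
    ∀ csk ∈ keySpace κ, tagEval.fn H (inp κ [pp, csk]) ∈ bitStrings (tagLen κ)

namespace TaggingScheme

variable {𝓗 : HashModel} (T : TaggingScheme 𝓗)

def pk (H : Hash) (κ : ℕ) (pp csk : Val) : Val := T.keyGen.fn H (inp κ [pp, csk])

def tag (H : Hash) (κ : ℕ) (pp csk : Val) : Val := T.tagEval.fn H (inp κ [pp, csk])

def oneWayGame (A : Code) (κ : ℕ) : PMF Prop := do
  let H ← 𝓗 κ
  let pp ← T.setup.dist H (inp κ [])
  let csk ← sampleKey κ
  let csk' ← A.dist H (inp κ [pp, T.tag H κ pp csk, T.pk H κ pp csk])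
  pure (csk' ∈ keySpace κ ∧ T.tag H κ pp csk' = T.tag H κ pp csk)

def OneWay : Prop := ∀ A : Code, A.PPT → Negligible fun κ => prob (T.oneWayGame A κ)

def collisionGame (A : Code) (κ : ℕ) : PMF Prop := do
  let H ← 𝓗 κ
  let pp ← T.setup.dist H (inp κ [])
  let out ← A.dist H (inp κ [pp])
  pure (out.get 0 ∈ keySpace κ ∧ out.get 1 ∈ keySpace κ ∧ out.get 0 ≠ out.get 1 ∧
    T.pk H κ pp (out.get 0) = T.pk H κ pp (out.get 1))

def CollisionResistant : Prop := ∀ A : Code, A.PPT → Negligible fun κ => prob (T.collisionGame A κ)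

/-- The adversary sees the tag and the public key of a random secret key. -/
def prGame0 (A : Code) (κ : ℕ) : PMF Prop := do
  let H ← 𝓗 κ
  let pp ← T.setup.dist H (inp κ [])
  let csk ← sampleKey κ
  let out ← A.dist H (inp κ [pp, T.tag H κ pp csk, T.pk H κ pp csk])
  pure (out ≠ nil)

/-- The adversary sees a random tag and a random public key. -/
def prGame1 (A : Code) (κ : ℕ) : PMF Prop := do
  let H ← 𝓗 κ
  let pp ← T.setup.dist H (inp κ [])
  let tag ← uniformBits (T.tagLen κ)
  let cpk ← uniformBits (T.pkLen κ)
  let out ← A.dist H (inp κ [pp, tag, cpk])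
  pure (out ≠ nil)

def Pseudorandom : Prop :=
  ∀ A : Code, A.PPT → Negligible fun κ => |prob (T.prGame0 A κ) - prob (T.prGame1 A κ)|

def Secure : Prop := T.OneWay ∧ T.CollisionResistant ∧ T.Pseudorandom

end TaggingScheme

/-! ## Merkle trees -/

/-- A Merkle tree over the strings of length `leafLen κ`, for lists whose length belongs to `sizes`,
which contains the powers of two. `init` may reject other lists by returning `nil` (that is, `⊥`).
Positions in a list are counted from `0`. -/
structure MerkleTree (leafLen : ℕ → ℕ) where
  init : Code
  prove : Code
  verify : Code
  sizes : Set ℕ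
  two_pow_mem : ∀ k : ℕ, 2 ^ k ∈ sizes
  init_ppt : init.PPT
  prove_ppt : prove.PPT
  verify_ppt : verify.PPT
  init_det : init.Det
  prove_det : prove.Det
  verify_det : verify.Det

namespace MerkleTree

variable {leafLen : ℕ → ℕ} (M : MerkleTree leafLen)

/-- The root of a list, `none` if the list is rejected. -/
def root (H : Hash) (κ : ℕ) (xs : List Val) : Option Val :=
  (M.init.fn H (inp κ [ofList xs])).toOption

def path (H : Hash) (κ : ℕ) (j : ℕ) (x : Val) (xs : List Val) : Val :=
  M.prove.fn H (inp κ [unary j, x, ofList xs])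

def Accepts (H : Hash) (κ : ℕ) (j x rt pth : Val) : Prop :=
  M.verify.fn H (inp κ [j, x, rt, pth]) ≠ nil

/-- Lists of strings of the right length are not rejected, and for every list that is not rejected
the honest proofs verify. -/
def Correct (𝓗 : HashModel) : Prop :=
  ∀ κ, ∀ H ∈ (𝓗 κ).support, ∀ xs : List Val,
    ((xs.length ∈ M.sizes ∧ ∀ x ∈ xs, x ∈ bitStrings (leafLen κ)) → (M.root H κ xs).isSome) ∧
    ∀ rt, M.root H κ xs = some rt → ∀ (j : ℕ) (hj : j < xs.length),
      M.Accepts H κ (unary j) xs[j] rt (M.path H κ j xs[j] xs)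

/-- The adversary outputs a list, a position, a value and a proof; it wins if the proof verifies for
the root of the list although the value is not the entry of the list at that position. -/
def game (𝓗 : HashModel) (A : Code) (κ : ℕ) : PMF Prop := do
  let H ← 𝓗 κ
  let out ← A.dist H (inp κ [])
  pure (∃ rt, M.root H κ (out.get 0).toList = some rt ∧
    M.Accepts H κ (out.get 1) (out.get 2) rt (out.get 3) ∧
    (out.get 0).toList[(out.get 1).toNat]? ≠ some (out.get 2))

def Secure (𝓗 : HashModel) : Prop :=
  M.Correct 𝓗 ∧ ∀ A : Code, A.PPT → Negligible fun κ => prob (M.game 𝓗 A κ)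

end MerkleTree

/-! ## zk-SNARKs -/

/-- A relation generator: `gen` outputs the description `d` of a circuit on input `1^κ`, and
`rel H κ d` is the relation between statements and witnesses that the circuit decides. -/
structure RelationGenerator where
  gen : Code
  rel : Hash → ℕ → Val → Val → Val → Prop

/-- The algorithms of a zk-SNARK. `setup` takes `1^κ` and a description of the circuit, and outputs
the pair of the proving key and the verification key. -/
structure ZkSnark where
  setup : Code
  prove : Code
  verify : Code
  setup_ppt : setup.PPT
  prove_ppt : prove.PPT
  verify_ppt : verify.PPT
  verify_det : verify.Det

/-- A simulator: `setup` outputs `cons crs τ`, simulated keys and a trapdoor; `prove` takes the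
trapdoor and a statement. -/
structure Simulator where
  setup : Code
  prove : Code
  setup_ppt : setup.PPT
  prove_ppt : prove.PPT

namespace ZkSnark

variable (S : ZkSnark) (𝓗 : HashModel) (𝓡 : RelationGenerator)

def Accepts (H : Hash) (κ : ℕ) (vrfyK stmt π : Val) : Prop :=
  S.verify.fn H (inp κ [vrfyK, stmt, π]) ≠ nil

/-- Perfect completeness. -/
def Complete : Prop :=
  ∀ κ, ∀ H ∈ (𝓗 κ).support, ∀ d ∈ (𝓡.gen.dist H (inp κ [])).support, ∀ stmt wit : Val,
    𝓡.rel H κ d stmt wit → ∀ crs ∈ (S.setup.dist H (inp κ [d])).support,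
      ∀ π ∈ (S.prove.dist H (inp κ [crs.fst, stmt, wit])).support, S.Accepts H κ crs.snd stmt π

/-- Honest proofs of the statements for which the adversary provides a witness; `⊥` otherwise. -/
def proveOracle (H : Hash) (κ : ℕ) (d crs : Val) (s : Unit) (q : Val) : PMF (Val × Unit) :=
  open Classical in
  if 𝓡.rel H κ d (q.get 0) (q.get 1) then do
    let π ← S.prove.dist H (inp κ [crs.fst, q.get 0, q.get 1])
    pure (ofList [π], s)
  else pure (nil, s)

/-- Simulated proofs of the statements for which the adversary provides a witness; `⊥` otherwise. -/
def simProveOracle (Sim : Simulator) (H : Hash) (κ : ℕ) (d τ : Val) (s : Unit) (q : Val) :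
    PMF (Val × Unit) :=
  open Classical in
  if 𝓡.rel H κ d (q.get 0) (q.get 1) then do
    let π ← Sim.prove.dist H (inp κ [τ, q.get 0])
    pure (ofList [π], s)
  else pure (nil, s)

def zkGame0 (A : Code) (κ : ℕ) : PMF Prop := do
  let H ← 𝓗 κ
  let d ← 𝓡.gen.dist H (inp κ [])
  let crs ← S.setup.dist H (inp κ [d])
  let (out, _, _) ← A.play H (S.proveOracle 𝓡 H κ d crs) () (inp κ [d, crs])
  pure (out ≠ nil)

def zkGame1 (Sim : Simulator) (A : Code) (κ : ℕ) : PMF Prop := do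
  let H ← 𝓗 κ
  let d ← 𝓡.gen.dist H (inp κ [])
  let c ← Sim.setup.dist H (inp κ [d])
  let (out, _, _) ← A.play H (simProveOracle 𝓡 Sim H κ d c.snd) () (inp κ [d, c.fst])
  pure (out ≠ nil)

def ZeroKnowledge (Sim : Simulator) : Prop :=
  ∀ A : Code, A.PPT → Negligible fun κ =>
    |prob (S.zkGame0 𝓗 𝓡 A κ) - prob (zkGame1 𝓗 𝓡 Sim A κ)|

/-- Simulated proofs of arbitrary statements; the state records the statements. -/
def simOracle (Sim : Simulator) (H : Hash) (κ : ℕ) (τ : Val) (Q : List Val) (stmt : Val) :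
    PMF (Val × List Val) := do
  let π ← Sim.prove.dist H (inp κ [τ, stmt])
  pure (ofList [π], Q ++ [stmt])

/-- The adversary, who gets simulated keys and simulated proofs, outputs a statement and a proof. It
wins if the proof verifies, no proof of the statement was simulated, and the extractor `X` finds no
witness from the transcript of the adversary. -/
def seGame (Sim : Simulator) (A X : Code) (κ : ℕ) : PMF Prop := do
  let H ← 𝓗 κ
  let d ← 𝓡.gen.dist H (inp κ [])
  let c ← Sim.setup.dist H (inp κ [d])
  let (out, Q, l) ← A.play H (simOracle Sim H κ c.snd) [] (inp κ [d, c.fst])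
  let wit ← X.dist H (inp κ [d, c.fst, ofList l])
  pure (S.Accepts H κ c.fst.snd (out.get 0) (out.get 1) ∧ out.get 0 ∉ Q ∧
    ¬ 𝓡.rel H κ d (out.get 0) wit)

def SimulationExtractable (Sim : Simulator) : Prop :=
  ∀ A : Code, A.PPT → ∃ X : Code, X.PPT ∧ Negligible fun κ => prob (S.seGame 𝓗 𝓡 Sim A X κ)

/-- Completeness, and zero knowledge and simulation extractability with a common simulator. -/
def Secure : Prop :=
  S.Complete 𝓗 𝓡 ∧ ∃ Sim : Simulator, S.ZeroKnowledge 𝓗 𝓡 Sim ∧ S.SimulationExtractable 𝓗 𝓡 Sim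

end ZkSnark

/-! ## Data tumbling layers -/

/-- A data tumbling layer with message space `{0,1}^(msgLen κ)`. `accumulate` is defined (not `none`)
on lists of honest public keys whose length belongs to `sizes`. -/
structure DTL where
  msgLen : ℕ → ℕ
  sizes : Set ℕ
  setup : Hash → ℕ → PMF Val
  create : Hash → ℕ → Val → Val → PMF (Val × Val)
  accumulate : Hash → ℕ → Val → List Val → Option Val
  redeem : Hash → ℕ → Val → List Val → Val → Val → PMF (Option (Val × Val))
  verify : Hash → ℕ → Val → Val → Val → Val → Val → Prop

/-- A record of the redeem oracle. -/
structure Redemption where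
  st : Val
  cpk : Val
  tag : Val
  π : Val
  m : Val

/-- The state of the oracles: the created key pairs `(cpk, csk)` and the redemptions. -/
structure OracleState where
  C : List (Val × Val)
  R : List Redemption

/-- An answer of a redemption as a value, with `nil` for `⊥`. -/
def redeemReply : Option (Val × Val) → Val
  | none => nil
  | some (tag, π) => cons tag π

namespace DTL

variable (D : DTL) (𝓗 : HashModel)

/-- The experiment of correctness: key pairs for the list `data` are created, accumulated, and each
of them is redeemed. -/
def correctGame (κ : ℕ) (data : List Val) (m : Val) : PMF Prop := do
  let H ← 𝓗 κ
  let pp ← D.setup H κ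
  let keys ← data.mapM (D.create H κ pp)
  let outs ← keys.mapM fun k => D.redeem H κ pp (keys.map Prod.fst) k.2 m
  pure (∃ st, D.accumulate H κ pp (keys.map Prod.fst) = some st ∧
    ∀ o ∈ outs, ∃ tag π, o = some (tag, π) ∧ D.verify H κ pp st tag π m)

def Correct : Prop :=
  ∀ κ, ∀ data : List Val, data.length ∈ D.sizes → ∀ m ∈ bitStrings (D.msgLen κ),
    prob (D.correctGame 𝓗 κ data m) = 1

def createO (H : Hash) (κ : ℕ) (pp : Val) (s : OracleState) (data : Val) :
    PMF (Val × OracleState) := do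
  let k ← D.create H κ pp data
  pure (k.1, { s with C := s.C ++ [k] })

/-- The redeem oracle; the position `i` in the list is counted from `0`. -/
def redeemO (H : Hash) (κ : ℕ) (pp : Val) (s : OracleState) (cpks : List Val) (i : ℕ) (m : Val) :
    PMF (Option (Val × Val) × OracleState) :=
  open Classical in
  match s.C.find? (fun k => cpks[i]? = some k.1), D.accumulate H κ pp cpks with
  | some k, some st =>
      if m ∈ bitStrings (D.msgLen κ) then do
        let o ← D.redeem H κ pp cpks k.2 m
        match o with
        | some (tag, π) => pure (some (tag, π), { s with R := s.R ++ [⟨st, k.1, tag, π, m⟩] })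
        | none => pure (none, s)
      else pure (none, s)
  | _, _ => pure (none, s)

/-- The two oracles together: a question `cons nil data` is addressed to the create oracle, a
question `cons (cons _ _) (list, i, m)` to the redeem oracle. -/
def oracle (H : Hash) (κ : ℕ) (pp : Val) (s : OracleState) : Val → PMF (Val × OracleState)
  | nil => pure (nil, s)
  | cons nil data => D.createO H κ pp s data
  | cons (cons _ _) q => do
      let (o, s') ← D.redeemO H κ pp s (q.get 0).toList (q.get 1).toNat (q.get 2)
      pure (redeemReply o, s')

/-- The adversary outputs a list of triples `(tag, π, m)` and a list of public keys. -/
def oneMoreGame (A : Code) (κ : ℕ) : PMF Prop := do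
  let H ← 𝓗 κ
  let pp ← D.setup H κ
  let out ← A.dist H (inp κ [pp])
  let triples := (out.get 0).toList
  let cpks := (out.get 1).toList
  pure (triples.length = cpks.length + 1 ∧
    ∃ st, D.accumulate H κ pp cpks = some st ∧
      (∀ t ∈ triples, D.verify H κ pp st (t.get 0) (t.get 1) (t.get 2)) ∧
      triples.Pairwise fun t t' => t.get 0 ≠ t'.get 0)

def NoOneMoreRedeeming : Prop :=
  ∀ A : Code, A.PPT → Negligible fun κ => prob (D.oneMoreGame 𝓗 A κ)

/-- The adversary outputs a list of public keys, a tag, a proof and a message. -/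
def theftGame (A : Code) (κ : ℕ) : PMF Prop := do
  let H ← 𝓗 κ
  let pp ← D.setup H κ
  let (out, s, _) ← A.play H (D.oracle H κ pp) ⟨[], []⟩ (inp κ [pp])
  let cpks := (out.get 0).toList
  let tag := out.get 1
  let π := out.get 2
  let m := out.get 3
  pure (∃ st, D.accumulate H κ pp cpks = some st ∧ D.verify H κ pp st tag π m ∧
    (∀ cpk ∈ cpks, ∃ k ∈ s.C, k.1 = cpk) ∧
    ¬ ∃ e ∈ s.R, e.st = st ∧ e.tag = tag ∧ e.m = m)

def TheftPrevention : Prop := ∀ A : Code, A.PPT → Negligible fun κ => prob (D.theftGame 𝓗 A κ)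

/-- The adversary outputs two public keys, a tag, a proof and a message; then the first public key is
redeemed for a random message. -/
def slanderGame (A : Code) (κ : ℕ) : PMF Prop := do
  let H ← 𝓗 κ
  let pp ← D.setup H κ
  let (out, s, _) ← A.play H (D.oracle H κ pp) ⟨[], []⟩ (inp κ [pp])
  let cpk := out.get 0
  let cpk' := out.get 1
  let tag' := out.get 2
  let π' := out.get 3
  let m' := out.get 4
  let m ← uniformBits (D.msgLen κ)
  let (o, s') ← D.redeemO H κ pp s [cpk, cpk'] 0 m
  pure (∃ st tag π, D.accumulate H κ pp [cpk, cpk'] = some st ∧ o = some (tag, π) ∧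
    (∃ k ∈ s.C, k.1 = cpk) ∧ tag = tag' ∧ D.verify H κ pp st tag' π' m' ∧
    ¬ ∃ e ∈ s'.R, e.st = st ∧ e.tag = tag ∧ e.m = m')

def NonSlanderability : Prop :=
  ∀ A : Code, A.PPT → Negligible fun κ => prob (D.slanderGame 𝓗 A κ)

/-- The first stage `A₁` of the adversary outputs `(data₀, data₁, state)`. The second stage `A₂`,
which has the oracles, gets the state, the two public keys and the two redemptions in the order given
by the bit `b`, and outputs a guess of `b`. -/
def unlinkGame (A₁ A₂ : Code) (κ : ℕ) : PMF Prop := do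
  let H ← 𝓗 κ
  let pp ← D.setup H κ
  let m ← uniformBits (D.msgLen κ)
  let a ← A₁.dist H (inp κ [pp, m])
  let (cpk₀, csk₀) ← D.create H κ pp (a.get 0)
  let (cpk₁, csk₁) ← D.create H κ pp (a.get 1)
  let o₀ ← D.redeem H κ pp [cpk₀, cpk₁] csk₀ m
  let o₁ ← D.redeem H κ pp [cpk₀, cpk₁] csk₁ m
  let b ← coin
  let (out, s, _) ← A₂.play H (D.oracle H κ pp) ⟨[], []⟩
    (inp κ [a.get 2, cpk₀, cpk₁, redeemReply (if b then o₁ else o₀),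
      redeemReply (if b then o₀ else o₁)])
  pure ((b = true ↔ out ≠ nil) ∧ ¬ ∃ e ∈ s.R, e.cpk = cpk₀ ∨ e.cpk = cpk₁)

def Unlinkability : Prop :=
  ∀ A₁ A₂ : Code, A₁.PPT → A₂.PPT →
    Negligible fun κ => |prob (D.unlinkGame 𝓗 A₁ A₂ κ) - 1 / 2|

end DTL

/-! ## The construction for fixed data -/

section Construction

variable {𝓗 : HashModel} (T : TaggingScheme 𝓗) (M : MerkleTree T.pkLen) (msgLen : ℕ → ℕ)

/-- The circuits of the construction: the description of the circuit is the public parameter of the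
tagging scheme, and the relation holds between the statement `(st, tag, m)` and the witness
`(i, csk, path)` if the path authenticates the public key of `csk` at position `i` for the root `st`,
and `tag` is the tag of `csk`. -/
def fixedRelation : RelationGenerator where
  gen := T.setup
  rel H κ pp stmt wit := ∃ st tag m i csk pth : Val,
    stmt = ofList [st, tag, m] ∧ wit = ofList [i, csk, pth] ∧
    m ∈ bitStrings (msgLen κ) ∧ csk ∈ keySpace κ ∧
    M.Accepts H κ i (T.pk H κ pp csk) st pth ∧ tag = T.tag H κ pp csk

variable (S : ZkSnark) (dataFixed : Val)

/-- The data tumbling layer for fixed data. Its public parameters are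
`(prvK, vrfyK, pp, dataFixed)`, where `pp` is the public parameter of the tagging scheme. -/
def dtlFixed : DTL where
  msgLen := msgLen
  sizes := M.sizes
  setup H κ := do
    let pp ← T.setup.dist H (inp κ [])
    let crs ← S.setup.dist H (inp κ [pp])
    pure (ofList [crs.fst, crs.snd, pp, dataFixed])
  create H κ pp _ := do
    let csk ← sampleKey κ
    pure (T.pk H κ (pp.get 2) csk, csk)
  accumulate H κ _ cpks := M.root H κ cpks
  redeem H κ pp cpks csk m :=
    open Classical in
    let cpk := T.pk H κ (pp.get 2) csk
    match cpks.findIdx? (fun x => x = cpk), M.root H κ cpks with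
    | some j, some st => do
        let tag := T.tag H κ (pp.get 2) csk
        let π ← S.prove.dist H (inp κ [pp.get 0, ofList [st, tag, m],
          ofList [unary j, csk, M.path H κ j cpk cpks]])
        pure (some (tag, π))
    | _, _ => pure none
  verify H κ pp st tag π m := S.Accepts H κ (pp.get 1) (ofList [st, tag, m]) π

end Construction

end

end Tumbling

/-! ### Interactive computations, their laws and their cost -/

namespace Tumbling
open Val

noncomputable section

/-! ## Values -/

namespace Val

/-! Zero knowledge allows the honest proofs, in whatever the adversary sees, to be replaced by
simulated ones (`zk_transfer`, `oracle_transfer`). From then on the oracles use only the public key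
and the tag of a created key, never its secret key, and simulation extractability turns a valid
proof of a new statement into a witness: a position, a secret key and a Merkle path.

Correctness (`correct`) is completeness of the SNARK applied to the honest witness (`rel_honest`).

The core of theft prevention and non-slanderability is `forge`: it is infeasible to prove a new
statement about the tag of a created key. The reduction guesses which created key is attacked, with
polynomial loss (`pr_tag_mem_le`), and plants there the tag and public key of a one-wayness
challenge; the extracted secret key then opens this tag. The obstacle is that an extractor is
promised only for adversaries that start from the parameters and the simulated keys, without
auxiliary input, whereas the reduction holds a challenge. So the extractor is taken for an adversary
that tosses coins for the tag and the public key. These coins are literally the two strings, and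
they open its transcript (`ex_extract_bits`). By pseudorandomness a real pair may be put in their
place, because the event that the extracted key does not open the tag can be tested in polynomial
time.

Non-slanderability follows when the adversary makes the final redemption itself. For theft there is
a second case, a tag that belongs to no created key (`theft_new_tag`): here all secret keys may be
known to the reduction. The extracted key has a public key that is authenticated under the root.
Either it is not at the claimed position of the list, against the Merkle tree, or it equals the
public key of a created key with another tag, which is a collision.

For one-more redeeming, n + 1 proofs with distinct tags stand against n public keys, but an
extractor yields one witness per run. The adversary is run once; then a random one of its triples is
claimed and extracted, twice and independently. For fixed first output every triple is explained by
some position of the list with noticeable probability, unless extraction or the Merkle tree fails;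
two different triples must share a position, and the two runs hit such a pair with noticeable
probability (`one_le_add_of_pigeonhole`, `one_le_of_oneMore`). Equal public keys with different tags
are a collision.

For unlinkability, with simulated proofs the challenge depends on the two secret keys only through
two pairs of tag and public key. A hybrid replaces both by random strings (`slot_transfer`). The
tags are then independent of the public keys, so the two redemptions are independent and identically
distributed and their order is perfectly hidden (`ex_simHit_random`). That the second stage redeems
a challenge key requires a repeated public key, which collision resistance and the entropy of the
keys exclude (`pr_same_pk_negl`).

Since adversaries are programs with an explicit cost, every reduction has to be a program. `PP` says
that a family of computations is realized in polynomial time, and its closure properties let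
instance search assemble most reductions. `PP.interp` is the essential closure: an adversary can be
run with coins and oracle replaced by programs. Such replacements cut replies at a length (κ + 2) ^
k, chosen above every size that occurs, so that nothing is ever cut (`exists_fuel`). -/

@[simp] theorem fst_cons (a b : Val) : (cons a b).fst = a := rfl
@[simp] theorem snd_cons (a b : Val) : (cons a b).snd = b := rfl
@[simp] theorem fst_nil : nil.fst = nil := rfl
@[simp] theorem snd_nil : nil.snd = nil := rfl
@[simp] theorem size_nil : nil.size = 1 := rfl
@[simp] theorem size_cons (a b : Val) : (cons a b).size = a.size + b.size + 1 := rfl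
@[simp] theorem toList_nil : nil.toList = [] := rfl
@[simp] theorem toList_cons (a b : Val) : (cons a b).toList = a :: b.toList := rfl
@[simp] theorem ofList_nil : ofList [] = nil := rfl
@[simp] theorem ofList_cons (a : Val) (l : List Val) : ofList (a :: l) = cons a (ofList l) := rfl

@[simp] theorem toList_ofList (l : List Val) : (ofList l).toList = l := by
  induction l <;> simp [*]

@[simp] theorem ofList_toList (v : Val) : ofList v.toList = v := by
  induction v <;> simp [*]

theorem ofList_injective : Function.Injective ofList :=
  Function.LeftInverse.injective toList_ofList

theorem size_pos (v : Val) : 0 < v.size := by cases v <;> simp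

theorem size_fst_le (v : Val) : v.fst.size ≤ v.size := by
  cases v
  · simp
  · simp; omega

theorem size_snd_le (v : Val) : v.snd.size ≤ v.size := by
  cases v
  · simp
  · simp; omega

theorem size_mem_lt {v a : Val} (h : a ∈ v.toList) : a.size < v.size := by
  induction v with
  | nil => simp at h
  | cons x y _ ih =>
    simp only [toList_cons, List.mem_cons] at h
    rcases h with rfl | h
    · simp only [size_cons]; omega
    · have := ih h; simp only [size_cons]; omega

theorem length_toList_lt (v : Val) : v.toList.length < v.size := by
  induction v with
  | nil => simp
  | cons x y _ ih => simp; omega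

@[simp] theorem toNat_nil : nil.toNat = 0 := rfl
@[simp] theorem toNat_cons (a b : Val) : (cons a b).toNat = b.toNat + 1 := rfl
@[simp] theorem toNat_unary (n : ℕ) : (unary n).toNat = n := by simp [toNat, unary]
@[simp] theorem unary_zero : unary 0 = nil := rfl
@[simp] theorem unary_succ (n : ℕ) : unary (n + 1) = cons nil (unary n) := rfl

@[simp] theorem size_unary (n : ℕ) : (unary n).size = 2 * n + 1 := by
  induction n with
  | zero => rfl
  | succ n ih => simp [ih]; omega

theorem size_ofBool_le (b : Bool) : (ofBool b).size ≤ 3 := by cases b <;> simp [ofBool]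

@[simp] theorem ofBool_true : ofBool true = cons nil nil := rfl
@[simp] theorem ofBool_false : ofBool false = nil := rfl

@[simp] theorem get_zero (v : Val) : v.get 0 = v.fst := by cases v <;> rfl
@[simp] theorem get_succ (v : Val) (i : ℕ) : v.get (i + 1) = v.snd.get i := by
  cases v <;> simp [get]
@[simp] theorem get_one (v : Val) : v.get 1 = v.snd.fst := by rw [get_succ, get_zero]
@[simp] theorem get_two (v : Val) : v.get 2 = v.snd.snd.fst := by rw [get_succ, get_one]
@[simp] theorem get_three (v : Val) : v.get 3 = v.snd.snd.snd.fst := by rw [get_succ, get_two]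
@[simp] theorem get_four (v : Val) : v.get 4 = v.snd.snd.snd.snd.fst := by
  rw [get_succ, get_three]

theorem size_fit_le_max (n : ℕ) (v : Val) : (fit n v).size ≤ n + 1 := by
  unfold fit; split
  · omega
  · simp

theorem fit_of_le {n : ℕ} {v : Val} (h : v.size ≤ n) : fit n v = v := if_pos h

@[simp] theorem fit_nil (n : ℕ) : fit n nil = nil := by
  unfold fit; split <;> rfl

/-- The total size of the elements of a list, with its spine. -/
theorem size_ofList_append (l m : List Val) :
    (ofList (l ++ m)).size + 1 = (ofList l).size + (ofList m).size := by
  induction l with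
  | nil => simp; omega
  | cons a l ih => simp; omega

end Val

/-! ## The monad of computations -/

namespace Comp

variable {α β γ σ : Type}

@[simp] theorem ret_bind (a : α) (f : α → Comp β) : (ret a).bind f = f a := rfl
@[simp] theorem flip_bind (k : Bool → Comp α) (f : α → Comp β) :
    (flip k).bind f = flip fun b => (k b).bind f := rfl
@[simp] theorem query_bind (n : ℕ) (q : Val) (k : Val → Comp α) (f : α → Comp β) :
    (query n q k).bind f = query n q fun b => (k b).bind f := rfl

@[simp] theorem bind_ret (c : Comp α) : c.bind ret = c := by
  induction c with
  | ret a => rfl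
  | flip k ih => simp [ih]
  | query n q k ih => simp [ih]

@[simp] theorem bind_assoc (c : Comp α) (f : α → Comp β) (g : β → Comp γ) :
    (c.bind f).bind g = c.bind fun a => (f a).bind g := by
  induction c with
  | ret a => rfl
  | flip k ih => simp [ih]
  | query n q k ih => simp [ih]

/-- Application of a function to the result. -/
def map (f : α → β) (c : Comp α) : Comp β := c.bind fun a => ret (f a)

@[simp] theorem map_ret (f : α → β) (a : α) : (ret a).map f = ret (f a) := rfl
@[simp] theorem map_flip (f : α → β) (k : Bool → Comp α) :
    (flip k).map f = flip fun b => (k b).map f := rfl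
@[simp] theorem map_query (f : α → β) (n : ℕ) (q : Val) (k : Val → Comp α) :
    (query n q k).map f = query n q fun b => (k b).map f := rfl
@[simp] theorem map_bind (f : β → γ) (c : Comp α) (g : α → Comp β) :
    (c.bind g).map f = c.bind fun a => (g a).map f := by simp [map]
@[simp] theorem bind_map (f : α → β) (c : Comp α) (g : β → Comp γ) :
    (c.map f).bind g = c.bind fun a => g (f a) := by simp [map]
@[simp] theorem map_map (f : α → β) (g : β → γ) (c : Comp α) :
    (c.map f).map g = c.map fun a => g (f a) := by simp [map]

/-- The possible results of a computation. -/
def Out : Comp α → α → Prop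
  | ret a, b => b = a
  | flip k, b => ∃ c, (k c).Out b
  | query n _ k, b => ∃ r, (k (fit n r)).Out b

@[simp] theorem out_ret (a b : α) : (ret a).Out b ↔ b = a := Iff.rfl
@[simp] theorem out_flip (k : Bool → Comp α) (b : α) : (flip k).Out b ↔ ∃ c, (k c).Out b := Iff.rfl
@[simp] theorem out_query (n : ℕ) (q : Val) (k : Val → Comp α) (b : α) :
    (query n q k).Out b ↔ ∃ r, (k (fit n r)).Out b := Iff.rfl

theorem all_iff {P : α → Prop} (c : Comp α) : c.All P ↔ ∀ a, c.Out a → P a := by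
  induction c with
  | ret a => simp [All]
  | flip k ih => simp only [All, ih, out_flip]; exact ⟨fun h a ⟨b, hb⟩ => h b a hb, fun h b a hb => h a ⟨b, hb⟩⟩
  | query n q k ih =>
    simp only [All, ih, out_query]; exact ⟨fun h a ⟨b, hb⟩ => h b a hb, fun h b a hb => h a ⟨b, hb⟩⟩

@[simp] theorem out_bind (c : Comp α) (f : α → Comp β) (b : β) :
    (c.bind f).Out b ↔ ∃ a, c.Out a ∧ (f a).Out b := by
  induction c with
  | ret a => simp
  | flip k ih => simp only [flip_bind, out_flip, ih]; aesop
  | query n q k ih => simp only [query_bind, out_query, ih]; aesop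

@[simp] theorem out_map (c : Comp α) (f : α → β) (b : β) :
    (c.map f).Out b ↔ ∃ a, c.Out a ∧ b = f a := by simp [map]

theorem exists_out (c : Comp α) : ∃ a, c.Out a := by
  induction c with
  | ret a => exact ⟨a, rfl⟩
  | flip k ih => obtain ⟨a, ha⟩ := ih true; exact ⟨a, true, ha⟩
  | query n q k ih => obtain ⟨a, ha⟩ := ih (fit n .nil); exact ⟨a, _, ha⟩

/-- Execution without the transcript. -/
def exec (O : σ → Val → PMF (Val × σ)) : Comp α → σ → PMF (α × σ)
  | ret a, s => PMF.pure (a, s)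
  | flip k, s => coin.bind fun b => (k b).exec O s
  | query n q k, s => (O s q).bind fun x => (k (fit n x.1)).exec O x.2

variable (O : σ → Val → PMF (Val × σ))

@[simp] theorem exec_ret (a : α) (s : σ) : (ret a).exec O s = PMF.pure (a, s) := rfl
@[simp] theorem exec_flip (k : Bool → Comp α) (s : σ) :
    (flip k).exec O s = coin.bind fun b => (k b).exec O s := rfl
@[simp] theorem exec_query (n : ℕ) (q : Val) (k : Val → Comp α) (s : σ) :
    (query n q k).exec O s = (O s q).bind fun x => (k (fit n x.1)).exec O x.2 := rfl

theorem run_ret (a : α) (s : σ) : (ret a).run O s = PMF.pure (a, s, []) := rfl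
theorem run_flip (k : Bool → Comp α) (s : σ) :
    (flip k).run O s = coin.bind fun b => ((k b).run O s).bind fun x =>
      PMF.pure (x.1, x.2.1, ofBool b :: x.2.2) := rfl
theorem run_query (n : ℕ) (q : Val) (k : Val → Comp α) (s : σ) :
    (query n q k).run O s = (O s q).bind fun y => ((k (fit n y.1)).run O y.2).bind fun x =>
      PMF.pure (x.1, x.2.1, fit n y.1 :: x.2.2) := rfl

theorem run_map_exec (c : Comp α) (s : σ) :
    (c.run O s).map (fun r => (r.1, r.2.1)) = c.exec O s := by
  induction c generalizing s with
  | ret a => simp [run_ret, PMF.pure_map]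
  | flip k ih => simp [run_flip, ← ih, PMF.map, Function.comp_def]
  | query n q k ih => simp [run_query, ← ih, PMF.map, Function.comp_def]

theorem exec_bind (c : Comp α) (f : α → Comp β) (s : σ) :
    (c.bind f).exec O s = (c.exec O s).bind fun x => (f x.1).exec O x.2 := by
  induction c generalizing s with
  | ret a => simp
  | flip k ih => simp [ih]
  | query n q k ih => simp [ih]

theorem exec_map (c : Comp α) (f : α → β) (s : σ) :
    (c.map f).exec O s = (c.exec O s).map fun x => (f x.1, x.2) := by
  simp [map, exec_bind, PMF.map, Function.comp_def]

theorem run_bind (c : Comp α) (f : α → Comp β) (s : σ) :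
    (c.bind f).run O s = (c.run O s).bind fun x => ((f x.1).run O x.2.1).bind fun y =>
      PMF.pure (y.1, y.2.1, x.2.2 ++ y.2.2) := by
  induction c generalizing s with
  | ret a => simp [run_ret]
  | flip k ih => simp [run_flip, ih]
  | query n q k ih => simp [run_query, ih]

theorem run_map (c : Comp α) (f : α → β) (s : σ) :
    (c.map f).run O s = (c.run O s).map fun x => (f x.1, x.2) := by
  simp [map, run_bind, run_ret, PMF.map, Function.comp_def]

theorem out_of_mem_support {c : Comp α} {s : σ} {x : α × σ} (h : x ∈ (c.exec O s).support) :
    c.Out x.1 := by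
  induction c generalizing s with
  | ret a => simp at h; simp [h]
  | flip k ih =>
    simp only [exec_flip, PMF.mem_support_bind_iff] at h
    obtain ⟨b, _, hb⟩ := h; exact ⟨b, ih _ hb⟩
  | query n q k ih =>
    simp only [exec_query, PMF.mem_support_bind_iff] at h
    obtain ⟨b, _, hb⟩ := h; exact ⟨b.1, ih _ hb⟩

/-- All questions are answered with `nil`. -/
def mute : Comp α → Comp α
  | ret a => ret a
  | flip k => flip fun b => (k b).mute
  | query _ _ k => (k .nil).mute

/-- The oracle that answers every question with `nil`. -/
abbrev nullO (_ : Unit) (_ : Val) : PMF (Val × Unit) := PMF.pure (.nil, ())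

/-- The distribution of the result if every question is answered with `nil`. -/
def distr (c : Comp α) : PMF α := (c.exec nullO ()).map Prod.fst

/-- A muted computation never reaches the oracle. This is how an algorithm without oracle runs
inside a program that has one. -/
theorem exec_mute (c : Comp α) (s : σ) : c.mute.exec O s = c.distr.map fun a => (a, s) := by
  unfold distr
  induction c with
  | ret a => simp [mute, PMF.pure_map]
  | flip k ih => simp [mute, ih, PMF.map_bind]
  | query n q k ih => simp [mute, ih, PMF.pure_bind]

@[simp] theorem distr_ret (a : α) : (ret a).distr = PMF.pure a := by simp [distr, PMF.pure_map]
@[simp] theorem distr_flip (k : Bool → Comp α) :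
    (flip k).distr = coin.bind fun b => (k b).distr := by simp [distr, PMF.map_bind]
@[simp] theorem distr_query (n : ℕ) (q : Val) (k : Val → Comp α) :
    (query n q k).distr = (k .nil).distr := by simp [distr]

@[simp] theorem distr_bind (c : Comp α) (f : α → Comp β) :
    (c.bind f).distr = c.distr.bind fun a => (f a).distr := by
  induction c with
  | ret a => simp
  | flip k ih => simp [ih]
  | query n q k ih => simp [ih]

@[simp] theorem distr_map (c : Comp α) (f : α → β) : (c.map f).distr = c.distr.map f := by
  simp [map, PMF.map, Function.comp_def]

@[simp] theorem distr_mute (c : Comp α) : c.mute.distr = c.distr := by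
  induction c with
  | ret a => simp [mute]
  | flip k ih => simp [mute, ih]
  | query n q k ih => simp [mute, ih]

theorem out_of_mem_support_distr {c : Comp α} {a : α} (h : a ∈ c.distr.support) : c.Out a := by
  simp only [distr, PMF.support_map, Set.mem_image] at h
  obtain ⟨x, hx, rfl⟩ := h
  exact out_of_mem_support _ hx

/-- A loop over a list. -/
def foldl (body : Val → Comp Val) : List Val → Val → Comp Val
  | [], x => ret x
  | a :: l, x => (body (.cons a x)).bind (foldl body l)

theorem foldl_ret (f : Val → Val) (l : List Val) (x : Val) :
    foldl (fun w => ret (f w)) l x = ret (l.foldl (fun x a => f (.cons a x)) x) := by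
  induction l generalizing x with
  | nil => rfl
  | cons a l ih => simp [foldl, ih]

theorem foldl_append (body : Val → Comp Val) (l m : List Val) (x : Val) :
    foldl body (l ++ m) x = (foldl body l x).bind (foldl body m) := by
  induction l generalizing x with
  | nil => rfl
  | cons a l ih => simp only [List.cons_append, foldl, bind_assoc]; congr 1; funext y; exact ih y

end Comp

/-! ## Costs -/

theorem eval_mono (p : Polynomial ℕ) : Monotone fun n : ℕ => p.eval n := by
  intro a b h
  simp only [Polynomial.eval_eq_sum]
  exact Finset.sum_le_sum fun i _ => Nat.mul_le_mul_left _ (Nat.pow_le_pow_left h i)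

/-- This is the form of bound that a program can write down in unary (`PP.unary_pow`). A base of at
least 2 lets the exponent absorb the coefficients. -/
theorem exists_pow_bound (p : Polynomial ℕ) : ∃ k : ℕ, ∀ n : ℕ, p.eval n ≤ (n + 2) ^ k := by
  induction p using Polynomial.induction_on' with
  | add p q hp hq =>
    obtain ⟨k, hk⟩ := hp
    obtain ⟨l, hl⟩ := hq
    refine ⟨k + l + 1, fun n => ?_⟩
    have h1 : (n + 2) ^ k ≤ (n + 2) ^ (k + l) := Nat.pow_le_pow_right (by omega) (by omega)
    have h2 : (n + 2) ^ l ≤ (n + 2) ^ (k + l) := Nat.pow_le_pow_right (by omega) (by omega)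
    have := hk n
    have := hl n
    rw [Polynomial.eval_add, pow_succ]
    nlinarith [Nat.zero_le ((n + 2) ^ (k + l))]
  | monomial m a =>
    refine ⟨a + m, fun n => ?_⟩
    rw [Polynomial.eval_monomial, pow_add]
    have h1 : a ≤ (n + 2) ^ a := (Nat.lt_pow_self (by omega)).le
    exact Nat.mul_le_mul h1 (Nat.pow_le_pow_left (by omega) m)

namespace Code

open Tumbling.Comp

theorem iterate_map_fst (body : Val → Comp (Val × ℕ)) (l : List Val) (x : Val) :
    (iterate body l x).map Prod.fst = foldl (fun w => (body w).map Prod.fst) l x := by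
  induction l generalizing x with
  | nil => rfl
  | cons a l ih => simp only [iterate, foldl, map_bind, map_ret, bind_map, ← ih]; rfl

/-- Every node of a result is paid for by some instruction. The factor 2 covers the small outputs,
such as the three nodes of a truth value, on inputs of size 1. -/
theorem out_eval {c : Code} {H : Hash} {v : Val} {r : Val × ℕ} (h : (c.eval H v).Out r) :
    r.1.size ≤ 2 * r.2 ∧ 1 + v.size ≤ r.2 := by
  have hv := v.size_pos
  induction c generalizing v r with
  | id => simp [eval] at h; subst h; simp; omega
  | nil => simp [eval] at h; subst h; simp; omega
  | fst => simp [eval] at h; subst h; have := v.size_fst_le; simp; omega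
  | snd => simp [eval] at h; subst h; have := v.size_snd_le; simp; omega
  | eq =>
    simp [eval] at h; subst h; refine ⟨?_, le_rfl⟩
    split <;> simp <;> omega
  | flip =>
    simp [eval] at h
    rcases h with h | h <;> subst h <;> simp <;> omega
  | hash =>
    simp [eval] at h; subst h; have := v.size_fst_le; have := size_fit_le_max v.fst.size (H v.snd)
    simp; omega
  | query =>
    simp [eval] at h; obtain ⟨s, h⟩ := h; subst h
    have := v.size_fst_le; have := size_fit_le_max v.fst.size s; simp; omega
  | pair f g hf hg =>
    simp [eval] at h
    obtain ⟨a, m, h1, b, n, h2, rfl⟩ := h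
    have := hf h1 hv; have := hg h2 hv
    simp at *; omega
  | comp g f hg hf =>
    simp [eval] at h
    obtain ⟨a, m, h1, b, n, h2, rfl⟩ := h
    have := hf h1 hv; have := hg h2 a.size_pos
    simp at *; omega
  | ite c f g hc hf hg =>
    simp [eval] at h
    obtain ⟨a, m, h1, b, n, h2, rfl⟩ := h
    split at h2
    · have := hg h2 hv; simp at *; omega
    · have := hf h2 hv; simp at *; omega
  | fold f hf =>
    simp only [eval, out_bind, out_ret] at h
    obtain ⟨r', h1, rfl⟩ := h
    -- A loop may return its initial state at no cost of its own, so this state is counted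
    -- separately; the enclosing instruction pays for it as part of its input.
    have key : ∀ (l : List Val) (x : Val) (r : Val × ℕ), (iterate (f.eval H) l x).Out r →
        r.1.size ≤ x.size + 2 * r.2 := by
      intro l
      induction l with
      | nil => intro x r h; simp [iterate] at h; subst h; simp
      | cons a l ih =>
        intro x r h
        simp only [iterate, out_bind, out_ret] at h
        obtain ⟨r1, h1, r2, h2, rfl⟩ := h
        have := hf h1 (Val.size_pos _); have := ih _ _ h2
        simp at *; omega
    have := key _ _ _ h1; have := v.size_snd_le
    simp; omega

theorem PPT.out {c : Code} (hc : c.PPT) : ∃ p : Polynomial ℕ, ∀ H v r, (c.eval H v).Out r →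
    r.2 ≤ p.eval v.size := by
  obtain ⟨p, hp⟩ := hc
  exact ⟨p, fun H v r h => (all_iff _).1 (hp H v) r h⟩

theorem PPT.of_out {c : Code} (p : Polynomial ℕ) (hp : ∀ H v r, (c.eval H v).Out r →
    r.2 ≤ p.eval v.size) : c.PPT :=
  ⟨p, fun H v => (all_iff _).2 fun r h => hp H v r h⟩

theorem Det.eval_eq {c : Code} (hc : c.Det) (H : Hash) (v : Val) : ∃ t, c.eval H v = ret (c.fn H v, t) := by
  suffices h : ∃ r, c.eval H v = ret r by
    obtain ⟨r, h⟩ := h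
    exact ⟨r.2, by simp [fn, h, value]⟩
  induction c generalizing v with
  | id | nil | fst | snd | eq | hash => exact ⟨_, rfl⟩
  | flip | query => exact hc.elim
  | pair f g hf hg =>
    obtain ⟨r, hr⟩ := hf hc.1 v
    obtain ⟨s, hs⟩ := hg hc.2 v
    exact ⟨_, by simp only [eval, hr, hs, ret_bind]; rfl⟩
  | comp g f hg hf =>
    obtain ⟨r, hr⟩ := hf hc.2 v
    obtain ⟨s, hs⟩ := hg hc.1 r.1
    exact ⟨_, by simp only [eval, hr, hs, ret_bind]; rfl⟩
  | ite c f g h1 h2 h3 =>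
    obtain ⟨r, hr⟩ := h1 hc.1 v
    obtain ⟨s, hs⟩ := h2 hc.2.1 v
    obtain ⟨t, ht⟩ := h3 hc.2.2 v
    by_cases h : r.1 = .nil
    · exact ⟨_, by simp only [eval, hr, ht, h, if_true, ret_bind]; rfl⟩
    · exact ⟨_, by simp only [eval, hr, hs, h, if_false, ret_bind]; rfl⟩
  | fold f hf =>
    have key : ∀ (l : List Val) (x : Val), ∃ r, iterate (f.eval H) l x = ret r := by
      intro l
      induction l with
      | nil => exact fun x => ⟨_, rfl⟩
      | cons a l ih =>
        intro x
        obtain ⟨r, hr⟩ := hf hc (.cons a x)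
        obtain ⟨s, hs⟩ := ih r.1
        exact ⟨_, by simp only [iterate, hr, hs, ret_bind]; rfl⟩
    obtain ⟨r, hr⟩ := key v.fst.toList v.snd
    exact ⟨_, by simp only [eval, hr, ret_bind]; rfl⟩

end Code

/-! ## Bounds for the questions -/

namespace Comp

variable {α β σ : Type}

/-- At any time, the sum of the sizes of the questions and buffers so far and of the offset `n` is at
most the final cost. -/
def Charged : ℕ → Comp (Val × ℕ) → Prop
  | n, ret r => n ≤ r.2
  | n, flip k => ∀ b, Charged n (k b)
  | n, query m q k => ∀ r, Charged (n + m + q.size) (k (fit m r))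

/-- At most `m` questions are asked, and the questions and buffers have size at most `T`. -/
def Bdd (T : ℕ) : ℕ → Comp α → Prop
  | _, ret _ => True
  | m, flip k => ∀ b, Bdd T m (k b)
  | 0, query _ _ _ => False
  | m + 1, query n q k => n ≤ T ∧ q.size ≤ T ∧ ∀ r, Bdd T m (k (fit n r))

theorem charged_bind {c : Comp (Val × ℕ)} {f : Val × ℕ → Comp (Val × ℕ)} {n : ℕ}
    (hc : Charged n c) (hf : ∀ r m, n ≤ m → m ≤ r.2 → Charged m (f r)) : Charged n (c.bind f) := by
  induction c generalizing n with
  | ret r => exact hf r n le_rfl hc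
  | flip k ih => exact fun b => ih b (hc b) hf
  | query m q k ih =>
    exact fun r => ih (fit m r) (hc r) fun s j h => hf s j (by omega)

theorem Charged.mono {c : Comp (Val × ℕ)} {m n : ℕ} (hc : Charged n c) (h : m ≤ n) : Charged m c := by
  induction c generalizing m n with
  | ret r => exact h.trans hc
  | flip k ih => exact fun b => ih b (hc b) h
  | query j q k ih => exact fun r => ih _ (hc r) (by omega)

/-- Adding a constant cost. -/
theorem Charged.add_cost {c : Comp (Val × ℕ)} {n d : ℕ} {f : Val × ℕ → Val × ℕ}
    (hc : Charged n c) (hf : ∀ r, r.2 + d ≤ (f r).2) : Charged (n + d) (c.map f) := by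
  induction c generalizing n with
  | ret r => have := hf r; simp [Charged] at *; omega
  | flip k ih => exact fun b => ih b (hc b)
  | query m q k ih =>
    intro r
    have := ih (fit m r) (hc r)
    exact this.mono (by omega)

/-- Each question has size at least 1 and so raises the charge by at least 1, while the charge never
exceeds the final cost. Hence at most T - n further questions fit, each of size at most T. -/
theorem Charged.bdd {c : Comp (Val × ℕ)} {n T : ℕ} (hc : Charged n c) (h : ∀ r, c.Out r → r.2 ≤ T) :
    Bdd T (T - n) c := by
  induction c generalizing n with
  | ret r => simp [Bdd]
  | flip k ih => exact fun b => ih b (hc b) fun r hr => h r ⟨b, hr⟩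
  | query m q k ih =>
    have hle : n + m + q.size ≤ T := by
      obtain ⟨a, ha⟩ := (k (fit m .nil)).exists_out
      have h1 : ∀ c : Comp (Val × ℕ), ∀ n, Charged n c → ∀ a, c.Out a → n ≤ a.2 := by
        intro c
        induction c with
        | ret r => rintro n h a rfl; exact h
        | flip k ih => rintro n h a ⟨b, hb⟩; exact ih b n (h b) a hb
        | query m q k ih => rintro n h a ⟨b, hb⟩; have := ih _ _ (h b) a hb; omega
      exact (h1 _ _ (hc .nil) a ha).trans (h a ⟨_, ha⟩)
    have hq := q.size_pos
    obtain ⟨j, hj⟩ : ∃ j, T - n = j + 1 := ⟨T - n - 1, by omega⟩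
    rw [hj]
    refine ⟨by omega, by omega, fun r => ?_⟩
    have := ih (fit m r) (hc r) fun a ha => h a ⟨_, ha⟩
    have hmono : ∀ (c : Comp (Val × ℕ)) (i j : ℕ), i ≤ j → Bdd T i c → Bdd T j c := by
      intro c
      induction c with
      | ret r => intros; simp [Bdd]
      | flip k ih => exact fun i j hij h b => ih b i j hij (h b)
      | query m q k ih =>
        intro i j hij h
        match i, j, hij, h with
        | i + 1, j + 1, hij, h => exact ⟨h.1, h.2.1, fun r => ih _ i j (by omega) (h.2.2 r)⟩
    exact hmono _ _ _ (by omega) this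

theorem Bdd.mono {c : Comp α} {T m T' m' : ℕ} (h : Bdd T m c) (hT : T ≤ T') (hm : m ≤ m') : Bdd T' m' c := by
  induction c generalizing m m' with
  | ret a => exact trivial
  | flip k ih => exact fun b => ih b (h b) hm
  | query n q k ih =>
    match m, m', h, hm with
    | m + 1, m' + 1, h, hm => exact ⟨h.1.trans hT, h.2.1.trans hT, fun r => ih _ (h.2.2 r) (by omega)⟩

theorem Bdd.bind_ret {c : Comp α} {T m : ℕ} (h : Bdd T m c) (f : α → β) : Bdd T m (c.map f) := by
  induction c generalizing m with
  | ret a => simp [Bdd]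
  | flip k ih => exact fun b => ih b (h b)
  | query n q k ih =>
    match m, h with
    | m + 1, h => exact ⟨h.1, h.2.1, fun r => ih _ (h.2.2 r)⟩

end Comp

namespace Code
open Tumbling.Comp

theorem charged_iterate {body : Val → Comp (Val × ℕ)} (hb : ∀ w, Charged 0 (body w)) (l : List Val)
    (x : Val) : Charged 0 (iterate body l x) := by
  induction l generalizing x with
  | nil => simp [iterate, Charged]
  | cons a l ih =>
    refine charged_bind (hb _) fun r m _ hm => ?_
    have := (ih r.1).add_cost (d := m) (f := fun r' => (r'.1, r.2 + r'.2)) (fun r' => by simp; omega)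
    simpa [Comp.map] using this

/-- The input of a `query` instruction consists of the buffer and the question, and the instruction
costs at least their sizes; costs add up everywhere else. -/
theorem charged_eval (c : Code) (H : Hash) (v : Val) : Charged 0 (c.eval H v) := by
  induction c generalizing v with
  | id | nil | fst | snd | eq | hash => simp [eval, Charged]
  | flip => simp [eval, Charged]
  | query =>
    intro r
    cases v
    · simp [Charged]
    · simp only [Charged, size_cons, fst_cons, snd_cons]; omega
  | pair f g hf hg =>
    refine charged_bind (hf v) fun r m _ hm => ?_
    have := (hg v).add_cost (d := m) (f := fun s => (.cons r.1 s.1, 1 + v.size + r.2 + s.2))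
      (fun s => by simp; omega)
    simpa [Comp.map] using this
  | comp g f hg hf =>
    refine charged_bind (hf v) fun r m _ hm => ?_
    have := (hg r.1).add_cost (d := m) (f := fun s => (s.1, 1 + v.size + r.2 + s.2))
      (fun s => by simp; omega)
    simpa [Comp.map] using this
  | ite c f g hc hf hg =>
    refine charged_bind (hc v) fun r m _ hm => ?_
    have h : Charged 0 (if r.1 = Val.nil then g.eval H v else f.eval H v) := by
      split
      · exact hg v
      · exact hf v
    have := h.add_cost (d := m) (f := fun s => (s.1, 1 + v.size + r.2 + s.2))
      (fun s => by simp; omega)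
    simpa [Comp.map] using this
  | fold f hf =>
    have := (charged_iterate (hf ·) v.fst.toList v.snd).add_cost (d := 0)
      (f := fun r => (r.1, 1 + v.size + r.2)) (fun s => by simp)
    simpa [Comp.map, eval] using this

theorem bdd_eval {c : Code} {H : Hash} {v : Val} {T : ℕ} (h : ∀ r, (c.eval H v).Out r → r.2 ≤ T) :
    Bdd T T (c.eval H v) := by
  simpa using (c.charged_eval H v).bdd h

end Code

end
end Tumbling

/-! ### Running a program with replaced coins and replaced oracle -/

namespace Tumbling
open Val

noncomputable section

/-! ## Computations with handlers for coins and questions -/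

namespace Comp

variable {α β σ : Type}

/-- Coins and questions are passed to handlers that share a state. -/
def interp (hf : Val → Comp (Bool × Val)) (hq : ℕ → Val → Val → Comp (Val × Val)) :
    Comp α → Val → Comp (α × Val)
  | ret a, s => ret (a, s)
  | flip k, s => (hf s).bind fun r => (k r.1).interp hf hq r.2
  | query n q k, s => (hq n q s).bind fun r => (k r.1).interp hf hq r.2

variable (hf : Val → Comp (Bool × Val)) (hq : ℕ → Val → Val → Comp (Val × Val))

@[simp] theorem interp_ret (a : α) (s : Val) : (ret a).interp hf hq s = ret (a, s) := rfl
@[simp] theorem interp_flip (k : Bool → Comp α) (s : Val) :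
    (flip k).interp hf hq s = (hf s).bind fun r => (k r.1).interp hf hq r.2 := rfl
@[simp] theorem interp_query (n : ℕ) (q : Val) (k : Val → Comp α) (s : Val) :
    (query n q k).interp hf hq s = (hq n q s).bind fun r => (k r.1).interp hf hq r.2 := rfl

@[simp] theorem interp_bind (c : Comp α) (f : α → Comp β) (s : Val) :
    (c.bind f).interp hf hq s = (c.interp hf hq s).bind fun x => (f x.1).interp hf hq x.2 := by
  induction c generalizing s with
  | ret a => rfl
  | flip k ih => simp [ih]
  | query n q k ih => simp [ih]

end Comp

namespace Code

open Tumbling.Comp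

/-- The result of a program, without the running time. -/
def den (c : Code) (H : Hash) (v : Val) : Comp Val := (c.eval H v).map Prod.fst

section den
variable (H : Hash) (v : Val)

@[simp] theorem den_id : den id H v = ret v := rfl
@[simp] theorem den_nil : den nil H v = ret .nil := rfl
@[simp] theorem den_fst : den fst H v = ret v.fst := rfl
@[simp] theorem den_snd : den snd H v = ret v.snd := rfl
@[simp] theorem den_eq : den eq H v = ret (if v.fst = v.snd then ofBool true else ofBool false) := rfl
@[simp] theorem den_flip : den flip H v = .flip fun b => ret (ofBool b) := rfl
@[simp] theorem den_hash : den hash H v = ret (fit v.fst.size (H v.snd)) := rfl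
@[simp] theorem den_query : den query H v = .query v.fst.size v.snd fun r => ret r := rfl

@[simp] theorem den_pair (f g : Code) :
    den (pair f g) H v = (den f H v).bind fun a => (den g H v).bind fun b => ret (.cons a b) := by
  simp [den, eval]

@[simp] theorem den_comp (g f : Code) : den (comp g f) H v = (den f H v).bind (den g H) := by
  simp [den, eval]; rfl

@[simp] theorem den_ite (c f g : Code) :
    den (ite c f g) H v = (den c H v).bind fun r => if r = .nil then den g H v else den f H v := by
  simp only [den, eval, map_bind, map_ret, bind_map]
  congr 1; funext r; split <;> rfl

@[simp] theorem den_fold (f : Code) :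
    den (fold f) H v = Comp.foldl (den f H) v.fst.toList v.snd := by
  have : (fun w => (f.eval H w).map Prod.fst) = den f H := rfl
  rw [← this, ← iterate_map_fst]; simp [den, eval]; rfl

end den

theorem fn_eq_den {c : Code} (hc : c.Det) (H : Hash) (v : Val) : den c H v = ret (c.fn H v) := by
  obtain ⟨t, ht⟩ := hc.eval_eq H v
  simp [den, ht]

theorem play_eq {σ : Type} (c : Code) (H : Hash) (O : σ → Val → PMF (Val × σ)) (s : σ) (v : Val) :
    c.play H O s v = (c.den H v).run O s := by
  simp [play, den, run_map]

theorem dist_eq (c : Code) (H : Hash) (v : Val) : c.dist H v = (c.den H v).distr := by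
  rw [dist, play_eq, distr, ← run_map_exec, PMF.map_comp]; rfl

/-! ## State passing -/

/-- `cons v s ↦ cons s.fst v`-style rearrangements used in `pass`. -/
def swapIn : Code := pair snd (comp snd fst)

def assoc : Code := pair (pair fst (comp fst snd)) (comp snd snd)

/-- The program `c` with a state: it maps `cons v s` to `cons r s'`, and runs `cf` and `cq` on
`cons v s` instead of tossing a coin or asking a question. -/
def pass (cf cq : Code) : Code → Code
  | id => id
  | nil => pair nil snd
  | fst => pair (comp fst fst) snd
  | snd => pair (comp snd fst) snd
  | pair f g => comp assoc (comp (pair (comp fst fst) (comp (pass cf cq g) swapIn))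
      (pair (pass cf cq f) fst))
  | comp g f => comp (pass cf cq g) (pass cf cq f)
  | ite c f g => comp (ite (comp fst fst) (comp (pass cf cq f) swapIn) (comp (pass cf cq g) swapIn))
      (pair (pass cf cq c) fst)
  | eq => pair (comp eq fst) snd
  | fold f => comp (fold (comp (pass cf cq f) assoc))
      (pair (comp fst fst) (pair (comp snd fst) snd))
  | flip => cf
  | hash => pair (comp hash fst) snd
  | query => cq

/-- This makes subroutine calls possible: the transformed program runs `c` while coins and questions
are served by `cf` and `cq`, which share a state that is threaded through all instructions. -/
theorem den_pass {cf cq : Code} {H : Hash} {hf : Val → Comp (Bool × Val)}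
    {hq : ℕ → Val → Val → Comp (Val × Val)}
    (hcf : ∀ v s, cf.den H (.cons v s) = (hf s).map fun x => .cons (ofBool x.1) x.2)
    (hcq : ∀ v s, cq.den H (.cons v s) = (hq v.fst.size v.snd s).map fun x => .cons x.1 x.2)
    (c : Code) (v s : Val) :
    (pass cf cq c).den H (.cons v s) =
      (interp hf hq (c.den H v) s).map fun x => .cons x.1 x.2 := by
  induction c generalizing v s with
  | id | nil | fst | snd | eq | hash => simp [pass]
  | flip => simp [pass, hcf, Comp.map]
  | query => simp [pass, hcq, Comp.map]
  | comp g f hg hf => simp [pass, hf, hg]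
  | pair f g hf hg => simp [pass, hf, hg, assoc, swapIn]
  | ite c f g hc hf hg =>
    simp [pass, hc, hf, hg, swapIn]
    congr 1; funext r; split <;> rfl
  | fold f hf =>
    simp only [pass, den_comp, den_pair, den_fst, den_snd, ret_bind, fst_cons, snd_cons, den_fold]
    generalize v.fst.toList = l
    generalize v.snd = x
    induction l generalizing x s with
    | nil => simp [Comp.foldl]
    | cons a l ih =>
      have h : ∀ w, assoc.den H w = ret (.cons (.cons w.fst w.snd.fst) w.snd.snd) := by simp [assoc]
      simp [Comp.foldl, h, hf, ih]

/-- The factor for the cost of state passing. -/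
def passCost : Code → ℕ
  | pair f g => passCost g + passCost f + 100
  | comp g f => passCost g + passCost f + 10
  | ite c f g => passCost c + passCost g + passCost f + 100
  | fold f => passCost f + 200
  | flip | query => 1
  | _ => 20

/-- Bound for the cost of state passing. -/
theorem out_pass {cf cq : Code} {I : ℕ → Val → Prop} {B Φ : ℕ → ℕ}
    (hΦ : Monotone Φ) (hle : ∀ m, m + B m ≤ Φ m)
    (hI : ∀ n s, I n s → s.size ≤ B n) (hIm : ∀ m n s, m ≤ n → I m s → I n s) {H : Hash}
    (hcf : ∀ n v s r, I n s → (cf.eval H (.cons v s)).Out r → ∃ b s', r.1 = .cons (ofBool b) s' ∧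
      I (n + 1 + v.size) s' ∧ r.2 ≤ Φ (n + 1 + v.size))
    (hcq : ∀ n v s r, I n s → (cq.eval H (.cons v s)).Out r → ∃ a s', r.1 = .cons a s' ∧
      fit v.fst.size a = a ∧ I (n + 1 + v.size) s' ∧ r.2 ≤ Φ (n + 1 + v.size)) (c : Code) :
    ∀ n v s r', I n s → ((pass cf cq c).eval H (.cons v s)).Out r' →
      ∃ r s', r'.1 = .cons r.1 s' ∧ (c.eval H v).Out r ∧ I (n + r.2) s' ∧
        r'.2 ≤ passCost c * r.2 * Φ (n + r.2) := by
  have hlin : ∀ {x F : ℕ}, 1 ≤ x → F ≤ x * F := fun h => Nat.le_mul_of_pos_left _ h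
  -- Here n is the cost of the original program up to the present point, `I n` the invariant of the
  -- state at that cost, and B n a bound for its size. Each original instruction becomes a bounded
  -- number of instructions that move data of size at most n + B n, hence cost O(Φ); replaced coins
  -- and questions cost at most Φ by hypothesis. So the total is a constant times the original cost
  -- times the final value of Φ.
  induction c with
  | id | nil | fst | snd | eq | hash =>
    intro n v s r' hs h
    simp only [passCost]
    simp only [pass, eval, out_ret, out_bind, exists_eq_left, fst_cons, snd_cons, size_cons] at h
    subst h
    refine ⟨_, s, rfl, rfl, hIm _ _ _ (by simp) hs, ?_⟩
    have h3 := hle (n + (1 + v.size))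
    have h4 := hI _ _ (hIm n (n + (1 + v.size)) _ (by omega) hs)
    have h5 := @hlin (1 + v.size) (Φ (n + (1 + v.size))) (by omega)
    rw [mul_assoc]
    dsimp only
    omega
  | flip =>
    intro n v s r' hs h
    simp only [passCost]
    obtain ⟨b, s', h1, h2, h3⟩ := hcf n v s r' hs h
    refine ⟨(ofBool b, 1 + v.size), s', h1, ⟨b, rfl⟩, by simpa [add_assoc] using h2, ?_⟩
    have h5 := @hlin (1 + v.size) (Φ (n + (1 + v.size))) (by omega)
    rw [add_assoc] at h3
    rw [mul_assoc]; dsimp only; omega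
  | query =>
    intro n v s r' hs h
    simp only [passCost]
    obtain ⟨a, s', h1, h0, h2, h3⟩ := hcq n v s r' hs h
    refine ⟨(a, 1 + v.size), s', h1, ⟨a, by simp [h0]⟩, by simpa [add_assoc] using h2, ?_⟩
    have h5 := @hlin (1 + v.size) (Φ (n + (1 + v.size))) (by omega)
    rw [add_assoc] at h3
    rw [mul_assoc]; dsimp only; omega
  | comp g f hg hf =>
    simp only [passCost]
    generalize passCost g = Kg at *
    generalize passCost f = Kf at *
    intro n v s r' hs h
    simp only [pass, eval, out_ret, out_bind] at h
    obtain ⟨r1, h1, r2, h2, rfl⟩ := h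
    obtain ⟨⟨a, t1⟩, s1, e1, o1, i1, c1⟩ := hf n v s r1 hs h1
    rw [e1] at h2
    obtain ⟨⟨b, t2⟩, s2, e2, o2, i2, c2⟩ := hg _ _ _ _ i1 h2
    refine ⟨(b, 1 + v.size + t1 + t2), s2, e2, ?_, hIm _ _ _ (by dsimp only; omega) i2, ?_⟩
    · simp only [eval, out_ret, out_bind]; exact ⟨_, o1, _, o2, rfl⟩
    dsimp only at *
    set t := 1 + v.size + t1 + t2 with ht
    have hm1 : Φ (n + t1) ≤ Φ (n + t) := hΦ (by omega)
    have hm2 : Φ (n + t1 + t2) ≤ Φ (n + t) := hΦ (by omega)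
    have b1 : Kf * t1 * Φ (n + t1) ≤ Kf * (t * Φ (n + t)) := by
      rw [mul_assoc]; gcongr; omega
    have b2 : Kg * t2 * Φ (n + t1 + t2) ≤ Kg * (t * Φ (n + t)) := by
      rw [mul_assoc]; gcongr; omega
    have h3 := hle (n + t)
    have h4 := hI _ _ (hIm n (n + t) _ (by omega) hs)
    have h5 := @hlin t (Φ (n + t)) (by omega)
    simp only [size_cons, add_mul, mul_assoc] at *
    omega
  | pair f g hf hg =>
    simp only [passCost]
    generalize passCost g = Kg at *
    generalize passCost f = Kf at *
    intro n v s r' hs h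
    simp only [pass, eval, out_ret, out_bind, swapIn, assoc, exists_eq_left, fst_cons] at h
    obtain ⟨r3, ⟨r4, ⟨r1, h1, rfl⟩, r5, ⟨r6, ⟨r2, h2, rfl⟩, rfl⟩, rfl⟩, rfl⟩ := h
    obtain ⟨⟨a, t1⟩, s1, e1, o1, i1, c1⟩ := hf n v s r1 hs h1
    simp only [e1, snd_cons] at h2
    obtain ⟨⟨b, t2⟩, s2, e2, o2, i2, c2⟩ := hg _ _ _ _ i1 h2
    refine ⟨(.cons a b, 1 + v.size + t1 + t2), s2, by simp [e1, e2], ?_,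
      hIm _ _ _ (by dsimp only; omega) i2, ?_⟩
    · simp only [eval, out_ret, out_bind]; exact ⟨_, o1, _, o2, rfl⟩
    have z1 := (out_eval o1).1
    have z2 := (out_eval o2).1
    simp only [e1, e2, fst_cons, snd_cons, size_cons] at *
    set t := 1 + v.size + t1 + t2 with ht
    have hm1 : Φ (n + t1) ≤ Φ (n + t) := hΦ (by omega)
    have hm2 : Φ (n + t1 + t2) ≤ Φ (n + t) := hΦ (by omega)
    have b1 : Kf * t1 * Φ (n + t1) ≤ Kf * (t * Φ (n + t)) := by
      rw [mul_assoc]; gcongr; omega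
    have b2 : Kg * t2 * Φ (n + t1 + t2) ≤ Kg * (t * Φ (n + t)) := by
      rw [mul_assoc]; gcongr; omega
    have h3 := hle (n + t)
    have h4 := hI _ _ (hIm n (n + t) _ (by omega) hs)
    have h6 := hI _ _ (hIm (n + t1) (n + t) _ (by omega) i1)
    have h7 := hI _ _ (hIm (n + t1 + t2) (n + t) _ (by omega) i2)
    have h5 := @hlin t (Φ (n + t)) (by omega)
    simp only [add_mul]
    rw [mul_assoc Kf] at *
    rw [mul_assoc Kg] at *
    rw [mul_assoc 100] at *
    omega
  | ite c f g hc hf hg =>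
    simp only [passCost]
    generalize passCost c = Kc at *
    generalize passCost g = Kg at *
    generalize passCost f = Kf at *
    intro n v s r' hs h
    simp only [pass, eval, out_ret, out_bind, swapIn, exists_eq_left, fst_cons] at h
    obtain ⟨r3, ⟨r1, h1, rfl⟩, r4, h4, rfl⟩ := h
    obtain ⟨⟨a, t1⟩, s1, e1, o1, i1, c1⟩ := hc n v s r1 hs h1
    have z1 := (out_eval o1).1
    simp only [e1, fst_cons, snd_cons] at h4
    have hle1 : ∀ t t2, t = 1 + v.size + t1 + t2 → ∀ K c2, c2 ≤ K * t2 * Φ (n + t1 + t2) → K ≤ Kg + Kf →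
        ∀ X, X ≤ r1.2 + c2 + 50 * (n + t + B (n + t)) →
        X ≤ (Kc + Kg + Kf + 100) * t * Φ (n + t) := by
      intro t t2 ht K c2 hc2 hK X hX
      have hm1 : Φ (n + t1) ≤ Φ (n + t) := hΦ (by omega)
      have hm2 : Φ (n + t1 + t2) ≤ Φ (n + t) := hΦ (by omega)
      have b1 : Kc * t1 * Φ (n + t1) ≤ Kc * (t * Φ (n + t)) := by
        rw [mul_assoc]; gcongr; omega
      have b2 : K * t2 * Φ (n + t1 + t2) ≤ (Kg + Kf) * (t * Φ (n + t)) := by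
        rw [mul_assoc]; gcongr; omega
      have h3 := hle (n + t)
      have h5 := @hlin t (Φ (n + t)) (by omega)
      dsimp only at c1
      rw [mul_assoc, show Kc + Kg + Kf + 100 = Kc + (Kg + Kf) + 100 by omega, add_mul, add_mul]
      omega
    by_cases ha : a = .nil
    · simp only [ha, if_true, out_bind, out_ret, snd_cons, exists_eq_left] at h4
      obtain ⟨_, ⟨r2, h2, rfl⟩, rfl⟩ := h4
      obtain ⟨⟨b, t2⟩, s2, e2, o2, i2, c2⟩ := hg _ _ _ _ i1 h2
      refine ⟨(b, 1 + v.size + t1 + t2), s2, e2, ?_, hIm _ _ _ (by dsimp only; omega) i2, ?_⟩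
      · simp only [eval, out_ret, out_bind]; exact ⟨_, o1, _, by simpa [ha] using o2, rfl⟩
      refine hle1 _ t2 rfl Kg _ c2 (by omega) _ ?_
      have h4 := hI _ _ (hIm n (n + (1 + v.size + t1 + t2)) _ (by omega) hs)
      have h6 := hI _ _ (hIm (n + t1) (n + (1 + v.size + t1 + t2)) _ (by omega) i1)
      simp only [e1, size_cons, ha] at *
      omega
    · simp only [ha, if_false, out_bind, out_ret, snd_cons, exists_eq_left] at h4
      obtain ⟨_, ⟨r2, h2, rfl⟩, rfl⟩ := h4
      obtain ⟨⟨b, t2⟩, s2, e2, o2, i2, c2⟩ := hf _ _ _ _ i1 h2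
      refine ⟨(b, 1 + v.size + t1 + t2), s2, e2, ?_, hIm _ _ _ (by dsimp only; omega) i2, ?_⟩
      · simp only [eval, out_ret, out_bind]; exact ⟨_, o1, _, by simpa [ha] using o2, rfl⟩
      refine hle1 _ t2 rfl Kf _ c2 (by omega) _ ?_
      have h4 := hI _ _ (hIm n (n + (1 + v.size + t1 + t2)) _ (by omega) hs)
      have h6 := hI _ _ (hIm (n + t1) (n + (1 + v.size + t1 + t2)) _ (by omega) i1)
      simp only [e1, size_cons, ha] at *
      omega
  | fold f hf =>
    simp only [passCost]
    generalize passCost f = Kf at *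
    -- The extra 100 pays for rearranging element, loop state and handler state in each iteration;
    -- an iteration of the original costs at least 1, so this is absorbed.
    have key : ∀ (l : List Val) (x : Val) n s r', I n s →
        (iterate ((comp (pass cf cq f) assoc).eval H) l (.cons x s)).Out r' →
        ∃ r s', r'.1 = .cons r.1 s' ∧ (iterate (f.eval H) l x).Out r ∧ I (n + r.2) s' ∧
          r'.2 ≤ (Kf + 100) * r.2 * Φ (n + r.2) := by
      intro l
      induction l with
      | nil =>
        intro x n s r' hs h
        simp only [iterate, out_ret] at h
        subst h
        exact ⟨(x, 0), s, rfl, rfl, hs, by simp⟩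
      | cons a l ih =>
        intro x n s r' hs h
        simp only [iterate, eval, out_ret, out_bind, assoc, exists_eq_left, fst_cons, snd_cons] at h
        obtain ⟨_, ⟨r1, h1, rfl⟩, r2, h2, rfl⟩ := h
        obtain ⟨⟨y, t1⟩, s1, e1, o1, i1, c1⟩ := hf _ _ _ _ hs h1
        simp only [e1] at h2
        obtain ⟨⟨z, t2⟩, s2, e2, o2, i2, c2⟩ := ih _ _ _ _ i1 h2
        refine ⟨(z, t1 + t2), s2, e2, ?_, hIm _ _ _ (by dsimp only; omega) i2, ?_⟩
        · simp only [iterate, out_ret, out_bind]; exact ⟨_, o1, _, o2, rfl⟩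
        have z0 := (out_eval o1).2
        simp only [size_cons] at *
        rw [← add_assoc n]
        have hm1 : Φ (n + t1) ≤ Φ (n + t1 + t2) := hΦ (by omega)
        have b1 : Kf * t1 * Φ (n + t1) ≤ Kf * (t1 * Φ (n + t1 + t2)) := by
          rw [mul_assoc]; gcongr
        have h3 := hle (n + t1 + t2)
        have h4 := hI _ _ (hIm n (n + t1 + t2) _ (by omega) hs)
        have h5 := @hlin t1 (Φ (n + t1 + t2)) (by omega)
        have e : (Kf + 100) * (t1 + t2) * Φ (n + t1 + t2) = Kf * (t1 * Φ (n + t1 + t2)) +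
          100 * (t1 * Φ (n + t1 + t2)) + (Kf + 100) * t2 * Φ (n + t1 + t2) := by ring
        rw [e]
        omega
    intro n v s r' hs h
    simp only [pass, eval, out_ret, out_bind, exists_eq_left, fst_cons, snd_cons] at h
    obtain ⟨_, ⟨r1, h1, rfl⟩, rfl⟩ := h
    obtain ⟨⟨y, t1⟩, s1, e1, o1, i1, c1⟩ := key _ _ _ _ _ hs h1
    refine ⟨(y, 1 + v.size + t1), s1, e1, ?_, hIm _ _ _ (by dsimp only; omega) i1, ?_⟩
    · simp only [eval, out_ret, out_bind]; exact ⟨_, o1, rfl⟩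
    have z1 := v.size_fst_le
    have z2 := v.size_snd_le
    simp only [size_cons] at *
    set t := 1 + v.size + t1 with ht
    have hm1 : Φ (n + t1) ≤ Φ (n + t) := hΦ (by omega)
    have b1 : (Kf + 100) * t1 * Φ (n + t1) ≤ (Kf + 100) * (t * Φ (n + t)) := by
      rw [mul_assoc]; gcongr; omega
    have h3 := hle (n + t)
    have h4 := hI _ _ (hIm n (n + t) _ (by omega) hs)
    have h5 := @hlin t (Φ (n + t)) (by omega)
    rw [mul_assoc, show Kf + 200 = (Kf + 100) + 100 by omega, add_mul (Kf + 100)]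
    omega

end Code
end
end Tumbling

/-! ### Closure properties of polynomial time computations -/

namespace Tumbling
open Val

noncomputable section

open Tumbling.Comp

/-- Families of computations that are realized by a polynomial time program. -/
class PP (F : Hash → Val → Comp Val) : Prop where
  exists_code : ∃ c : Code, c.PPT ∧ ∀ H v, c.den H v = F H v

/-- Functions that are computed by a deterministic polynomial time program. -/
abbrev PolyFn (f : Hash → Val → Val) : Prop := PP fun H v => ret (f H v)

/-- The polynomial time program `c`, all whose questions are answered with `nil`. -/
def Code.muted (c : Code) (H : Hash) (v : Val) : Comp Val := (c.den H v).mute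

/-- A coin toss. -/
def flipC : Comp Val := .flip fun b => ret (ofBool b)

/-- The question `q` with a buffer of size `n`. -/
def queryC (n : ℕ) (q : Val) : Comp Val := .query n q ret

theorem Code.out_den {c : Code} {H : Hash} {v a : Val} :
    (c.den H v).Out a ↔ ∃ t, (c.eval H v).Out (a, t) := by
  simp [Code.den]

namespace PP

variable {F G : Hash → Val → Comp Val} {f g h : Hash → Val → Val}

theorem of_code {c : Code} (hc : c.PPT) : PP c.den := ⟨c, hc, fun _ _ => rfl⟩

theorem of_det {c : Code} (hc : c.PPT) (hd : c.Det) : PolyFn c.fn :=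
  ⟨c, hc, fun _ _ => Code.fn_eq_den hd _ _⟩

theorem size (hF : PP F) : ∃ p : Polynomial ℕ, ∀ H v a, (F H v).Out a → a.size ≤ p.eval v.size := by
  obtain ⟨c, hc, h⟩ := hF
  obtain ⟨p, hp⟩ := hc.out
  refine ⟨2 * p, fun H v a ha => ?_⟩
  rw [← h, Code.out_den] at ha
  obtain ⟨t, ht⟩ := ha
  have := hp _ _ _ ht
  have := (Code.out_eval ht).1
  simp at *; omega

theorem fn_size (hf : PolyFn f) : ∃ p : Polynomial ℕ, ∀ H v, (f H v).size ≤ p.eval v.size := by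
  obtain ⟨p, hp⟩ := hf.size
  exact ⟨p, fun H v => hp H v _ rfl⟩

instance id' : PP fun _ v => ret v :=
  ⟨.id, .of_out (1 + .X) (by rintro H v r rfl; simp), fun _ _ => rfl⟩

theorem bind' (hF : PP F) (hG : PP G) : PP fun H v => (F H v).bind (G H) := by
  obtain ⟨c, hc, h1⟩ := hF
  obtain ⟨d, hd, h2⟩ := hG
  refine ⟨.comp d c, ?_, fun H v => ?_⟩
  · obtain ⟨p, hp⟩ := hc.out
    obtain ⟨q, hq⟩ := hd.out
    refine .of_out (1 + .X + p + q.comp (2 * p)) fun H v r hr => ?_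
    simp only [Code.eval, out_bind, out_ret] at hr
    obtain ⟨a, ha, b, hb, rfl⟩ := hr
    have h3 := hp _ _ _ ha
    have h4 := hq _ _ _ hb
    have h5 := eval_mono q (show a.1.size ≤ 2 * p.eval v.size by have := (Code.out_eval ha).1; omega)
    simp at *; omega
  · simp only [Code.den_comp, h1]; congr 1; funext a; rw [h2]

theorem pair' (hF : PP F) (hG : PP G) :
    PP fun H v => (F H v).bind fun a => (G H v).bind fun b => ret (.cons a b) := by
  obtain ⟨c, hc, h1⟩ := hF
  obtain ⟨d, hd, h2⟩ := hG
  refine ⟨.pair c d, ?_, fun H v => ?_⟩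
  · obtain ⟨p, hp⟩ := hc.out
    obtain ⟨q, hq⟩ := hd.out
    refine .of_out (1 + .X + p + q) fun H v r hr => ?_
    simp only [Code.eval, out_bind, out_ret] at hr
    obtain ⟨a, ha, b, hb, rfl⟩ := hr
    have h3 := hp _ _ _ ha
    have h4 := hq _ _ _ hb
    simp at *; omega
  · simp [h1, h2]

theorem ite' {E : Hash → Val → Comp Val} (hE : PP E) (hF : PP F) (hG : PP G) :
    PP fun H v => (E H v).bind fun r => if r = .nil then G H v else F H v := by
  obtain ⟨e, he, h0⟩ := hE
  obtain ⟨c, hc, h1⟩ := hF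
  obtain ⟨d, hd, h2⟩ := hG
  refine ⟨.ite e c d, ?_, fun H v => ?_⟩
  · obtain ⟨p, hp⟩ := hc.out
    obtain ⟨q, hq⟩ := hd.out
    obtain ⟨q', hq'⟩ := he.out
    refine .of_out (1 + .X + p + q + q') fun H v r hr => ?_
    simp only [Code.eval, out_bind, out_ret] at hr
    obtain ⟨a, ha, b, hb, rfl⟩ := hr
    have h3 := hq' _ _ _ ha
    split at hb
    · have h4 := hq _ _ _ hb; simp at *; omega
    · have h4 := hp _ _ _ hb; simp at *; omega
  · simp [h0, h1, h2]

/-- Sequencing: the second computation has access to the input and to the first result. -/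
instance bind [hF : PP F] {K : Hash → Val → Val → Comp Val}
    [hK : PP fun H w => K H w.snd w.fst] : PP fun H v => (F H v).bind fun a => K H v a := by
  have := bind' (pair' hF id') hK
  simpa using this

theorem subst (hG : PP G) (hf : PolyFn f) : PP fun H v => G H (f H v) := by
  simpa using bind' hf hG

instance fst' [hf : PolyFn f] : PolyFn fun H v => (f H v).fst := by
  have h : PolyFn fun _ v => v.fst :=
    ⟨.fst, .of_out (1 + .X) (by rintro H v r rfl; simp), fun _ _ => rfl⟩
  exact subst (G := fun _ v => ret (v.fst)) h hf

instance snd' [hf : PolyFn f] : PolyFn fun H v => (f H v).snd := by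
  have h : PolyFn fun _ v => v.snd :=
    ⟨.snd, .of_out (1 + .X) (by rintro H v r rfl; simp), fun _ _ => rfl⟩
  exact subst (G := fun _ v => ret (v.snd)) h hf

instance cons' [hf : PolyFn f] [hg : PolyFn g] : PolyFn fun H v => .cons (f H v) (g H v) := by
  simpa using pair' hf hg

instance const' (c : Val) : PolyFn fun _ _ => c := by
  induction c with
  | nil => exact ⟨.nil, .of_out (1 + .X) (by rintro H v r rfl; simp), fun _ _ => rfl⟩
  | cons a b ha hb => exact cons'

instance ofList_cons' {l : Hash → Val → List Val} [hf : PolyFn f] [hl : PolyFn fun H v => ofList (l H v)] :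
    PolyFn fun H v => ofList (f H v :: l H v) := cons' (f := f) (g := fun H v => ofList (l H v))

instance get' [hf : PolyFn f] (i : ℕ) : PolyFn fun H v => (f H v).get i := by
  induction i generalizing f with
  | zero => simpa using fst'
  | succ i ih => simpa using ih (f := fun H v => (f H v).snd)

instance eq' [hf : PolyFn f] [hg : PolyFn g] :
    PolyFn fun H v => ofBool (decide (f H v = g H v)) := by
  have h : PolyFn fun _ v => if v.fst = v.snd then ofBool true else ofBool false :=
    ⟨.eq, .of_out (1 + .X) (by rintro H v r rfl; simp), fun _ _ => rfl⟩
  have := subst h (cons' (f := f) (g := g))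
  convert this using 4 with H v
  by_cases h : f H v = g H v <;> simp [h]

instance ite_comp [hf : PolyFn f] [hF : PP F] [hG : PP G] :
    PP fun H v => if f H v = .nil then F H v else G H v := by
  simpa using ite' hf hG hF

instance ite_fn [hf : PolyFn f] [hg : PolyFn g] [hh : PolyFn h] :
    PolyFn fun H v => if f H v = .nil then g H v else h H v := by
  have := ite' hf hh hg
  convert this using 3 with H v
  simp only [ret_bind]
  split <;> rfl

instance flip' : PP fun _ _ => flipC :=
  ⟨.flip, .of_out (1 + .X) (by rintro H v r ⟨b, rfl⟩; simp), fun _ _ => rfl⟩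

instance query' [hf : PolyFn f] [hg : PolyFn g] : PP fun H v => queryC (f H v).size (g H v) := by
  have h : PP fun _ v => queryC v.fst.size v.snd :=
    ⟨.query, .of_out (1 + .X) (by rintro H v r ⟨b, rfl⟩; simp), fun _ _ => rfl⟩
  simpa using subst h (cons' (f := f) (g := g))

/-! ### Loops -/

variable {L init : Hash → Val → Val}

/-- A loop with access to the input, if the states have polynomial size. -/
theorem foldM_of_bound {K : Hash → Val → Val → Val → Comp Val}
    (hK : PP fun H w => K H w.fst w.snd.fst w.snd.snd) (hL : PolyFn L) (hi : PolyFn init)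
    (q : Polynomial ℕ) (hq : ∀ H v l x, l <+: (L H v).toList →
      (Comp.foldl (fun w => K H v w.snd w.fst) l (init H v)).Out x → x.size ≤ q.eval v.size) :
    PP fun H v => Comp.foldl (fun w => K H v w.snd w.fst) (L H v).toList (init H v) := by
  -- the body acts on `cons a (cons v x)`; the bound is imposed by a test on the input
  obtain ⟨c, hc, h1⟩ := hL
  obtain ⟨d, hd, h2⟩ := hi
  have key : ∀ H v (l : List Val) x, Comp.foldl (fun w => (K H w.snd.fst w.snd.snd w.fst).map
      fun y => .cons w.snd.fst y) l (.cons v x) =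
      (Comp.foldl (fun w => K H v w.snd w.fst) l x).map fun y => .cons v y := by
    intro H v l
    induction l with
    | nil => intro x; rfl
    | cons a l ih => intro x; simp [Comp.foldl, ih]
  have hbody : PP fun H w => (K H w.snd.fst w.snd.snd w.fst).map fun y => .cons w.snd.fst y := by
    have h3 : PP fun H w => K H w.snd.fst w.snd.snd w.fst := by
      have := subst (f := fun _ w => .cons w.snd.fst (.cons w.snd.snd w.fst)) hK inferInstance
      simpa using this
    exact bind (hF := h3) (K := fun H w y => ret (.cons w.snd.fst y))
  obtain ⟨e, he, h3⟩ := hbody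
  have hcode : ∀ H v, (Code.comp .snd (.comp (.fold e) (.pair c (.pair .id d)))).den H v =
      Comp.foldl (fun w => K H v w.snd w.fst) (L H v).toList (init H v) := by
    intro H v
    have : e.den H = _ := funext (h3 H)
    simp [h1, h2, this, key]
  refine ⟨.comp .snd (.comp (.fold e) (.pair c (.pair .id d))), ?_, hcode⟩
  obtain ⟨pc, hpc⟩ := hc.out
  obtain ⟨pd, hpd⟩ := hd.out
  obtain ⟨p, hp⟩ := he.out
  let z : Polynomial ℕ := 1 + 2 * pc + .X + 2 * pd + 1
  refine .of_out (50 * (1 + z + .X + q) + pc + pd + 2 * pc * p.comp (2 * pc + .X + q + 2)) fun H v r hr => ?_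
  simp only [Code.eval, out_bind, out_ret, exists_eq_left] at hr
  obtain ⟨_, ⟨_, ⟨⟨L', tL⟩, hL, _, ⟨⟨i', ti⟩, hi, rfl⟩, rfl⟩, _, ⟨⟨y, t⟩, ha, rfl⟩, rfl⟩, rfl⟩ := hr
  have eL : L' = L H v := by
    have : (c.den H v).Out L' := Code.out_den.2 ⟨_, hL⟩
    simpa [h1] using this
  have ei : i' = init H v := by
    have : (d.den H v).Out i' := Code.out_den.2 ⟨_, hi⟩
    simpa [h2] using this
  have zL := (Code.out_eval hL).1
  have zi := (Code.out_eval hi).1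
  have tL' := hpc _ _ _ hL
  have ti' := hpd _ _ _ hi
  simp only [fst_cons, snd_cons] at ha
  have hden : ∀ m x s, (Code.iterate (e.eval H) m (.cons v x)).Out s →
      ∃ x', s.1 = .cons v x' ∧ (Comp.foldl (fun w => K H v w.snd w.fst) m x).Out x' := by
    intro m x s hs
    have h4 : ((Code.iterate (e.eval H) m (.cons v x)).map Prod.fst).Out s.1 := by
      simp only [out_map]; exact ⟨s, hs, rfl⟩
    have h5 : (fun w => (e.eval H w).map Prod.fst) = _ := funext (h3 H)
    rw [Code.iterate_map_fst, h5, key, out_map] at h4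
    obtain ⟨x', hx', e⟩ := h4
    exact ⟨x', e, hx'⟩
  -- After a prefix m of the list the state has size at most q by hypothesis, so each remaining
  -- iteration runs on an input of bounded size and has the same cost bound.
  have key2 : ∀ (l m : List Val) (x : Val) (r : Val × ℕ), m ++ l = L'.toList →
      (Comp.foldl (fun w => K H v w.snd w.fst) m i').Out x → (Code.iterate (e.eval H) l (.cons v x)).Out r →
      r.2 ≤ l.length * p.eval (L'.size + v.size + q.eval v.size + 2) := by
    intro l
    induction l with
    | nil => rintro m x r _ _ h; simp [Code.iterate] at h; simp [h]
    | cons a l ih =>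
      intro m x r hm hx h
      simp only [Code.iterate, out_bind, out_ret] at h
      obtain ⟨s, hs, t, ht, rfl⟩ := h
      have e1 := hp _ _ _ hs
      have e2 := hq H v m x ⟨_, by rw [hm, eL]⟩ (by rwa [ei] at hx)
      have e3 : a.size < L'.size := size_mem_lt (by rw [← hm]; simp)
      have e5 := eval_mono p (show (Val.cons a (.cons v x)).size ≤ L'.size + v.size + q.eval v.size + 2 by
        simp; omega)
      obtain ⟨x', e7, e8⟩ := hden [a] x (s.1, s.2 + 0) (by
        simp only [Code.iterate, out_bind, out_ret, exists_eq_left]; exact ⟨s, hs, rfl⟩)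
      simp only at e7
      rw [e7] at ht
      have e6 := ih (m ++ [a]) x' t (by simp [hm]) (by
        rw [foldl_append, out_bind]; exact ⟨x, hx, e8⟩) ht
      simp only [List.length_cons, add_mul] at *
      omega
  have b1 := key2 _ [] i' (y, t) (by simp) rfl ha
  obtain ⟨x', e7, e8⟩ := hden _ _ _ ha
  have b2 := hq H v _ x' List.prefix_rfl (by rwa [← eL, ← ei])
  have b3 := length_toList_lt L'
  have b4 := eval_mono p (show L'.size + v.size + q.eval v.size + 2 ≤
    2 * pc.eval v.size + v.size + q.eval v.size + 2 by dsimp only at *; omega)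
  have b5 := Nat.mul_le_mul (show L'.toList.length ≤ 2 * pc.eval v.size by dsimp only at *; omega) b4
  simp only at e7
  subst e7
  simp [z] at *
  omega

/-- The growth allowed per iteration depends on the input and the element, not on the state. Growth
is therefore additive along the loop; a state that may double would become exponential. -/
theorem foldM {K : Hash → Val → Val → Val → Comp Val}
    (hK : PP fun H w => K H w.fst w.snd.fst w.snd.snd) (hL : PolyFn L) (hi : PolyFn init)
    (g : Polynomial ℕ) (hg : ∀ H v x a y, (K H v x a).Out y → y.size ≤ x.size + g.eval (v.size + a.size)) :
    PP fun H v => Comp.foldl (fun w => K H v w.snd w.fst) (L H v).toList (init H v) := by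
  obtain ⟨p, hp⟩ := hL.fn_size
  obtain ⟨r, hr⟩ := hi.fn_size
  refine foldM_of_bound hK hL hi (r + p * g.comp (.X + p)) fun H v l x hl hx => ?_
  have key : ∀ (l : List Val) (x y : Val), (∀ a ∈ l, a.size ≤ (L H v).size) →
      (Comp.foldl (fun w => K H v w.snd w.fst) l x).Out y →
      y.size ≤ x.size + l.length * g.eval (v.size + (L H v).size) := by
    intro l
    induction l with
    | nil => intro x y _ h; simp [Comp.foldl] at h; simp [h]
    | cons a l ih =>
      intro x y ha h
      simp only [Comp.foldl, out_bind] at h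
      obtain ⟨z, h1, h2⟩ := h
      have e1 := hg _ _ _ _ _ h1
      have e2 := ih _ _ (fun b hb => ha b (by simp [hb])) h2
      have e3 := eval_mono g (show v.size + a.size ≤ v.size + (L H v).size by
        have := ha a (by simp); omega)
      simp only [snd_cons, fst_cons, List.length_cons, add_mul] at *
      omega
  have h1 := key l _ _ (fun a ha => (size_mem_lt (hl.subset ha)).le) hx
  have h2 := hr H v
  have h3 := hp H v
  have h4 := length_toList_lt (L H v)
  have h5 := hl.length_le
  have h6 := eval_mono g (show v.size + (L H v).size ≤ v.size + p.eval v.size by omega)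
  have h7 := Nat.mul_le_mul (show l.length ≤ p.eval v.size by omega) h6
  simp at *; omega

theorem fold {K : Hash → Val → Val → Val → Val}
    (hK : PolyFn fun H w => K H w.fst w.snd.fst w.snd.snd) (hL : PolyFn L) (hi : PolyFn init)
    (g : Polynomial ℕ) (hg : ∀ H v x a, (K H v x a).size ≤ x.size + g.eval (v.size + a.size)) :
    PolyFn fun H v => (L H v).toList.foldl (fun x a => K H v x a) (init H v) := by
  have := foldM (K := fun H v x a => ret (K H v x a)) hK hL hi g (by
    rintro H v x a y rfl; exact hg H v x a)
  simpa [foldl_ret] using this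

/-! ### Handlers -/

/-- The state of the handlers is a fixed environment together with a variable part, which grows per
question by an amount that depends on the environment and the question only. As questions are
charged to the running time of `A`, the state remains polynomial although the cost of a handler
depends on it. -/
theorem interp {A : Code} (hA : A.PPT) {hf : Hash → Val → Comp (Bool × Val)}
    {hq : Hash → ℕ → Val → Val → Comp (Val × Val)}
    (hcf : PP fun H w => (hf H w.snd).map fun x => .cons (ofBool x.1) x.2)
    (hcq : PP fun H w => (hq H w.fst.fst.size w.fst.snd w.snd).map fun x => .cons x.1 x.2)
    (hfit : ∀ H n q s x, (hq H n q s).Out x → fit n x.1 = x.1) (g : Polynomial ℕ)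
    (hgf : ∀ H s x, (hf H s).Out x → x.2.fst = s.fst ∧
      x.2.snd.size ≤ s.snd.size + g.eval s.fst.size)
    (hgq : ∀ H n q s x, (hq H n q s).Out x → x.2.fst = s.fst ∧
      x.2.snd.size ≤ s.snd.size + g.eval (s.fst.size + n + q.size)) :
    PP fun H (v : Val) => (Comp.interp (hf H) (hq H) (A.den H v.fst) v.snd).map fun x => .cons x.1 x.2 := by
  obtain ⟨cf, hcf, h1⟩ := hcf
  obtain ⟨cq, hcq, h2⟩ := hcq
  have hpass : ∀ H (v : Val), (Code.pass cf cq A).den H (.cons v.fst v.snd) =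
      (Comp.interp (hf H) (hq H) (A.den H v.fst) v.snd).map fun x => .cons x.1 x.2 :=
    fun H v => Code.den_pass (fun v s => h1 H (.cons v s)) (fun v s => h2 H (.cons v s)) A _ _
  refine ⟨.comp (Code.pass cf cq A) (.pair .fst .snd), ?_, fun H v => by simpa using hpass H v⟩
  obtain ⟨pf, hpf⟩ := hcf.out
  obtain ⟨pq, hpq⟩ := hcq.out
  obtain ⟨pA, hpA⟩ := hA.out
  -- X bounds the environment and the initial variable part. At cost n there were at most n growth
  -- steps, and buffer and question together have size at most 2n, which explains g (X + 2n); the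
  -- final 1 is the node that joins the two parts.
  let B (X : ℕ) (n : ℕ) : ℕ := 2 * X + n * g.eval (X + 2 * n) + 1
  let Φ (X : ℕ) (n : ℕ) : ℕ := n + B X n + (pf + pq).eval (n + B X n)
  let I (e : Val) (X : ℕ) (n : ℕ) (s : Val) : Prop :=
    s.fst = e ∧ s.snd.size ≤ X + n * g.eval (X + 2 * n)
  have hB : ∀ X, Monotone (B X) := fun X m n h => by
    have := Nat.mul_le_mul h (eval_mono g (show X + 2 * m ≤ X + 2 * n by omega))
    simp only [B]; dsimp only at this; omega
  have hΦ : ∀ X, Monotone (Φ X) := fun X m n h => by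
    have h1 := hB X h
    have := eval_mono (pf + pq) (show m + B X m ≤ n + B X n by omega)
    simp only [Φ]; dsimp only at this; omega
  have hIm : ∀ e X m n s, m ≤ n → I e X m s → I e X n s := fun e X m n s h hs => by
    refine ⟨hs.1, hs.2.trans ?_⟩
    have := Nat.mul_le_mul h (eval_mono g (show X + 2 * m ≤ X + 2 * n by omega))
    dsimp only at this; omega
  have hIB : ∀ e X n s, e.size ≤ X → I e X n s → s.size ≤ B X n := by
    rintro e X n s he ⟨h1, h2⟩
    subst h1
    cases s with
    | nil => simp [B]
    | cons a b => simp only [fst_cons, snd_cons, size_cons, B] at *; omega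
  have hcost : ∀ e X n v s, e.size ≤ X → I e X n s →
      (Val.cons v s).size ≤ n + 1 + v.size + B X (n + 1 + v.size) := fun e X n v s he hs => by
    have h1 := hIB e X n s he hs
    have h2 := hB X (show n ≤ n + 1 + v.size by omega)
    simp only [size_cons]; omega
  have hstep : ∀ e X n (v s s' : Val), e.size ≤ X → I e X n s → s'.fst = s.fst →
      s'.snd.size ≤ s.snd.size + g.eval (s.fst.size + 2 * v.size) → I e X (n + 1 + v.size) s' := by
    rintro e X n v s s' he ⟨h1, h2⟩ h3 h4
    refine ⟨h3.trans h1, ?_⟩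
    have h5 := eval_mono g (show s.fst.size + 2 * v.size ≤ X + 2 * (n + 1 + v.size) by rw [h1]; omega)
    have h6 := eval_mono g (show X + 2 * n ≤ X + 2 * (n + 1 + v.size) by omega)
    have h7 := Nat.mul_le_mul_left n h6
    dsimp only at h5 h7
    have h8 : (n + 1 + v.size) * g.eval (X + 2 * (n + 1 + v.size)) = n * g.eval (X + 2 * (n + 1 + v.size)) +
      g.eval (X + 2 * (n + 1 + v.size)) + v.size * g.eval (X + 2 * (n + 1 + v.size)) := by ring
    omega
  have hmain := fun e X (he : e.size ≤ X) H => Code.out_pass (cf := cf) (cq := cq) (H := H)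
    (I := I e X) (B := B X) (Φ := Φ X) (hΦ X) (fun m => by simp [Φ]) (fun n s h => hIB e X n s he h)
    (hIm e X) (fun n v s r hs hr => by
      have hd : (cf.den H (.cons v s)).Out r.1 := Code.out_den.2 ⟨_, hr⟩
      rw [h1, out_map] at hd
      obtain ⟨x, hx, ex⟩ := hd
      obtain ⟨g1, g2⟩ := hgf H s x hx
      refine ⟨x.1, x.2, ex, hstep e X n v s _ he hs g1 (g2.trans ?_), ?_⟩
      · have := eval_mono g (show s.fst.size ≤ s.fst.size + 2 * v.size by omega)
        dsimp only at this; omega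
      · have := hpf _ _ _ hr
        have h9 := eval_mono pf (hcost e X n v s he hs)
        simp only [Φ, Polynomial.eval_add] at *; omega) (fun n v s r hs hr => by
      have hd : (cq.den H (.cons v s)).Out r.1 := Code.out_den.2 ⟨_, hr⟩
      rw [h2, out_map] at hd
      obtain ⟨x, hx, ex⟩ := hd
      obtain ⟨g1, g2⟩ := hgq H _ _ _ x hx
      refine ⟨x.1, x.2, ex, hfit _ _ _ _ _ hx, hstep e X n v s _ he hs g1 (g2.trans ?_), ?_⟩
      · have := eval_mono g (show s.fst.size + v.fst.size + v.snd.size ≤ s.fst.size + 2 * v.size by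
          have := v.size_fst_le; have := v.size_snd_le; omega)
        simp only [fst_cons, snd_cons] at *; omega
      · have := hpq _ _ _ hr
        have h9 := eval_mono pq (hcost e X n v s he hs)
        simp only [Φ, Polynomial.eval_add] at *; omega) A
  -- This is n + B X n with X the size of the whole input and n the time bound of `A` on it, written
  -- as a polynomial.
  let M : Polynomial ℕ := pA + (2 * .X + pA * g.comp (.X + 2 * pA) + 1)
  refine .of_out (50 * (1 + .X) + (A.passCost : Polynomial ℕ) * pA * (M + (pf + pq).comp M)) fun H w r hr => ?_
  simp only [Code.eval, out_bind, out_ret, exists_eq_left] at hr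
  obtain ⟨r', hr, rfl⟩ := hr
  have h0 := w.size_fst_le
  have h00 := w.size_snd_le
  obtain ⟨⟨a, t⟩, s', -, ha, -, hc⟩ := hmain w.snd.fst w.size (w.snd.size_fst_le.trans h00) H 0 _ _ _
    ⟨rfl, by have := w.snd.size_snd_le; simp; omega⟩ hr
  have ht : t ≤ pA.eval w.size := (hpA _ _ _ ha).trans (eval_mono pA h0)
  have hM : (50 * (1 + Polynomial.X) + (A.passCost : Polynomial ℕ) * pA * (M + (pf + pq).comp M)).eval w.size =
      50 * (1 + w.size) + A.passCost * pA.eval w.size * Φ w.size (pA.eval w.size) := by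
    simp [M, Φ, B]
  rw [hM]
  have h3 : A.passCost * t * Φ w.size (0 + t) ≤ A.passCost * pA.eval w.size * Φ w.size (pA.eval w.size) := by
    have := hΦ w.size ht
    rw [zero_add]
    gcongr
  simp only [size_cons] at *
  omega

end PP
end
end Tumbling

namespace Tumbling
open Val

noncomputable section

open Tumbling.Comp

/-! ## A library of polynomial time functions -/

theorem interp_mute {α : Type} (c : Comp α) (s : Val) :
    c.interp (fun s => .flip fun b => ret (b, s)) (fun _ _ s => ret (.nil, s)) s =
      c.mute.map fun a => (a, s) := by
  induction c with
  | ret a => rfl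
  | flip k ih => simp [mute, ih]
  | query n q k ih => simp [mute, ih]

/-- Handlers that pass coins on and answer every question with `nil` turn a program with an oracle
into one that asks nothing. -/
theorem PP.muted {c : Code} (hc : c.PPT) : PP c.muted := by
  have h1 : PP fun (_ : Hash) w => (Comp.flip fun b => ret (b, w.snd)).map
      fun x : Bool × Val => .cons (ofBool x.1) x.2 := by
    have : PP fun _ w => flipC.bind fun b => ret (.cons b w.snd) := inferInstance
    simpa [flipC] using this
  have h2 : PP fun (_ : Hash) w => (ret (.nil, w.snd)).map fun x : Val × Val => .cons x.1 x.2 := by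
    have : PolyFn fun _ w => .cons .nil w.snd := inferInstance
    simpa using this
  have h3 := PP.interp hc (hf := fun _ s => .flip fun b => ret (b, s))
    (hq := fun _ _ _ s => ret (.nil, s)) h1 h2 (by simp) 0 (by simp) (by simp)
  have h4 := h3.subst (f := fun _ v => .cons v .nil) inferInstance
  have h5 : PP fun H v => ((Comp.interp (fun s => .flip fun b => ret (b, s))
    (fun _ _ s => ret (.nil, s)) (c.den H v) .nil).map fun x => Val.cons x.1 x.2).bind
      fun r => ret r.fst := by
    exact PP.bind (hF := by simpa using h4) (K := fun _ _ r => ret r.fst)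
  have h6 : c.muted = fun H v => (c.den H v).mute := rfl
  rw [h6]
  simpa [interp_mute] using h5

theorem Code.distr_muted (c : Code) (H : Hash) (v : Val) : (c.muted H v).distr = c.dist H v := by
  simp [Code.muted, Code.dist_eq]

namespace PP

variable {F G : Hash → Val → Comp Val} {f g h L : Hash → Val → Val}

theorem muted_comp {c : Code} (hc : c.PPT) [hf : PolyFn f] : PP fun H v => c.muted H (f H v) :=
  subst (muted hc) hf

theorem det_comp {c : Code} (hc : c.PPT) (hd : c.Det) [hf : PolyFn f] :
    PolyFn fun H v => c.fn H (f H v) :=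
  subst (G := fun H v => ret (c.fn H v)) (of_det hc hd) hf

end PP

namespace Val

theorem foldl_cons (f : Val → Val) (l : List Val) (x : Val) :
    l.foldl (fun x a => cons (f a) x) x = ofList ((l.map f).reverse ++ x.toList) := by
  induction l generalizing x with
  | nil => simp
  | cons a l ih => simp [ih]

def append (v w : Val) : Val := ofList (v.toList ++ w.toList)

/-- `v` with `a` added at the end. -/
def snoc (v a : Val) : Val := ofList (v.toList ++ [a])

def map (f : Val → Val) (v : Val) : Val := ofList (v.toList.map f)

/-- `v` without its first `i.toNat` elements. -/
def drop (v i : Val) : Val := ofList (v.toList.drop i.toNat)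

/-- The position of the first occurrence of `a` in `v`. -/
def idx (v a : Val) : Val := open Classical in unary (v.toList.findIdx fun x => x = a)

/-- A truth value as a data value. -/
def test (P : Prop) : Val := open Classical in ofBool (decide P)

@[simp] theorem toList_append (v w : Val) : (v.append w).toList = v.toList ++ w.toList := by
  simp [append]
@[simp] theorem toList_snoc (v a : Val) : (v.snoc a).toList = v.toList ++ [a] := by simp [snoc]
@[simp] theorem toList_map (f : Val → Val) (v : Val) : (v.map f).toList = v.toList.map f := by
  simp [map]
@[simp] theorem toList_drop (v i : Val) : (v.drop i).toList = v.toList.drop i.toNat := by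
  simp [drop]

theorem size_snoc (v a : Val) : (v.snoc a).size = v.size + a.size + 1 := by
  have := size_ofList_append v.toList [a]
  simp [snoc] at *; omega

theorem size_append (v w : Val) : (v.append w).size + 1 = v.size + w.size := by
  have := size_ofList_append v.toList w.toList
  simp [append] at *; omega

@[simp] theorem test_ne_nil {P : Prop} : test P ≠ nil ↔ P := by
  by_cases h : P <;> simp [test, h]

@[simp] theorem test_eq_nil {P : Prop} : test P = nil ↔ ¬ P := by
  by_cases h : P <;> simp [test, h]

theorem test_of {P : Prop} (h : P) : test P = cons nil nil := by simp [test, h]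
theorem test_of_not {P : Prop} (h : ¬ P) : test P = nil := by simp [test, h]

theorem size_test_le (P : Prop) : (test P).size ≤ 3 := size_ofBool_le _

end Val

theorem mem_bitStrings {n : ℕ} {v : Val} :
    v ∈ bitStrings n ↔ v.toList.length = n ∧ ∀ a ∈ v.toList, a = nil ∨ a = cons nil nil := by
  constructor
  · rintro ⟨f, rfl⟩
    simp only [toList_ofList, List.length_map, List.length_ofFn, List.mem_map, true_and]
    rintro _ ⟨b, _, rfl⟩
    cases b <;> simp
  · rintro ⟨h1, h2⟩
    subst h1
    refine ⟨fun i => decide (v.toList[i] ≠ nil), ?_⟩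
    conv_lhs => rw [← ofList_toList v]
    refine congrArg ofList (List.ext_getElem (by simp) fun i h3 h4 => ?_)
    rcases h2 _ (List.getElem_mem h3) with h | h <;> simp [h]

namespace PP

variable {F G : Hash → Val → Comp Val} {f g h L : Hash → Val → Val}

/-- A loop can only put new elements in front, so it builds the list reversed; applying this twice
restores the order. -/
theorem map_rev {K : Hash → Val → Val → Val} (hL : PolyFn L) (hK : PolyFn fun H w => K H w.fst w.snd)
    (hg : PolyFn g) :
    PolyFn fun H v => ofList (((L H v).toList.map (K H v)).reverse ++ (g H v).toList) := by
  obtain ⟨p, hp⟩ := hK.fn_size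
  have := fold (K := fun H v x a => .cons (K H v a) x) (L := L) (init := g) (by
    have := subst (f := fun _ w => .cons w.fst w.snd.snd) hK inferInstance
    simp only [fst_cons, snd_cons] at this
    exact cons' (hf := this)) hL hg (p.comp (.X + 1) + 1) (fun H v x a => by
      have := hp H (.cons v a); simp at *; omega)
  simpa only [foldl_cons] using this

instance append' [hf : PolyFn f] [hg : PolyFn g] : PolyFn fun H v => (f H v).append (g H v) := by
  have h1 := map_rev (K := fun _ _ a => a) hf inferInstance (const' .nil)
  have h2 := map_rev (K := fun _ _ a => a) h1 inferInstance hg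
  simpa [Val.append, Function.comp_def] using h2

instance snoc' [hf : PolyFn f] [hg : PolyFn g] : PolyFn fun H v => (f H v).snoc (g H v) := by
  have := append' (hf := hf) (g := fun H v => .cons (g H v) .nil)
  simpa [Val.append, Val.snoc] using this

instance map' {K : Hash → Val → Val → Val} [hL : PolyFn L] [hK : PolyFn fun H w => K H w.fst w.snd] :
    PolyFn fun H v => (L H v).map (K H v) := by
  have h1 := map_rev hL hK (const' .nil)
  have h2 := map_rev (K := fun _ _ a => a) h1 inferInstance (const' .nil)
  simpa [Val.map, Function.comp_def] using h2

instance drop' [hf : PolyFn f] [hg : PolyFn g] : PolyFn fun H v => (f H v).drop (g H v) := by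
  have := fold (K := fun _ _ x _ => x.snd) (L := g) (init := f) inferInstance hg hf 0
    (fun H v x a => by have := x.size_snd_le; simpa)
  have key : ∀ (l : List Val) (x : Val), l.foldl (fun x _ => x.snd) x = ofList (x.toList.drop l.length) := by
    intro l
    induction l with
    | nil => simp
    | cons a l ih => intro x; cases x <;> simp [ih]
  simpa only [key, Val.drop, Val.toNat] using this

/-! ### Predicates -/

variable {P Q : Hash → Val → Prop}

instance test_eq [hf : PolyFn f] [hg : PolyFn g] : PolyFn fun H v => test (f H v = g H v) := by
  have := eq' (hf := hf) (hg := hg)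
  convert this using 4 with H v
  by_cases h : f H v = g H v <;> simp [h, test]

instance test_and [hP : PolyFn fun H v => test (P H v)] [hQ : PolyFn fun H v => test (Q H v)] :
    PolyFn fun H v => test (P H v ∧ Q H v) := by
  have := ite_fn (hf := hP) (g := fun _ _ => .nil) (hh := hQ)
  convert this using 4 with H v
  by_cases h1 : P H v <;> by_cases h2 : Q H v <;> simp [h1, h2, test]

instance test_not [hP : PolyFn fun H v => test (P H v)] : PolyFn fun H v => test (¬ P H v) := by
  have := ite_fn (hf := hP) (g := fun _ _ => .cons .nil .nil) (h := fun _ _ => .nil)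
  convert this using 4 with H v
  by_cases h1 : P H v <;> simp [h1, test]

instance test_ne [hf : PolyFn f] [hg : PolyFn g] : PolyFn fun H v => test (f H v ≠ g H v) :=
  test_not (P := fun H v => f H v = g H v)

instance test_or [hP : PolyFn fun H v => test (P H v)] [hQ : PolyFn fun H v => test (Q H v)] :
    PolyFn fun H v => test (P H v ∨ Q H v) := by
  have := ite_fn (hf := hP) (hg := hQ) (h := fun _ _ => .cons .nil .nil)
  convert this using 4 with H v
  by_cases h1 : P H v <;> by_cases h2 : Q H v <;> simp [h1, h2, test]

instance test_iff [hP : PolyFn fun H v => test (P H v)] [hQ : PolyFn fun H v => test (Q H v)] :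
    PolyFn fun H v => test (P H v ↔ Q H v) := by
  have := test_eq (hf := hP) (hg := hQ)
  convert this using 4 with H v
  by_cases h1 : P H v <;> by_cases h2 : Q H v <;> simp [h1, h2, test]

instance test_forall {P : Hash → Val → Val → Prop} [hL : PolyFn L]
    [hP : PolyFn fun H w => test (P H w.fst w.snd)] :
    PolyFn fun H v => test (∀ a ∈ (L H v).toList, P H v a) := by
  have := fold (K := fun H v x a => if test (P H v a) = .nil then .nil else x) (L := L)
    (init := fun _ _ => .cons .nil .nil) (by
    have := subst (f := fun _ w => .cons w.fst w.snd.snd) hP inferInstance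
    simp only [fst_cons, snd_cons] at this
    exact ite_fn (hf := this)) hL inferInstance 1 (fun H v x a => by split <;> simp)
  convert this using 3 with H v
  have key : ∀ (l : List Val) (Q : Val → Prop) (R : Prop),
      l.foldl (fun x a => if test (Q a) = .nil then .nil else x) (test R) = test (R ∧ ∀ a ∈ l, Q a) := by
    intro l Q
    induction l with
    | nil => simp
    | cons a l ih =>
      intro R
      by_cases h : Q a
      · simp [h, ih]
      · have := ih False
        simp only [test_of_not not_false, false_and] at this
        simp [h, this, test_of_not]
  have := key (L H v).toList (P H v) True
  rw [test_of trivial] at this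
  simp [this]

instance test_exists {P : Hash → Val → Val → Prop} [hL : PolyFn L]
    [hP : PolyFn fun H w => test (P H w.fst w.snd)] :
    PolyFn fun H v => test (∃ a ∈ (L H v).toList, P H v a) := by
  have := test_not (P := fun H v => ∀ a ∈ (L H v).toList, ¬ P H v a)
  simpa using this

instance test_mem [hL : PolyFn L] [hf : PolyFn f] : PolyFn fun H v => test (f H v ∈ (L H v).toList) := by
  have : PolyFn fun H v => test (∃ a ∈ (L H v).toList, a = f H v) := by
    refine test_exists (hP := ?_)
    have := subst (f := fun _ w => w.fst) hf inferInstance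
    exact test_eq (hg := this)
  simpa using this

/-- The first element with a property, as a list of length at most one. -/
instance find' {P : Hash → Val → Val → Prop} [hL : PolyFn L]
    [hP : PolyFn fun H w => test (P H w.fst w.snd)] :
    PolyFn fun H v => open Classical in
      ofList ((L H v).toList.find? fun a => decide (P H v a)).toList := by
  classical
  have := fold (K := fun H v x a => if x = .nil then (if test (P H v a) = .nil then .nil else .cons a .nil) else x)
    (L := L) (init := fun _ _ => .nil) (by
    have := subst (f := fun _ w => .cons w.fst w.snd.snd) hP inferInstance
    simp only [fst_cons, snd_cons] at this
    exact ite_fn (hg := ite_fn (hf := this))) hL inferInstance (.X + 2) (fun H v x a => by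
      have := v.size_pos
      split
      · split <;> simp <;> omega
      · simp)
  convert this using 3 with H v
  have key : ∀ (l : List Val) (Q : Val → Prop) (x : Val), x ≠ .nil → l.foldl (fun x a =>
      if x = .nil then (if test (Q a) = .nil then .nil else .cons a .nil) else x) x = x := by
    intro l Q
    induction l with
    | nil => simp
    | cons a l ih => intro x hx; simpa [hx] using ih x hx
  have key : ∀ (l : List Val) (Q : Val → Prop), l.foldl (fun x a =>
      if x = .nil then (if test (Q a) = .nil then .nil else .cons a .nil) else x) .nil =
        ofList (l.find? fun a => decide (Q a)).toList := by
    intro l Q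
    induction l with
    | nil => simp
    | cons a l ih =>
      by_cases h : Q a
      · rw [List.foldl_cons, if_pos rfl, if_neg (by simpa using h), key _ _ _ (by simp)]; simp [h]
      · rw [List.foldl_cons, if_pos rfl, if_pos (by simpa using h), ih]; simp [h]
  exact (key _ _).symm

instance idx' [hL : PolyFn L] [hf : PolyFn f] : PolyFn fun H v => (L H v).idx (f H v) := by
  classical
  -- The first component is a flag that is raised at the first match and freezes the state; the
  -- second counts the elements before it.
  have := fold (K := fun H v x a => if x.fst = .nil then
    (if test (a = f H v) = .nil then .cons .nil (.cons .nil x.snd) else .cons (.cons .nil .nil) x.snd) else x)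
    (L := L) (init := fun _ _ => .cons .nil .nil) (by
    have : PolyFn fun H w => f H w.fst := subst (f := fun _ w => w.fst) hf inferInstance
    infer_instance) hL inferInstance 4 (fun H v x a => by
      rcases x with _ | ⟨x1, x2⟩
      · by_cases h2 : a = f H v <;> simp [h2]
      · by_cases h1 : x1 = .nil <;> by_cases h2 : a = f H v <;> simp [h1, h2] <;> omega)
  have h2 := snd' (hf := this)
  convert h2 using 3 with H v
  have k1 : ∀ (l : List Val) (Q : Val → Prop) (x : Val), x.fst ≠ .nil → l.foldl (fun x a =>
      if x.fst = .nil then (if test (Q a) = .nil then .cons .nil (.cons .nil x.snd)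
        else .cons (.cons .nil .nil) x.snd) else x) x = x := by
    intro l Q
    induction l with
    | nil => simp
    | cons a l ih => intro x hx; simpa [hx] using ih x hx
  have key : ∀ (l : List Val) (Q : Val → Prop) (n : ℕ), (l.foldl (fun (x a : Val) =>
      if x.fst = .nil then (if test (Q a) = .nil then .cons .nil (.cons .nil x.snd)
        else .cons (.cons .nil .nil) x.snd) else x) (.cons .nil (unary n))).snd =
        unary (n + l.findIdx fun a => decide (Q a)) := by
    intro l Q
    induction l with
    | nil => simp
    | cons a l ih =>
      intro n
      by_cases h : Q a
      · rw [List.foldl_cons, if_pos (fst_cons _ _), if_neg (by simpa using h), k1 _ _ _ (by simp)]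
        simp [List.findIdx_cons, h]
      · have := ih (n + 1)
        rw [List.foldl_cons, if_pos (fst_cons _ _), if_pos (by simpa using h), snd_cons, ← unary_succ, this]; simp [List.findIdx_cons, h]; congr 1; omega
  have := key (L H v).toList (· = f H v) 0
  simp only [unary_zero, zero_add] at this
  rw [this, idx]
  congr!

instance test_bits [hf : PolyFn f] [hg : PolyFn g] :
    PolyFn fun H v => test (f H v ∈ bitStrings (g H v).toNat) := by
  have h1 : PolyFn fun H v => test ((f H v).map (fun _ => .nil) = (g H v).map (fun _ => .nil) ∧
    ∀ a ∈ (f H v).toList, a = .nil ∨ a = .cons .nil .nil) := inferInstance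
  convert h1 using 4 with H v
  rw [mem_bitStrings, ← toList_ofList ((f H v).toList)]
  have : (f H v).map (fun _ => .nil) = (g H v).map (fun _ => .nil) ↔
      (f H v).toList.length = (g H v).toNat := by
    simp only [Val.map, ofList_injective.eq_iff, List.map_const', Val.toNat]
    exact ⟨fun h => by simpa using congrArg List.length h, fun h => by rw [h]⟩
  rw [this]; simp

instance test_key [hf : PolyFn f] [hg : PolyFn g] :
    PolyFn fun H v => test (f H v ∈ keySpace (g H v).toNat) := by
  have h1 : PolyFn fun H v => test (f H v ≠ .nil ∧ (f H v).fst ∈ bitStrings (g H v).toNat ∧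
    (f H v).snd ∈ bitStrings (g H v).toNat) := inferInstance
  convert h1 using 4 with H v
  constructor
  · rintro ⟨k, hk, r, hr, h⟩; simp [h, hk, hr]
  · rintro ⟨h1, h2, h3⟩
    refine ⟨_, h2, _, h3, ?_⟩
    cases h : f H v <;> simp_all

/-! ### Unary arithmetic -/

/-- Multiplication is repeated concatenation. The loop runs over the numeral with two elements
added, which gives the factor toNat + 2. -/
instance unary_pow [hf : PolyFn f] (k : ℕ) : PolyFn fun H v => unary (((f H v).toNat + 2) ^ k) := by
  induction k with
  | zero => simpa only [pow_zero] using const' (unary 1)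
  | succ k ih =>
    have h := fold (K := fun H v x _ => (unary (((f H v).toNat + 2) ^ k)).append x)
      (L := fun H v => .cons .nil (.cons .nil (f H v))) (init := fun _ _ => .nil) (by
        have h1 : PolyFn fun H w => unary (((f H w.fst).toNat + 2) ^ k) :=
          subst (f := fun _ w => w.fst) ih inferInstance
        infer_instance) inferInstance inferInstance
      ih.fn_size.choose (fun H v x a => by
        have := ih.fn_size.choose_spec H v
        have h2 := size_append (unary (((f H v).toNat + 2) ^ k)) x
        have h3 := eval_mono ih.fn_size.choose (show v.size ≤ v.size + a.size by omega)
        dsimp only at h3; omega)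
    convert h using 3 with H v
    have key : ∀ (l : List Val) (n m : ℕ), l.foldl (fun x _ => (unary n).append x) (unary m) =
        unary (l.length * n + m) := by
      intro l n
      induction l with
      | nil => simp
      | cons a l ih =>
        intro m
        have : (unary n).append (unary m) = unary (n + m) := by
          simp only [Val.append, unary, toList_ofList, List.replicate_add]
        simp only [List.foldl_cons, this, ih, List.length_cons]; congr 1; ring
    have h2 := key (Val.cons .nil (.cons .nil (f H v))).toList (((f H v).toNat + 2) ^ k) 0
    simp only [unary_zero] at h2
    rw [h2]; simp only [toList_cons, List.length_cons, Val.toNat, add_zero]; congr 1; ring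

end PP
end
end Tumbling

/-! ### Truncation, sampling and probabilities -/

namespace Tumbling
open Val

noncomputable section

open Tumbling.Comp
open scoped ENNReal

/-! ## Truncation by a program -/

namespace Val

/-- One step of a traversal of the trees on a stack. -/
def pop (s : Val) : Val := if s.fst = nil then s.snd else cons s.fst.fst (cons s.fst.snd s.snd)

/-- One step of a parallel traversal, which stops when one of the stacks is empty. -/
def popBoth (x : Val) : Val :=
  if x.fst = nil then x else if x.snd = nil then x else cons (pop x.fst) (pop x.snd)

def weight (s : Val) : ℕ := (s.toList.map size).sum

theorem weight_eq_zero {s : Val} : s.weight = 0 ↔ s = nil := by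
  cases s with
  | nil => simp [weight]
  | cons a b => have := a.size_pos; simp [weight]; omega

theorem weight_pop {s : Val} (h : s ≠ nil) : (pop s).weight = s.weight - 1 := by
  rcases s with _ | ⟨a, s⟩
  · exact absurd rfl h
  · rcases a with _ | ⟨a, b⟩
    · simp [pop, weight]
    · simp [pop, weight]; omega

theorem size_pop_le (s : Val) : (pop s).size ≤ s.size := by
  rcases s with _ | ⟨a, s⟩
  · simp [pop]
  · rcases a with _ | ⟨a, b⟩
    · simp [pop]; omega
    · simp [pop]; omega

theorem size_popBoth_le (x : Val) : (popBoth x).size ≤ x.size := by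
  unfold popBoth
  split
  · rfl
  · split
    · rfl
    · rcases x with _ | ⟨a, b⟩
      · simp_all
      · have := size_pop_le a; have := size_pop_le b; simp; omega

/-- `v` if its size is at most the length of `n` and the size of `b`, and `nil` otherwise. -/
def trunc (n b v : Val) : Val :=
  if (n.toList.foldl (fun x _ => popBoth x) (cons (cons v nil) (cons b nil))).fst = nil then v else nil

/-- Loops run over lists, so the traversal of `v` needs a list `n` as fuel. Each step removes one
node from the stack of `v` and one from the stack of `b`; the first stack is empty at the end
exactly if neither the fuel nor `b` ran out before `v`. -/
theorem trunc_eq (n b v : Val) : trunc n b v = fit (min n.toNat b.size) v := by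
  have key : ∀ (l : List Val) (s t : Val), ((l.foldl (fun x _ => popBoth x) (cons s t)).fst = nil ↔
      s.weight ≤ min l.length t.weight) := by
    intro l
    induction l with
    | nil => intro s t; simp [← weight_eq_zero]
    | cons a l ih =>
      intro s t
      -- Once one stack is empty the state is frozen, so remaining fuel has no effect.
      have halt : ∀ (x : Val) (l : List Val), (x.fst = nil ∨ x.snd = nil) →
          l.foldl (fun x _ => popBoth x) x = x := by
        intro x l hx
        induction l with
        | nil => rfl
        | cons a l ih =>
          have : popBoth x = x := by unfold popBoth; rcases hx with h | h <;> simp [h]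
          simp only [List.foldl_cons, this, ih]
      by_cases hs : s = nil
      · rw [halt _ _ (Or.inl (by simpa using hs))]; simp [hs, weight]
      · by_cases ht : t = nil
        · rw [halt _ _ (Or.inr (by simpa using ht))]; simp [ht, weight, hs]
          simpa [weight] using mt weight_eq_zero.1 hs
        · have h1 : popBoth (cons s t) = cons (pop s) (pop t) := by simp [popBoth, hs, ht]
          have h2 := mt weight_eq_zero.1 hs
          have h3 := mt weight_eq_zero.1 ht
          simp only [List.foldl_cons, h1, ih, weight_pop hs, weight_pop ht, List.length_cons]
          omega
  have := key n.toList (cons v nil) (cons b nil)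
  simp only [weight, toList_cons, toList_nil, List.map_cons, List.map_nil, List.sum_cons,
    List.sum_nil, add_zero] at this
  exact if_congr this rfl rfl

/-! ## Halving -/

/-- Two counters change places at each step and one of them is increased, so each receives every
other step; the second one ends at the quotient rounded down. -/
def half (v : Val) : Val :=
  (v.toList.foldl (fun x _ => cons (cons nil x.snd) x.fst) (cons nil nil)).snd

theorem half_unary (n : ℕ) : half (unary n) = unary (n / 2) := by
  have key : ∀ (l : List Val) (a b : ℕ), l.foldl (fun x _ => cons (cons nil x.snd) x.fst)
      (cons (unary a) (unary b)) = if l.length % 2 = 0 then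
        cons (unary (a + l.length / 2)) (unary (b + l.length / 2)) else
        cons (unary (b + (l.length + 1) / 2)) (unary (a + l.length / 2)) := by
    intro l
    induction l with
    | nil => simp
    | cons x l ih =>
      intro a b
      have := ih (b + 1) a
      simp only [List.foldl_cons, fst_cons, snd_cons, List.length_cons, unary_succ] at this ⊢
      rw [this]
      split
      · rw [if_neg (by omega)]; congr 2; all_goals omega
      · rw [if_pos (by omega)]; congr 2; omega
  have := key (unary n).toList 0 0
  simp only [unary_zero, zero_add] at this
  have hl : (unary n).toList.length = n := toNat_unary n
  rw [half, this, hl]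
  split <;> rfl

end Val

namespace PP

variable {F G : Hash → Val → Comp Val} {f g h L : Hash → Val → Val}

instance pop' [hf : PolyFn f] : PolyFn fun H v => (f H v).pop := by
  unfold Val.pop; infer_instance

instance popBoth' [hf : PolyFn f] : PolyFn fun H v => (f H v).popBoth := by
  unfold Val.popBoth; infer_instance

instance trunc' [hf : PolyFn f] [hg : PolyFn g] [hh : PolyFn h] :
    PolyFn fun H v => trunc (f H v) (g H v) (h H v) := by
  have := fold (K := fun _ _ x _ => popBoth x) (L := f)
    (init := fun H v => .cons (.cons (h H v) .nil) (.cons (g H v) .nil)) inferInstance hf inferInstance 0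
    (fun H v x a => by simpa using size_popBoth_le x)
  unfold trunc
  exact ite_fn (hf := fst' (hf := this))

instance half' [hf : PolyFn f] : PolyFn fun H v => (f H v).half := by
  have := fold (K := fun _ _ x _ => Val.cons (.cons .nil x.snd) x.fst) (L := f)
    (init := fun _ _ => .cons .nil .nil) inferInstance hf inferInstance 4
    (fun H v x a => by cases x <;> simp; omega)
  exact snd' (hf := this)

end PP

/-! ## Random bits, keys and indices -/

/-- As many random bits as `n` has elements. -/
def bitsC (n : Val) : Comp Val :=
  Comp.foldl (fun w => flipC.bind fun b => ret (w.snd.snoc b)) n.toList .nil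

/-- A random secret key. -/
def keyC (n : Val) : Comp Val := (bitsC n).bind fun k => (bitsC n).bind fun r => ret (.cons k r)

/-- A random index: a unary number below a power of two that exceeds the length of `n`. -/
def idxStep (x : Val) : Comp Val :=
  if x.fst = .nil then ret x else flipC.bind fun b => ret
    (.cons x.fst.half (if b = .nil then x.snd.append x.snd else .cons .nil (x.snd.append x.snd)))

/-- The counter in the first component is halved until it vanishes and one random bit is appended
per halving. The result has as many random bits as the length of `n` has binary digits, and needs no
rejection. -/
def idxC (n : Val) : Comp Val :=
  (Comp.foldl (fun w => idxStep w.snd) n.toList (.cons (n.map fun _ => .nil) .nil)).map Val.snd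

namespace PP

variable {F G : Hash → Val → Comp Val} {f g h L : Hash → Val → Val}

instance bitsC' [hf : PolyFn f] : PP fun H v => bitsC (f H v) := by
  refine foldM (K := fun _ _ x _ => flipC.bind fun b => ret (x.snoc b)) inferInstance hf inferInstance
    4 (fun H v x a y hy => ?_)
  simp only [flipC, flip_bind, ret_bind, out_flip, out_ret] at hy
  obtain ⟨b, rfl⟩ := hy
  rw [size_snoc]
  have := size_ofBool_le b
  simp; omega

instance keyC' [hf : PolyFn f] : PP fun H v => keyC (f H v) := by
  have : PolyFn fun H w => f H w.snd := subst (f := fun _ w => w.snd) hf inferInstance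
  have : PolyFn fun H w => f H w.snd.snd := subst (f := fun _ w => w.snd.snd) hf inferInstance
  unfold keyC
  infer_instance

instance idxC' [hf : PolyFn f] : PP fun H v => idxC (f H v) := by
  obtain ⟨p, hp⟩ := hf.fn_size
  have : PP fun H v => Comp.foldl (fun w => idxStep w.snd) (f H v).toList
      (.cons ((f H v).map fun _ => .nil) .nil) := by
    refine foldM_of_bound (K := fun _ _ x _ => idxStep x) ?_ hf inferInstance (20 * (p + 1))
      (fun H v l x hl hx => ?_)
    · have : PP fun H v => idxStep v := by unfold idxStep; infer_instance
      exact subst this inferInstance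
    -- The value doubles at each step, so additive growth is not available. Instead counter times
    -- (value + 1) does not increase, because halving compensates doubling; a positive counter then
    -- gives j + 1 ≤ N, whence 2j + 1 ≤ 2N.
    · have key : ∀ (l : List Val) (n j : ℕ) (N : ℕ) x, n * (j + 1) ≤ N → j ≤ 2 * N →
          (Comp.foldl (fun w => idxStep w.snd) l (.cons (unary n) (unary j))).Out x →
          ∃ n' j' : ℕ, x = .cons (unary n') (unary j') ∧ n' * (j' + 1) ≤ N ∧ j' ≤ 2 * N := by
        intro l
        induction l with
        | nil => rintro n j N x h1 h2 rfl; exact ⟨n, j, rfl, h1, h2⟩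
        | cons a l ih =>
          intro n j N x h1 h2 hx
          simp only [Comp.foldl, snd_cons, out_bind] at hx
          obtain ⟨y, hy, hx⟩ := hx
          simp only [idxStep, snd_cons, fst_cons] at hy
          rcases n with _ | n
          · simp at hy; subst hy; exact ih 0 j N x h1 h2 hx
          · simp only [unary_succ, reduceCtorEq, if_false, flipC, flip_bind, ret_bind, out_flip, out_ret] at hy
            obtain ⟨b, rfl⟩ := hy
            rw [← unary_succ, half_unary] at hx
            have happ : (unary j).append (unary j) = unary (2 * j) := by
              simp only [Val.append, unary, toList_ofList, List.replicate_append_replicate]; congr 2; omega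
            rw [happ] at hx
            have h3 := Nat.div_mul_le_self (n + 1) 2
            have h4 : (n + 1) / 2 * 2 * (j + 1) ≤ N := (Nat.mul_le_mul_right _ h3).trans h1
            have h5 : j + 1 ≤ N := le_trans (by nlinarith) h1
            cases b
            · exact ih ((n + 1) / 2) (2 * j) N x (by nlinarith) (by omega) (by simpa using hx)
            · exact ih ((n + 1) / 2) (2 * j + 1) N x (by nlinarith) (by omega) (by simpa using hx)
      have h0 : (f H v).map (fun _ => .nil) = unary (f H v).toNat := by
        simp [Val.map, unary, Val.toNat]
      rw [h0] at hx
      obtain ⟨n', j', rfl, h1, h2⟩ := key l (f H v).toNat 0 (f H v).toNat x (by simp) (by simp) hx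
      have h3 : (f H v).toNat < (f H v).size := length_toList_lt _
      have h4 := hp H v
      have h5 : n' ≤ (f H v).toNat := le_trans (by nlinarith) h1
      simp; omega
  exact bind (hF := this) (K := fun _ _ y => ret y.snd)

end PP

/-! ## Probabilities -/

variable {α β γ σ : Type}

/-- The expected value. -/
def ex (p : PMF α) (F : α → ℝ≥0∞) : ℝ≥0∞ := ∑' a, p a * F a

/-- The probability of an event. -/
def pr (p : PMF α) (P : α → Prop) : ℝ≥0∞ := p.toOuterMeasure {a | P a}

section prob
variable {p : PMF α} {P Q : α → Prop} {F G : α → ℝ≥0∞}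

theorem ex_mono (h : ∀ a ∈ p.support, F a ≤ G a) : ex p F ≤ ex p G :=
  ENNReal.tsum_le_tsum fun a => by
    by_cases ha : p a = 0
    · simp [ha]
    · exact mul_le_mul_right (h a ((PMF.mem_support_iff _ _).2 ha)) _

theorem ex_congr (h : ∀ a ∈ p.support, F a = G a) : ex p F = ex p G :=
  le_antisymm (ex_mono fun a ha => (h a ha).le) (ex_mono fun a ha => (h a ha).ge)

@[simp] theorem ex_const (c : ℝ≥0∞) : ex p (fun _ => c) = c := by
  simp [ex, ENNReal.tsum_mul_right]

theorem ex_add : ex p (fun a => F a + G a) = ex p F + ex p G := by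
  simp [ex, mul_add, ENNReal.tsum_add]

theorem ex_const_mul (c : ℝ≥0∞) : ex p (fun a => c * F a) = c * ex p F := by
  simp only [ex, ← ENNReal.tsum_mul_left]; congr 1; funext a; ring

theorem ex_le (c : ℝ≥0∞) (h : ∀ a ∈ p.support, F a ≤ c) : ex p F ≤ c := by
  simpa using ex_mono (G := fun _ => c) h

@[simp] theorem ex_pure (a : α) (F : α → ℝ≥0∞) : ex (PMF.pure a) F = F a := by
  rw [ex, tsum_eq_single a]
  · simp
  · intro b hb; simp [PMF.pure_apply, hb]

@[simp] theorem ex_bind (f : α → PMF β) (F : β → ℝ≥0∞) :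
    ex (p.bind f) F = ex p fun a => ex (f a) F := by
  simp only [ex, PMF.bind_apply, ← ENNReal.tsum_mul_right, ← ENNReal.tsum_mul_left]
  rw [ENNReal.tsum_comm]; simp only [mul_assoc]

@[simp] theorem ex_map (f : α → β) (F : β → ℝ≥0∞) : ex (p.map f) F = ex p fun a => F (f a) := by
  simp [PMF.map, Function.comp_def]

theorem ex_comm (q : PMF β) (F : α → β → ℝ≥0∞) :
    ex p (fun a => ex q fun b => F a b) = ex q fun b => ex p fun a => F a b := by
  simp only [ex, ← ENNReal.tsum_mul_left]
  rw [ENNReal.tsum_comm]; congr 1; funext b; congr 1; funext a; ring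

theorem pr_eq_ex : pr p P = ex p fun a => open Classical in if P a then 1 else 0 := by
  classical
  rw [pr, PMF.toOuterMeasure_apply, ex]
  congr 1; funext a
  by_cases h : P a <;> simp [Set.indicator, h]

@[simp] theorem pr_bind (f : α → PMF β) (P : β → Prop) :
    pr (p.bind f) P = ex p fun a => pr (f a) P := by simp only [pr_eq_ex, ex_bind]

@[simp] theorem pr_map (f : α → β) (P : β → Prop) : pr (p.map f) P = pr p fun a => P (f a) := by
  simp only [pr_eq_ex, ex_map]

theorem pr_pure (a : α) (P : α → Prop) :
    pr (PMF.pure a) P = open Classical in if P a then 1 else 0 := by simp only [pr_eq_ex, ex_pure]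

theorem pr_pure_of {a : α} (h : P a) : pr (PMF.pure a) P = 1 := by simp [pr_pure, h]
theorem pr_pure_of_not {a : α} (h : ¬ P a) : pr (PMF.pure a) P = 0 := by simp [pr_pure, h]

theorem pr_mono (h : ∀ a ∈ p.support, P a → Q a) : pr p P ≤ pr p Q := by
  classical
  rw [pr_eq_ex, pr_eq_ex]
  refine ex_mono fun a ha => ?_
  by_cases hP : P a
  · simp [hP, h a ha hP]
  · simp [hP]

theorem pr_congr (h : ∀ a ∈ p.support, (P a ↔ Q a)) : pr p P = pr p Q :=
  le_antisymm (pr_mono fun a ha => (h a ha).1) (pr_mono fun a ha => (h a ha).2)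

theorem pr_le_one : pr p P ≤ 1 := by
  classical
  rw [pr_eq_ex]
  exact ex_le 1 fun a _ => by split <;> simp

theorem pr_ne_top : pr p P ≠ ∞ := (pr_le_one.trans_lt ENNReal.one_lt_top).ne

theorem pr_or_le : pr p (fun a => P a ∨ Q a) ≤ pr p P + pr p Q := by
  classical
  simp only [pr_eq_ex, ← ex_add]
  refine ex_mono fun a _ => ?_
  by_cases hP : P a <;> by_cases hQ : Q a <;> simp [hP, hQ]

theorem pr_add_not : pr p P + pr p (fun a => ¬ P a) = 1 := by
  classical
  simp only [pr_eq_ex, ← ex_add]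
  rw [← ex_const (p := p) 1]
  refine ex_congr fun a _ => ?_
  by_cases hP : P a <;> simp [hP]

theorem pr_of_forall (h : ∀ a ∈ p.support, P a) : pr p P = 1 := by
  have : pr p P = pr p fun _ => True := pr_congr fun a ha => by simp [h a ha]
  rw [this, pr_eq_ex]; simp

theorem pr_of_forall_not (h : ∀ a ∈ p.support, ¬ P a) : pr p P = 0 := by
  have : pr p P = pr p fun _ => False := pr_congr fun a ha => by simp [h a ha]
  rw [this, pr_eq_ex]; simp

end prob

theorem prob_eq (e : PMF Prop) : prob e = (pr e fun P => P).toReal := by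
  have : {P : Prop | P} = {True} := by ext P; simp
  rw [prob, pr, this, PMF.toOuterMeasure_apply_singleton]

theorem coin_apply (b : Bool) : coin b = 2⁻¹ := by simp [coin]

theorem ex_coin (F : Bool → ℝ≥0∞) : ex coin F = 2⁻¹ * F true + 2⁻¹ * F false := by
  simp [ex, coin_apply]

end
end Tumbling

namespace Tumbling
open Val

noncomputable section

open Tumbling.Comp
open scoped ENNReal

variable {α β γ σ : Type}

/-! ## Distributions of random bits, keys and indices -/

theorem uniformBits_zero : uniformBits 0 = PMF.pure .nil := by
  ext v
  simp only [uniformBits, PMF.map_apply, PMF.uniformOfFintype_apply, PMF.pure_apply]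
  rw [tsum_fintype]
  simp

theorem uniformBits_succ (n : ℕ) :
    uniformBits (n + 1) = (uniformBits n).bind fun v => coin.map fun b => v.snoc (ofBool b) := by
  have h : PMF.uniformOfFintype (Fin (n + 1) → Bool) = (PMF.uniformOfFintype (Fin n → Bool)).bind
      fun f => coin.map fun b => (Fin.snoc f b : Fin (n + 1) → Bool) := by
    ext g
    rw [PMF.bind_apply, tsum_eq_single (Fin.init g)]
    · rw [PMF.map_apply, tsum_eq_single (g (Fin.last n))]
      · simp [coin_apply, pow_succ, ENNReal.mul_inv]
      · intro b hb
        rw [if_neg]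
        rintro h; exact hb (by rw [h]; simp)
    · intro f hf
      rw [PMF.map_apply]
      simp only [mul_eq_zero, ENNReal.tsum_eq_zero]
      right
      intro b
      rw [if_neg]
      rintro h; exact hf (by rw [h]; simp)
  rw [uniformBits, h, PMF.map_bind, uniformBits, PMF.bind_map]
  congr 1; funext f
  simp only [PMF.map_comp, Function.comp_def]
  congr 1; funext b
  simp only [Val.snoc, toList_ofList]
  rw [List.ofFn_succ']
  simp

theorem support_uniformBits (n : ℕ) : (uniformBits n).support = bitStrings n := by
  ext v
  simp [uniformBits, bitStrings, eq_comm]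

theorem run_bits (l : List Val) (O : σ → Val → PMF (Val × σ)) (s : σ) :
    (Comp.foldl (fun w => flipC.bind fun b => ret (w.snd.snoc b)) l .nil).run O s =
      (uniformBits l.length).map fun v => (v, s, v.toList) := by
  induction l using List.reverseRecOn with
  | nil => simp [Comp.foldl, run_ret, uniformBits_zero, PMF.pure_map]
  | append_singleton l a ih =>
    rw [foldl_append, run_bind, ih, List.length_append, List.length_singleton, uniformBits_succ]
    simp [Comp.foldl, flipC, run_flip, run_ret, Function.comp_def,
      PMF.map]

/-- The recorded coins are the string itself. An extractor for an adversary that begins by sampling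
a string can therefore be fed a transcript that begins with any chosen string. -/
theorem run_bitsC (n : Val) (O : σ → Val → PMF (Val × σ)) (s : σ) :
    (bitsC n).run O s = (uniformBits n.toNat).map fun v => (v, s, v.toList) := run_bits _ _ _

theorem exec_bitsC (n : Val) (O : σ → Val → PMF (Val × σ)) (s : σ) :
    (bitsC n).exec O s = (uniformBits n.toNat).map fun v => (v, s) := by
  rw [← run_map_exec, run_bitsC, PMF.map_comp]; rfl

theorem exec_keyC (n : Val) (O : σ → Val → PMF (Val × σ)) (s : σ) :
    (keyC n).exec O s = (sampleKey n.toNat).map fun v => (v, s) := by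
  have h : ∀ κ, sampleKey κ = (uniformBits κ).bind fun k => (uniformBits κ).bind fun r =>
    PMF.pure (.cons k r) := fun _ => rfl
  simp [keyC, exec_bind, exec_bitsC, h, PMF.map_bind, PMF.bind_map, Function.comp_def, PMF.pure_map]

theorem distr_bitsC (n : Val) : (bitsC n).distr = uniformBits n.toNat := by
  rw [distr, exec_bitsC, PMF.map_comp]; exact PMF.map_id _

theorem distr_keyC (n : Val) : (keyC n).distr = sampleKey n.toNat := by
  rw [distr, exec_keyC, PMF.map_comp]; exact PMF.map_id _

theorem mem_keySpace_of_mem_support {κ : ℕ} {v : Val} (h : v ∈ (sampleKey κ).support) :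
    v ∈ keySpace κ := by
  have h' : v ∈ ((uniformBits κ).bind fun k => (uniformBits κ).bind fun r =>
    PMF.pure (Val.cons k r)).support := h
  simp only [PMF.mem_support_bind_iff, support_uniformBits, PMF.mem_support_pure_iff] at h'
  exact h'

/-- The last bit has to agree with probability 1/2, and the rest of the string with the remaining
bits. -/
theorem pr_uniformBits_le (n : ℕ) (v : Val) : pr (uniformBits n) (· = v) ≤ 2⁻¹ ^ n := by
  induction n generalizing v with
  | zero => simpa using pr_le_one
  | succ n ih =>
    rw [uniformBits_succ, pr_bind]
    have h1 : ∀ w ∈ (uniformBits n).support, pr (coin.map fun b => w.snoc (ofBool b)) (· = v) ≤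
        2⁻¹ * pr (PMF.pure w) (· = ofList v.toList.dropLast) := by
      intro w _
      classical
      rw [pr_map, pr_eq_ex, ex_coin]
      by_cases hw : w = ofList v.toList.dropLast
      · rw [pr_pure, if_pos hw]
        by_cases h2 : w.snoc (ofBool true) = v
        · have h3 : ¬ w.snoc (ofBool false) = v := by
            rw [← h2]; simp [Val.snoc, ofList_injective.eq_iff]
          rw [if_pos h2, if_neg h3]; simp
        · simp only [h2, if_false]; split <;> simp
      · have h3 : ∀ b, ¬ w.snoc (ofBool b) = v := by
          rintro b rfl; exact hw (by simp)
        rw [if_neg (h3 _), if_neg (h3 _)]; simp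
    refine (ex_mono h1).trans ?_
    rw [ex_const_mul, pow_succ, mul_comm]
    gcongr
    have := ih (ofList v.toList.dropLast)
    rw [pr_eq_ex] at this
    simpa only [pr_pure] using this

theorem pr_sampleKey_le (κ : ℕ) (v : Val) : pr (sampleKey κ) (· = v) ≤ 2⁻¹ ^ κ := by
  have h : sampleKey κ = (uniformBits κ).bind fun k => (uniformBits κ).bind fun r =>
    PMF.pure (.cons k r) := rfl
  rw [h, pr_bind]
  have : ∀ k ∈ (uniformBits κ).support, pr ((uniformBits κ).bind fun r => PMF.pure (Val.cons k r)) (· = v) ≤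
      2⁻¹ ^ κ := by
    intro k _
    refine le_trans ?_ (pr_uniformBits_le κ v.snd)
    have h2 : ((uniformBits κ).bind fun r => PMF.pure (Val.cons k r)) = (uniformBits κ).map fun r => .cons k r := rfl
    rw [h2, pr_map]
    refine pr_mono fun r _ hr => ?_
    rw [← hr, snd_cons]
  exact ex_le _ this

/-- The result is uniform below 2 ^ r, where r is the number of binary digits of N. Thus N < 2 ^ r,
so every t ≤ N is hit, and 2 ^ r ≤ 2N + 1. -/
theorem pr_idxC (N t : ℕ) (ht : t ≤ N) :
    ((2 * N + 1 : ℕ) : ℝ≥0∞)⁻¹ ≤ pr (idxC (unary N)).distr (· = unary t) := by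
  -- With r bits to come and prefix j, the reachable values form the interval from 2 ^ r * j to 2 ^
  -- r * (j + 1). If t lies in it, exactly one value of the next bit keeps t reachable.
  have key : ∀ (l : List Val) (n j r : ℕ), n ≤ l.length → n < 2 ^ r → 2 ^ r ≤ 2 * n + 1 →
      2 ^ r * j ≤ t → t < 2 ^ r * (j + 1) →
      2⁻¹ ^ r ≤ pr (Comp.foldl (fun w => idxStep w.snd) l (.cons (unary n) (unary j))).distr
        fun x => x.snd = unary t := by
    intro l
    induction l with
    | nil =>
      intro n j r h1 h2 h3 h4 h5
      have : n = 0 := by simpa using h1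
      subst this
      have hr : r = 0 := by
        by_contra h
        have := Nat.pow_le_pow_right (show 0 < 2 by omega) (Nat.one_le_iff_ne_zero.2 h)
        omega
      subst hr
      have : t = j := by simp at h4 h5; omega
      simp [Comp.foldl, pr_pure, this]
    | cons a l ih =>
      intro n j r h1 h2 h3 h4 h5
      rcases n with _ | n
      · simpa [Comp.foldl, idxStep] using ih 0 j r (by simp) h2 h3 h4 h5
      · obtain ⟨r, rfl⟩ : ∃ r', r = r' + 1 := ⟨r - 1, by
          rcases r with _ | r
          · simp at h2
          · simp⟩
        have happ : (unary j).append (unary j) = unary (2 * j) := by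
          simp only [Val.append, unary, toList_ofList, List.replicate_append_replicate]; congr 2; omega
        rw [pow_succ] at h2 h3 h4 h5
        have hstep : (Comp.foldl (fun w => idxStep w.snd) (a :: l) (.cons (unary (n + 1)) (unary j))).distr =
            coin.bind fun b => (Comp.foldl (fun w => idxStep w.snd) l (.cons (unary ((n + 1) / 2))
              (unary (2 * j + b.toNat)))).distr := by
          simp only [Comp.foldl, snd_cons, fst_cons, idxStep, unary_succ, reduceCtorEq, if_false, distr_bind,
            flipC, distr_flip, distr_ret, PMF.bind_bind, PMF.pure_bind]
          congr 1; funext b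
          rw [← unary_succ, half_unary, happ]
          cases b <;> simp
        rw [hstep, pr_bind, ex_coin, pow_succ, mul_comm]
        simp only [List.length_cons] at h1
        by_cases hb : t < 2 ^ r * (2 * j + 1)
        · refine le_trans ?_ (le_add_left le_rfl)
          gcongr
          exact ih _ _ r (by omega) (by omega) (by omega) (by simp; nlinarith) (by simpa using hb)
        · refine le_trans ?_ (le_add_right le_rfl)
          gcongr
          refine ih _ _ r (by omega) (by omega) (by omega) (by simpa using hb) (by simp; nlinarith)
  obtain ⟨r, h1, h2⟩ : ∃ r, N < 2 ^ r ∧ 2 ^ r ≤ 2 * N + 1 := by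
    rcases Nat.eq_zero_or_pos N with rfl | hN
    · exact ⟨0, by simp⟩
    · refine ⟨Nat.log 2 N + 1, Nat.lt_pow_succ_log_self (by omega) N, ?_⟩
      have := Nat.pow_log_le_self 2 hN.ne'
      rw [pow_succ]; omega
  have h0 : (unary N).map (fun _ => .nil) = unary N := by
    simp [Val.map, unary]
  have := key (unary N).toList N 0 r (toNat_unary N).ge h1 h2 (by simp) (by simp; omega)
  rw [idxC, h0, distr_map, pr_map]
  refine le_trans ?_ this
  rw [← ENNReal.inv_pow, ENNReal.inv_le_inv]
  exact_mod_cast h2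

/-! ## Negligible functions -/

/-- Negligible functions with values in `ℝ≥0∞`. -/
def Negl (f : ℕ → ℝ≥0∞) : Prop := (∀ κ, f κ ≠ ∞) ∧ Negligible fun κ => (f κ).toReal

namespace Negl

theorem mono {f g : ℕ → ℝ≥0∞} (hg : Negl g) (h : ∀ κ, f κ ≤ g κ) : Negl f := by
  refine ⟨fun κ => ne_top_of_le_ne_top (hg.1 κ) (h κ), ?_⟩
  refine Asymptotics.SuperpolynomialDecay.trans_abs_le hg.2 fun κ => ?_
  rw [abs_of_nonneg ENNReal.toReal_nonneg, abs_of_nonneg ENNReal.toReal_nonneg]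
  exact ENNReal.toReal_mono (hg.1 κ) (h κ)

theorem add {f g : ℕ → ℝ≥0∞} (hf : Negl f) (hg : Negl g) : Negl fun κ => f κ + g κ := by
  refine ⟨fun κ => by simp [hf.1 κ, hg.1 κ], ?_⟩
  refine Asymptotics.SuperpolynomialDecay.congr (hf.2.add hg.2) fun κ => ?_
  simp [ENNReal.toReal_add (hf.1 κ) (hg.1 κ)]

theorem poly_mul {f : ℕ → ℝ≥0∞} (hf : Negl f) (p : Polynomial ℕ) :
    Negl fun κ => ((p.eval κ : ℕ) : ℝ≥0∞) * f κ := by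
  refine ⟨fun κ => ENNReal.mul_ne_top (ENNReal.natCast_ne_top _) (hf.1 κ), ?_⟩
  refine Asymptotics.SuperpolynomialDecay.congr
    (hf.2.polynomial_mul (p.map (Nat.castRingHom ℝ))) fun κ => ?_
  simp [ENNReal.toReal_mul, Polynomial.eval_natCast_map]

theorem of_prob {e : ℕ → PMF Prop} (h : Negligible fun κ => prob (e κ)) :
    Negl fun κ => pr (e κ) fun P => P :=
  ⟨fun _ => pr_ne_top, by simpa only [prob_eq] using h⟩

theorem negligible {e : ℕ → PMF Prop} (h : Negl fun κ => pr (e κ) fun P => P) :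
    Negligible fun κ => prob (e κ) := by simpa only [prob_eq] using h.2

theorem of_diff {f g : ℕ → ℝ} (h : Negligible fun κ => |f κ - g κ|) :
    Negl fun κ => ENNReal.ofReal |f κ - g κ| :=
  ⟨fun _ => ENNReal.ofReal_ne_top, by simpa only [ENNReal.toReal_ofReal (abs_nonneg _)] using h⟩

theorem half_pow : Negl fun κ => 2⁻¹ ^ κ := by
  refine ⟨fun κ => by simp, ?_⟩
  intro n
  have := tendsto_pow_const_mul_const_pow_of_abs_lt_one n (r := (2⁻¹ : ℝ)) (by norm_num [abs_of_pos])
  simpa using this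

end Negl

/-- One direction suffices for all reductions; a two-sided statement is obtained by applying it to
an event and to its complement. -/
theorem pr_le_add_diff (e e' : PMF Prop) :
    pr e (fun P => P) ≤ pr e' (fun P => P) + ENNReal.ofReal |prob e - prob e'| := by
  rw [← ENNReal.ofReal_toReal (pr_ne_top (p := e)), ← ENNReal.ofReal_toReal (pr_ne_top (p := e')),
    ← prob_eq, ← prob_eq, ← ENNReal.ofReal_add (by rw [prob_eq]; exact ENNReal.toReal_nonneg) (abs_nonneg _)]
  exact ENNReal.ofReal_le_ofReal (by have := le_abs_self (prob e - prob e'); linarith)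

/-! ## Execution with handlers -/

section
variable {ω ξ : Type} {O : ω → Val → PMF (Val × ω)} {O' : ξ → Val → PMF (Val × ξ)}
  {hf : Val → Comp (Bool × Val)} {hq : ℕ → Val → Val → Comp (Val × Val)}

/-- Handlers that implement an oracle `O'` whose states are encoded by `e₁` (in the state of the
handlers) and `e₂` (in the state of the outer oracle). -/
theorem exec_interp (e₁ : ξ → Val) (e₂ : ξ → ω) (Inv : ξ → Prop) (T : ℕ)
    (h1 : ∀ x, hf (e₁ x) = .flip fun b => ret (b, e₁ x))
    (h2 : ∀ x n q, Inv x → n ≤ T → q.size ≤ T → (hq n q (e₁ x)).exec O (e₂ x) =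
      (O' x q).map fun y => ((fit n y.1, e₁ y.2), e₂ y.2))
    (h3 : ∀ x q, Inv x → q.size ≤ T → ∀ y ∈ (O' x q).support, Inv y.2)
    (c : Comp α) {m : ℕ} (hc : Bdd T m c) {x : ξ} (hx : Inv x) :
    (c.interp hf hq (e₁ x)).exec O (e₂ x) =
      (c.exec O' x).map fun y => ((y.1, e₁ y.2), e₂ y.2) := by
  induction c generalizing m x with
  | ret a => simp [PMF.pure_map]
  | flip k ih =>
    simp only [interp_flip, h1, flip_bind, ret_bind, exec_flip, PMF.map_bind]
    congr 1; funext b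
    exact ih b (hc b) hx
  | query n q k ih =>
    match m, hc with
    | m + 1, hc =>
      simp only [interp_query, exec_bind, exec_query, h2 x n q hx hc.1 hc.2.1, PMF.map_bind, PMF.bind_map,
        Function.comp_def]
      ext z
      simp only [PMF.bind_apply]
      congr 1; funext y
      by_cases hy : (O' x q) y = 0
      · simp [hy]
      · rw [ih _ (hc.2.2 _) (h3 x q hx hc.2.1 y ((PMF.mem_support_iff _ _).2 hy))]

/-- An invariant of the states of an oracle. -/
theorem inv_of_mem_support_exec (Inv : ξ → Prop) (T : ℕ)
    (h3 : ∀ x q, Inv x → q.size ≤ T → ∀ y ∈ (O' x q).support, Inv y.2)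
    (c : Comp α) {m : ℕ} (hc : Bdd T m c) {x : ξ} (hx : Inv x) {y : α × ξ}
    (hy : y ∈ (c.exec O' x).support) : Inv y.2 := by
  induction c generalizing m x with
  | ret a => simp at hy; simpa [hy] using hx
  | flip k ih =>
    simp only [exec_flip, PMF.mem_support_bind_iff] at hy
    obtain ⟨b, _, hb⟩ := hy
    exact ih b (hc b) hx hb
  | query n q k ih =>
    match m, hc with
    | m + 1, hc =>
      simp only [exec_query, PMF.mem_support_bind_iff] at hy
      obtain ⟨b, hb, hy⟩ := hy
      exact ih _ (hc.2.2 _) (h3 x q hx hc.2.1 b hb) hy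

/-- Two oracles with the same behaviour. -/
theorem exec_eq_of_map {O₂ : ω → Val → PMF (Val × ω)} (e : ξ → ω) (Inv : ξ → Prop) (T : ℕ)
    (h2 : ∀ x q, Inv x → q.size ≤ T → O₂ (e x) q = (O' x q).map fun y => (y.1, e y.2))
    (h3 : ∀ x q, Inv x → q.size ≤ T → ∀ y ∈ (O' x q).support, Inv y.2)
    (c : Comp α) {m : ℕ} (hc : Bdd T m c) {x : ξ} (hx : Inv x) :
    c.exec O₂ (e x) = (c.exec O' x).map fun y => (y.1, e y.2) := by
  induction c generalizing m x with
  | ret a => simp [PMF.pure_map]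
  | flip k ih =>
    simp only [exec_flip, PMF.map_bind]
    congr 1; funext b
    exact ih b (hc b) hx
  | query n q k ih =>
    match m, hc with
    | m + 1, hc =>
      simp only [exec_query, h2 x q hx hc.2.1, PMF.map_bind, PMF.bind_map, Function.comp_def]
      ext z
      simp only [PMF.bind_apply]
      congr 1; funext y
      by_cases hy : (O' x q) y = 0
      · simp [hy]
      · rw [ih _ (hc.2.2 _) (h3 x q hx hc.2.1 y ((PMF.mem_support_iff _ _).2 hy))]

end

end
end Tumbling

/-! ### The oracles of the layer as programs -/

namespace Tumbling
open Val

noncomputable section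

open Tumbling.Comp
open scoped ENNReal

/-! ## Lengths computed by programs -/

section
variable {ℓ : ℕ → ℕ}

def PolyLength.code (h : PolyLength ℓ) : Code := h.choose

/-- The length, as a unary number. -/
def PolyLength.len (h : PolyLength ℓ) (H : Hash) (κV : Val) : Val := h.code.fn H κV

theorem PolyLength.len_unary (h : PolyLength ℓ) (H : Hash) (κ : ℕ) :
    h.len H (unary κ) = unary (ℓ κ) := h.choose_spec.2.2 H κ

namespace PP
variable {𝓗 : HashModel} (T : TaggingScheme 𝓗) (M : MerkleTree T.pkLen) {f g h k : Hash → Val → Val}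

instance len' (hl : PolyLength ℓ) [hf : PolyFn f] : PolyFn fun H v => hl.len H (f H v) :=
  det_comp hl.choose_spec.2.1 hl.choose_spec.1

instance keyGen' [hf : PolyFn f] : PolyFn fun H v => T.keyGen.fn H (f H v) :=
  det_comp T.keyGen_ppt T.keyGen_det

instance tagEval' [hf : PolyFn f] : PolyFn fun H v => T.tagEval.fn H (f H v) :=
  det_comp T.tagEval_ppt T.tagEval_det

instance init' [hf : PolyFn f] : PolyFn fun H v => M.init.fn H (f H v) :=
  det_comp M.init_ppt M.init_det

instance prove' [hf : PolyFn f] : PolyFn fun H v => M.prove.fn H (f H v) :=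
  det_comp M.prove_ppt M.prove_det

instance snarkVerify' (S : ZkSnark) [hf : PolyFn f] : PolyFn fun H v => S.verify.fn H (f H v) :=
  det_comp S.verify_ppt S.verify_det

theorem subst₂ {G : Hash → Val → Val → Comp Val} (hG : PP fun H v => G H v.fst v.snd)
    [hf : PolyFn f] [hg : PolyFn g] : PP fun H v => G H (f H v) (g H v) := by
  simpa using subst (f := fun H v => .cons (f H v) (g H v)) hG inferInstance

theorem subst₃ {G : Hash → Val → Val → Val → Comp Val} (hG : PP fun H v => G H v.fst v.snd.fst v.snd.snd)
    [hf : PolyFn f] [hg : PolyFn g] [hh : PolyFn h] : PP fun H v => G H (f H v) (g H v) (h H v) := by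
  simpa using subst (f := fun H v => .cons (f H v) (.cons (g H v) (h H v))) hG inferInstance

theorem subst₄ {G : Hash → Val → Val → Val → Val → Comp Val}
    (hG : PP fun H v => G H v.fst v.snd.fst v.snd.snd.fst v.snd.snd.snd)
    [hf : PolyFn f] [hg : PolyFn g] [hh : PolyFn h] [hk : PolyFn k] :
    PP fun H v => G H (f H v) (g H v) (h H v) (k H v) := by
  simpa using subst (f := fun H v => .cons (f H v) (.cons (g H v) (.cons (h H v) (k H v)))) hG inferInstance

end PP

theorem size_of_mem_bitStrings {n : ℕ} {v : Val} (h : v ∈ bitStrings n) : v.size ≤ 4 * n + 1 := by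
  obtain ⟨h1, h2⟩ := mem_bitStrings.1 h
  rw [← ofList_toList v]
  generalize v.toList = l at *
  clear h
  induction l generalizing n with
  | nil => simp
  | cons a l ih =>
    simp only [List.length_cons] at h1
    have := ih (n := n - 1) (by omega) fun x hx => h2 x (by simp [hx])
    have h3 : a.size ≤ 3 := by rcases h2 a (by simp) with rfl | rfl <;> simp
    simp only [ofList_cons, size_cons]; omega

theorem size_of_mem_keySpace {n : ℕ} {v : Val} (h : v ∈ keySpace n) : v.size ≤ 8 * n + 3 := by
  obtain ⟨k, hk, r, hr, rfl⟩ := h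
  have := size_of_mem_bitStrings hk
  have := size_of_mem_bitStrings hr
  simp only [size_cons]; omega

end

/-! ## The oracles of the data tumbling layer as a program -/

section
variable {leafLen : ℕ → ℕ} (M : MerkleTree leafLen)

/-- Here e = (public key, tag, secret key) is a created key and q = (list, position, message) a
redeem question. The statement uses only the tag of e; the secret key occurs only in the witness. -/
def stmtF (H : Hash) (κV e q : Val) : Val :=
  ofList [M.init.fn H (ofList [κV, q.get 0]), e.get 1, q.get 2]

def witF (H : Hash) (κV e q : Val) : Val :=
  ofList [(q.get 0).idx e.fst, e.get 2, M.prove.fn H (ofList [κV, (q.get 0).idx e.fst, e.fst, q.get 0])]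

/-- The question for a proof, with the witness on demand. -/
def ask (z : Bool) (H : Hash) (κV e q : Val) : Val :=
  match z with
  | true => ofList [stmtF M H κV e q, witF M H κV e q]
  | false => stmtF M H κV e q

/-- The state is ((1^κ, 1^N, pp), keys to be created next, created keys, proved statements). The
reply from the proof oracle is received in a buffer of the size of 1^N. -/
def redeemRaw (z : Bool) (H : Hash) (e q s : Val) : Comp Val :=
  (queryC (s.fst.get 1).size (ask M z H s.fst.fst e q)).bind fun r =>
    ret (.cons (.cons (e.get 1) r.fst) (.cons s.fst (.cons s.snd.fst (.cons s.snd.snd.fst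
      (s.snd.snd.snd.snoc (stmtF M H s.fst.fst e q))))))

end

section
variable {𝓗 : HashModel} (T : TaggingScheme 𝓗) (M : MerkleTree T.pkLen) {msgLen : ℕ → ℕ}
  (hl : PolyLength msgLen)

/-- A created key, as public key, tag and secret key. The secret key is kept only on demand. -/
def entry (keep : Bool) (H : Hash) (κV pp k : Val) : Val :=
  ofList [T.keyGen.fn H (ofList [κV, pp, k]), T.tagEval.fn H (ofList [κV, pp, k]),
    match keep with
    | true => k
    | false => .nil]

/-- The first entry of `C` whose public key is at position `i` of the list `L`, as a list. -/
def lookup (C L i : Val) : Val :=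
  open Classical in ofList (C.toList.find? fun e => decide (L.toList[i.toNat]? = some e.fst)).toList

/-- The condition on the tag holds for every honest key. It is tested so that the growth of the
state is bounded for arbitrary states, as `PP.interp` requires. -/
def Valid (H : Hash) (κV e q : Val) : Prop :=
  M.init.fn H (ofList [κV, q.get 0]) ≠ .nil ∧ q.get 2 ∈ bitStrings (hl.len H κV).toNat ∧
    e.get 1 ∈ bitStrings (T.tagLen_poly.len H κV).toNat

/-- A `nil` at the head of the prepared keys, or an empty list of them, means that a fresh key is
sampled; another entry is handed out as it is. -/
def createRaw (keep : Bool) (H : Hash) (s : Val) : Comp Val :=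
  (if s.snd.fst.fst = .nil then (keyC s.fst.fst).bind fun k => ret (entry T keep H s.fst.fst (s.fst.get 2) k)
    else ret s.snd.fst.fst).bind fun e =>
    ret (.cons e.fst (.cons s.fst (.cons s.snd.fst.snd (.cons (s.snd.snd.fst.snoc e) s.snd.snd.snd))))

/-- The oracles, where proofs are asked from another oracle. The first entries to be created can be
given in the state. -/
def worldRaw (z keep : Bool) (H : Hash) (q s : Val) : Comp Val :=
  if q = .nil then ret (.cons .nil s)
  else if q.fst = .nil then createRaw T keep H s
  else (ret (lookup s.snd.snd.fst (q.snd.get 0) (q.snd.get 1))).bind fun e =>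
    if test (e ≠ .nil ∧ Valid T M hl H s.fst.fst e.fst q.snd) = .nil then ret (.cons .nil s)
    else redeemRaw M z H e.fst q.snd s

def passFlip (s : Val) : Comp (Bool × Val) := .flip fun b => ret (b, s)

/-- A reply is delivered into a buffer, which is computed only if it is small. -/
def deliver (N : ℕ) (raw : Comp Val) (n : ℕ) : Comp (Val × Val) :=
  raw.map fun x => (fit (min N n) x.fst, x.snd)

def worldQuery (z keep : Bool) (H : Hash) (n : ℕ) (q s : Val) : Comp (Val × Val) :=
  deliver (s.fst.get 1).toNat (worldRaw T M hl z keep H q s) n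

/-- An adversary with the oracles. -/
def world (z keep : Bool) (A : Code) (H : Hash) (a s : Val) : Comp Val :=
  (interp passFlip (worldQuery T M hl z keep H) (A.den H a) s).map fun x => .cons x.1 x.2

namespace PP
variable {f g h k : Hash → Val → Val}

instance entry' (keep : Bool) [hf : PolyFn f] [hg : PolyFn g] [hh : PolyFn h] :
    PolyFn fun H v => entry T keep H (f H v) (g H v) (h H v) := by
  cases keep <;> (unfold entry; infer_instance)

instance lookup' [hf : PolyFn f] [hg : PolyFn g] [hh : PolyFn h] :
    PolyFn fun H v => lookup (f H v) (g H v) (h H v) := by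
  refine subst₃ (G := fun H a b c => ret (lookup a b c)) ?_
  have h1 := find' (L := fun _ v => v.fst) (P := fun _ v e =>
    v.snd.fst.drop v.snd.snd ≠ .nil ∧ (v.snd.fst.drop v.snd.snd).fst = e.fst)
  convert h1 using 5 with H v
  rw [lookup]
  congr! 6 with e
  have h2 : v.snd.fst.toList[v.snd.snd.toNat]? = (v.snd.fst.drop v.snd.snd).toList.head? := by
    simp [List.head?_drop]
  rw [h2]
  cases v.snd.fst.drop v.snd.snd <;> simp

instance stmtF' [hf : PolyFn f] [hg : PolyFn g] [hh : PolyFn h] :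
    PolyFn fun H v => stmtF M H (f H v) (g H v) (h H v) := by
  unfold stmtF; infer_instance

instance witF' [hf : PolyFn f] [hg : PolyFn g] [hh : PolyFn h] :
    PolyFn fun H v => witF M H (f H v) (g H v) (h H v) := by
  unfold witF; infer_instance

instance valid' [hf : PolyFn f] [hg : PolyFn g] [hh : PolyFn h] :
    PolyFn fun H v => test (Valid T M hl H (f H v) (g H v) (h H v)) := by
  unfold Valid; infer_instance

instance ask' (z : Bool) [hf : PolyFn f] [hg : PolyFn g] [hh : PolyFn h] :
    PolyFn fun H v => ask M z H (f H v) (g H v) (h H v) := by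
  cases z <;> (dsimp only [ask]; infer_instance)

instance createRaw' (keep : Bool) [hf : PolyFn f] : PP fun H v => createRaw T keep H (f H v) := by
  refine subst (G := fun H v => createRaw T keep H v) ?_ hf
  unfold createRaw
  infer_instance

instance redeemRaw' (z : Bool) [hf : PolyFn f] [hg : PolyFn g] [hh : PolyFn h] :
    PP fun H v => redeemRaw M z H (f H v) (g H v) (h H v) := by
  refine subst₃ ?_
  unfold redeemRaw
  infer_instance

instance worldRaw' (z keep : Bool) [hf : PolyFn f] [hg : PolyFn g] :
    PP fun H v => worldRaw T M hl z keep H (f H v) (g H v) := by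
  refine subst₂ ?_
  unfold worldRaw
  infer_instance

end PP

/-- The tag is counted separately because it comes from the state; `size_valid` then bounds it in
terms of κ alone. -/
theorem size_stmtF : ∃ p : Polynomial ℕ, ∀ H κV e q,
    (stmtF M H κV e q).size ≤ p.eval (κV.size + q.size) + (e.get 1).size := by
  have : PolyFn fun H v => stmtF M H v.fst .nil v.snd := inferInstance
  obtain ⟨p, hp⟩ := this.fn_size
  refine ⟨p.comp (1 + .X), fun H κV e q => ?_⟩
  have := hp H (.cons κV q)
  simp only [fst_cons, snd_cons, size_cons] at this
  have h2 : κV.size + q.size + 1 = 1 + (κV.size + q.size) := by omega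
  rw [h2] at this
  simp only [stmtF, ofList_cons, size_cons, Polynomial.eval_comp, Polynomial.eval_add, Polynomial.eval_one,
    Polynomial.eval_X] at *
  omega

theorem size_valid : ∃ p : Polynomial ℕ, ∀ H κV e q, Valid T M hl H κV e q →
    (e.get 1).size ≤ p.eval κV.size := by
  have : PolyFn fun H v => T.tagLen_poly.len H v := inferInstance
  obtain ⟨p, hp⟩ := this.fn_size
  refine ⟨4 * p + 1, fun H κV e q h => (size_of_mem_bitStrings h.2.2).trans ?_⟩
  have := hp H κV
  have h2 := length_toList_lt (T.tagLen_poly.len H κV)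
  simp only [Val.toNat, Polynomial.eval_add, Polynomial.eval_mul, Polynomial.eval_ofNat, Polynomial.eval_one]
  omega

theorem Val.fit_fit_min (a n : ℕ) (v : Val) : fit n (fit (min a n) v) = fit (min a n) v := by
  simp only [fit]
  split_ifs <;> first | rfl | omega

theorem Val.size_fst_add_snd (v : Val) : v.fst.size + v.snd.size ≤ v.size + 1 := by
  cases v <;> simp; omega

/-- A creation appends an entry that is fresh, of polynomial size, or merely moved from the prepared
keys; a redemption appends one statement, whose only part from the state is a tag of bounded length.
-/
theorem world_growth (z keep : Bool) : ∃ g : Polynomial ℕ, ∀ H n q s x,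
    (worldQuery T M hl z keep H n q s).Out x → x.2.fst = s.fst ∧
      x.2.snd.size ≤ s.snd.size + g.eval (s.fst.size + n + q.size) := by
  obtain ⟨p1, h1⟩ := size_stmtF T M
  obtain ⟨p2, h2⟩ := size_valid T M hl
  have : PP fun H v => (keyC v.fst).bind fun k => ret (entry T keep H v.fst (v.get 2) k) := inferInstance
  obtain ⟨p3, h3⟩ := this.size
  refine ⟨20 + p1 + p2 + p3, fun H n q s x hx => ?_⟩
  have e1 := size_fst_add_snd s.snd
  have e2 := size_fst_add_snd s.snd.snd
  have e3 := size_fst_add_snd s.snd.fst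
  have m1 := eval_mono p1 (show s.fst.fst.size + q.snd.size ≤ s.fst.size + n + q.size by
    have := size_fst_le s.fst; have := size_snd_le q; omega)
  have m2 := eval_mono p2 (show s.fst.fst.size ≤ s.fst.size + n + q.size by
    have := size_fst_le s.fst; omega)
  have m3 := eval_mono p3 (show s.fst.size ≤ s.fst.size + n + q.size by omega)
  simp only [worldQuery, deliver, out_map] at hx
  obtain ⟨y, hy, rfl⟩ := hx
  simp only [Polynomial.eval_add, Polynomial.eval_ofNat]
  simp only [worldRaw] at hy
  split at hy
  · obtain rfl := hy; simp
  split at hy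
  · simp only [createRaw, out_bind, out_ret] at hy
    obtain ⟨e, he, rfl⟩ := hy
    have he' : e.size ≤ s.snd.fst.fst.size + p3.eval s.fst.size := by
      split at he
      · exact (h3 H s.fst e he).trans (by omega)
      · obtain rfl := he; omega
    simp only [snd_cons, fst_cons, size_cons, size_snoc, true_and]
    dsimp only at *
    omega
  · simp only [ret_bind] at hy
    split at hy
    · obtain rfl := hy; simp
    · rename_i hv
      rw [← ne_eq, test_ne_nil] at hv
      simp only [redeemRaw, out_bind, out_ret, queryC, out_query] at hy
      obtain ⟨r, -, rfl⟩ := hy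
      have v1 := h2 _ _ _ _ hv.2
      have v2 := h1 H s.fst.fst (lookup s.snd.snd.fst (q.snd.get 0) (q.snd.get 1)).fst q.snd
      simp only [snd_cons, fst_cons, size_cons, size_snoc, true_and]
      dsimp only at *
      omega

theorem PP.world' (z keep : Bool) {A : Code} (hA : A.PPT) {f g : Hash → Val → Val} [hf : PolyFn f]
    [hg : PolyFn g] : PP fun H v => world T M hl z keep A H (f H v) (g H v) := by
  refine subst₂ (G := fun H a s => world T M hl z keep A H a s) ?_
  obtain ⟨p, hp⟩ := world_growth T M hl z keep
  refine PP.interp hA (hf := fun _ => passFlip) (hq := worldQuery T M hl z keep) ?_ ?_ ?_ p ?_ hp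
  · exact (inferInstance : PP fun _ w => flipC.bind fun b => ret (.cons b w.snd))
  · have : PP fun H w => (worldRaw T M hl z keep H w.fst.snd w.snd).bind fun x =>
      ret (.cons (trunc (w.snd.fst.get 1) w.fst.fst x.fst) x.snd) := inferInstance
    simpa only [worldQuery, deliver, trunc_eq, Comp.map, Comp.bind_assoc, ret_bind] using this
  · intro H n q s x hx
    simp only [worldQuery, deliver, out_map] at hx
    obtain ⟨y, -, rfl⟩ := hx
    exact fit_fit_min _ _ _
  · rintro H s x ⟨b, rfl⟩
    simp

end

end
end Tumbling

namespace Tumbling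
open Val

noncomputable section

open Tumbling.Comp
open scoped ENNReal

theorem bind_congr_support {α β : Type} {p : PMF α} {f g : α → PMF β} (h : ∀ a ∈ p.support, f a = g a) :
    p.bind f = p.bind g := by
  ext b
  simp only [PMF.bind_apply]
  refine tsum_congr fun a => ?_
  by_cases ha : p a = 0
  · simp [ha]
  · rw [h a ((PMF.mem_support_iff _ _).2 ha)]

/-! ## The oracles with a prover as a parameter -/

/-- The keys that will be created next, the created keys and the statements that were proved. -/
structure WState where
  pend : List Val
  C : List Val
  Q : List Val

def WState.enc (E : Val) (x : WState) : Val := .cons E (.cons (ofList x.pend) (.cons (ofList x.C) (ofList x.Q)))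

section
variable {𝓗 : HashModel} (T : TaggingScheme 𝓗) (M : MerkleTree T.pkLen) {msgLen : ℕ → ℕ}
  (hl : PolyLength msgLen)

/-- The prover receives statement and witness, so that the same oracle describes honest proofs and,
with a prover that ignores the witness, simulated ones. -/
def redeemW (H : Hash) (κ : ℕ) (prover : Val → Val → PMF Val) (x : WState) (q : Val) : PMF (Val × WState) :=
  open Classical in
  match x.C.find? fun e => decide ((q.get 0).toList[(q.get 1).toNat]? = some e.fst) with
    | none => PMF.pure (.nil, x)
    | some e =>
      if Valid T M hl H (unary κ) e q then
        (prover (stmtF M H (unary κ) e q) (witF M H (unary κ) e q)).map fun π =>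
          (.cons (e.get 1) π, ⟨x.pend, x.C, x.Q ++ [stmtF M H (unary κ) e q]⟩)
      else PMF.pure (.nil, x)

/-- This is the law that `worldRaw` realizes, without buffers and encodings of the state;
`exec_world` connects the two. -/
def worldO (keep : Bool) (H : Hash) (κ : ℕ) (pp : Val) (prover : Val → Val → PMF Val) (x : WState) (q : Val) :
    PMF (Val × WState) :=
  if q = .nil then PMF.pure (.nil, x)
  else if q.fst = .nil then
    (if x.pend.headD .nil = .nil then (sampleKey κ).map fun k => entry T keep H (unary κ) pp k
      else PMF.pure (x.pend.headD .nil)).map fun e => (e.fst, ⟨x.pend.tail, x.C ++ [e], x.Q⟩)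
  else redeemW T M hl H κ prover x q.snd

variable {T M hl}

theorem Val.fst_ofList (l : List Val) : (ofList l).fst = l.headD .nil := by cases l <;> rfl
theorem Val.snd_ofList (l : List Val) : (ofList l).snd = ofList l.tail := by cases l <;> rfl

/-- The keys in a state have a property. -/
def WState.Keys (P : Val → Prop) (x : WState) : Prop :=
  (∀ e ∈ x.C, P e) ∧ ∀ e ∈ x.pend, e ≠ .nil → P e

theorem worldO_keys {keep : Bool} {H : Hash} {κ : ℕ} {pp : Val} {prover : Val → Val → PMF Val} {P : Val → Prop}
    (hP : ∀ k ∈ keySpace κ, P (entry T keep H (unary κ) pp k)) {x : WState} (hx : x.Keys P) {q : Val}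
    {y : Val × WState} (hy : y ∈ (worldO T M hl keep H κ pp prover x q).support) : y.2.Keys P := by
  simp only [worldO] at hy
  split at hy
  · simp only [PMF.mem_support_pure_iff] at hy; rw [hy]; exact hx
  split at hy
  · simp only [PMF.mem_support_map_iff] at hy
    obtain ⟨e, he, rfl⟩ := hy
    refine ⟨fun a ha => ?_, fun a ha => hx.2 a (List.mem_of_mem_tail ha)⟩
    rcases List.mem_append.1 ha with ha | ha
    · exact hx.1 a ha
    · rw [List.mem_singleton] at ha
      subst ha
      split at he
      · simp only [PMF.mem_support_map_iff] at he
        obtain ⟨k, hk, rfl⟩ := he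
        exact hP k (mem_keySpace_of_mem_support hk)
      · rename_i h
        simp only [PMF.mem_support_pure_iff] at he
        rw [he]
        refine hx.2 _ ?_ h
        cases hp : x.pend with
        | nil => rw [hp] at h; simp at h
        | cons a l => simp
  · simp only [redeemW] at hy
    split at hy
    · simp only [PMF.mem_support_pure_iff] at hy; rw [hy]; exact hx
    split at hy
    · simp only [PMF.mem_support_map_iff] at hy
      obtain ⟨e, he, rfl⟩ := hy
      exact hx
    · simp only [PMF.mem_support_pure_iff] at hy; rw [hy]; exact hx

theorem worldRaw_accept {z keep : Bool} {H : Hash} {q s e : Val} (h1 : q ≠ .nil) (h2 : q.fst ≠ .nil)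
    (h : lookup s.snd.snd.fst (q.snd.get 0) (q.snd.get 1) = .cons e .nil)
    (hv : Valid T M hl H s.fst.fst e q.snd) :
    worldRaw T M hl z keep H q s = redeemRaw M z H e q.snd s := by
  rw [worldRaw, if_neg h1, if_neg h2, ret_bind, h, if_neg (by simpa using hv), fst_cons]

theorem worldRaw_reject {z keep : Bool} {H : Hash} {q s : Val} (h1 : q ≠ .nil) (h2 : q.fst ≠ .nil)
    (h : ¬ (lookup s.snd.snd.fst (q.snd.get 0) (q.snd.get 1) ≠ .nil ∧
      Valid T M hl H s.fst.fst (lookup s.snd.snd.fst (q.snd.get 0) (q.snd.get 1)).fst q.snd)) :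
    worldRaw T M hl z keep H q s = ret (.cons .nil s) := by
  rw [worldRaw, if_neg h1, if_neg h2, ret_bind, if_pos (by simpa using h)]

/-- As the buffer n of the question is at most N, the cut at N is invisible, and as proofs have size
at most N, the inner question loses nothing. The outer oracle has to behave like the prover only on
accepted questions about keys that occur in the list, which is where an honest witness is valid. -/
theorem exec_worldQuery {ω : Type} {z keep : Bool} {H : Hash} {κ : ℕ} {pp : Val} {prover : Val → Val → PMF Val}
    {O : ω → Val → PMF (Val × ω)} (w : List Val → ω) {N n : ℕ} {q : Val} {x : WState} (hn : n ≤ N)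
    (hO : ∀ e ∈ x.C, e.fst ∈ (q.snd.get 0).toList → Valid T M hl H (unary κ) e q.snd →
      O (w x.Q) (ask M z H (unary κ) e q.snd) =
        (prover (stmtF M H (unary κ) e q.snd) (witF M H (unary κ) e q.snd)).map fun π =>
          (ofList [π], w (x.Q ++ [stmtF M H (unary κ) e q.snd])))
    (hN : ∀ e ∈ x.C, e.fst ∈ (q.snd.get 0).toList → Valid T M hl H (unary κ) e q.snd →
      ∀ π ∈ (prover (stmtF M H (unary κ) e q.snd) (witF M H (unary κ) e q.snd)).support, π.size ≤ N) :
    (worldQuery T M hl z keep H n q (x.enc (ofList [unary κ, unary N, pp]))).exec O (w x.Q) =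
      (worldO T M hl keep H κ pp prover x q).map fun y =>
        ((fit n y.1, y.2.enc (ofList [unary κ, unary N, pp])), w y.2.Q) := by
  have hD : deliver ((x.enc (ofList [unary κ, unary N, pp])).fst.get 1).toNat = deliver N := by
    simp [WState.enc]
  rw [worldQuery, hD, deliver, exec_map, min_eq_right hn]
  by_cases h1 : q = .nil
  · rw [worldRaw, worldO, if_pos h1, if_pos h1]
    simp [PMF.pure_map]
  by_cases h2 : q.fst = .nil
  · rw [worldRaw, worldO, if_neg h1, if_neg h1, if_pos h2, if_pos h2]
    by_cases h3 : x.pend.headD .nil = .nil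
    · rw [createRaw, if_pos (by simpa [WState.enc, fst_ofList] using h3), if_pos h3]
      simp only [WState.enc, Comp.bind_assoc, exec_bind, fst_cons, snd_cons, get_two, ofList_cons, exec_keyC,
        toNat_unary, PMF.bind_map, Function.comp_def, exec_ret, ret_bind, snd_ofList, Val.snoc,
        toList_ofList, PMF.map_bind, PMF.pure_map, PMF.map_comp]
      rfl
    · rw [createRaw, if_neg (by simpa [WState.enc, fst_ofList] using h3), if_neg h3]
      simp [PMF.pure_map, snd_ofList, Val.snoc, WState.enc, fst_ofList]
  have hlook : lookup (x.enc (ofList [unary κ, unary N, pp])).snd.snd.fst (q.snd.get 0) (q.snd.get 1) =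
      ofList (x.C.find? fun e => decide ((q.snd.get 0).toList[(q.snd.get 1).toNat]? = some e.fst)).toList := by
    simp only [lookup, WState.enc, snd_cons, fst_cons, toList_ofList]
  rw [worldO, if_neg h1, if_neg h2, redeemW]
  cases hf : x.C.find? fun e => decide ((q.snd.get 0).toList[(q.snd.get 1).toNat]? = some e.fst) with
  | none =>
    rw [worldRaw_reject h1 h2 (by rw [hlook, hf]; simp)]
    simp [PMF.pure_map]
  | some e =>
    have he := List.mem_of_find?_eq_some hf
    have hm : e.fst ∈ (q.snd.get 0).toList := List.mem_of_getElem? (by simpa using List.find?_some hf)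
    dsimp only
    by_cases hv : Valid T M hl H (unary κ) e q.snd
    · rw [worldRaw_accept h1 h2 (by rw [hlook, hf]; rfl) hv, if_pos hv]
      simp only [redeemRaw, WState.enc, fst_cons, snd_cons, get_one, exec_bind, queryC, exec_query,
        PMF.bind_map, Function.comp_def, exec_ret, Val.snoc, ofList_cons,
        toList_ofList, PMF.map_comp, hO e he hm hv]
      simp only [PMF.map, PMF.bind_bind, PMF.pure_bind, Function.comp_def]
      refine bind_congr_support fun π hπ => ?_
      -- The reply is a list with one proof, of size |π| + 2, and the buffer 1^N has size 2N + 1;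
      -- this suffices because 1 ≤ |π| ≤ N.
      have := hN e he hm hv π hπ
      have := size_pos π
      rw [fit_of_le (v := .cons π _) (by simp; omega)]
      simp
    · rw [worldRaw_reject h1 h2 (by rw [hlook, hf]; rintro ⟨-, h⟩; exact hv h), if_neg hv]
      simp [PMF.pure_map]

/-- Running an adversary with the program for the oracles. -/
theorem exec_world {ω : Type} {z keep : Bool} {H : Hash} {κ : ℕ} {pp : Val} {prover : Val → Val → PMF Val}
    {O : ω → Val → PMF (Val × ω)} (w : List Val → ω) {N B m : ℕ} {P : Val → Prop} (hB : B ≤ N)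
    (hP : ∀ k ∈ keySpace κ, P (entry T keep H (unary κ) pp k))
    (hO : ∀ Q e q, P e → q.size ≤ B → e.fst ∈ (q.get 0).toList → Valid T M hl H (unary κ) e q →
      O (w Q) (ask M z H (unary κ) e q) =
        (prover (stmtF M H (unary κ) e q) (witF M H (unary κ) e q)).map fun π =>
          (ofList [π], w (Q ++ [stmtF M H (unary κ) e q])))
    (hN : ∀ e q, P e → q.size ≤ B → e.fst ∈ (q.get 0).toList → Valid T M hl H (unary κ) e q →
      ∀ π ∈ (prover (stmtF M H (unary κ) e q) (witF M H (unary κ) e q)).support, π.size ≤ N)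
    {A : Code} {a : Val} (hA : Bdd B m (A.den H a)) {x : WState} (hx : x.Keys P) :
    (world T M hl z keep A H a (x.enc (ofList [unary κ, unary N, pp]))).exec O (w x.Q) =
      ((A.den H a).exec (worldO T M hl keep H κ pp prover) x).map fun y =>
        (.cons y.1 (y.2.enc (ofList [unary κ, unary N, pp])), w y.2.Q) := by
  have := exec_interp (O := O) (O' := worldO T M hl keep H κ pp prover) (hf := passFlip)
    (hq := worldQuery T M hl z keep H) (fun x => x.enc (ofList [unary κ, unary N, pp])) (fun x => w x.Q)
    (WState.Keys P) B (fun x => rfl) (fun x n q hx hn hq => exec_worldQuery w (hn.trans hB)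
      (fun e he hm hv => hO _ e q.snd (hx.1 e he) (q.size_snd_le.trans hq) hm hv)
      (fun e he hm hv => hN e q.snd (hx.1 e he) (q.size_snd_le.trans hq) hm hv))
    (fun x q hx _ y hy => worldO_keys hP hx hy) (A.den H a) hA hx
  rw [world, exec_map, this, PMF.map_comp]
  rfl

/-! ## The oracles of the data tumbling layer -/

/-- The created keys and the statements that were proved. -/
def OracleState.toWorld (keep : Bool) (H : Hash) (κ : ℕ) (pp : Val) (x : OracleState) : WState :=
  ⟨[], x.C.map fun k => entry T keep H (unary κ) pp k.2, x.R.map fun r => ofList [r.st, r.tag, r.m]⟩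

/-- The keys are honest. -/
def OracleState.Honest (H : Hash) (κ : ℕ) (pp : Val) (x : OracleState) : Prop :=
  ∀ k ∈ x.C, k.2 ∈ keySpace κ ∧ k.1 = T.pk H κ pp k.2

variable {S : ZkSnark} {dataFixed : Val}

theorem toOption_eq_some {v w : Val} : v.toOption = some w ↔ v = w ∧ v ≠ .nil := by
  cases v <;> simp [toOption]

theorem toOption_eq_none {v : Val} : v.toOption = none ↔ v = .nil := by
  cases v <;> simp [toOption]

theorem oracle_honest {H : Hash} {κ : ℕ} {par pp : Val} (hpp : par.get 2 = pp) {x : OracleState}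
    (hx : x.Honest (T := T) H κ pp) {q : Val} {y : Val × OracleState}
    (hy : y ∈ ((dtlFixed T M msgLen S dataFixed).oracle H κ par x q).support) : y.2.Honest (T := T) H κ pp := by
  subst hpp
  have hb : ∀ {α β : Type} (p : PMF α) (f : α → PMF β) (b : β), b ∈ (p >>= f).support ↔
    ∃ a ∈ p.support, b ∈ (f a).support := fun p f b => PMF.mem_support_bind_iff p f b
  have hp : ∀ {α : Type} (a b : α), b ∈ (pure a : PMF α).support ↔ b = a := fun a b =>
    PMF.mem_support_pure_iff a b
  unfold DTL.oracle at hy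
  split at hy
  · rw [hp] at hy; rw [hy]; exact hx
  · simp only [DTL.createO, dtlFixed, hb, hp] at hy
    obtain ⟨k, ⟨csk, h1, rfl⟩, rfl⟩ := hy
    intro k hk
    rcases List.mem_append.1 hk with hk | hk
    · exact hx k hk
    · rw [List.mem_singleton] at hk
      subst hk
      exact ⟨mem_keySpace_of_mem_support h1, rfl⟩
  · simp only [hb, hp] at hy
    obtain ⟨z, hz, rfl⟩ := hy
    have : z.2.C = x.C := by
      simp only [DTL.redeemO] at hz
      split at hz
      · split at hz
        · simp only [hb] at hz
          obtain ⟨o, -, ho⟩ := hz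
          split at ho <;> (rw [hp] at ho; rw [ho])
        · rw [hp] at hz; rw [hz]
      · rw [hp] at hz; rw [hz]
    intro k hk
    exact hx k (this ▸ hk)

theorem redeem_eq {H : Hash} {κ : ℕ} {par : Val} {cpks : List Val} {csk m rt : Val}
    (h1 : T.pk H κ (par.get 2) csk ∈ cpks) (h2 : M.root H κ cpks = some rt) :
    (dtlFixed T M msgLen S dataFixed).redeem H κ par cpks csk m =
      (S.prove.dist H (inp κ [par.get 0, ofList [rt, T.tag H κ (par.get 2) csk, m],
        ofList [(ofList cpks).idx (T.pk H κ (par.get 2) csk), csk, M.prove.fn H (inp κ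
          [(ofList cpks).idx (T.pk H κ (par.get 2) csk), T.pk H κ (par.get 2) csk, ofList cpks])]])).map fun π =>
        some (T.tag H κ (par.get 2) csk, π) := by
  classical
  have hidx : cpks.findIdx? (fun x => decide (x = T.pk H κ (par.get 2) csk)) =
      some (cpks.findIdx (fun x => decide (x = T.pk H κ (par.get 2) csk))) :=
    List.findIdx?_eq_some_of_exists ⟨_, h1, by simp⟩
  have hi : (ofList cpks).idx (T.pk H κ (par.get 2) csk) =
      unary (cpks.findIdx (fun x => decide (x = T.pk H κ (par.get 2) csk))) := by
    rw [Val.idx, toList_ofList]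
  rw [hi]
  simp only [dtlFixed, h2]
  split
  · rename_i j st hj hst
    have : j = cpks.findIdx (fun x => decide (x = T.pk H κ (par.get 2) csk)) := by
      rw [← Option.some_inj, ← hidx, ← hj]
    subst this
    cases hst
    rfl
  · rename_i h
    exact (h _ rt hidx rfl).elim

/-- The lookup by public key gives the same result because the stored keys are honest. The condition
on the prover is what the erasure of secret keys costs: it is trivial if they are kept, and holds
without them if the proofs do not depend on the witness. -/
theorem oracle_eq_worldO {keep : Bool} {H : Hash} {κ : ℕ} {par pp : Val} (hpp : par.get 2 = pp)
    (hH : H ∈ (𝓗 κ).support) (hs : pp ∈ (T.setup.dist H (inp κ [])).support)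
    {prover : Val → Val → PMF Val} (hprov : ∀ k ∈ keySpace κ, ∀ q,
      prover (stmtF M H (unary κ) (entry T keep H (unary κ) pp k) q)
        (witF M H (unary κ) (entry T keep H (unary κ) pp k) q) =
      S.prove.dist H (inp κ [par.get 0, stmtF M H (unary κ) (entry T true H (unary κ) pp k) q,
        witF M H (unary κ) (entry T true H (unary κ) pp k) q]))
    {x : OracleState} (hx : x.Honest (T := T) H κ pp) (q : Val) :
    worldO T M hl keep H κ pp prover (x.toWorld (T := T) keep H κ pp) q =
      ((dtlFixed T M msgLen S dataFixed).oracle H κ par x q).map fun y =>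
        (y.1, y.2.toWorld (T := T) keep H κ pp) := by
  subst hpp
  have e1 : ∀ {α β : Type} (p : PMF α) (f : α → PMF β), p >>= f = p.bind f := fun p f => rfl
  have e2 : ∀ {α : Type} (a : α), (pure a : PMF α) = PMF.pure a := fun a => rfl
  have e3 : ∀ {α β : Type} (p : PMF α) (f : α → β), p.map f = p.bind fun a => PMF.pure (f a) := fun p f => rfl
  match q with
  | .nil => simp [worldO, DTL.oracle, e2, PMF.pure_map]
  | .cons .nil data =>
    simp [worldO, DTL.oracle, DTL.createO, dtlFixed, e1, e2, e3, OracleState.toWorld, entry, TaggingScheme.pk, inp]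
  | .cons (.cons a b) q =>
    have hf : (x.C.map fun k => entry T keep H (unary κ) (par.get 2) k.2).find?
        (fun e => decide ((q.get 0).toList[(q.get 1).toNat]? = some e.fst)) =
        (x.C.find? fun k => decide ((q.get 0).toList[(q.get 1).toNat]? = some k.1)).map
          fun k => entry T keep H (unary κ) (par.get 2) k.2 := by
      rw [List.find?_map]
      congr 1
      refine List.find?_congr fun k hk => decide_eq_decide.2 ?_
      rw [(hx k hk).2]; rfl
    rw [worldO, if_neg (by simp), if_neg (by simp), snd_cons, redeemW]
    dsimp only [OracleState.toWorld, DTL.oracle, DTL.redeemO]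
    rw [hf]
    cases hk : x.C.find? fun k => decide ((q.get 0).toList[(q.get 1).toNat]? = some k.1) with
    | none => simp only [Option.map_none, e1, e2, PMF.pure_bind, PMF.pure_map, redeemReply]
    | some k =>
      have hkC := hx k (List.mem_of_find?_eq_some hk)
      have hkL : (q.get 0).toList[(q.get 1).toNat]? = some k.1 := by simpa using List.find?_some hk
      have htag : T.tagEval.fn H (ofList [unary κ, par.get 2, k.2]) ∈
          bitStrings (T.tagLen_poly.len H (unary κ)).toNat := by
        rw [PolyLength.len_unary, toNat_unary]
        exact T.tagEval_mem κ H hH _ hs _ hkC.1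
      have hv : Valid T M hl H (unary κ) (entry T keep H (unary κ) (par.get 2) k.2) q ↔
          M.init.fn H (inp κ [q.get 0]) ≠ .nil ∧ q.get 2 ∈ bitStrings (msgLen κ) := by
        have hm : hl.len H (unary κ) = unary (msgLen κ) := hl.len_unary H κ
        rw [Valid, hm, toNat_unary]
        exact ⟨fun h => ⟨h.1, h.2.1⟩, fun h => ⟨h.1, h.2, htag⟩⟩
      have hroot : (dtlFixed T M msgLen S dataFixed).accumulate H κ par (q.get 0).toList =
        (M.init.fn H (inp κ [q.get 0])).toOption := by simp [dtlFixed, MerkleTree.root]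
      by_cases h0 : M.init.fn H (inp κ [q.get 0]) = .nil
      · rw [hroot, toOption_eq_none.2 h0]
        simp only [Option.map_some, hv, h0, ne_eq, not_true, false_and, if_false, e1, e2, PMF.pure_bind,
          PMF.pure_map, redeemReply]
      rw [hroot, toOption_eq_some.2 ⟨rfl, h0⟩]
      by_cases h1 : q.get 2 ∈ bitStrings (msgLen κ)
      · have hroot' : M.root H κ (q.get 0).toList = some (M.init.fn H (inp κ [q.get 0])) := by
          rw [← toOption_eq_some.2 ⟨rfl, h0⟩, ← hroot]; rfl
        have hred := redeem_eq (S := S) (dataFixed := dataFixed) (msgLen := msgLen) (m := q.get 2)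
          (by rw [← hkC.2]; exact List.mem_of_getElem? hkL) hroot'
        dsimp only [Option.map_some]
        rw [if_pos (hv.2 ⟨h0, h1⟩), if_pos (show q.get 2 ∈ bitStrings ((dtlFixed T M msgLen S dataFixed).msgLen κ) from h1), hred, hprov k.2 hkC.1 q, ofList_toList]
        simp only [e1, e2, e3, PMF.bind_bind, PMF.pure_bind, List.map_append, List.map_cons, List.map_nil]
        rfl
      · simp only [Option.map_some, hv, h1, and_false, if_false, e1, e2, PMF.pure_bind,
          PMF.pure_map, redeemReply, dtlFixed]

end

end
end Tumbling

/-! ### Transcripts, extractors and the experiments in explicit form -/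

namespace Tumbling
open Val

noncomputable section

open Tumbling.Comp
open scoped ENNReal

/-! ## Recording a transcript -/

section
variable (Sim : Simulator)

/-- Coins are recorded. -/
def recFlip (s : Val) : Comp (Bool × Val) :=
  .flip fun b => ret (b, .cons s.fst (.cons (s.snd.fst.snoc (ofBool b)) s.snd.snd))

/-- Simulated proofs are recorded, and so are the statements. -/
def recQuery (H : Hash) (n : ℕ) (q s : Val) : Comp (Val × Val) :=
  (Sim.prove.muted H (ofList [s.fst.fst, s.fst.get 2, q])).bind fun π =>
    (ret (fit (min (s.fst.get 1).toNat n) (ofList [π]))).bind fun r =>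
      ret (r, .cons s.fst (.cons (s.snd.fst.snoc r) (s.snd.snd.snoc q)))

/-- Running a program with the oracle for simulated proofs. -/
def record (B : Code) (H : Hash) (a s : Val) : Comp Val :=
  (interp recFlip (recQuery Sim H) (B.den H a) s).map fun x => .cons x.1 x.2

theorem PP.record' {B : Code} (hB : B.PPT) {f g : Hash → Val → Val} [hf : PolyFn f]
    [hg : PolyFn g] : PP fun H v => record Sim B H (f H v) (g H v) := by
  refine subst₂ (G := fun H a s => record Sim B H a s) ?_
  refine PP.interp hB (hf := fun _ => recFlip) (hq := recQuery Sim) ?_ ?_ ?_ (20 + 2 * .X) ?_ ?_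
  · exact (inferInstance : PP fun _ w => flipC.bind fun b =>
      ret (.cons b (.cons w.snd.fst (.cons (w.snd.snd.fst.snoc b) w.snd.snd.snd))))
  · have : PP fun H v => Sim.prove.muted H (ofList [v.snd.fst.fst, v.snd.fst.get 2, v.fst.snd]) :=
      muted_comp Sim.prove_ppt
    have : PP fun H w => (Sim.prove.muted H (ofList [w.snd.fst.fst, w.snd.fst.get 2, w.fst.snd])).bind fun π =>
      (ret (trunc (w.snd.fst.get 1) w.fst.fst (ofList [π]))).bind fun r =>
      ret (.cons r (.cons w.snd.fst (.cons (w.snd.snd.fst.snoc r) (w.snd.snd.snd.snoc w.fst.snd)))) := inferInstance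
    simpa only [recQuery, trunc_eq, map_bind, map_ret] using this
  · intro H n q s x hx
    simp only [recQuery, out_bind, out_ret] at hx
    obtain ⟨π, -, r, rfl, rfl⟩ := hx
    exact fit_fit_min _ _ _
  · rintro H s x ⟨b, rfl⟩
    have h1 := size_fst_add_snd s.snd
    have h2 := size_ofBool_le b
    simp only [fst_cons, snd_cons, size_cons, size_snoc, true_and, Polynomial.eval_add, Polynomial.eval_ofNat]
    omega
  · intro H n q s x hx
    simp only [recQuery, out_bind, out_ret] at hx
    obtain ⟨π, -, r, rfl, rfl⟩ := hx
    have h1 := size_fst_add_snd s.snd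
    have h2 := size_fit_le_max (min (s.fst.get 1).toNat n) (ofList [π])
    simp only [fst_cons, snd_cons, size_cons, size_snoc, true_and, Polynomial.eval_add, Polynomial.eval_ofNat,
      Polynomial.eval_mul, Polynomial.eval_X]
    omega

def recState (κ N : ℕ) (τ : Val) (l Q : List Val) : Val :=
  .cons (ofList [unary κ, unary N, τ]) (.cons (ofList l) (ofList Q))

/-- A program that holds the trapdoor can play the simulation oracle itself and write down the
transcript of the adversary. The cut at N is harmless because all buffers are at most N. -/
theorem distr_interp_rec {α : Type} {H : Hash} {κ N B m : ℕ} {τ : Val} (hB : B ≤ N) (c : Comp α) (hc : Bdd B m c)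
    (l Q : List Val) :
    (interp recFlip (recQuery Sim H) c (recState κ N τ l Q)).distr =
      (c.run (ZkSnark.simOracle Sim H κ τ) Q).map fun y => (y.1, recState κ N τ (l ++ y.2.2) y.2.1) := by
  induction c generalizing m l Q with
  | ret a => simp [run_ret, PMF.pure_map]
  | flip k ih =>
    simp only [interp_flip, recFlip, flip_bind, ret_bind, distr_flip, run_flip, PMF.map_bind]
    congr 1; funext b
    have : (recState κ N τ l Q).fst.cons (((recState κ N τ l Q).snd.fst.snoc (ofBool b)).cons
        (recState κ N τ l Q).snd.snd) = recState κ N τ (l ++ [ofBool b]) Q := by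
      simp [recState, Val.snoc]
    rw [this, ih b (hc b)]
    simp [PMF.map, Function.comp_def]
  | query n q k ih =>
    match m, hc with
    | m + 1, hc =>
      have h1 : ∀ π, (recState κ N τ l Q).fst.cons (((recState κ N τ l Q).snd.fst.snoc π).cons
          ((recState κ N τ l Q).snd.snd.snoc q)) = recState κ N τ (l ++ [π]) (Q ++ [q]) := by
        intro π; simp [recState, Val.snoc]
      have h2 : (ofList [(recState κ N τ l Q).fst.fst, (recState κ N τ l Q).fst.get 2, q]) = inp κ [τ, q] := by
        simp [recState, inp]
      have h3 : ((recState κ N τ l Q).fst.get 1).toNat = N := by simp [recState]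
      have h4 : ZkSnark.simOracle Sim H κ τ Q q = (Sim.prove.dist H (inp κ [τ, q])).bind fun π =>
        PMF.pure (ofList [π], Q ++ [q]) := rfl
      simp only [interp_query, recQuery, ret_bind, Comp.bind_assoc, distr_bind, h1, h2, h3, Code.distr_muted, run_query,
        h4, PMF.bind_bind, PMF.pure_bind, PMF.map_bind, PMF.pure_map, min_eq_right (hc.1.trans hB), ih _ (hc.2.2 _)]
      simp [PMF.map, Function.comp_def]

theorem distr_record {B : Code} {H : Hash} {κ N b m : ℕ} {τ a : Val} (hB : b ≤ N) (hc : Bdd b m (B.den H a))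
    (l : List Val) :
    (record Sim B H a (recState κ N τ l [])).distr =
      ((B.den H a).run (ZkSnark.simOracle Sim H κ τ) []).map fun y =>
        .cons y.1 (recState κ N τ (l ++ y.2.2) y.2.1) := by
  rw [record, distr_map, distr_interp_rec Sim hB _ hc, PMF.map_comp]
  rfl

theorem Code.PPT.bdd {c : Code} (hc : c.PPT) : ∃ p : Polynomial ℕ, ∀ H v n, v.size ≤ n →
    Bdd (p.eval n) (p.eval n) (c.den H v) := by
  obtain ⟨p, hp⟩ := hc.out
  exact ⟨p, fun H v n hn => (Code.bdd_eval fun r hr =>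
    (hp H v r hr).trans (eval_mono p hn)).bind_ret _⟩

/-! ## The experiment of simulation extractability -/

/-- A run of an adversary, with initial transcript `l`, and of an extractor. -/
def extract (B X : Code) (H : Hash) (κ : ℕ) (pp crs τ a : Val) (l : List Val) : PMF (Val × List Val × Val) :=
  ((B.den H a).run (ZkSnark.simOracle Sim H κ τ) []).bind fun y =>
    (X.dist H (inp κ [pp, crs, ofList (l ++ y.2.2)])).map fun wit => (y.1, y.2.1, wit)

/-- The same as a program. -/
def extractC (B X : Code) (k : ℕ) (H : Hash) (κV pp crs τ a l : Val) : Comp Val :=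
  (record Sim B H a (.cons (ofList [κV, unary ((κV.toNat + 2) ^ k), τ]) (.cons l .nil))).bind fun y =>
    (X.muted H (ofList [κV, pp, crs, y.snd.snd.fst])).bind fun wit =>
      ret (ofList [y.fst, y.snd.snd.snd, wit])

theorem distr_extractC {B X : Code} {k : ℕ} {H : Hash} {κ b m : ℕ} {pp crs τ a : Val} {l : List Val}
    (hB : b ≤ (κ + 2) ^ k) (hc : Bdd b m (B.den H a)) :
    (extractC Sim B X k H (unary κ) pp crs τ a (ofList l)).distr =
      (extract Sim B X H κ pp crs τ a l).map fun y => ofList [y.1, ofList y.2.1, y.2.2] := by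
  have h := distr_record Sim (τ := τ) (κ := κ) hB hc l
  simp only [recState, ofList_nil] at h
  simp only [extractC, toNat_unary, distr_bind, h, PMF.bind_map, extract, PMF.map_bind, PMF.map_comp,
    Code.distr_muted, distr_ret]
  rfl

theorem PP.extractC' {B X : Code} (hB : B.PPT) (hX : X.PPT) (k : ℕ) {κV pp crs τ a l : Hash → Val → Val}
    [PolyFn κV] [PolyFn pp] [PolyFn crs] [PolyFn τ] [PolyFn a] [PolyFn l] :
    PP fun H v => extractC Sim B X k H (κV H v) (pp H v) (crs H v) (τ H v) (a H v) (l H v) := by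
  have : PP fun H v => extractC Sim B X k H (v.get 0) (v.get 1) (v.get 2) (v.get 3) (v.get 4) (v.snd.get 4) := by
    have h1 : PP fun H v => record Sim B H (v.get 4)
        (.cons (ofList [v.get 0, unary (((v.get 0).toNat + 2) ^ k), v.get 3]) (.cons (v.snd.get 4) .nil)) :=
      PP.record' Sim hB
    have h2 : PP fun H w => X.muted H (ofList [w.snd.get 0, w.snd.get 1, w.snd.get 2, w.fst.snd.snd.fst]) :=
      muted_comp hX
    unfold extractC
    infer_instance
  simpa using subst (f := fun H v => ofList [κV H v, pp H v, crs H v, τ H v, a H v, l H v]) this inferInstance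

end

/-! ## Experiments -/

theorem pmf_bind_def {α β : Type} (p : PMF α) (f : α → PMF β) : p >>= f = p.bind f := rfl
theorem pmf_pure_def {α : Type} (a : α) : (pure a : PMF α) = PMF.pure a := rfl

theorem ex_pr_pure {α : Type} (p : PMF α) (P : α → Prop) :
    (ex p fun a => pr (PMF.pure (P a)) fun Q => Q) = pr p P := by
  simp only [pr_eq_ex, ex_pure]

section
variable {𝓗 : HashModel} (T : TaggingScheme 𝓗)

/-- Expectation over the hash oracle and the public parameters. -/
def exG (κ : ℕ) (F : Hash → Val → ℝ≥0∞) : ℝ≥0∞ :=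
  ex (𝓗 κ) fun H => ex (T.setup.dist H (inp κ [])) fun pp => F H pp

variable {T} {κ : ℕ} {F G : Hash → Val → ℝ≥0∞}

theorem exG_mono (h : ∀ H ∈ (𝓗 κ).support, ∀ pp ∈ (T.setup.dist H (inp κ [])).support, F H pp ≤ G H pp) :
    exG T κ F ≤ exG T κ G := ex_mono fun H hH => ex_mono fun pp hpp => h H hH pp hpp

theorem exG_congr (h : ∀ H ∈ (𝓗 κ).support, ∀ pp ∈ (T.setup.dist H (inp κ [])).support, F H pp = G H pp) :
    exG T κ F = exG T κ G := ex_congr fun H hH => ex_congr fun pp hpp => h H hH pp hpp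

theorem exG_add : (exG T κ fun H pp => F H pp + G H pp) = exG T κ F + exG T κ G := by
  simp only [exG, ex_add]

theorem exG_const_mul (c : ℝ≥0∞) : (exG T κ fun H pp => c * F H pp) = c * exG T κ F := by
  simp only [exG, ex_const_mul]

variable (A : Code)

theorem oneWay_eq : (pr (T.oneWayGame A κ) fun P => P) = exG T κ fun H pp => ex (sampleKey κ) fun k =>
    pr (A.dist H (inp κ [pp, T.tag H κ pp k, T.pk H κ pp k])) fun k' =>
      k' ∈ keySpace κ ∧ T.tag H κ pp k' = T.tag H κ pp k := by
  simp only [TaggingScheme.oneWayGame, pmf_bind_def, pmf_pure_def, pr_bind, ex_pr_pure, exG]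

theorem collision_eq : (pr (T.collisionGame A κ) fun P => P) = exG T κ fun H pp =>
    pr (A.dist H (inp κ [pp])) fun out => out.get 0 ∈ keySpace κ ∧ out.get 1 ∈ keySpace κ ∧
      out.get 0 ≠ out.get 1 ∧ T.pk H κ pp (out.get 0) = T.pk H κ pp (out.get 1) := by
  simp only [TaggingScheme.collisionGame, pmf_bind_def, pmf_pure_def, pr_bind, ex_pr_pure, exG]

theorem pr0_eq : (pr (T.prGame0 A κ) fun P => P) = exG T κ fun H pp => ex (sampleKey κ) fun k =>
    pr (A.dist H (inp κ [pp, T.tag H κ pp k, T.pk H κ pp k])) (· ≠ .nil) := by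
  simp only [TaggingScheme.prGame0, pmf_bind_def, pmf_pure_def, pr_bind, ex_pr_pure, exG]

theorem pr1_eq : (pr (T.prGame1 A κ) fun P => P) = exG T κ fun H pp =>
    ex (uniformBits (T.tagLen κ)) fun tag => ex (uniformBits (T.pkLen κ)) fun cpk =>
      pr (A.dist H (inp κ [pp, tag, cpk])) (· ≠ .nil) := by
  simp only [TaggingScheme.prGame1, pmf_bind_def, pmf_pure_def, pr_bind, ex_pr_pure, exG]

variable (M : MerkleTree T.pkLen) (msgLen : ℕ → ℕ) (S : ZkSnark) (Sim : Simulator)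

theorem zk0_eq : (pr (S.zkGame0 𝓗 (fixedRelation T M msgLen) A κ) fun P => P) = exG T κ fun H pp =>
    ex (S.setup.dist H (inp κ [pp])) fun crs =>
      pr ((A.den H (inp κ [pp, crs])).exec (S.proveOracle (fixedRelation T M msgLen) H κ pp crs) ())
        (·.1 ≠ .nil) := by
  simp only [ZkSnark.zkGame0, pmf_bind_def, pmf_pure_def, pr_bind, ex_pr_pure, exG, Code.play_eq, ← run_map_exec, pr_map]
  rfl

theorem zk1_eq : (pr (ZkSnark.zkGame1 𝓗 (fixedRelation T M msgLen) Sim A κ) fun P => P) = exG T κ fun H pp =>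
    ex (Sim.setup.dist H (inp κ [pp])) fun c =>
      pr ((A.den H (inp κ [pp, c.fst])).exec
        (ZkSnark.simProveOracle (fixedRelation T M msgLen) Sim H κ pp c.snd) ()) (·.1 ≠ .nil) := by
  simp only [ZkSnark.zkGame1, pmf_bind_def, pmf_pure_def, pr_bind, ex_pr_pure, exG, Code.play_eq, ← run_map_exec, pr_map]
  rfl

theorem se_eq (X : Code) : (pr (S.seGame 𝓗 (fixedRelation T M msgLen) Sim A X κ) fun P => P) =
    exG T κ fun H pp => ex (Sim.setup.dist H (inp κ [pp])) fun c =>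
      pr (extract Sim A X H κ pp c.fst c.snd (inp κ [pp, c.fst]) []) fun y =>
        S.Accepts H κ c.fst.snd (y.1.get 0) (y.1.get 1) ∧ y.1.get 0 ∉ y.2.1 ∧
          ¬ (fixedRelation T M msgLen).rel H κ pp (y.1.get 0) y.2.2 := by
  simp only [ZkSnark.seGame, pmf_bind_def, pmf_pure_def, pr_bind, ex_pr_pure, exG, Code.play_eq, extract, pr_map,
    List.nil_append]
  rfl

theorem merkle_eq : (pr (M.game 𝓗 A κ) fun P => P) = ex (𝓗 κ) fun H => pr (A.dist H (inp κ [])) fun out =>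
    ∃ rt, M.root H κ (out.get 0).toList = some rt ∧ M.Accepts H κ (out.get 1) (out.get 2) rt (out.get 3) ∧
      (out.get 0).toList[(out.get 1).toNat]? ≠ some (out.get 2) := by
  simp only [MerkleTree.game, pmf_bind_def, pmf_pure_def, pr_bind, ex_pr_pure]

end

end
end Tumbling

namespace Tumbling
open Val

noncomputable section

open Tumbling.Comp
open scoped ENNReal

section
variable {𝓗 : HashModel} {T : TaggingScheme 𝓗} {M : MerkleTree T.pkLen} {msgLen : ℕ → ℕ}
  {S : ZkSnark} {dataFixed : Val}

/-! ## Honest witnesses and correctness -/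

/-- Correctness of the Merkle tree applies at the first position where the public key occurs in the
list. -/
theorem rel_honest (hM : M.Correct 𝓗) {H : Hash} {κ : ℕ} (hH : H ∈ (𝓗 κ).support) {pp csk m rt : Val}
    {cpks : List Val} (hm : m ∈ bitStrings (msgLen κ)) (hk : csk ∈ keySpace κ)
    (h1 : T.pk H κ pp csk ∈ cpks) (h2 : M.root H κ cpks = some rt) :
    (fixedRelation T M msgLen).rel H κ pp (ofList [rt, T.tag H κ pp csk, m])
      (ofList [(ofList cpks).idx (T.pk H κ pp csk), csk, M.prove.fn H (inp κ
          [(ofList cpks).idx (T.pk H κ pp csk), T.pk H κ pp csk, ofList cpks])]) := by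
  classical
  refine ⟨_, _, _, _, _, _, rfl, rfl, hm, hk, ?_, rfl⟩
  have hi : (ofList cpks).idx (T.pk H κ pp csk) = unary (cpks.findIdx (fun x => decide (x = T.pk H κ pp csk))) := by
    rw [Val.idx, toList_ofList]
  have hlt : cpks.findIdx (fun x => decide (x = T.pk H κ pp csk)) < cpks.length :=
    List.findIdx_lt_length_of_exists ⟨_, h1, by simp⟩
  have := (hM κ H hH cpks).2 rt h2 _ hlt
  have he : cpks[cpks.findIdx (fun x => decide (x = T.pk H κ pp csk))] = T.pk H κ pp csk := by
    simpa using List.findIdx_getElem (w := hlt)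
  rw [he] at this
  rw [hi]
  exact this

theorem of_mem_support_mapM {α β : Type} {f : α → PMF β} {l : List α} {y : List β}
    (h : y ∈ (l.mapM f).support) : y.length = l.length ∧ ∀ b ∈ y, ∃ a ∈ l, b ∈ (f a).support := by
  induction l generalizing y with
  | nil =>
    rw [List.mapM_nil, pmf_pure_def, PMF.mem_support_pure_iff] at h
    subst h; simp
  | cons a l ih =>
    rw [List.mapM_cons, pmf_bind_def, PMF.mem_support_bind_iff] at h
    obtain ⟨b, hb, h⟩ := h
    rw [pmf_bind_def, PMF.mem_support_bind_iff] at h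
    obtain ⟨z, hz, h⟩ := h
    rw [pmf_pure_def, PMF.mem_support_pure_iff] at h
    subst h
    obtain ⟨h1, h2⟩ := ih hz
    refine ⟨by simp [h1], fun c hc => ?_⟩
    rcases List.mem_cons.1 hc with rfl | hc
    · exact ⟨a, by simp, hb⟩
    · obtain ⟨d, hd, h⟩ := h2 c hc
      exact ⟨d, by simp [hd], h⟩

/-- Honest public keys are strings of the right length, so the list is accepted; the honest
witnesses are in the relation and completeness applies to every possible outcome. -/
theorem correct (hM : M.Correct 𝓗) (hS : S.Complete 𝓗 (fixedRelation T M msgLen)) :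
    (dtlFixed T M msgLen S dataFixed).Correct 𝓗 := by
  intro κ data hdata m hm
  rw [prob_eq, pr_of_forall, ENNReal.toReal_one]
  intro P hP
  simp only [DTL.correctGame, pmf_bind_def, pmf_pure_def, PMF.mem_support_bind_iff, PMF.mem_support_pure_iff] at hP
  obtain ⟨H, hH, par, hpar, keys, hkeys, outs, houts, rfl⟩ := hP
  simp only [dtlFixed, pmf_bind_def, pmf_pure_def, PMF.mem_support_bind_iff, PMF.mem_support_pure_iff] at hpar
  obtain ⟨pp, hpp, crs, hcrs, rfl⟩ := hpar
  obtain ⟨hlen, hkeys⟩ := of_mem_support_mapM hkeys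
  obtain ⟨-, houts⟩ := of_mem_support_mapM houts
  have hk : ∀ k ∈ keys, k.2 ∈ keySpace κ ∧ k.1 = T.pk H κ pp k.2 := by
    intro k hk
    obtain ⟨a, -, ha⟩ := hkeys k hk
    simp only [dtlFixed, pmf_bind_def, pmf_pure_def, PMF.mem_support_bind_iff, PMF.mem_support_pure_iff] at ha
    obtain ⟨csk, hcsk, rfl⟩ := ha
    exact ⟨mem_keySpace_of_mem_support hcsk, rfl⟩
  obtain ⟨rt, hrt⟩ := Option.isSome_iff_exists.1 ((hM κ H hH (keys.map Prod.fst)).1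
    ⟨by rw [List.length_map, hlen]; exact hdata, fun x hx => by
      obtain ⟨k, h, rfl⟩ := List.mem_map.1 hx
      rw [(hk k h).2]
      exact T.keyGen_mem κ H hH pp hpp _ (hk k h).1⟩)
  refine ⟨rt, hrt, fun o ho => ?_⟩
  obtain ⟨k, hkk, ho⟩ := houts o ho
  have hmem : T.pk H κ pp k.2 ∈ keys.map Prod.fst := (hk k hkk).2 ▸ List.mem_map_of_mem hkk
  have hred := redeem_eq (T := T) (M := M) (S := S) (dataFixed := dataFixed) (msgLen := msgLen) (H := H) (κ := κ) (m := m)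
    (par := ofList [crs.fst, crs.snd, pp, dataFixed]) (csk := k.2) hmem hrt
  rw [hred, PMF.mem_support_map_iff] at ho
  obtain ⟨π, hπ, rfl⟩ := ho
  exact ⟨_, π, rfl, hS κ H hH pp hpp _ _ (rel_honest hM hH hm (hk k hkk).1 hmem hrt) crs hcrs π hπ⟩

/-! ## Proofs that do not depend on the witness -/

/-- The prover of the simulator, as the prover of a zk-SNARK. -/
theorem exists_simSnark (S : ZkSnark) (Sim : Simulator) : ∃ S' : ZkSnark, ∀ H κ key stmt wit,
    S'.prove.dist H (inp κ [key, stmt, wit]) = Sim.prove.dist H (inp κ [key, stmt]) := by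
  have : PP fun H v => Sim.prove.muted H (ofList [v.fst, v.get 1, v.get 2]) := PP.muted_comp Sim.prove_ppt
  obtain ⟨c, hc, h⟩ := this
  refine ⟨⟨S.setup, c, S.verify, S.setup_ppt, hc, S.verify_ppt, S.verify_det⟩, fun H κ key stmt wit => ?_⟩
  rw [Code.dist_eq, h, Code.distr_muted]
  rfl

/-- With it, a run with simulated proofs is a run of the layer itself for another SNARK, the
trapdoor in the place of the proving key. Facts about the layer's oracles then need no second
version. -/
def simSnark (S : ZkSnark) (Sim : Simulator) : ZkSnark := (exists_simSnark S Sim).choose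

theorem simSnark_prove (S : ZkSnark) (Sim : Simulator) (H : Hash) (κ : ℕ) (key stmt wit : Val) :
    (simSnark S Sim).prove.dist H (inp κ [key, stmt, wit]) = Sim.prove.dist H (inp κ [key, stmt]) :=
  (exists_simSnark S Sim).choose_spec H κ key stmt wit

/-! ## Sizes -/

theorem size_inp (κ : ℕ) (l : List Val) : (inp κ l).size = 2 * κ + 2 + (ofList l).size := by
  simp [inp]; omega

variable (T M S) in
theorem exists_size_setup (Sim : Simulator) : ∃ p : Polynomial ℕ, ∀ H κ, ∀ pp ∈ (T.setup.dist H (inp κ [])).support,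
    (∀ crs ∈ (S.setup.dist H (inp κ [pp])).support, pp.size + crs.size ≤ p.eval κ) ∧
    ∀ c ∈ (Sim.setup.dist H (inp κ [pp])).support, pp.size + c.size ≤ p.eval κ := by
  have h1 : PP fun H v => S.setup.muted H (ofList [v.snd.fst, v.fst]) := PP.muted_comp S.setup_ppt
  have h2 : PP fun H v => Sim.setup.muted H (ofList [v.snd.fst, v.fst]) := PP.muted_comp Sim.setup_ppt
  have h3 : PP T.setup.muted := PP.muted T.setup_ppt
  have h4 : PP fun H v => (T.setup.muted H v).bind fun pp => (S.setup.muted H (ofList [v.fst, pp])).bind fun crs =>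
    ret (.cons pp crs) := inferInstance
  have h5 : PP fun H v => (T.setup.muted H v).bind fun pp => (Sim.setup.muted H (ofList [v.fst, pp])).bind fun crs =>
    ret (.cons pp crs) := inferInstance
  obtain ⟨p1, hp1⟩ := h4.size
  obtain ⟨p2, hp2⟩ := h5.size
  have hout : ∀ (c : Code) H v x, x ∈ (c.dist H v).support → (c.muted H v).Out x := fun c H v x hx =>
    out_of_mem_support_distr (by rwa [Code.distr_muted])
  have hs : ∀ κ : ℕ, (inp κ []).size = 2 * κ + 3 := fun κ => by rw [size_inp]; simp
  refine ⟨p1.comp (2 * .X + 3) + p2.comp (2 * .X + 3), fun H κ pp hpp => ⟨fun crs hcrs => ?_, fun c hc => ?_⟩⟩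
  · have := hp1 H (inp κ []) (.cons pp crs) (by
      simp only [out_bind, out_ret]
      exact ⟨pp, hout _ _ _ _ hpp, crs, hout _ _ _ _ hcrs, rfl⟩)
    rw [hs] at this
    simp only [size_cons, Polynomial.eval_add, Polynomial.eval_comp, Polynomial.eval_mul, Polynomial.eval_ofNat,
      Polynomial.eval_X] at *
    omega
  · have := hp2 H (inp κ []) (.cons pp c) (by
      simp only [out_bind, out_ret]
      exact ⟨pp, hout _ _ _ _ hpp, c, hout _ _ _ _ hc, rfl⟩)
    rw [hs] at this
    simp only [size_cons, Polynomial.eval_add, Polynomial.eval_comp, Polynomial.eval_mul, Polynomial.eval_ofNat,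
      Polynomial.eval_X] at *
    omega

variable (T M) in
/-- The sizes of the proofs that an adversary with the redeem oracle gets. -/
theorem exists_size_prove (S : ZkSnark) : ∃ p : Polynomial ℕ, ∀ H κ key pp k q n, k ∈ keySpace κ →
    key.size + pp.size + q.size ≤ n →
    ∀ π ∈ (S.prove.dist H (inp κ [key, stmtF M H (unary κ) (entry T true H (unary κ) pp k) q,
      witF M H (unary κ) (entry T true H (unary κ) pp k) q])).support, π.size ≤ p.eval (κ + n) := by
  have h0 : PP fun H v => S.prove.muted H (ofList [v.fst, v.get 1,
      stmtF M H v.fst (entry T true H v.fst (v.get 2) (v.get 3)) (v.get 4),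
      witF M H v.fst (entry T true H v.fst (v.get 2) (v.get 3)) (v.get 4)]) := PP.muted_comp S.prove_ppt
  obtain ⟨p, hp⟩ := h0.size
  refine ⟨p.comp (10 * .X + 20), fun H κ key pp k q n hk hn π hπ => ?_⟩
  have h1 := hp H (ofList [unary κ, key, pp, k, q]) π (out_of_mem_support_distr (by
    rw [Code.distr_muted]; simpa [inp] using hπ))
  refine h1.trans ((eval_mono p ?_).trans (le_of_eq (by
    simp only [Polynomial.eval_comp, Polynomial.eval_add, Polynomial.eval_mul, Polynomial.eval_ofNat,
      Polynomial.eval_X]; rfl)))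
  have := size_of_mem_keySpace hk
  simp only [ofList_cons, ofList_nil, size_cons, size_unary, size_nil]
  omega

end

end
end Tumbling

/-! ### From honest proofs to simulated proofs -/

namespace Tumbling
open Val

noncomputable section

open Tumbling.Comp
open scoped ENNReal

section
variable {𝓗 : HashModel} {T : TaggingScheme 𝓗} {M : MerkleTree T.pkLen} {msgLen : ℕ → ℕ}
  {hl : PolyLength msgLen} {S : ZkSnark} {Sim : Simulator} {dataFixed : Val}

variable (T M hl) in
/-- The sizes of simulated proofs. -/
theorem exists_size_simProve (Sim : Simulator) : ∃ p : Polynomial ℕ, ∀ H κ τ e q n,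
    Valid T M hl H (unary κ) e q → τ.size + q.size ≤ n →
    ∀ π ∈ (Sim.prove.dist H (inp κ [τ, stmtF M H (unary κ) e q])).support, π.size ≤ p.eval (κ + n) := by
  obtain ⟨p1, h1⟩ := size_stmtF T M
  obtain ⟨p2, h2⟩ := size_valid T M hl
  have h0 : PP fun H v => Sim.prove.muted H v := PP.muted Sim.prove_ppt
  obtain ⟨p, hp⟩ := h0.size
  refine ⟨p.comp (2 * .X + 10 + .X + p1.comp (2 * .X + 1) + p2.comp (2 * .X + 1)), fun H κ τ e q n hv hn π hπ => ?_⟩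
  refine (hp H _ π (out_of_mem_support_distr (by rwa [Code.distr_muted]))).trans ?_
  have e1 := h1 H (unary κ) e q
  have e2 := h2 _ _ _ _ hv
  have m1 := eval_mono p1 (show (unary κ).size + q.size ≤ 2 * (κ + n) + 1 by simp; omega)
  have m2 := eval_mono p2 (show (unary κ).size ≤ 2 * (κ + n) + 1 by simp)
  refine (eval_mono p (b := 2 * (κ + n) + 10 + (κ + n) + p1.eval (2 * (κ + n) + 1) + p2.eval (2 * (κ + n) + 1))
    ?_).trans (le_of_eq ?_)
  · rw [size_inp]
    simp only [ofList_cons, ofList_nil, size_cons, size_nil]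
    dsimp only at *
    omega
  · simp

variable (M hl S Sim) in
/-- Bounds for the running time of an adversary and for the proofs that it gets. -/
theorem exists_fuel {A : Code} (hA : A.PPT) (pa : Polynomial ℕ) : ∃ (b : Polynomial ℕ) (k : ℕ),
    (∀ κ, b.eval κ ≤ (κ + 2) ^ k) ∧ (∀ κ, pa.eval κ ≤ b.eval κ) ∧
    (∀ κ H (a : Val), a.size ≤ pa.eval κ → Bdd (b.eval κ) (b.eval κ) (A.den H a)) ∧
    ∀ κ H, ∀ pp ∈ (T.setup.dist H (inp κ [])).support,
      (∀ crs ∈ (S.setup.dist H (inp κ [pp])).support, ∀ k' ∈ keySpace κ, ∀ q : Val, q.size ≤ b.eval κ →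
        ∀ π ∈ (S.prove.dist H (inp κ [crs.fst, stmtF M H (unary κ) (entry T true H (unary κ) pp k') q,
          witF M H (unary κ) (entry T true H (unary κ) pp k') q])).support, π.size ≤ (κ + 2) ^ k) ∧
      ∀ c ∈ (Sim.setup.dist H (inp κ [pp])).support, ∀ e q : Val, q.size ≤ b.eval κ → Valid T M hl H (unary κ) e q →
        ∀ π ∈ (Sim.prove.dist H (inp κ [c.snd, stmtF M H (unary κ) e q])).support, π.size ≤ (κ + 2) ^ k := by
  obtain ⟨pA, hpA⟩ := hA.bdd
  obtain ⟨ps, hps⟩ := exists_size_setup T S Sim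
  obtain ⟨p1, hp1⟩ := exists_size_prove T M S
  obtain ⟨p2, hp2⟩ := exists_size_simProve T M hl Sim
  obtain ⟨k, hk⟩ := exists_pow_bound (pA.comp pa + pa + p1.comp (.X + (ps + (pA.comp pa + pa))) +
    p2.comp (.X + (ps + (pA.comp pa + pa))))
  simp only [Polynomial.eval_add, Polynomial.eval_comp, Polynomial.eval_X] at hk
  refine ⟨pA.comp pa + pa, k, fun κ => ?_, fun κ => ?_, fun κ H a ha => ?_, fun κ H pp hpp => ⟨?_, ?_⟩⟩
  · have := hk κ; simp only [Polynomial.eval_add, Polynomial.eval_comp]; omega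
  · simp
  · refine (hpA H a _ ha).mono ?_ ?_ <;> simp
  · intro crs hcrs k' hk' q hq π hπ
    have := (hps H κ pp hpp).1 crs hcrs
    have h2 := size_fst_le crs
    simp only [Polynomial.eval_add, Polynomial.eval_comp] at hq
    have := hp1 H κ crs.fst pp k' q (ps.eval κ + (pA.eval (pa.eval κ) + pa.eval κ)) hk' (by omega) π hπ
    have := hk κ
    omega
  · intro c hc e q hq hv π hπ
    have := (hps H κ pp hpp).2 c hc
    have h2 := size_snd_le c
    simp only [Polynomial.eval_add, Polynomial.eval_comp] at hq
    have := hp2 H κ c.snd e q (ps.eval κ + (pA.eval (pa.eval κ) + pa.eval κ)) hv (by omega) π hπ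
    have := hk κ
    omega

/-! ## Adversaries with the oracles of the data tumbling layer -/

variable (T M msgLen dataFixed) in
/-- A run of an adversary with the oracles, where `key` is the proving key. -/
def dtlExec (S : ZkSnark) (A : Code) (H : Hash) (κ : ℕ) (pp key vk a : Val) : PMF (Val × OracleState) :=
  (A.den H a).exec ((dtlFixed T M msgLen S dataFixed).oracle H κ (ofList [key, vk, pp, dataFixed])) ⟨[], []⟩

/-- The oracles of the layer are transported to `worldO` by an encoding of their states; the
invariant needed along the run is that the created keys are honest. -/
theorem dtlExec_toWorld {A : Code} {keep : Bool} {H : Hash} {κ B m : ℕ} {pp key vk a : Val}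
    (hH : H ∈ (𝓗 κ).support) (hs : pp ∈ (T.setup.dist H (inp κ [])).support)
    {prover : Val → Val → PMF Val} (hprov : ∀ k ∈ keySpace κ, ∀ q,
      prover (stmtF M H (unary κ) (entry T keep H (unary κ) pp k) q)
        (witF M H (unary κ) (entry T keep H (unary κ) pp k) q) =
      S.prove.dist H (inp κ [key, stmtF M H (unary κ) (entry T true H (unary κ) pp k) q,
        witF M H (unary κ) (entry T true H (unary κ) pp k) q])) (hA : Bdd B m (A.den H a)) :
    (A.den H a).exec (worldO T M hl keep H κ pp prover) ⟨[], [], []⟩ =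
      (dtlExec T M msgLen dataFixed S A H κ pp key vk a).map fun y => (y.1, y.2.toWorld (T := T) keep H κ pp) :=
  exec_eq_of_map (O₂ := worldO T M hl keep H κ pp prover)
    (O' := (dtlFixed T M msgLen S dataFixed).oracle H κ (ofList [key, vk, pp, dataFixed]))
    (OracleState.toWorld (T := T) keep H κ pp) (OracleState.Honest (T := T) H κ pp) B
    (fun x q hx _ => oracle_eq_worldO (par := ofList [key, vk, pp, dataFixed]) (pp := pp) rfl hH hs hprov hx q) (fun x q hx _ y hy => oracle_honest (par := ofList [key, vk, pp, dataFixed]) (pp := pp) rfl hx hy)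
    (A.den H a) hA (x := ⟨[], []⟩) (by simp [OracleState.Honest])

theorem honest_of_mem_support {A : Code} {H : Hash} {κ B m : ℕ} {pp key vk a : Val} (hA : Bdd B m (A.den H a))
    {y : Val × OracleState} (hy : y ∈ (dtlExec T M msgLen dataFixed S A H κ pp key vk a).support) :
    y.2.Honest (T := T) H κ pp :=
  inv_of_mem_support_exec (OracleState.Honest (T := T) H κ pp) B (fun x q hx _ y hy => oracle_honest (par := ofList [key, vk, pp, dataFixed]) (pp := pp) rfl hx hy)
    (A.den H a) hA (x := ⟨[], []⟩) (by simp [OracleState.Honest]) hy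

/-- The initial state of the program for the oracles. -/
def world₀ (κV N pp : Val) : Val := .cons (ofList [κV, N, pp]) (.cons .nil (.cons .nil .nil))

theorem rel_of_valid (hM : M.Correct 𝓗) {H : Hash} {κ : ℕ} (hH : H ∈ (𝓗 κ).support) {pp k q : Val}
    (hk : k ∈ keySpace κ) (hm : (entry T true H (unary κ) pp k).fst ∈ (q.get 0).toList)
    (hv : Valid T M hl H (unary κ) (entry T true H (unary κ) pp k) q) :
    (fixedRelation T M msgLen).rel H κ pp (stmtF M H (unary κ) (entry T true H (unary κ) pp k) q)
      (witF M H (unary κ) (entry T true H (unary κ) pp k) q) := by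
  have h := hv.2.1
  have hlen : hl.len H (unary κ) = unary (msgLen κ) := hl.len_unary H κ
  rw [hlen, toNat_unary] at h
  have := rel_honest hM hH h hk hm (rt := M.init.fn H (inp κ [q.get 0])) (by
    rw [MerkleTree.root, ofList_toList]
    exact toOption_eq_some.2 ⟨rfl, hv.1⟩)
  rwa [ofList_toList] at this

/-- The oracle of the zero knowledge experiment answers only questions with a valid witness, so the
secret keys are kept and the witness is sent along; `rel_of_valid` guarantees that accepted
questions are answered. -/
theorem exec_world_zk {O : Unit → Val → PMF (Val × Unit)} (hM : M.Correct 𝓗) {A : Code} {H : Hash} {κ B m N : ℕ}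
    {pp key vk a : Val} (hH : H ∈ (𝓗 κ).support) (hs : pp ∈ (T.setup.dist H (inp κ [])).support)
    (hO : ∀ stmt wit, (fixedRelation T M msgLen).rel H κ pp stmt wit → O () (ofList [stmt, wit]) =
      (S.prove.dist H (inp κ [key, stmt, wit])).map fun π => (ofList [π], ())) (hB : B ≤ N)
    (hN : ∀ k ∈ keySpace κ, ∀ q : Val, q.size ≤ B → Valid T M hl H (unary κ) (entry T true H (unary κ) pp k) q →
      ∀ π ∈ (S.prove.dist H (inp κ [key, stmtF M H (unary κ) (entry T true H (unary κ) pp k) q,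
        witF M H (unary κ) (entry T true H (unary κ) pp k) q])).support, π.size ≤ N)
    (hA : Bdd B m (A.den H a)) :
    (world T M hl true true A H a (world₀ (unary κ) (unary N) pp)).exec O () =
      (dtlExec T M msgLen dataFixed S A H κ pp key vk a).map fun y =>
        (.cons y.1 ((y.2.toWorld (T := T) true H κ pp).enc (ofList [unary κ, unary N, pp])), ()) := by
  have h := exec_world (T := T) (M := M) (hl := hl) (z := true) (keep := true) (O := O)
    (prover := fun stmt wit => S.prove.dist H (inp κ [key, stmt, wit])) (fun _ => ()) (H := H) (κ := κ) (pp := pp)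
    (P := fun e => ∃ k ∈ keySpace κ, e = entry T true H (unary κ) pp k) hB (fun k hk => ⟨k, hk, rfl⟩)
    (by rintro Q _ q ⟨k, hk, rfl⟩ - hm hv; exact hO _ _ (rel_of_valid hM hH hk hm hv))
    (by rintro _ q ⟨k, hk, rfl⟩ hq - hv; exact hN k hk q hq hv) hA (x := ⟨[], [], []⟩) (by constructor <;> simp)
  refine h.trans ?_
  rw [dtlExec_toWorld (S := S) (key := key) (vk := vk) (dataFixed := dataFixed) hH hs (fun _ _ _ => rfl) hA,
    PMF.map_comp]
  rfl

/-- The simulator as a prover. -/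
def simProver (Sim : Simulator) (H : Hash) (κ : ℕ) (τ stmt _wit : Val) : PMF Val :=
  Sim.prove.dist H (inp κ [τ, stmt])

/-- Here questions consist of the statement alone, so this holds for any state and also without
secret keys. The statements recorded by the outer oracle are those in the state, so freshness means
the same on both sides. -/
theorem exec_world_se {A : Code} {keep : Bool} {H : Hash} {κ B m N : ℕ} {pp τ a : Val} (hB : B ≤ N)
    (hN : ∀ e q : Val, q.size ≤ B → Valid T M hl H (unary κ) e q →
      ∀ π ∈ (Sim.prove.dist H (inp κ [τ, stmtF M H (unary κ) e q])).support, π.size ≤ N)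
    (hA : Bdd B m (A.den H a)) (x : WState) :
    (world T M hl false keep A H a (x.enc (ofList [unary κ, unary N, pp]))).exec
        (ZkSnark.simOracle Sim H κ τ) x.Q =
      ((A.den H a).exec (worldO T M hl keep H κ pp (simProver Sim H κ τ)) x).map fun y =>
        (.cons y.1 (y.2.enc (ofList [unary κ, unary N, pp])), y.2.Q) :=
  exec_world (w := fun Q => Q) (P := fun _ => True) hB (fun _ _ => trivial) (fun Q e q _ _ _ _ => rfl)
    (fun e q _ hq _ hv => hN e q hq hv) hA (x := x) (by constructor <;> simp)

/-! ## From proofs to simulated proofs -/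

theorem pr_exec_test {α σ : Type} {O : σ → Val → PMF (Val × σ)} {s : σ} (c : Comp α) (P : α → Prop) :
    pr ((c.bind fun x => ret (test (P x))).exec O s) (·.1 ≠ .nil) = pr (c.exec O s) fun y => P y.1 := by
  have : (c.bind fun x => ret (test (P x))) = c.map fun x => test (P x) := rfl
  rw [this, exec_map, pr_map]
  simp only [test_ne_nil]

/-- Any event that a polynomial time program with the proof oracle can test has nearly the same
probability in both worlds; the program is the distinguisher. -/
theorem zk_transfer (hZK : S.ZeroKnowledge 𝓗 (fixedRelation T M msgLen) Sim) {F : Hash → Val → Comp Val}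
    (hF : PP F) : ∃ ε, Negl ε ∧ ∀ κ,
    (exG T κ fun H pp => ex (S.setup.dist H (inp κ [pp])) fun crs =>
      pr ((F H (inp κ [pp, crs])).exec (S.proveOracle (fixedRelation T M msgLen) H κ pp crs) ()) (·.1 ≠ .nil)) ≤
    (exG T κ fun H pp => ex (Sim.setup.dist H (inp κ [pp])) fun c =>
      pr ((F H (inp κ [pp, c.fst])).exec
        (ZkSnark.simProveOracle (fixedRelation T M msgLen) Sim H κ pp c.snd) ()) (·.1 ≠ .nil)) + ε κ := by
  obtain ⟨A, hA, h⟩ := hF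
  refine ⟨_, Negl.of_diff (hZK A hA), fun κ => ?_⟩
  have := pr_le_add_diff (S.zkGame0 𝓗 (fixedRelation T M msgLen) A κ)
    (ZkSnark.zkGame1 𝓗 (fixedRelation T M msgLen) Sim A κ)
  rw [zk0_eq, zk1_eq] at this
  simpa only [h] using this

theorem proveOracle_of_rel {H : Hash} {κ : ℕ} {pp crs stmt wit : Val}
    (h : (fixedRelation T M msgLen).rel H κ pp stmt wit) :
    S.proveOracle (fixedRelation T M msgLen) H κ pp crs () (ofList [stmt, wit]) =
      (S.prove.dist H (inp κ [crs.fst, stmt, wit])).map fun π => (ofList [π], ()) := by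
  rw [ZkSnark.proveOracle, if_pos (by simpa using h)]
  simp; rfl

theorem simProveOracle_of_rel {H : Hash} {κ : ℕ} {pp τ stmt wit : Val}
    (h : (fixedRelation T M msgLen).rel H κ pp stmt wit) :
    ZkSnark.simProveOracle (fixedRelation T M msgLen) Sim H κ pp τ () (ofList [stmt, wit]) =
      ((simSnark S Sim).prove.dist H (inp κ [τ, stmt, wit])).map fun π => (ofList [π], ()) := by
  rw [ZkSnark.simProveOracle, if_pos (by simpa using h), simSnark_prove]
  simp; rfl

theorem size_params (κ : ℕ) (crs pp d : Val) (l : List Val) :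
    (inp κ (ofList [crs.fst, crs.snd, pp, d] :: l)).size ≤
      2 * κ + 20 + crs.size + pp.size + d.size + (ofList l).size := by
  have := size_fst_add_snd crs
  rw [size_inp]; simp only [ofList_cons, ofList_nil, size_cons, size_nil]; omega

variable (dataFixed) in
/-- Replacing proofs by simulated proofs. -/
theorem oracle_transfer (hl : PolyLength msgLen) (hM : M.Correct 𝓗) (hZK : S.ZeroKnowledge 𝓗 (fixedRelation T M msgLen) Sim) {A : Code}
    (hA : A.PPT) {P : Hash → Val → Prop} (hP : PolyFn fun H v => test (P H v)) : ∃ ε, Negl ε ∧ ∀ κ,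
    (exG T κ fun H pp => ex (S.setup.dist H (inp κ [pp])) fun crs =>
      pr (dtlExec T M msgLen dataFixed S A H κ pp crs.fst crs.snd
        (inp κ [ofList [crs.fst, crs.snd, pp, dataFixed]])) fun y =>
        P H (ofList [unary κ, pp, crs, y.1, ofList (y.2.toWorld (T := T) true H κ pp).C,
          ofList (y.2.toWorld (T := T) true H κ pp).Q])) ≤
    (exG T κ fun H pp => ex (Sim.setup.dist H (inp κ [pp])) fun c =>
      pr (dtlExec T M msgLen dataFixed (simSnark S Sim) A H κ pp c.snd c.fst.snd
        (inp κ [ofList [c.fst.fst, c.fst.snd, pp, dataFixed]])) fun y =>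
        P H (ofList [unary κ, pp, c.fst, y.1, ofList (y.2.toWorld (T := T) true H κ pp).C,
          ofList (y.2.toWorld (T := T) true H κ pp).Q])) + ε κ := by
  obtain ⟨ps, hps⟩ := exists_size_setup T S Sim
  obtain ⟨b, k, hb, -, hbdd, hfuel⟩ := exists_fuel M hl S Sim hA (2 * .X + 20 + (ps + dataFixed.size + 1))
  have hw : PP fun H v => world T M hl true true A H
      (ofList [v.fst, ofList [(v.get 2).fst, (v.get 2).snd, v.get 1, dataFixed]])
      (world₀ v.fst (unary ((v.fst.toNat + 2) ^ k)) (v.get 1)) := by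
    have : PolyFn fun H v => world₀ v.fst (unary ((v.fst.toNat + 2) ^ k)) (v.get 1) := by
      unfold world₀; infer_instance
    exact PP.world' T M hl true true hA
  have hP' : PolyFn fun H w => test (P H (ofList [w.snd.fst, w.snd.get 1, w.snd.get 2, w.fst.fst,
      w.fst.snd.snd.snd.fst, w.fst.snd.snd.snd.snd])) :=
    PP.subst (G := fun H v => ret (test (P H v))) (f := fun H w => ofList [w.snd.fst, w.snd.get 1, w.snd.get 2, w.fst.fst,
      w.fst.snd.snd.snd.fst, w.fst.snd.snd.snd.snd]) hP inferInstance
  obtain ⟨ε, hε, h⟩ := zk_transfer hZK (PP.bind (hF := hw) (K := fun H v x => ret (test (P H (ofList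
    [v.fst, v.get 1, v.get 2, x.fst, x.snd.snd.snd.fst, x.snd.snd.snd.snd])))) (hK := hP'))
  refine ⟨ε, hε, fun κ => ?_⟩
  -- The same program is run in both worlds; only the keys, the proof oracle and the SNARK differ,
  -- so one computation serves both sides.
  have main : ∀ H ∈ (𝓗 κ).support, ∀ pp ∈ (T.setup.dist H (inp κ [])).support, ∀ (S' : ZkSnark) (crs key : Val)
      (O : Unit → Val → PMF (Val × Unit)), pp.size + crs.size ≤ ps.eval κ →
      (∀ stmt wit, (fixedRelation T M msgLen).rel H κ pp stmt wit → O () (ofList [stmt, wit]) =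
        (S'.prove.dist H (inp κ [key, stmt, wit])).map fun π => (ofList [π], ())) →
      (∀ k' ∈ keySpace κ, ∀ q : Val, q.size ≤ b.eval κ → Valid T M hl H (unary κ) (entry T true H (unary κ) pp k') q →
        ∀ π ∈ (S'.prove.dist H (inp κ [key, stmtF M H (unary κ) (entry T true H (unary κ) pp k') q,
        witF M H (unary κ) (entry T true H (unary κ) pp k') q])).support, π.size ≤ (κ + 2) ^ k) →
      pr (((world T M hl true true A H (ofList [(inp κ [pp, crs]).fst, ofList [((inp κ [pp, crs]).get 2).fst,
        ((inp κ [pp, crs]).get 2).snd, (inp κ [pp, crs]).get 1, dataFixed]]) (world₀ (inp κ [pp, crs]).fst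
          (unary (((inp κ [pp, crs]).fst.toNat + 2) ^ k)) ((inp κ [pp, crs]).get 1))).bind fun x =>
        ret (test (P H (ofList [(inp κ [pp, crs]).fst, (inp κ [pp, crs]).get 1, (inp κ [pp, crs]).get 2,
          x.fst, x.snd.snd.snd.fst, x.snd.snd.snd.snd])))).exec O ()) (·.1 ≠ .nil) =
      pr (dtlExec T M msgLen dataFixed S' A H κ pp key crs.snd (inp κ [ofList [crs.fst, crs.snd, pp, dataFixed]]))
        fun y => P H (ofList [unary κ, pp, crs, y.1, ofList (y.2.toWorld (T := T) true H κ pp).C,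
          ofList (y.2.toWorld (T := T) true H κ pp).Q]) := by
    intro H hH pp hpp S' crs key O hsz hO hN
    have e := exec_world_zk (hl := hl) (dataFixed := dataFixed) (vk := crs.snd) hM hH hpp hO (hb κ) hN
      (hbdd κ H (inp κ [ofList [crs.fst, crs.snd, pp, dataFixed]]) ((size_params κ crs pp dataFixed []).trans (by
        simp; omega)))
    simp only [inp, ofList_cons, ofList_nil, fst_cons, get_one, get_two, snd_cons, toNat_unary] at e ⊢
    rw [pr_exec_test, e, pr_map]
    rfl
  refine le_trans (le_of_eq ?_) ((h κ).trans (le_of_eq ?_))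
  · refine exG_congr fun H hH pp hpp => ex_congr fun crs hcrs => ?_
    exact (main H hH pp hpp S crs crs.fst _ ((hps H κ pp hpp).1 crs hcrs) (fun _ _ => proveOracle_of_rel)
      fun k' hk' q hq _ => (hfuel κ H pp hpp).1 crs hcrs k' hk' q hq).symm
  · congr 1
    refine exG_congr fun H hH pp hpp => ex_congr fun c hc => ?_
    exact main H hH pp hpp (simSnark S Sim) c.fst c.snd _
      (by have := (hps H κ pp hpp).2 c hc; have := size_fst_le c; omega) (fun _ _ => simProveOracle_of_rel)
      fun k' hk' q hq hv => by rw [simSnark_prove]; exact (hfuel κ H pp hpp).2 c hc _ q hq hv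

end

end
end Tumbling

namespace Tumbling
open Val

noncomputable section

open Tumbling.Comp
open scoped ENNReal

/-! ## Guessing -/

section
variable {α β σ : Type} {p : PMF α}

theorem pr_exists_lt_le (P : ℕ → α → Prop) (m : ℕ) :
    pr p (fun a => ∃ i < m, P i a) ≤ ∑ i ∈ Finset.range m, pr p (P i) := by
  induction m with
  | zero => rw [pr_of_forall_not]; simp; simp
  | succ m ih =>
    rw [Finset.sum_range_succ]
    refine le_trans (pr_mono fun a _ h => ?_) (pr_or_le.trans (add_le_add ih le_rfl))
    obtain ⟨i, hi, h⟩ := h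
    rcases Nat.lt_succ_iff_lt_or_eq.1 hi with h1 | rfl
    · exact .inl ⟨i, h1, h⟩
    · exact .inr h

theorem pr_eq_apply (a : α) : pr p (· = a) = p a := by
  simp [pr, PMF.toOuterMeasure_apply_singleton]

/-- A sum over polynomially many possibilities is at most a polynomial times the expectation for a
random guess, since each index has probability at least 1 / (2N + 1). -/
theorem sum_le_ex_idxC (f : ℕ → ℝ≥0∞) {m N : ℕ} (h : m ≤ N) :
    ∑ i ∈ Finset.range m, f i ≤ ((2 * N + 1 : ℕ) : ℝ≥0∞) * ex (idxC (unary N)).distr fun v => f v.toNat := by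
  have h1 : ∑ i ∈ Finset.range m, ((2 * N + 1 : ℕ) : ℝ≥0∞)⁻¹ * f i ≤ ex (idxC (unary N)).distr fun v => f v.toNat := by
    have hinj : Set.InjOn unary (Finset.range m : Set ℕ) := fun i _ j _ hij => by
      simpa using congrArg toNat hij
    have h2 : ∑ v ∈ (Finset.range m).image unary, (idxC (unary N)).distr v * f v.toNat ≤
        ex (idxC (unary N)).distr fun v => f v.toNat := ENNReal.sum_le_tsum _
    rw [Finset.sum_image hinj] at h2
    refine le_trans (Finset.sum_le_sum fun i hi => ?_) h2
    rw [toNat_unary, ← pr_eq_apply]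
    gcongr
    exact pr_idxC N i ((Finset.mem_range.1 hi).le.trans h)
  rw [← Finset.mul_sum] at h1
  refine le_trans (le_of_eq ?_) (mul_le_mul_right h1 _)
  rw [← mul_assoc, ENNReal.mul_inv_cancel (by simp) (ENNReal.natCast_ne_top _), one_mul]

theorem exec_foldl_of_pure {O : σ → Val → PMF (Val × σ)} {s : σ} {body : Val → Comp Val}
    (h : ∀ w, (body w).exec O s = (body w).distr.map fun a => (a, s)) (l : List Val) (x : Val) :
    (Comp.foldl body l x).exec O s = (Comp.foldl body l x).distr.map fun a => (a, s) := by
  induction l generalizing x with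
  | nil => simp [Comp.foldl, PMF.pure_map]
  | cons a l ih =>
    simp only [Comp.foldl, exec_bind, h, PMF.bind_map, Function.comp_def, distr_bind, PMF.map_bind, ih]

theorem exec_idxC (n : Val) (O : σ → Val → PMF (Val × σ)) (s : σ) :
    (idxC n).exec O s = (idxC n).distr.map fun a => (a, s) := by
  rw [idxC, exec_map, exec_foldl_of_pure, distr_map, PMF.map_comp, PMF.map_comp]
  · rfl
  · intro w
    rw [idxStep]
    split
    · simp [PMF.pure_map]
    · simp [flipC, PMF.map_bind, PMF.pure_map]

end

/-! ## Keys created in advance -/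

section
variable {𝓗 : HashModel} {T : TaggingScheme 𝓗} {M : MerkleTree T.pkLen} {msgLen : ℕ → ℕ}
  {hl : PolyLength msgLen} {S : ZkSnark} {Sim : Simulator} {dataFixed : Val} {α : Type}
  {keep : Bool} {H : Hash} {κ : ℕ} {pp : Val} {prover : Val → Val → PMF Val}

theorem entry_ne_nil {k : Val} : entry T keep H (unary κ) pp k ≠ .nil := by simp [entry]

theorem entry_get_one {k : Val} : (entry T keep H (unary κ) pp k).get 1 = T.tag H κ pp k := rfl

theorem entry_headD (k : Val) (g : ℕ) :
    (List.replicate g Val.nil ++ [entry T keep H (unary κ) pp k]).headD .nil =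
      if g = 0 then entry T keep H (unary κ) pp k else .nil := by
  cases g <;> simp [List.replicate_succ]

/-- A redemption neither reads nor changes the prepared keys. -/
theorem ex_redeemW (p C Q : List Val) (q : Val) (F : Val × WState → ℝ≥0∞) :
    ex (redeemW T M hl H κ prover ⟨p, C, Q⟩ q) F =
      ex (redeemW T M hl H κ prover ⟨[], C, Q⟩ q) fun y => F (y.1, ⟨p, y.2.C, y.2.Q⟩) := by
  simp only [redeemW]
  split
  · simp
  · split <;> simp

theorem redeemW_C {x : WState} {q : Val} {y : Val × WState} (hy : y ∈ (redeemW T M hl H κ prover x q).support) :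
    y.2.pend = x.pend ∧ y.2.C = x.C := by
  simp only [redeemW] at hy
  split at hy
  · rw [PMF.mem_support_pure_iff] at hy; simp [hy]
  · split at hy
    · rw [PMF.mem_support_map_iff] at hy; obtain ⟨π, -, rfl⟩ := hy; simp
    · rw [PMF.mem_support_pure_iff] at hy; simp [hy]

/-- One of the keys can be sampled in advance. -/
theorem ex_exec_pend (c : Comp α) (g : ℕ) (C Q : List Val) (F : α → List Val → List Val → ℝ≥0∞) :
    ex (c.exec (worldO T M hl keep H κ pp prover) ⟨[], C, Q⟩) (fun y => F y.1 y.2.C y.2.Q) =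
      ex (sampleKey κ) fun k => ex (c.exec (worldO T M hl keep H κ pp prover)
        ⟨List.replicate g .nil ++ [entry T keep H (unary κ) pp k], C, Q⟩) fun y => F y.1 y.2.C y.2.Q := by
  induction c generalizing g C Q with
  | ret a => simp
  | flip c ih =>
    simp only [exec_flip, ex_bind, fun b => ih b g C Q]
    rw [ex_comm]
  | query n q c ih =>
    simp only [exec_query, ex_bind, worldO]
    by_cases h1 : q = .nil
    · simp only [if_pos h1, ex_pure]
      exact ih _ g C Q
    by_cases h2 : q.fst = .nil
    · simp only [if_neg h1, if_pos h2, entry_headD, List.headD_nil, if_true, List.tail_nil]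
      rcases g with _ | g
      · simp [entry_ne_nil]
      · simp only [Nat.add_eq_zero_iff, one_ne_zero, and_false, if_false, if_true, ex_map,
          List.replicate_succ, List.cons_append, List.tail_cons]
        -- The key created now and the one prepared for later are independent, so the later one may
        -- be sampled first.
        rw [ex_comm]
        exact ex_congr fun k _ => ih _ g _ Q
    · simp only [if_neg h1, if_neg h2]
      rw [ex_congr fun k _ => ex_redeemW _ _ _ _ _, ex_comm]
      refine ex_congr fun y hy => ?_
      have := ih (fit n y.1) g y.2.C y.2.Q
      have h3 : y.2 = ⟨[], y.2.C, y.2.Q⟩ := by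
        have := (redeemW_C hy).1
        obtain ⟨a, p, C', Q'⟩ := y
        simp_all
      rw [← h3] at this
      exact this

theorem length_C_le (c : Comp α) {B m : ℕ} (hc : Bdd B m c) {x : WState} {y : α × WState}
    (hy : y ∈ (c.exec (worldO T M hl keep H κ pp prover) x).support) : y.2.C.length ≤ x.C.length + m := by
  induction c generalizing m x with
  | ret a => simp at hy; simp [hy]
  | flip k ih =>
    simp only [exec_flip, PMF.mem_support_bind_iff] at hy
    obtain ⟨b, _, hb⟩ := hy
    exact ih b (hc b) hb
  | query n q k ih =>
    match m, hc with
    | m + 1, hc =>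
      simp only [exec_query, PMF.mem_support_bind_iff] at hy
      obtain ⟨z, hz, hy⟩ := hy
      have h1 := ih _ (hc.2.2 _) hy
      have h2 : z.2.C.length ≤ x.C.length + 1 := by
        simp only [worldO] at hz
        split at hz
        · rw [PMF.mem_support_pure_iff] at hz; simp [hz]
        split at hz
        · rw [PMF.mem_support_map_iff] at hz; obtain ⟨π, -, rfl⟩ := hz; simp
        · rw [(redeemW_C hz).2]; simp
      omega

/-- The key created in advance gets its position. -/
theorem getElem_C (c : Comp α) {B m : ℕ} (hc : Bdd B m c) {e : Val} (he : e ≠ .nil) {g : ℕ} {y : α × WState}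
    (hy : y ∈ (c.exec (worldO T M hl keep H κ pp prover) ⟨List.replicate g .nil ++ [e], [], []⟩).support)
    {e' : Val} (h : y.2.C[g]? = some e') : e' = e := by
  have := inv_of_mem_support_exec (O' := worldO T M hl keep H κ pp prover)
    (fun x => (∃ i, x.pend = List.replicate i .nil ++ [e] ∧ x.C.length + i = g) ∨ x.pend = [] ∧ x.C[g]? = some e) B
    ?_ c hc (.inl ⟨g, rfl, by simp⟩) hy
  · rcases this with ⟨i, -, hi⟩ | ⟨-, h'⟩
    · rw [List.getElem?_eq_none (by omega)] at h; cases h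
    · rw [h'] at h; exact (Option.some_inj.1 h).symm
  · intro x q hx _ z hz
    simp only [worldO] at hz
    split at hz
    · rw [PMF.mem_support_pure_iff] at hz; simpa [hz] using hx
    split at hz
    · rw [PMF.mem_support_map_iff] at hz
      obtain ⟨a, ha, rfl⟩ := hz
      rcases hx with ⟨i, hi, hg⟩ | ⟨hp, hC⟩
      · rcases i with _ | i
        · right
          rw [hi] at ha ⊢
          simp [he] at ha
          subst ha
          refine ⟨by simp, ?_⟩
          have : g = x.C.length := by omega
          simp [this]
        · left
          refine ⟨i, by rw [hi]; simp [List.replicate_succ], ?_⟩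
          simp; omega
      · right
        refine ⟨by simp [hp], ?_⟩
        rw [List.getElem?_append_left (List.getElem?_eq_some_iff.1 hC).1]; exact hC
    · obtain ⟨h1, h2⟩ := redeemW_C hz
      rw [h1, h2]; exact hx

/-- Guessing which of the keys has a certain tag. -/
theorem pr_tag_mem_le (c : Comp α) {B m N : ℕ} (hc : Bdd B m c) (hN : m ≤ N) (W : α → List Val → Prop) (tg : α → Val) :
    pr (c.exec (worldO T M hl keep H κ pp prover) ⟨[], [], []⟩)
        (fun y => W y.1 y.2.Q ∧ ∃ e ∈ y.2.C, e.get 1 = tg y.1) ≤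
      ((2 * N + 1 : ℕ) : ℝ≥0∞) * ex (idxC (unary N)).distr fun v => ex (sampleKey κ) fun k =>
        pr (c.exec (worldO T M hl keep H κ pp prover)
          ⟨List.replicate v.toNat .nil ++ [entry T keep H (unary κ) pp k], [], []⟩)
          fun y => W y.1 y.2.Q ∧ tg y.1 = T.tag H κ pp k := by
  have h0 := sum_le_ex_idxC (fun g => ex (sampleKey κ) fun k =>
        pr (c.exec (worldO T M hl keep H κ pp prover)
          ⟨List.replicate g .nil ++ [entry T keep H (unary κ) pp k], [], []⟩)
          fun y => W y.1 y.2.Q ∧ tg y.1 = T.tag H κ pp k) hN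
  refine le_trans ?_ h0
  clear h0
  have h0 := pr_exists_lt_le (p := c.exec (worldO T M hl keep H κ pp prover) ⟨[], [], []⟩)
    (fun g y => W y.1 y.2.Q ∧ ∃ e, y.2.C[g]? = some e ∧ e.get 1 = tg y.1) m
  -- Each question creates at most one key, so the position of the attacked key is below m and a
  -- union bound over positions applies.
  refine le_trans (pr_mono fun y hy h => ?_) (h0.trans (Finset.sum_le_sum fun g _ => ?_))
  · obtain ⟨h1, e, he, h2⟩ := h
    obtain ⟨i, hi, rfl⟩ := List.getElem_of_mem he
    have := length_C_le c hc hy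
    exact ⟨i, by simp at this; omega, h1, _, List.getElem?_eq_getElem hi, h2⟩
  -- For a fixed position g, the key is sampled in advance and preceded by g empty places; if
  -- position g is reached, it holds exactly this key.
  · have := ex_exec_pend (T := T) (M := M) (hl := hl) (keep := keep) (H := H) (κ := κ) (pp := pp) (prover := prover)
      c g [] [] (fun a C Q => pr (PMF.pure ()) fun _ => W a Q ∧ ∃ e, C[g]? = some e ∧ e.get 1 = tg a)
    have hp : ∀ (p : PMF (α × WState)) (P : α × WState → Prop), ex p (fun y => pr (PMF.pure ()) fun _ => P y) = pr p P :=
      fun p P => by simp only [pr_eq_ex, ex_pure]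
    simp only [hp] at this
    rw [this]
    refine ex_mono fun k _ => ?_
    refine pr_mono fun y hy h => ?_
    obtain ⟨h1, e, he, h2⟩ := h
    have h3 : e = entry T keep H (unary κ) pp k := getElem_C c hc entry_ne_nil hy he
    refine ⟨h1, ?_⟩
    rw [← h2, h3, entry_get_one]

end

theorem PolyLength.bound {ℓ : ℕ → ℕ} (h : PolyLength ℓ) : ∃ p : Polynomial ℕ, ∀ κ, ℓ κ ≤ p.eval κ := by
  have : PolyFn fun H v => h.len H v := inferInstance
  obtain ⟨p, hp⟩ := this.fn_size
  refine ⟨p.comp (2 * .X + 1), fun κ => ?_⟩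
  have := hp (fun _ => .nil) (unary κ)
  rw [h.len_unary, size_unary, size_unary] at this
  simp only [Polynomial.eval_comp, Polynomial.eval_add, Polynomial.eval_mul, Polynomial.eval_ofNat,
    Polynomial.eval_X, Polynomial.eval_one]
  omega

end
end Tumbling

namespace Tumbling
open Val

noncomputable section

open Tumbling.Comp
open scoped ENNReal

/-! ## Reductions as programs -/

section
variable {𝓗 : HashModel} {T : TaggingScheme 𝓗} {M : MerkleTree T.pkLen} {msgLen : ℕ → ℕ}
  {S : ZkSnark} {Sim : Simulator} {F : Hash → Val → Comp Val}

theorem TaggingScheme.CollisionResistant.negl (h : T.CollisionResistant) (hF : PP F) : Negl fun κ =>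
    exG T κ fun H pp => pr (F H (inp κ [pp])).distr fun out => out.get 0 ∈ keySpace κ ∧ out.get 1 ∈ keySpace κ ∧
      out.get 0 ≠ out.get 1 ∧ T.pk H κ pp (out.get 0) = T.pk H κ pp (out.get 1) := by
  obtain ⟨A, hA, hAF⟩ := hF
  have := Negl.of_prob (h A hA)
  simpa only [collision_eq, Code.dist_eq, hAF] using this

theorem TaggingScheme.OneWay.negl (h : T.OneWay) (hF : PP F) : Negl fun κ =>
    exG T κ fun H pp => ex (sampleKey κ) fun k => pr (F H (inp κ [pp, T.tag H κ pp k, T.pk H κ pp k])).distr fun k' =>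
      k' ∈ keySpace κ ∧ T.tag H κ pp k' = T.tag H κ pp k := by
  obtain ⟨A, hA, hAF⟩ := hF
  have := Negl.of_prob (h A hA)
  simpa only [oneWay_eq, Code.dist_eq, hAF] using this

/-- The tag and the public key of a random key can be replaced by random strings. -/
theorem TaggingScheme.Pseudorandom.transfer (h : T.Pseudorandom) (hF : PP F) : ∃ ε, Negl ε ∧ ∀ κ,
    (exG T κ fun H pp => ex (sampleKey κ) fun k =>
      pr (F H (inp κ [pp, T.tag H κ pp k, T.pk H κ pp k])).distr (· ≠ .nil)) ≤
    (exG T κ fun H pp => ex (uniformBits (T.tagLen κ)) fun tag => ex (uniformBits (T.pkLen κ)) fun cpk =>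
      pr (F H (inp κ [pp, tag, cpk])).distr (· ≠ .nil)) + ε κ := by
  obtain ⟨A, hA, hAF⟩ := hF
  refine ⟨_, Negl.of_diff (h A hA), fun κ => ?_⟩
  have := pr_le_add_diff (T.prGame0 A κ) (T.prGame1 A κ)
  simpa only [pr0_eq, pr1_eq, Code.dist_eq, hAF] using this

theorem MerkleTree.Secure.negl (h : M.Secure 𝓗) (hF : PP F) : Negl fun κ =>
    ex (𝓗 κ) fun H => pr (F H (inp κ [])).distr fun out =>
      ∃ rt, M.root H κ (out.get 0).toList = some rt ∧ M.Accepts H κ (out.get 1) (out.get 2) rt (out.get 3) ∧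
        (out.get 0).toList[(out.get 1).toNat]? ≠ some (out.get 2) := by
  obtain ⟨A, hA, hAF⟩ := hF
  have := Negl.of_prob (h.2 A hA)
  simpa only [merkle_eq, Code.dist_eq, hAF] using this

/-- The probability that an extractor fails. -/
theorem ZkSnark.SimulationExtractable.exists_extractor
    (h : S.SimulationExtractable 𝓗 (fixedRelation T M msgLen) Sim) {B : Code} (hB : B.PPT) :
    ∃ X : Code, X.PPT ∧ Negl fun κ => exG T κ fun H pp => ex (Sim.setup.dist H (inp κ [pp])) fun c =>
      pr (extract Sim B X H κ pp c.fst c.snd (inp κ [pp, c.fst]) []) fun y =>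
        S.Accepts H κ c.fst.snd (y.1.get 0) (y.1.get 1) ∧ y.1.get 0 ∉ y.2.1 ∧
          ¬ (fixedRelation T M msgLen).rel H κ pp (y.1.get 0) y.2.2 := by
  obtain ⟨X, hX, hn⟩ := h B hB
  refine ⟨X, hX, ?_⟩
  have := Negl.of_prob hn
  simpa only [se_eq] using this

/-- The exponent only has to exceed the time bound of `B`, hence its buffers, on inputs of size p κ;
then the recording loses nothing. It does not depend on the extractor. -/
theorem exists_distr_extractC (Sim : Simulator) {B : Code} (hB : B.PPT) (p : Polynomial ℕ) : ∃ k : ℕ,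
    ∀ X H κ pp crs τ a l, a.size ≤ p.eval κ → (extractC Sim B X k H (unary κ) pp crs τ a (ofList l)).distr =
      (extract Sim B X H κ pp crs τ a l).map fun y => ofList [y.1, ofList y.2.1, y.2.2] := by
  obtain ⟨q, hq⟩ := hB.bdd
  obtain ⟨k, hk⟩ := exists_pow_bound (q.comp p)
  refine ⟨k, fun X H κ pp crs τ a l ha => distr_extractC Sim ?_ (hq H a _ ha)⟩
  simpa using hk κ

/-- The extractor runs after the adversary, so events that ignore the witness are events of the
adversary alone. -/
theorem pr_extract {B X : Code} {H : Hash} {κ : ℕ} {pp crs τ a : Val} {l : List Val} (P : Val → List Val → Prop) :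
    pr (extract Sim B X H κ pp crs τ a l) (fun y => P y.1 y.2.1) =
      pr ((B.den H a).exec (ZkSnark.simOracle Sim H κ τ) []) fun y => P y.1 y.2 := by
  rw [← run_map_exec]
  simp only [extract, pr_bind, pr_map, pr_eq_ex (p := (B.den H a).run _ _), pr_eq_ex (p := Code.dist _ _ _), ex_const]

/-- An adversary who begins with two random strings. -/
theorem ex_extract_bits {B B' X : Code} {H : Hash} {κ : ℕ} {pp crs τ a n₁ n₂ : Val} {f : Val → Val → Val}
    (h : B'.den H a = (bitsC n₁).bind fun t => (bitsC n₂).bind fun c => B.den H (f t c))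
    (F : Val × List Val × Val → ℝ≥0∞) :
    ex (extract Sim B' X H κ pp crs τ a []) F = ex (uniformBits n₁.toNat) fun t => ex (uniformBits n₂.toNat) fun c =>
      ex (extract Sim B X H κ pp crs τ (f t c) (t.append c).toList) F := by
  simp only [extract, h, run_bind, run_bitsC, ex_bind, ex_pure, PMF.map, Function.comp_def, List.nil_append,
    toList_append, List.append_assoc]

end

end
end Tumbling

/-! ### One-wayness and extraction without auxiliary input -/

namespace Tumbling
open Val

noncomputable section

open Tumbling.Comp
open scoped ENNReal

/-! ## Forgeries for the tag of an honest key -/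

section
variable {𝓗 : HashModel} (T : TaggingScheme 𝓗) (M : MerkleTree T.pkLen) {msgLen : ℕ → ℕ}
  (hl : PolyLength msgLen) (S : ZkSnark) (Sim : Simulator) (dataFixed : Val)

/-- The statement of an output `(st, tag, π, m)`. -/
def claimed (o : Val) : Val := ofList [o.get 0, o.get 1, o.get 3]

/-- The statement and the proof. -/
def claim (o : Val) : Val := ofList [claimed o, o.get 2]

instance PP.claimed' {f : Hash → Val → Val} [hf : PolyFn f] : PolyFn fun H v => claimed (f H v) := by
  unfold claimed; infer_instance

instance PP.claim' {f : Hash → Val → Val} [hf : PolyFn f] : PolyFn fun H v => claim (f H v) := by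
  unfold claim; infer_instance

/-- An adversary against the oracles, where a given public key and tag are used for one of the keys. -/
def guessC (A : Code) (k : ℕ) (H : Hash) (κV params pp tag cpk : Val) : Comp Val :=
  (idxC (unary ((κV.toNat + 2) ^ k))).bind fun g =>
    (world T M hl false false A H (ofList [κV, params]) (.cons (ofList [κV, unary ((κV.toNat + 2) ^ k), pp])
      (.cons ((g.map fun _ => .nil).snoc (ofList [cpk, tag, .nil])) (.cons .nil .nil)))).bind fun w =>
        ret (claim w.fst)

theorem PP.guessC' {A : Code} (hA : A.PPT) (k : ℕ) : PP fun H v =>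
    guessC T M hl A k H v.fst (ofList [(v.get 2).fst, (v.get 2).snd, v.get 1, dataFixed]) (v.get 1) (v.get 3) (v.get 4) := by
  have : PP fun H w => world T M hl false false A H (ofList [w.snd.fst, ofList [(w.snd.get 2).fst, (w.snd.get 2).snd,
      w.snd.get 1, dataFixed]]) (.cons (ofList [w.snd.fst, unary ((w.snd.fst.toNat + 2) ^ k), w.snd.get 1])
      (.cons ((w.fst.map fun _ => .nil).snoc (ofList [w.snd.get 4, w.snd.get 3, .nil])) (.cons .nil .nil))) :=
    PP.world' T M hl false false hA
  unfold guessC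
  infer_instance

variable {T M hl S Sim dataFixed}

/-- The challenge waits behind g empty places among the prepared keys and is thus handed out at the
creation number g, counted from 0. Its secret key is unknown, which is harmless as the simulator
needs only the tag. -/
theorem exec_guessC {A : Code} {H : Hash} {κ B m k : ℕ} {pp τ params tag cpk : Val} (hB : B ≤ (κ + 2) ^ k)
    (hN : ∀ e q : Val, q.size ≤ B → Valid T M hl H (unary κ) e q →
      ∀ π ∈ (Sim.prove.dist H (inp κ [τ, stmtF M H (unary κ) e q])).support, π.size ≤ (κ + 2) ^ k)
    (hA : Bdd B m (A.den H (inp κ [params]))) :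
    (guessC T M hl A k H (unary κ) params pp tag cpk).exec (ZkSnark.simOracle Sim H κ τ) [] =
      (idxC (unary ((κ + 2) ^ k))).distr.bind fun g => ((A.den H (inp κ [params])).exec
        (worldO T M hl false H κ pp (simProver Sim H κ τ))
        ⟨List.replicate g.toNat .nil ++ [ofList [cpk, tag, .nil]], [], []⟩).map fun y => (claim y.1, y.2.Q) := by
  have h := fun g : Val => exec_world_se (T := T) (M := M) (hl := hl) (keep := false) (Sim := Sim) (pp := pp) hB hN hA
    ⟨List.replicate g.toNat .nil ++ [ofList [cpk, tag, .nil]], [], []⟩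
  have e : ∀ g : Val, (g.map fun _ => Val.nil).snoc (ofList [cpk, tag, .nil]) =
    ofList (List.replicate g.toNat .nil ++ [ofList [cpk, tag, .nil]]) := fun g => by
      rw [Val.snoc, toList_map, List.map_const']; rfl
  simp only [WState.enc, inp, ofList_nil] at h
  simp only [guessC, exec_bind, exec_idxC, PMF.bind_map, toNat_unary, e, Function.comp_def, inp] at h ⊢
  congr 1; funext g
  rw [h g, PMF.bind_map]
  rfl

variable (T M hl S Sim dataFixed) in
/-- A run of the guessing adversary and of an extractor, for a given tag and public key. -/
def guessExtractC (B X : Code) (k : ℕ) (H : Hash) (v : Val) : Comp Val :=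
  (Sim.setup.muted H (ofList [v.fst, v.get 1])).bind fun c =>
    (extractC Sim B X k H v.fst (v.get 1) c.fst c.snd (ofList [v.fst, v.get 1, c.fst, v.get 2, v.get 3])
      ((v.get 2).append (v.get 3))).bind fun r => ret (.cons c.fst r)

theorem PP.guessExtractC' {B X : Code} (hB : B.PPT) (hX : X.PPT) (k : ℕ) : PP (guessExtractC Sim B X k) := by
  have h1 : PP fun H v => Sim.setup.muted H (ofList [v.fst, v.get 1]) := PP.muted_comp Sim.setup_ppt
  have h2 : PP fun H w => extractC Sim B X k H w.snd.fst (w.snd.get 1) w.fst.fst w.fst.snd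
      (ofList [w.snd.fst, w.snd.get 1, w.fst.fst, w.snd.get 2, w.snd.get 3]) ((w.snd.get 2).append (w.snd.get 3)) :=
    PP.extractC' Sim hB hX k
  unfold guessExtractC
  infer_instance

variable (S) in
/-- The adversary proves a new statement about a certain tag. -/
def NewClaim (H : Hash) (κV vk tag out : Val) (Q : List Val) : Prop :=
  S.verify.fn H (ofList [κV, vk, out.get 0, out.get 1]) ≠ .nil ∧ out.get 0 ∉ Q ∧ (out.get 0).get 1 = tag

variable (T) in
/-- A witness has a key for a certain tag. -/
def Opens (H : Hash) (κV pp tag wit : Val) : Prop :=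
  wit.get 1 ∈ keySpace κV.toNat ∧ T.tagEval.fn H (ofList [κV, pp, wit.get 1]) = tag

/-- It is infeasible to prove a new statement about the tag of a key of the oracles. -/
theorem forge (dataFixed : Val) (hl : PolyLength msgLen) (hT : T.Secure) (hM : M.Correct 𝓗)
    (hZK : S.ZeroKnowledge 𝓗 (fixedRelation T M msgLen) Sim)
    (hSE : S.SimulationExtractable 𝓗 (fixedRelation T M msgLen) Sim) {A : Code} (hA : A.PPT) : Negl fun κ =>
    exG T κ fun H pp => ex (S.setup.dist H (inp κ [pp])) fun crs =>
      pr (dtlExec T M msgLen dataFixed S A H κ pp crs.fst crs.snd (inp κ [ofList [crs.fst, crs.snd, pp, dataFixed]]))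
        fun y => S.Accepts H κ crs.snd (claimed y.1) (y.1.get 2) ∧
          (claimed y.1 ∉ y.2.R.map fun r => ofList [r.st, r.tag, r.m]) ∧ ∃ k ∈ y.2.C, T.tag H κ pp k.2 = y.1.get 1 := by
  obtain ⟨ε₁, hε₁, h₁⟩ := oracle_transfer dataFixed hl hM hZK hA (P := fun H v =>
    S.verify.fn H (ofList [v.fst, (v.get 2).snd, claimed (v.get 3), (v.get 3).get 2]) ≠ .nil ∧
      claimed (v.get 3) ∉ (v.snd.get 4).toList ∧ ∃ e ∈ (v.get 4).toList, e.get 1 = (v.get 3).get 1) inferInstance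
  obtain ⟨ps, hps⟩ := exists_size_setup T S Sim
  obtain ⟨b, k, hb, -, hbdd, hfuel⟩ := exists_fuel M hl S Sim hA (2 * .X + 20 + (ps + dataFixed.size + 1))
  obtain ⟨B, hB, hBden⟩ := PP.guessC' T M hl dataFixed hA k
  -- The adversary for which the extractor is taken samples tag and public key itself. It needs no
  -- auxiliary input, and its transcript begins with the two strings.
  have hB' : PP fun H v => (bitsC (T.tagLen_poly.len H v.fst)).bind fun t => (bitsC (T.pkLen_poly.len H v.fst)).bind
      fun c => B.den H (ofList [v.fst, v.get 1, v.get 2, t, c]) := by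
    have h1 : PP fun H w => B.den H (ofList [w.snd.snd.fst, w.snd.snd.get 1, w.snd.snd.get 2, w.snd.fst, w.fst]) :=
      PP.subst (PP.of_code hB) inferInstance
    have h2 : PP fun H v => bitsC (T.tagLen_poly.len H v.fst) := inferInstance
    have h3 : PP fun H w => bitsC (T.pkLen_poly.len H w.snd.fst) := inferInstance
    infer_instance
  obtain ⟨B', hB', hB'den⟩ := hB'
  obtain ⟨X, hX, hSE⟩ := hSE.exists_extractor hB'
  obtain ⟨pt, hpt⟩ := T.tagLen_poly.bound
  obtain ⟨pc, hpc⟩ := T.pkLen_poly.bound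
  obtain ⟨k₂, hk₂⟩ := exists_distr_extractC Sim hB (2 * .X + 10 + ps + 4 * pt + 4 * pc)
  have hG := PP.guessExtractC' (Sim := Sim) hB hX k₂
  -- The distinguisher: run guessing adversary and extractor on the given pair, and report a new
  -- claim whose extracted key does not open the tag. It needs only a test for the opening, not for
  -- the whole relation.
  have hD : PP fun H v => (guessExtractC Sim B X k₂ H v).bind fun r => ret (test
      (NewClaim S H v.fst r.fst.snd (v.get 2) (r.get 1) (r.get 2).toList ∧ ¬ Opens T H v.fst (v.get 1) (v.get 2) (r.get 3))) := by
    unfold NewClaim Opens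
    infer_instance
  -- The inverter: output the secret key of the extracted witness.
  have hO : PP fun H v => (guessExtractC Sim B X k₂ H v).bind fun r => ret ((r.get 3).get 1) := inferInstance
  obtain ⟨ε₂, hε₂, h₂⟩ := hT.2.2.transfer hD
  have h₃ := hT.1.negl hO
  -- The polynomial factor 2 (κ + 2) ^ k + 1 is the loss of guessing the attacked key; the loss from
  -- zero knowledge is outside of it, since the guess is made only with simulated proofs.
  refine (hε₁.add (((hSE.add hε₂).add h₃).poly_mul (2 * (.X + 2) ^ k + 1))).mono fun κ => ?_
  have hdist : ∀ H, ∀ pp ∈ (T.setup.dist H (inp κ [])).support, ∀ tag ∈ bitStrings (T.tagLen κ),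
      ∀ cpk ∈ bitStrings (T.pkLen κ), (guessExtractC Sim B X k₂ H (inp κ [pp, tag, cpk])).distr =
      (Sim.setup.dist H (inp κ [pp])).bind fun c => (extract Sim B X H κ pp c.fst c.snd (inp κ [pp, c.fst, tag, cpk])
        (tag.append cpk).toList).map fun y => .cons c.fst (ofList [y.1, ofList y.2.1, y.2.2]) := by
    intro H pp hpp tag htag cpk hcpk
    simp only [guessExtractC, inp, ofList_cons, fst_cons, snd_cons, get_one, get_two, get_three, distr_bind,
      Code.distr_muted, distr_ret]
    refine bind_congr_support fun c hc => ?_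
    rw [Val.append, hk₂, PMF.bind_map, toList_ofList]
    · rfl
    · have := (hps H κ pp hpp).2 c hc
      have := size_fst_le c
      have := size_of_mem_bitStrings htag
      have := size_of_mem_bitStrings hcpk
      have := hpt κ
      have := hpc κ
      simp
      omega
  have hkey : ∀ H ∈ (𝓗 κ).support, ∀ pp ∈ (T.setup.dist H (inp κ [])).support, ∀ k' ∈ (sampleKey κ).support,
      T.tag H κ pp k' ∈ bitStrings (T.tagLen κ) ∧ T.pk H κ pp k' ∈ bitStrings (T.pkLen κ) := fun H hH pp hpp k' hk' =>
    ⟨T.tagEval_mem κ H hH pp hpp k' (mem_keySpace_of_mem_support hk'),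
      T.keyGen_mem κ H hH pp hpp k' (mem_keySpace_of_mem_support hk')⟩
  -- Simulated proofs make the secret keys superfluous, so they are erased, the attacked key is
  -- guessed, and its pair is planted.
  have hsim : ∀ H ∈ (𝓗 κ).support, ∀ pp ∈ (T.setup.dist H (inp κ [])).support,
      ∀ c ∈ (Sim.setup.dist H (inp κ [pp])).support,
      pr (dtlExec T M msgLen dataFixed (simSnark S Sim) A H κ pp c.snd c.fst.snd
        (inp κ [ofList [c.fst.fst, c.fst.snd, pp, dataFixed]])) (fun y =>
          S.verify.fn H (ofList [unary κ, c.fst.snd, claimed y.1, y.1.get 2]) ≠ .nil ∧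
          claimed y.1 ∉ (y.2.toWorld (T := T) true H κ pp).Q ∧
            ∃ e ∈ (y.2.toWorld (T := T) true H κ pp).C, e.get 1 = y.1.get 1) ≤
      ((2 * (κ + 2) ^ k + 1 : ℕ) : ℝ≥0∞) * ex (sampleKey κ) fun k' =>
        pr (extract Sim B X H κ pp c.fst c.snd (inp κ [pp, c.fst, T.tag H κ pp k', T.pk H κ pp k'])
          ((T.tag H κ pp k').append (T.pk H κ pp k')).toList) fun y =>
            NewClaim S H (unary κ) c.fst.snd (T.tag H κ pp k') y.1 y.2.1 := by
    intro H hH pp hpp c hc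
    have hbd := hbdd κ H (inp κ [ofList [c.fst.fst, c.fst.snd, pp, dataFixed]])
      ((size_params κ c.fst pp dataFixed []).trans (by
        have := (hps H κ pp hpp).2 c hc; have := size_fst_le c; simp; omega))
    have e := dtlExec_toWorld (M := M) (hl := hl) (S := simSnark S Sim) (key := c.snd) (vk := c.fst.snd) (dataFixed := dataFixed)
      (keep := false) (prover := simProver Sim H κ c.snd) hH hpp (fun k' _ q => by rw [simSnark_prove]; rfl) hbd
    have h := pr_tag_mem_le (T := T) (M := M) (hl := hl) (keep := false) (H := H) (κ := κ) (pp := pp)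
      (prover := simProver Sim H κ c.snd) _ hbd (hb κ) (fun o Q =>
        S.verify.fn H (ofList [unary κ, c.fst.snd, claimed o, o.get 2]) ≠ .nil ∧ claimed o ∉ Q) fun o => o.get 1
    rw [e, pr_map] at h
    refine le_trans (pr_mono fun y _ hy => ?_) (h.trans (mul_le_mul_right (le_of_eq ?_) _))
    · obtain ⟨h1, h2, h3⟩ := hy
      refine ⟨⟨h1, h2⟩, ?_⟩
      simpa [OracleState.toWorld, entry] using h3
    · rw [ex_comm]
      refine ex_congr fun k' hk' => ?_
      rw [pr_extract (P := fun o Q => NewClaim S H (unary κ) c.fst.snd (T.tag H κ pp k') o Q), hBden]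
      simp only [inp, ofList_cons, fst_cons, snd_cons, get_one, get_two, get_three, get_four] at hbd ⊢
      have e := exec_guessC (T := T) (M := M) (hl := hl) (pp := pp) (tag := T.tag H κ pp k') (cpk := T.pk H κ pp k')
        (hb κ) ((hfuel κ H pp hpp).2 c hc) hbd
      simp only [inp, ofList_cons] at e
      rw [e, pr_bind]
      refine ex_congr fun g _ => ?_
      rw [pr_map]
      refine pr_congr fun y _ => ?_
      simp [NewClaim, claim, claimed, and_assoc]
  -- A new claim either comes with an extracted key that opens the tag, which inverts it, or it does
  -- not, which the distinguisher sees.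
  have hsplit : ∀ H ∈ (𝓗 κ).support, ∀ pp ∈ (T.setup.dist H (inp κ [])).support,
      (ex (Sim.setup.dist H (inp κ [pp])) fun c => ex (sampleKey κ) fun k' =>
        pr (extract Sim B X H κ pp c.fst c.snd (inp κ [pp, c.fst, T.tag H κ pp k', T.pk H κ pp k'])
          ((T.tag H κ pp k').append (T.pk H κ pp k')).toList) fun y =>
            NewClaim S H (unary κ) c.fst.snd (T.tag H κ pp k') y.1 y.2.1) ≤
      (ex (sampleKey κ) fun k' => pr ((guessExtractC Sim B X k₂ H (inp κ [pp, T.tag H κ pp k', T.pk H κ pp k'])).bind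
        fun r => ret (test (NewClaim S H (unary κ) r.fst.snd (T.tag H κ pp k') (r.get 1) (r.get 2).toList ∧
          ¬ Opens T H (unary κ) pp (T.tag H κ pp k') (r.get 3)))).distr (· ≠ .nil)) +
      ex (sampleKey κ) fun k' => pr ((guessExtractC Sim B X k₂ H (inp κ [pp, T.tag H κ pp k', T.pk H κ pp k'])).bind
        fun r => ret ((r.get 3).get 1)).distr fun a => a ∈ keySpace κ ∧ T.tag H κ pp a = T.tag H κ pp k' := by
    intro H hH pp hpp
    rw [ex_comm, ← ex_add]
    refine ex_mono fun k' hk' => ?_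
    simp only [distr_bind, hdist H pp hpp _ (hkey H hH pp hpp k' hk').1 _ (hkey H hH pp hpp k' hk').2, distr_ret, pr_bind,
      ex_bind, ex_map, ← ex_add]
    refine ex_mono fun c _ => ?_
    simp only [pr_eq_ex (p := extract _ _ _ _ _ _ _ _ _ _)]
    refine ex_mono fun y _ => ?_
    by_cases h : Opens T H (unary κ) pp (T.tag H κ pp k') y.2.2
    · rw [pr_pure_of (P := fun a => a ∈ _ ∧ _)]
      · refine le_add_left ?_
        split <;> simp
      · simpa [Opens, TaggingScheme.tag, inp] using h
    · refine le_add_right ?_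
      split
      next h' => rw [pr_pure_of]; simpa [h] using h'
      next => simp
  -- For random strings the run is one of the adversary that sampled them. A witness in the relation
  -- would open the tag in the statement, so a report of the distinguisher is a failure of the
  -- extractor.
  have hrand : ∀ H ∈ (𝓗 κ).support, ∀ pp ∈ (T.setup.dist H (inp κ [])).support,
      (ex (uniformBits (T.tagLen κ)) fun tag => ex (uniformBits (T.pkLen κ)) fun cpk =>
        pr ((guessExtractC Sim B X k₂ H (inp κ [pp, tag, cpk])).bind
          fun r => ret (test (NewClaim S H (unary κ) r.fst.snd tag (r.get 1) (r.get 2).toList ∧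
          ¬ Opens T H (unary κ) pp tag (r.get 3)))).distr (· ≠ .nil)) ≤
      ex (Sim.setup.dist H (inp κ [pp])) fun c =>
      pr (extract Sim B' X H κ pp c.fst c.snd (inp κ [pp, c.fst]) []) fun y =>
        S.Accepts H κ c.fst.snd (y.1.get 0) (y.1.get 1) ∧ y.1.get 0 ∉ y.2.1 ∧
          ¬ (fixedRelation T M msgLen).rel H κ pp (y.1.get 0) y.2.2 := by
    intro H hH pp hpp
    have e : ∀ c : Val, (pr (extract Sim B' X H κ pp c.fst c.snd (inp κ [pp, c.fst]) []) fun y =>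
        S.Accepts H κ c.fst.snd (y.1.get 0) (y.1.get 1) ∧ y.1.get 0 ∉ y.2.1 ∧
          ¬ (fixedRelation T M msgLen).rel H κ pp (y.1.get 0) y.2.2) =
        ex (uniformBits (T.tagLen κ)) fun tag => ex (uniformBits (T.pkLen κ)) fun cpk =>
        pr (extract Sim B X H κ pp c.fst c.snd (inp κ [pp, c.fst, tag, cpk]) (tag.append cpk).toList) fun y =>
        S.Accepts H κ c.fst.snd (y.1.get 0) (y.1.get 1) ∧ y.1.get 0 ∉ y.2.1 ∧
          ¬ (fixedRelation T M msgLen).rel H κ pp (y.1.get 0) y.2.2 := by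
      intro c
      simp only [pr_eq_ex (p := extract _ _ _ _ _ _ _ _ _ _)]
      rw [ex_extract_bits (B := B) (n₁ := T.tagLen_poly.len H (unary κ)) (n₂ := T.pkLen_poly.len H (unary κ))
          (f := fun t d => inp κ [pp, c.fst, t, d]) (by rw [hB'den]; simp [inp]),
        T.tagLen_poly.len_unary, T.pkLen_poly.len_unary, toNat_unary, toNat_unary]
    rw [ex_congr fun c _ => e c, ex_comm (p := Sim.setup.dist H _)]
    refine ex_mono fun tag htag => ?_
    rw [ex_comm (p := Sim.setup.dist H _)]
    refine ex_mono fun cpk hcpk => ?_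
    rw [support_uniformBits] at htag hcpk
    simp only [distr_bind, hdist H pp hpp _ htag _ hcpk, distr_ret, pr_bind, ex_bind, ex_map]
    refine ex_mono fun c _ => ?_
    simp only [pr_eq_ex (p := extract _ _ _ _ _ _ _ _ _ _)]
    refine ex_mono fun y _ => ?_
    rw [pr_eq_ex, ex_pure]
    split
    next h =>
      rw [if_pos]
      simp only [test_ne_nil, NewClaim, Opens, get_succ, get_zero, snd_cons, fst_cons, ofList_cons, toList_ofList] at h
      obtain ⟨⟨h1, h2, h3⟩, h4⟩ := h
      refine ⟨by simpa [ZkSnark.Accepts, inp] using h1, by simpa using h2, ?_⟩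
      rintro ⟨st, tag', m, i, csk, pth, h5, h6, -, h7, -, h8⟩
      refine h4 ⟨by simpa [h6] using h7, ?_⟩
      rw [← h3]
      simp only [get_zero] at h5
      simp [h5, h6, h8, TaggingScheme.tag, inp]
    next => simp
  refine le_trans ?_ ((h₁ κ).trans ?_)
  · refine exG_mono fun H hH pp hpp => ex_mono fun crs _ => pr_mono fun y _ h => ?_
    obtain ⟨h1, h2, h3⟩ := h
    refine ⟨by simpa [ZkSnark.Accepts, inp] using h1, by simpa [OracleState.toWorld] using h2, ?_⟩
    simpa [OracleState.toWorld, entry, TaggingScheme.tag, inp] using h3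
  · rw [add_comm]
    refine add_le_add le_rfl ?_
    have e : ((2 * (.X + 2) ^ k + 1 : Polynomial ℕ).eval κ) = 2 * (κ + 2) ^ k + 1 := by simp
    rw [e]
    refine le_trans (exG_mono (G := fun H pp => ((2 * (κ + 2) ^ k + 1 : ℕ) : ℝ≥0∞) *
      ex (Sim.setup.dist H (inp κ [pp])) fun c => ex (sampleKey κ) fun k' =>
        pr (extract Sim B X H κ pp c.fst c.snd (inp κ [pp, c.fst, T.tag H κ pp k', T.pk H κ pp k'])
          ((T.tag H κ pp k').append (T.pk H κ pp k')).toList) fun y =>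
            NewClaim S H (unary κ) c.fst.snd (T.tag H κ pp k') y.1 y.2.1)
      fun H hH pp hpp => ?_) (exG_const_mul _ |>.le.trans (mul_le_mul_right ?_ _))
    · rw [← ex_const_mul]
      refine ex_mono fun c hc => le_trans (le_of_eq ?_) (hsim H hH pp hpp c hc)
      simp [inp]
    · refine (exG_mono hsplit).trans (exG_add.le.trans (add_le_add ?_ le_rfl))
      have h := h₂ κ
      simp only [inp, ofList_cons, fst_cons, snd_cons, get_one, get_two] at h hrand ⊢
      exact h.trans (add_le_add (exG_mono hrand) le_rfl)

end

end
end Tumbling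

/-! ### Theft prevention and non-slanderability -/

namespace Tumbling
open Val

noncomputable section

open Tumbling.Comp
open scoped ENNReal

section
variable {𝓗 : HashModel} {T : TaggingScheme 𝓗} {M : MerkleTree T.pkLen} {msgLen : ℕ → ℕ}
  {hl : PolyLength msgLen} {S : ZkSnark} {Sim : Simulator} {dataFixed : Val}

/-! ## Runs of an extractor -/

variable (Sim) in
/-- A run of an adversary with simulated proofs and of an extractor. -/
def simExtractC (B X : Code) (k : ℕ) (H : Hash) (v : Val) : Comp Val :=
  (Sim.setup.muted H (ofList [v.fst, v.get 1])).bind fun c =>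
    (extractC Sim B X k H v.fst (v.get 1) c.fst c.snd (ofList [v.fst, v.get 1, c.fst]) .nil).bind fun r =>
      ret (.cons c.fst r)

theorem PP.simExtractC' {B X : Code} (hB : B.PPT) (hX : X.PPT) (k : ℕ) : PP (simExtractC Sim B X k) := by
  have h1 : PP fun H v => Sim.setup.muted H (ofList [v.fst, v.get 1]) := PP.muted_comp Sim.setup_ppt
  have h2 : PP fun H w => extractC Sim B X k H w.snd.fst (w.snd.get 1) w.fst.fst w.fst.snd
      (ofList [w.snd.fst, w.snd.get 1, w.fst.fst]) .nil := PP.extractC' Sim hB hX k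
  unfold simExtractC
  infer_instance

variable (T Sim) in
theorem exists_distr_simExtractC {B : Code} (hB : B.PPT) : ∃ k : ℕ, ∀ X H κ, ∀ pp ∈ (T.setup.dist H (inp κ [])).support,
    (simExtractC Sim B X k H (inp κ [pp])).distr = (Sim.setup.dist H (inp κ [pp])).bind fun c =>
      (extract Sim B X H κ pp c.fst c.snd (inp κ [pp, c.fst]) []).map fun y =>
        .cons c.fst (ofList [y.1, ofList y.2.1, y.2.2]) := by
  -- Only the bound for the simulated keys is used, so any algorithms of the right kind may fill in
  -- for the SNARK.
  obtain ⟨ps, hps⟩ := exists_size_setup T ⟨Sim.setup, Sim.setup, T.keyGen, Sim.setup_ppt, Sim.setup_ppt, T.keyGen_ppt, T.keyGen_det⟩ Sim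
  obtain ⟨k, hk⟩ := exists_distr_extractC Sim hB (2 * .X + 10 + ps)
  refine ⟨k, fun X H κ pp hpp => ?_⟩
  simp only [simExtractC, inp, ofList_cons, fst_cons, snd_cons, get_one, distr_bind, Code.distr_muted, distr_ret]
  refine bind_congr_support fun c hc => ?_
  rw [← ofList_nil, hk, PMF.bind_map]
  · rfl
  · have := (hps H κ pp hpp).2 c hc
    have := size_fst_le c
    simp
    omega

/-- An adversary against the Merkle tree can sample public parameters. -/
theorem MerkleTree.Secure.negl_exG (h : M.Secure 𝓗) {F : Hash → Val → Comp Val} (hF : PP F) : Negl fun κ =>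
    exG T κ fun H pp => pr (F H (inp κ [pp])).distr fun out =>
      ∃ rt, M.root H κ (out.get 0).toList = some rt ∧ M.Accepts H κ (out.get 1) (out.get 2) rt (out.get 3) ∧
        (out.get 0).toList[(out.get 1).toNat]? ≠ some (out.get 2) := by
  have h1 : PP fun H v => T.setup.muted H v := PP.muted_comp T.setup_ppt
  have h2 : PP fun H w => F H (ofList [w.snd.fst, w.fst]) := PP.subst hF inferInstance
  have := h.negl (F := fun H v => (T.setup.muted H v).bind fun pp => F H (ofList [v.fst, pp])) inferInstance
  simpa only [distr_bind, Code.distr_muted, pr_bind, inp, ofList_cons, fst_cons, exG] using this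

/-! ## Theft prevention -/

theorem theft_eq (A : Code) (κ : ℕ) : (pr ((dtlFixed T M msgLen S dataFixed).theftGame 𝓗 A κ) fun P => P) =
    exG T κ fun H pp => ex (S.setup.dist H (inp κ [pp])) fun crs =>
      pr (dtlExec T M msgLen dataFixed S A H κ pp crs.fst crs.snd (inp κ [ofList [crs.fst, crs.snd, pp, dataFixed]]))
        fun y => ∃ st, M.root H κ (y.1.get 0).toList = some st ∧
          S.Accepts H κ crs.snd (ofList [st, y.1.get 1, y.1.get 3]) (y.1.get 2) ∧
          (∀ cpk ∈ (y.1.get 0).toList, ∃ k ∈ y.2.C, k.1 = cpk) ∧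
          ¬ ∃ e ∈ y.2.R, e.st = st ∧ e.tag = y.1.get 1 ∧ e.m = y.1.get 3 := by
  simp only [DTL.theftGame, dtlFixed, pmf_bind_def, pmf_pure_def, PMF.bind_bind, PMF.pure_bind, pr_bind, ex_pr_pure, exG,
    Code.play_eq]
  refine ex_congr fun H _ => ex_congr fun pp _ => ex_congr fun crs _ => ?_
  rw [dtlExec, ← run_map_exec, pr_map]
  simp [pr_eq_ex]
  rfl

/-- The first element with a property. -/
def Val.find (P : Val → Prop) (v : Val) : Val :=
  open Classical in (ofList (v.toList.find? fun a => decide (P a)).toList).fst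

instance PP.find_fst' {L f : Hash → Val → Val} [hL : PolyFn L] [hf : PolyFn f] :
    PolyFn fun H v => (L H v).find fun e => e.fst = f H v := by
  have := PP.subst (f := fun _ w => w.fst) hf inferInstance
  have h := PP.find' (L := L) (P := fun H v e => e.fst = f H v) (hP := PP.test_eq (hg := this))
  exact PP.fst' (hf := h)

theorem Val.find_spec {P : Val → Prop} {v : Val} (h : ∃ a ∈ v.toList, P a) : v.find P ∈ v.toList ∧ P (v.find P) := by
  classical
  rw [Val.find]
  cases e : v.toList.find? fun a => decide (P a) with
  | none =>
    obtain ⟨a, ha, hP⟩ := h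
    simpa [hP] using List.find?_eq_none.1 e a ha
  | some a => exact ⟨by simpa using List.mem_of_find?_eq_some e, by simpa using List.find?_some e⟩

variable (S) in
/-- A theft with a tag that belongs to none of the keys, where `out` is the claim together with the list of public
keys and the created keys. -/
def NewTag (H : Hash) (κV vk out : Val) (Q : List Val) : Prop :=
  S.verify.fn H (ofList [κV, vk, out.get 0, out.get 1]) ≠ .nil ∧ out.get 0 ∉ Q ∧ (out.get 0).get 0 ≠ .nil ∧
    (∀ cpk ∈ (out.get 2).toList, ∃ e ∈ (out.get 3).toList, e.fst = cpk) ∧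
    ∀ e ∈ (out.get 3).toList, e.get 1 ≠ (out.get 0).get 1

variable (M) in
/-- The output of a thief, with the created keys. -/
def theftClaim (H : Hash) (κV o C : Val) : Val :=
  ofList [ofList [M.init.fn H (ofList [κV, o.get 0]), o.get 1, o.get 3], o.get 2, o.get 0, C]

instance PP.newTag' {f g h k : Hash → Val → Val} [hf : PolyFn f] [hg : PolyFn g] [hh : PolyFn h] [hk : PolyFn k] :
    PolyFn fun H v => test (NewTag S H (f H v) (g H v) (h H v) (k H v).toList) := by
  refine PP.subst₄ (G := fun H a b c d => ret (test (NewTag S H a b c d.toList))) ?_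
  unfold NewTag
  infer_instance

instance PP.theftClaim' {f g h : Hash → Val → Val} [hf : PolyFn f] [hg : PolyFn g] [hh : PolyFn h] :
    PolyFn fun H v => theftClaim M H (f H v) (g H v) (h H v) := by
  unfold theftClaim; infer_instance

/-- No challenge has to be planted here, so the reduction creates all keys itself, with their secret
keys, and the extractor is taken for adversary and oracles together. The extracted key either is not
authenticated properly or shares its public key with a created key; the tags differ, hence the
secret keys differ. -/
theorem theft_new_tag (dataFixed : Val) (hl : PolyLength msgLen) (hT : T.Secure) (hM : M.Secure 𝓗)
    (hZK : S.ZeroKnowledge 𝓗 (fixedRelation T M msgLen) Sim)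
    (hSE : S.SimulationExtractable 𝓗 (fixedRelation T M msgLen) Sim) {A : Code} (hA : A.PPT) : Negl fun κ =>
    exG T κ fun H pp => ex (S.setup.dist H (inp κ [pp])) fun crs =>
      pr (dtlExec T M msgLen dataFixed S A H κ pp crs.fst crs.snd (inp κ [ofList [crs.fst, crs.snd, pp, dataFixed]]))
        fun y => NewTag S H (unary κ) crs.snd (theftClaim M H (unary κ) y.1
          (ofList (y.2.toWorld (T := T) true H κ pp).C)) (y.2.toWorld (T := T) true H κ pp).Q := by
  obtain ⟨ε₁, hε₁, h₁⟩ := oracle_transfer dataFixed hl hM.1 hZK hA (P := fun H v =>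
    NewTag S H v.fst (v.get 2).snd (theftClaim M H v.fst (v.get 3) (v.get 4)) (v.snd.get 4).toList) inferInstance
  obtain ⟨ps, hps⟩ := exists_size_setup T S Sim
  obtain ⟨b, k, hb, -, hbdd, hfuel⟩ := exists_fuel M hl S Sim hA (2 * .X + 20 + (ps + dataFixed.size + 1))
  -- The adversary's output is extended by the list and by the created keys, so that the reductions
  -- below can read them off.
  have hB : PP fun H v => (world T M hl false true A H (ofList [v.fst, ofList [(v.get 2).fst, (v.get 2).snd, v.get 1,
      dataFixed]]) (world₀ v.fst (unary ((v.fst.toNat + 2) ^ k)) (v.get 1))).bind fun w =>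
        ret (theftClaim M H v.fst w.fst w.snd.snd.snd.fst) := by
    have : PolyFn fun H v => world₀ v.fst (unary ((v.fst.toNat + 2) ^ k)) (v.get 1) := by
      unfold world₀; infer_instance
    have : PP fun H v => world T M hl false true A H (ofList [v.fst, ofList [(v.get 2).fst, (v.get 2).snd, v.get 1,
      dataFixed]]) (world₀ v.fst (unary ((v.fst.toNat + 2) ^ k)) (v.get 1)) := PP.world' T M hl false true hA
    infer_instance
  obtain ⟨B, hB, hBden⟩ := hB
  obtain ⟨X, hX, hSE⟩ := hSE.exists_extractor hB
  obtain ⟨k₂, hk₂⟩ := exists_distr_simExtractC T Sim hB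
  have hG := PP.simExtractC' (Sim := Sim) hB hX k₂
  -- Against the Merkle tree: the list together with position, public key and path from the
  -- extracted witness.
  have h₂ := hM.negl_exG (T := T) (F := fun H v => (simExtractC Sim B X k₂ H v).bind fun r =>
    ret (ofList [(r.get 1).get 2, (r.get 3).get 0, T.keyGen.fn H (ofList [v.fst, v.get 1, (r.get 3).get 1]),
      (r.get 3).get 2])) inferInstance
  -- Against collision resistance: the extracted key and the secret key of the first created key
  -- with the same public key.
  have h₃ := hT.2.1.negl (F := fun H v => (simExtractC Sim B X k₂ H v).bind fun r =>
    ret (ofList [(r.get 3).get 1, (((r.get 1).get 3).find fun e =>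
      e.fst = T.keyGen.fn H (ofList [v.fst, v.get 1, (r.get 3).get 1])).get 2])) inferInstance
  refine (hε₁.add ((hSE.add h₂).add h₃)).mono fun κ => ?_
  have hsim : ∀ H ∈ (𝓗 κ).support, ∀ pp ∈ (T.setup.dist H (inp κ [])).support,
      ∀ c ∈ (Sim.setup.dist H (inp κ [pp])).support,
      pr (dtlExec T M msgLen dataFixed (simSnark S Sim) A H κ pp c.snd c.fst.snd
        (inp κ [ofList [c.fst.fst, c.fst.snd, pp, dataFixed]])) (fun y =>
          NewTag S H (unary κ) c.fst.snd (theftClaim M H (unary κ) y.1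
          (ofList (y.2.toWorld (T := T) true H κ pp).C)) (y.2.toWorld (T := T) true H κ pp).Q) ≤
      pr (extract Sim B X H κ pp c.fst c.snd (inp κ [pp, c.fst]) []) fun y =>
        NewTag S H (unary κ) c.fst.snd y.1 y.2.1 ∧ (y.1.get 0).get 0 = M.init.fn H (inp κ [y.1.get 2]) ∧
          ∀ e ∈ (y.1.get 3).toList, ∃ k ∈ keySpace κ, e = entry T true H (unary κ) pp k := by
    intro H hH pp hpp c hc
    have hbd := hbdd κ H (inp κ [ofList [c.fst.fst, c.fst.snd, pp, dataFixed]])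
      ((size_params κ c.fst pp dataFixed []).trans (by
        have := (hps H κ pp hpp).2 c hc; have := size_fst_le c; simp; omega))
    have e := dtlExec_toWorld (M := M) (hl := hl) (S := simSnark S Sim) (key := c.snd) (vk := c.fst.snd) (dataFixed := dataFixed)
      (keep := true) (prover := simProver Sim H κ c.snd) hH hpp (fun k' _ q => by rw [simSnark_prove]; rfl) hbd
    have e₂ := exec_world_se (keep := true) (pp := pp) (hb κ) ((hfuel κ H pp hpp).2 c hc) hbd ⟨[], [], []⟩
    rw [pr_extract (P := fun o Q => NewTag S H (unary κ) c.fst.snd o Q ∧ (o.get 0).get 0 = M.init.fn H (inp κ [o.get 2]) ∧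
          ∀ e ∈ (o.get 3).toList, ∃ k ∈ keySpace κ, e = entry T true H (unary κ) pp k), hBden]
    simp only [WState.enc, ofList_nil, inp, ofList_cons] at e e₂
    simp only [inp, ofList_cons, fst_cons, snd_cons, get_one, get_two, world₀, toNat_unary, exec_bind, ofList_nil, e₂, e,
      PMF.bind_map, PMF.map_comp, pr_bind, Function.comp_def]
    rw [pr_eq_ex]
    refine ex_mono fun y hy => ?_
    split
    next h =>
      rw [exec_ret, pr_pure_of]
      refine ⟨h, by simp [theftClaim], ?_⟩
      intro e he
      have := honest_of_mem_support hbd hy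
      simp [theftClaim, OracleState.toWorld] at he
      obtain ⟨a, k', hk', rfl⟩ := he
      exact ⟨k', (this _ hk').1, rfl⟩
    next => simp
  have hfin : ∀ H ∈ (𝓗 κ).support, ∀ pp ∈ (T.setup.dist H (inp κ [])).support,
      (ex (Sim.setup.dist H (inp κ [pp])) fun c => pr (extract Sim B X H κ pp c.fst c.snd (inp κ [pp, c.fst]) []) fun y =>
        NewTag S H (unary κ) c.fst.snd y.1 y.2.1 ∧ (y.1.get 0).get 0 = M.init.fn H (inp κ [y.1.get 2]) ∧
          ∀ e ∈ (y.1.get 3).toList, ∃ k ∈ keySpace κ, e = entry T true H (unary κ) pp k) ≤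
      (ex (Sim.setup.dist H (inp κ [pp])) fun c => pr (extract Sim B X H κ pp c.fst c.snd (inp κ [pp, c.fst]) []) fun y =>
        S.Accepts H κ c.fst.snd (y.1.get 0) (y.1.get 1) ∧ y.1.get 0 ∉ y.2.1 ∧
          ¬ (fixedRelation T M msgLen).rel H κ pp (y.1.get 0) y.2.2) +
      pr ((simExtractC Sim B X k₂ H (inp κ [pp])).bind fun r =>
        ret (ofList [(r.get 1).get 2, (r.get 3).get 0, T.keyGen.fn H (ofList [unary κ, pp, (r.get 3).get 1]),
          (r.get 3).get 2])).distr (fun out =>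
        ∃ rt, M.root H κ (out.get 0).toList = some rt ∧ M.Accepts H κ (out.get 1) (out.get 2) rt (out.get 3) ∧
        (out.get 0).toList[(out.get 1).toNat]? ≠ some (out.get 2)) +
      pr ((simExtractC Sim B X k₂ H (inp κ [pp])).bind fun r =>
        ret (ofList [(r.get 3).get 1, (((r.get 1).get 3).find fun e =>
          e.fst = T.keyGen.fn H (ofList [unary κ, pp, (r.get 3).get 1])).get 2])).distr (fun out =>
        out.get 0 ∈ keySpace κ ∧ out.get 1 ∈ keySpace κ ∧
          out.get 0 ≠ out.get 1 ∧ T.pk H κ pp (out.get 0) = T.pk H κ pp (out.get 1)) := by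
    intro H hH pp hpp
    simp only [distr_bind, hk₂ X H κ pp hpp, distr_ret, pr_bind, ex_bind, ex_map, ← ex_add]
    refine ex_mono fun c _ => ?_
    simp only [pr_eq_ex (p := extract _ _ _ _ _ _ _ _ _ _), ← ex_add]
    refine ex_mono fun y _ => ?_
    split
    swap
    · simp
    next h =>
    obtain ⟨⟨h1, h2, h3, h4, h5⟩, h6, h7⟩ := h
    by_cases hr : (fixedRelation T M msgLen).rel H κ pp (y.1.get 0) y.2.2
    · obtain ⟨st, tag, m, i, csk, pth, e1, e2, -, h8, h9, h10⟩ := hr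
      rw [e1, ofList_cons, get_zero, fst_cons] at h3 h6
      -- If the extracted public key is in the list, it is the key of a created entry, whose tag
      -- differs from the claimed one; otherwise the path violates the Merkle tree.
      by_cases h11 : (y.1.get 2).toList[i.toNat]? = some (T.pk H κ pp csk)
      · refine le_add_left ?_
        rw [pr_pure_of]
        obtain ⟨e, he⟩ := h4 _ (List.mem_of_getElem? h11)
        have h12 := Val.find_spec (P := fun e => e.fst = T.pk H κ pp csk) ⟨e, he⟩
        obtain ⟨k', hk', h13⟩ := h7 _ h12.1
        have h14 := h5 _ h12.1
        have h15 := h12.2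
        simp only [ofList_cons, ofList_nil, get_succ, get_zero, snd_cons, fst_cons, e2] at h12 h13 ⊢
        have h16 : T.keyGen.fn H ((unary κ).cons (pp.cons (csk.cons nil))) = T.pk H κ pp csk := rfl
        simp only [get_succ, get_zero] at h13 h14 h15
        rw [h16, h13]
        rw [h13] at h15 h14
        refine ⟨h8, by simpa [entry] using hk', ?_, ?_⟩
        · rintro rfl
          apply h14
          rw [get_zero] at e1
          rw [e1]
          simp [entry, h10, TaggingScheme.tag, inp]
        · exact h15.symm
      · refine le_add_right (le_add_left ?_)
        rw [pr_pure_of]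
        refine ⟨st, ?_, ?_⟩
        · rw [MerkleTree.root]
          simp only [ofList_cons, ofList_nil, get_succ, get_zero, snd_cons, fst_cons, ofList_toList]
          simp only [get_succ, get_zero] at h6
          exact toOption_eq_some.2 ⟨h6.symm, by rwa [← h6]⟩
        · simp only [ofList_cons, ofList_nil, get_succ, get_zero, snd_cons, fst_cons, e2]
          simp only [get_succ, get_zero] at h11
          exact ⟨by simpa [TaggingScheme.pk, inp] using h9, by simpa [TaggingScheme.pk, inp] using h11⟩
    · refine le_add_right (le_add_right ?_)
      rw [if_pos]
      exact ⟨by simpa [ZkSnark.Accepts, inp] using h1, h2, hr⟩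
  refine (le_of_eq ?_).trans ((h₁ κ).trans ?_)
  · simp
  · rw [add_comm]
    refine add_le_add le_rfl ?_
    rw [← exG_add, ← exG_add]
    refine exG_mono fun H hH pp hpp => le_trans (ex_mono fun c hc => ?_) ((hfin H hH pp hpp).trans (le_of_eq ?_))
    · refine le_trans (le_of_eq ?_) (hsim H hH pp hpp c hc)
      simp
    · simp [inp]

end

end
end Tumbling

namespace Tumbling
open Val

noncomputable section

open Tumbling.Comp
open scoped ENNReal

section
variable {𝓗 : HashModel} {T : TaggingScheme 𝓗} {M : MerkleTree T.pkLen} {msgLen : ℕ → ℕ}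
  {S : ZkSnark} {Sim : Simulator} {dataFixed : Val}

theorem toOption_root {H : Hash} {κ : ℕ} {L st : Val} :
    M.root H κ L.toList = some st ↔ M.init.fn H (inp κ [L]) = st ∧ st ≠ .nil := by
  rw [MerkleTree.root, ofList_toList, toOption_eq_some]
  constructor <;> rintro ⟨rfl, h⟩ <;> exact ⟨rfl, h⟩

/-- The cases are whether the stolen tag belongs to a created key. If so, `forge` applies to the
adversary that outputs the root in place of the list; otherwise `theft_new_tag` does. -/
theorem theftPrevention (dataFixed : Val) (hl : PolyLength msgLen) (hT : T.Secure) (hM : M.Secure 𝓗)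
    (hZK : S.ZeroKnowledge 𝓗 (fixedRelation T M msgLen) Sim)
    (hSE : S.SimulationExtractable 𝓗 (fixedRelation T M msgLen) Sim) :
    (dtlFixed T M msgLen S dataFixed).TheftPrevention 𝓗 := by
  intro A hA
  have : PP A.den := .of_code hA
  have hA' : PP fun H v => (A.den H v).bind fun o =>
      ret (ofList [M.init.fn H (ofList [v.fst, o.get 0]), o.get 1, o.get 2, o.get 3]) := inferInstance
  obtain ⟨A', hA', hA'den⟩ := hA'
  refine Negl.negligible (((forge dataFixed hl hT hM.1 hZK hSE hA').add
    (theft_new_tag dataFixed hl hT hM hZK hSE hA)).mono fun κ => ?_)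
  rw [theft_eq, ← exG_add]
  refine exG_mono fun H hH pp hpp => ?_
  rw [← ex_add]
  refine ex_mono fun crs _ => ?_
  have e : ∀ a : Val, dtlExec T M msgLen dataFixed S A' H κ pp crs.fst crs.snd a =
      (dtlExec T M msgLen dataFixed S A H κ pp crs.fst crs.snd a).map fun y =>
        (ofList [M.init.fn H (ofList [a.fst, y.1.get 0]), y.1.get 1, y.1.get 2, y.1.get 3], y.2) := by
    intro a
    rw [dtlExec, hA'den, exec_bind]
    rfl
  rw [e, pr_map]
  refine le_trans (pr_mono fun y hy h => ?_) pr_or_le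
  obtain ⟨st, h1, h2, h3, h4⟩ := h
  obtain ⟨h5, h6⟩ := toOption_root.1 h1
  have h8 : ofList [st, y.1.get 1, y.1.get 3] ∉ y.2.R.map fun r => ofList [r.st, r.tag, r.m] := by
    intro h
    obtain ⟨r, hr, h⟩ := List.mem_map.1 h
    refine h4 ⟨r, hr, ?_⟩
    simpa using h
  have h9 : M.init.fn H (ofList [(inp κ [ofList [crs.fst, crs.snd, pp, dataFixed]]).fst, y.1.get 0]) = st := h5
  rw [h9]
  by_cases h7 : ∃ k ∈ y.2.C, T.tag H κ pp k.2 = y.1.get 1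
  · refine .inl ⟨?_, ?_, h7⟩
    · exact h2
    · exact h8
  · refine .inr ?_
    have h10 : M.init.fn H (ofList [unary κ, y.1.get 0]) = st := h5
    refine ⟨?_, ?_, ?_, ?_, ?_⟩
    · rw [theftClaim, h10]; exact h2
    · rw [theftClaim, h10]; exact h8
    · rw [theftClaim, h10]; exact h6
    · intro cpk hcpk
      obtain ⟨k, hk, rfl⟩ := h3 cpk hcpk
      obtain ⟨p, hp⟩ := hA.bdd
      have := honest_of_mem_support (hp H _ _ le_rfl) hy k hk
      refine ⟨entry T true H (unary κ) pp k.2, ?_, ?_⟩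
      · simpa [theftClaim, OracleState.toWorld] using ⟨k.1, k.2, hk, rfl⟩
      · rw [this.2]; rfl
    · intro e he h
      simp only [theftClaim, OracleState.toWorld, ofList_cons, get_succ, get_zero, snd_cons, fst_cons, toList_ofList,
        List.mem_map] at he h
      obtain ⟨k, hk, rfl⟩ := he
      exact h7 ⟨k, hk, by rw [← entry_get_one (keep := true)]; simpa using h⟩

/-- Whatever the redeem oracle returns carries the tag of a created key; this is what makes the
slandered tag one to which `forge` applies. -/
theorem redeemO_tag {H : Hash} {κ : ℕ} {par m tag π : Val} {s : OracleState} {cpks : List Val} {i : ℕ}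
    {y : Option (Val × Val) × OracleState}
    (hy : y ∈ ((dtlFixed T M msgLen S dataFixed).redeemO H κ par s cpks i m).support) (h : y.1 = some (tag, π)) :
    y.2.C = s.C ∧ ∃ k ∈ s.C, T.tag H κ (par.get 2) k.2 = tag := by
  have hb : ∀ {α β : Type} (p : PMF α) (f : α → PMF β) (b : β), b ∈ (p >>= f).support ↔
    ∃ a ∈ p.support, b ∈ (f a).support := fun p f b => PMF.mem_support_bind_iff p f b
  have hp : ∀ {α : Type} (a b : α), b ∈ (pure a : PMF α).support ↔ b = a := fun a b =>
    PMF.mem_support_pure_iff a b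
  simp only [DTL.redeemO] at hy
  split at hy
  swap
  · rw [hp] at hy; simp [hy] at h
  next k st hk hst =>
  split at hy
  swap
  · rw [hp] at hy; simp [hy] at h
  rw [hb] at hy
  obtain ⟨o, ho, hy⟩ := hy
  cases o with
  | none => simp only [hp] at hy; simp [hy] at h
  | some o =>
    simp only [hp] at hy
    subst hy
    simp only [Option.some.injEq] at h
    refine ⟨rfl, k, List.mem_of_find?_eq_some hk, ?_⟩
    simp only [dtlFixed] at ho
    split at ho
    · rw [hb] at ho
      obtain ⟨π', -, ho⟩ := ho
      rw [hp] at ho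
      simp only [Option.some.injEq] at ho
      rw [ho] at h
      exact congrArg Prod.fst h
    · rw [hp] at ho; cases ho

theorem slander_eq (A : Code) (κ : ℕ) : (pr ((dtlFixed T M msgLen S dataFixed).slanderGame 𝓗 A κ) fun P => P) =
    exG T κ fun H pp => ex (S.setup.dist H (inp κ [pp])) fun crs =>
      ex (dtlExec T M msgLen dataFixed S A H κ pp crs.fst crs.snd (inp κ [ofList [crs.fst, crs.snd, pp, dataFixed]]))
        fun y => ex (uniformBits (msgLen κ)) fun m =>
          pr ((dtlFixed T M msgLen S dataFixed).redeemO H κ (ofList [crs.fst, crs.snd, pp, dataFixed]) y.2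
            [y.1.get 0, y.1.get 1] 0 m) fun o =>
            ∃ st tag π, M.root H κ [y.1.get 0, y.1.get 1] = some st ∧ o.1 = some (tag, π) ∧
              (∃ k ∈ y.2.C, k.1 = y.1.get 0) ∧ tag = y.1.get 2 ∧
              S.Accepts H κ crs.snd (ofList [st, y.1.get 2, y.1.get 4]) (y.1.get 3) ∧
              ¬ ∃ e ∈ o.2.R, e.st = st ∧ e.tag = tag ∧ e.m = y.1.get 4 := by
  have h0 : ∀ H κ, (dtlFixed T M msgLen S dataFixed).setup H κ = (T.setup.dist H (inp κ [])).bind fun pp =>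
    (S.setup.dist H (inp κ [pp])).bind fun crs => PMF.pure (ofList [crs.fst, crs.snd, pp, dataFixed]) := fun _ _ => rfl
  have h1 : (dtlFixed T M msgLen S dataFixed).msgLen = msgLen := rfl
  simp only [DTL.slanderGame, h0, h1, pmf_bind_def, pmf_pure_def, PMF.bind_bind, PMF.pure_bind, pr_bind, exG,
    Code.play_eq]
  refine ex_congr fun H _ => ex_congr fun pp _ => ex_congr fun crs _ => ?_
  rw [dtlExec, ← run_map_exec, ex_map]
  refine ex_congr fun y _ => ex_congr fun m _ => ?_
  simp only [pr_eq_ex, ex_pure]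
  rfl

/-- The final redemption is moved into the adversary, which chooses the random message itself. Then
the records at the end of its run are those of the experiment, and the slanderous statement is a new
one about the tag of a created key. -/
theorem nonSlanderability (dataFixed : Val) (hl : PolyLength msgLen) (hT : T.Secure) (hM : M.Secure 𝓗)
    (hZK : S.ZeroKnowledge 𝓗 (fixedRelation T M msgLen) Sim)
    (hSE : S.SimulationExtractable 𝓗 (fixedRelation T M msgLen) Sim) :
    (dtlFixed T M msgLen S dataFixed).NonSlanderability 𝓗 := by
  intro A hA
  have : PP A.den := .of_code hA
  have hA' : PP fun H v => (A.den H v).bind fun o => (bitsC (hl.len H v.fst)).bind fun m =>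
      -- The redemption is asked only for its effect on the records, so the reply gets a buffer of
      -- size 1.
      (queryC Val.nil.size (.cons (.cons .nil .nil) (ofList [ofList [o.get 0, o.get 1], .nil, m]))).bind fun _ =>
      ret (ofList [M.init.fn H (ofList [v.fst, ofList [o.get 0, o.get 1]]), o.get 2, o.get 3, o.get 4]) := by
    have : PP fun H w => bitsC (hl.len H w.snd.fst) := inferInstance
    infer_instance
  obtain ⟨A', hA', hA'den⟩ := hA'
  refine Negl.negligible ((forge dataFixed hl hT hM.1 hZK hSE hA').mono fun κ => ?_)
  rw [slander_eq]
  refine exG_mono fun H hH pp hpp => ex_mono fun crs _ => ?_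
  rw [dtlExec, dtlExec, hA'den, show (inp κ [ofList [crs.fst, crs.snd, pp, dataFixed]]).fst = unary κ from rfl,
    hl.len_unary]
  simp only [exec_bind, exec_bitsC, pr_bind, queryC, exec_query, ex_bind, exec_ret, PMF.bind_map, Function.comp_def,
    ex_pure, toNat_unary]
  refine ex_mono fun y _ => ex_mono fun m _ => ?_
  rw [DTL.oracle, pmf_bind_def, ex_bind]
  simp only [pmf_pure_def, ex_pure]
  rw [pr_eq_ex, show ((ofList [ofList [y.1.get 0, y.1.get 1], nil, m]).get 0).toList = [y.1.get 0, y.1.get 1] by simp,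
    show ((ofList [ofList [y.1.get 0, y.1.get 1], nil, m]).get 1).toNat = 0 by simp,
    show (ofList [ofList [y.1.get 0, y.1.get 1], nil, m]).get 2 = m by simp]
  refine ex_mono fun o ho => ?_
  split
  swap
  · simp
  next h =>
  rw [pr_pure_of]
  obtain ⟨st, tag, π, h1, h2, -, h3, h4, h5⟩ := h
  obtain ⟨h6, k, h7, h8⟩ := redeemO_tag ho h2
  have h9 : M.init.fn H (inp κ [ofList [y.1.get 0, y.1.get 1]]) = st :=
    (toOption_root.1 (by simpa using h1)).1
  have h10 : M.init.fn H (ofList [unary κ, ofList [y.1.get 0, y.1.get 1]]) = st := h9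
  subst h3
  rw [h10]
  refine ⟨h4, ?_, k, h6 ▸ h7, h8⟩
  intro h
  obtain ⟨r, hr, h⟩ := List.mem_map.1 h
  refine h5 ⟨r, hr, ?_⟩
  simpa [claimed] using h

end

end
end Tumbling

/-! ### No one-more redeeming -/

namespace Tumbling
open Val

noncomputable section

open Tumbling.Comp
open scoped ENNReal

/-! ## Two samples with the same index -/

/-- Either failures already have probability at least 1 / (2K), or each index j is explained by some
position i with probability at least 1 / (2Kn). There are n + 1 indices and n positions, so two
indices share a position, and independence of the two samples multiplies their probabilities. -/
theorem one_le_add_of_pigeonhole {α : Type} (p : PMF α) {n K : ℕ} (hK : K ≠ 0) (J I : ℕ → α → Prop) (bad : α → Prop)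
    (h₁ : ∀ j < n + 1, (K : ℝ≥0∞)⁻¹ ≤ pr p (J j))
    (h₂ : ∀ j < n + 1, ∀ a ∈ p.support, J j a → bad a ∨ ∃ i < n, I i a) :
    1 ≤ 2 * K * pr p bad + (2 * K * n) ^ 2 * ex p fun a => pr p fun a' =>
      ∃ j < n + 1, ∃ j' < n + 1, j ≠ j' ∧ ∃ i < n, (J j a ∧ I i a) ∧ J j' a' ∧ I i a' := by
  have hK1 : (K : ℝ≥0∞) * (K : ℝ≥0∞)⁻¹ = 1 := ENNReal.mul_inv_cancel (by simpa using hK) (ENNReal.natCast_ne_top _)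
  have h3 : ∀ j < n + 1, 1 ≤ K * pr p bad + K * ∑ i ∈ Finset.range n, pr p fun a => J j a ∧ I i a := by
    intro j hj
    rw [← mul_add, ← hK1]
    refine mul_le_mul_right ((h₁ j hj).trans ((pr_mono (Q := fun a => bad a ∨ ∃ i < n, J j a ∧ I i a)
      fun a ha h => ?_).trans (pr_or_le.trans (add_le_add le_rfl (pr_exists_lt_le _ _))))) _
    rcases h₂ j hj a ha h with h' | ⟨i, hi, h'⟩
    · exact .inl h'
    · exact .inr ⟨i, hi, h, h'⟩
  by_cases hb : 1 ≤ 2 * K * pr p bad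
  · exact hb.trans le_self_add
  have hb' : K * pr p bad < 2⁻¹ := by
    by_contra h
    refine hb ?_
    calc (1 : ℝ≥0∞) = 2 * 2⁻¹ := (ENNReal.mul_inv_cancel (by simp) (by simp)).symm
      _ ≤ 2 * (K * pr p bad) := mul_le_mul_right (not_lt.1 h) _
      _ = _ := by ring
  -- If every position had probability below 1 / (2Kn), positions and failures together would
  -- contribute less than 1/2 + 1/2. For n = 0 the sum is empty and the same contradiction arises.
  have h4 : ∀ j < n + 1, ∃ i < n, 1 ≤ 2 * K * n * pr p fun a => J j a ∧ I i a := by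
    intro j hj
    by_contra! hc
    have h5 : (K : ℝ≥0∞) * ∑ i ∈ Finset.range n, (pr p fun a => J j a ∧ I i a) ≤ 2⁻¹ := by
      rcases Nat.eq_zero_or_pos n with rfl | hn
      · simp
      rw [Finset.mul_sum]
      refine (Finset.sum_le_sum (g := fun _ => 2⁻¹ * (n : ℝ≥0∞)⁻¹) fun i hi => ?_).trans ?_
      · have hn0 : (n : ℝ≥0∞) ≠ 0 := by simpa using hn.ne'
        rw [← ENNReal.mul_inv (by simp) (by simp), ENNReal.le_inv_iff_mul_le]
        refine le_trans (le_of_eq ?_) (hc i (Finset.mem_range.1 hi)).le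
        ring
      · rw [Finset.sum_const, Finset.card_range, nsmul_eq_mul, mul_comm, mul_assoc,
          ENNReal.inv_mul_cancel (by simpa using hn.ne') (ENNReal.natCast_ne_top _), mul_one]
    have := (h3 j hj).trans_lt (ENNReal.add_lt_add_of_lt_of_le (h5.trans_lt (by simp)).ne hb' h5)
    rw [ENNReal.inv_two_add_inv_two] at this
    exact lt_irrefl _ this
  choose! f hf1 hf2 using h4
  obtain ⟨j, hj, j', hj', hne, hff⟩ := Finset.exists_ne_map_eq_of_card_lt_of_maps_to (s := Finset.range (n + 1))
    (t := Finset.range n) (by simp) (f := f) (fun j hj => by simpa using hf1 j (by simpa using hj))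
  simp only [Finset.mem_range] at hj hj'
  have h6 := mul_le_mul' (hf2 j hj) (hf2 j' hj')
  rw [one_mul] at h6
  refine le_add_left (h6.trans (le_of_eq_of_le ?_ (mul_le_mul_right (?_ :
    (pr p fun a => J j a ∧ I (f j) a) * (pr p fun a => J j' a ∧ I (f j') a) ≤ _) _)))
  · ring
  · rw [mul_comm, pr_eq_ex (P := fun a => J j a ∧ I (f j) a), ← ex_const_mul]
    refine ex_mono fun a _ => ?_
    split
    next h =>
      rw [mul_one]
      exact pr_mono fun a' _ h' => ⟨j, hj, j', hj', hne, f j, hf1 j hj, h, by rwa [hff]⟩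
    next => simp

namespace PP
variable {L : Hash → Val → Val}

/-- The state is a flag, true as long as no element was repeated, with the list of elements seen. -/
def _root_.Tumbling.nodupStep (x a : Val) : Val :=
  .cons (test (x.fst ≠ .nil ∧ a ∉ x.snd.toList)) (.cons a x.snd)

instance test_nodup [hL : PolyFn L] : PolyFn fun H v => test (L H v).toList.Nodup := by
  have h0 : PolyFn fun _ w => nodupStep w.snd.fst w.snd.snd := by unfold nodupStep; infer_instance
  have := fold (K := fun _ _ x a => nodupStep x a) (L := L)
    (init := fun _ _ => .cons (.cons .nil .nil) .nil) h0 hL inferInstance (.X + 10) (fun H v x a => by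
      have := size_test_le (x.fst ≠ .nil ∧ a ∉ x.snd.toList)
      have := size_fst_add_snd x
      have := x.fst.size_pos
      simp only [nodupStep, size_cons, Polynomial.eval_add, Polynomial.eval_X, Polynomial.eval_ofNat]
      omega)
  have key : ∀ (l : List Val) (m : List Val) (P : Prop), (l.foldl nodupStep (.cons (test P) (ofList m))).fst =
      test (P ∧ l.Nodup ∧ ∀ a ∈ l, a ∉ m) := by
    intro l
    induction l with
    | nil => simp
    | cons a l ih =>
      intro m P
      have := ih (a :: m) (P ∧ a ∉ m)
      rw [List.foldl_cons, nodupStep]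
      simp only [fst_cons, snd_cons, test_ne_nil, toList_ofList, ofList_cons] at this ⊢
      rw [this]
      congr 1
      simp only [List.nodup_cons, List.mem_cons, not_or, eq_iff_iff, forall_eq_or_imp]
      constructor
      · rintro ⟨⟨h1, h2⟩, h3, h4⟩
        exact ⟨h1, ⟨fun h => (h4 a h).1 rfl, h3⟩, h2, fun b hb => (h4 b hb).2⟩
      · rintro ⟨h1, ⟨h2, h3⟩, h4, h5⟩
        exact ⟨⟨h1, h4⟩, h3, fun b hb => ⟨fun e => h2 (e ▸ hb), h5 b hb⟩⟩
  have h2 := fst' (hf := this)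
  convert h2 using 3 with H v
  have := key (L H v).toList [] True
  rw [test_of trivial, ofList_nil] at this
  rw [this]
  simp

end PP

end
end Tumbling

namespace Tumbling
open Val

noncomputable section

open Tumbling.Comp
open scoped ENNReal

theorem Comp.state_of_mem_support_run_mute {α σ : Type} {O : σ → Val → PMF (Val × σ)} {c : Comp α} {s : σ}
    {y : α × σ × List Val} (hy : y ∈ (c.mute.run O s).support) : y.2.1 = s := by
  have : (y.1, y.2.1) ∈ (c.mute.exec O s).support := by
    rw [← run_map_exec, PMF.mem_support_map_iff]
    exact ⟨y, hy, rfl⟩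
  rw [exec_mute, PMF.mem_support_map_iff] at this
  obtain ⟨a, -, h⟩ := this
  exact (congrArg Prod.snd h).symm

section
variable {𝓗 : HashModel} {T : TaggingScheme 𝓗} {M : MerkleTree T.pkLen} {msgLen : ℕ → ℕ}
  {S : ZkSnark} {Sim : Simulator} {dataFixed : Val}

/-- An adversary in two stages, the first of which asks nothing. -/
theorem ex_extract_bind {A B I X : Code} {H : Hash} {κ : ℕ} {pp crs τ a : Val} {f : Val → Val}
    (h : B.den H a = (A.den H a).bind fun o => I.den H (f o)) {A' : Comp Val} (hA : A.den H a = A'.mute)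
    (F : Val × List Val × Val → ℝ≥0∞) :
    ex (extract Sim B X H κ pp crs τ a []) F = ex ((A.den H a).run (ZkSnark.simOracle Sim H κ τ) []) fun y =>
      ex (extract Sim I X H κ pp crs τ (f y.1) y.2.2) F := by
  simp only [extract, h, run_bind, ex_bind, ex_map, ex_pure, List.nil_append]
  refine ex_congr fun y hy => ?_
  rw [hA] at hy
  rw [Comp.state_of_mem_support_run_mute hy]

theorem mem_support_extract {B X : Code} {H : Hash} {κ : ℕ} {pp crs τ a : Val} {l : List Val} {z : Val × List Val × Val}
    (hz : z ∈ (extract Sim B X H κ pp crs τ a l).support) :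
    (z.1, z.2.1) ∈ ((B.den H a).exec (ZkSnark.simOracle Sim H κ τ) []).support := by
  rw [extract, PMF.mem_support_bind_iff] at hz
  obtain ⟨y, hy, hz⟩ := hz
  rw [PMF.mem_support_map_iff] at hz
  obtain ⟨w, -, rfl⟩ := hz
  rw [← run_map_exec, PMF.mem_support_map_iff]
  exact ⟨y, hy, rfl⟩

/-! ## No one-more redeeming -/

variable (M S) in
/-- The adversary redeems one more time than there are keys. -/
def OneMore (H : Hash) (κV vk out : Val) : Prop :=
  ((out.get 0).map fun _ => .nil) = .cons .nil ((out.get 1).map fun _ => .nil) ∧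
    M.init.fn H (ofList [κV, out.get 1]) ≠ .nil ∧
    (∀ t ∈ (out.get 0).toList,
      S.verify.fn H (ofList [κV, vk, ofList [M.init.fn H (ofList [κV, out.get 1]), t.get 0, t.get 2], t.get 1]) ≠ .nil) ∧
    ((out.get 0).map fun t => t.get 0).toList.Nodup

instance PP.oneMore' {f g h : Hash → Val → Val} [hf : PolyFn f] [hg : PolyFn g] [hh : PolyFn h] :
    PolyFn fun H v => test (OneMore M S H (f H v) (g H v) (h H v)) := by
  refine PP.subst₃ (G := fun H a b c => ret (test (OneMore M S H a b c))) ?_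
  unfold OneMore
  infer_instance

theorem oneMore_le (A : Code) (κ : ℕ) : (pr ((dtlFixed T M msgLen S dataFixed).oneMoreGame 𝓗 A κ) fun P => P) ≤
    exG T κ fun H pp => ex (S.setup.dist H (inp κ [pp])) fun crs =>
      pr (A.dist H (inp κ [ofList [crs.fst, crs.snd, pp, dataFixed]])) fun out =>
        OneMore M S H (unary κ) crs.snd out := by
  simp only [DTL.oneMoreGame, dtlFixed, pmf_bind_def, pmf_pure_def, PMF.bind_bind, PMF.pure_bind, pr_bind, ex_pr_pure, exG]
  refine ex_mono fun H _ => ex_mono fun pp _ => ex_mono fun crs _ => pr_mono fun out _ h => ?_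
  obtain ⟨h1, st, h2, h3, h4⟩ := h
  obtain ⟨h5, h6⟩ := toOption_root.1 h2
  have h7 : M.init.fn H (ofList [unary κ, out.get 1]) = st := h5
  rw [OneMore, h7]
  refine ⟨?_, h6, ?_, ?_⟩
  · rw [Val.map, Val.map, List.map_const', List.map_const', h1, List.replicate_succ]; rfl
  · intro t ht
    simpa [ZkSnark.Accepts, inp] using h3 t ht
  · rw [toList_map]
    exact List.pairwise_map.2 h4

variable (M) in
/-- The claim of one of the redemptions. -/
def pick (H : Hash) (κV out j : Val) : Val :=
  ofList [ofList [M.init.fn H (ofList [κV, out.get 1]), ((out.get 0).drop j).fst.get 0, ((out.get 0).drop j).fst.get 2],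
    ((out.get 0).drop j).fst.get 1, out.get 1, j]

variable (T M S msgLen) in
/-- The extractor fails, or it finds a witness with a key that does not belong to the list. -/
def Misses (H : Hash) (κ : ℕ) (pp vk : Val) (z : Val × List Val × Val) : Prop :=
  (S.Accepts H κ vk (z.1.get 0) (z.1.get 1) ∧ z.1.get 0 ∉ z.2.1 ∧
    ¬ (fixedRelation T M msgLen).rel H κ pp (z.1.get 0) z.2.2) ∨
  ∃ rt, M.root H κ (z.1.get 2).toList = some rt ∧ M.Accepts H κ (z.2.2.get 0) (T.pk H κ pp (z.2.2.get 1)) rt (z.2.2.get 2) ∧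
        (z.1.get 2).toList[(z.2.2.get 0).toNat]? ≠ some (T.pk H κ pp (z.2.2.get 1))

/-- Two keys for the same public key. -/
def Collision (T : TaggingScheme 𝓗) (H : Hash) (κ : ℕ) (pp k k' : Val) : Prop :=
  k ∈ keySpace κ ∧ k' ∈ keySpace κ ∧ k ≠ k' ∧ T.pk H κ pp k = T.pk H κ pp k'

/-- The output and transcript of the first stage are fixed; the randomness is that of the index and
of the extractor. Having the bound for each first stage, and not on average, is what allows two
extractions from the same list to be compared. -/
theorem one_le_of_oneMore {I X : Code} (hI : ∀ H v, I.den H v = (idxC (((v.get 1).get 0).map fun _ => .nil)).bind fun j =>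
      ret (pick M H v.fst (v.get 1) j)) {H : Hash} {κ : ℕ} {pp crs τ out : Val} {l : List Val}
    (h : OneMore M S H (unary κ) crs.snd out) :
    1 ≤ 2 * (2 * out.size + 1 : ℕ) * pr (extract Sim I X H κ pp crs τ (inp κ [out]) l)
      (Misses T M msgLen S H κ pp crs.snd) + (2 * (2 * out.size + 1 : ℕ) * out.size) ^ 2 *
      ex (extract Sim I X H κ pp crs τ (inp κ [out]) l) fun a =>
        pr (extract Sim I X H κ pp crs τ (inp κ [out]) l) fun a' => Collision T H κ pp (a.2.2.get 1) (a'.2.2.get 1) := by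
  obtain ⟨h1, h2, h3, h4⟩ := h
  have hlen : (out.get 0).toList.length = (out.get 1).toList.length + 1 := by
    have := congrArg (fun v => v.toList.length) h1
    simpa using this
  have hsz : (out.get 1).toList.length ≤ out.size := by
    have h5 := length_toList_lt (out.get 1)
    have h6 := size_snd_le out
    have h7 := size_fst_le out.snd
    rw [get_one] at h5 ⊢
    omega
  have hsz' : (out.get 1).toList.length + 1 ≤ out.size := by
    rw [← hlen]
    have h5 := length_toList_lt (out.get 0)
    have h6 := size_fst_le out
    rw [get_zero] at h5 ⊢
    omega
  have hget : ∀ j, (hj : j < (out.get 1).toList.length + 1) → ((out.get 0).drop (unary j)).fst =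
      (out.get 0).toList[j]'(hlen ▸ hj) := by
    intro j hj
    rw [Val.drop, Val.fst_ofList, List.headD_eq_head?_getD, List.head?_drop, toNat_unary,
      List.getElem?_eq_getElem (hlen ▸ hj), Option.getD_some]
  have hexec : ((I.den H (inp κ [out])).exec (ZkSnark.simOracle Sim H κ τ) []) =
      (idxC (unary ((out.get 1).toList.length + 1))).distr.map fun j => (pick M H (unary κ) out j, []) := by
    have e : ((out.get 0).map fun _ => Val.nil) = unary ((out.get 1).toList.length + 1) := by
      rw [Val.map, List.map_const', hlen]; rfl
    rw [hI, exec_bind, exec_idxC, PMF.bind_map]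
    simp only [inp, ofList_cons, fst_cons, get_one, snd_cons, e, PMF.map, Function.comp_def, exec_ret]
  have hz : ∀ z ∈ (extract Sim I X H κ pp crs τ (inp κ [out]) l).support, ∀ j, z.1.get 3 = unary j →
      z.1 = pick M H (unary κ) out (unary j) ∧ z.2.1 = [] := by
    intro z hz j hj
    have := mem_support_extract hz
    rw [hexec, PMF.mem_support_map_iff] at this
    obtain ⟨j', -, h⟩ := this
    rw [Prod.ext_iff] at h
    simp only at h
    have : j' = unary j := by rw [← hj, ← h.1]; simp [pick]
    exact ⟨by rw [← h.1, this], h.2.symm⟩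
  -- The index is sampled from the numeral n + 1, hence K = 2 (n + 1) + 1. It may fall outside of
  -- the n + 1 triples; such runs are not counted by any of the events for j < n + 1.
  have hK := one_le_add_of_pigeonhole (extract Sim I X H κ pp crs τ (inp κ [out]) l)
    (n := (out.get 1).toList.length) (K := 2 * ((out.get 1).toList.length + 1) + 1) (by omega)
    (fun j z => z.1.get 3 = unary j) (fun i z => (fixedRelation T M msgLen).rel H κ pp (z.1.get 0) z.2.2 ∧
      (out.get 1).toList[i]? = some (T.pk H κ pp (z.2.2.get 1))) (Misses T M msgLen S H κ pp crs.snd) ?_ ?_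
  · refine hK.trans (add_le_add (mul_le_mul' (mul_le_mul' le_rfl (by exact_mod_cast (by omega))) le_rfl) (mul_le_mul' ?_ ?_))
    · gcongr
    · refine ex_mono fun a ha => pr_mono fun a' ha' h => ?_
      obtain ⟨j, hj, j', hj', hne, i, hi, ⟨g1, g2, g3⟩, g4, g5, g6⟩ := h
      obtain ⟨e1, e2⟩ := hz a ha j g1
      obtain ⟨e1', e2'⟩ := hz a' ha' j' g4
      obtain ⟨st, tag, m, i, csk, pth, r1, r2, -, r3, -, r4⟩ := g2
      obtain ⟨st', tag', m', i', csk', pth', r1', r2', -, r3', -, r4'⟩ := g5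
      rw [g3] at g6
      refine ⟨by simpa [r2] using r3, by simpa [r2'] using r3', ?_, by simpa using g6⟩
      -- Equal extracted keys would have equal tags, whereas triples with different indices have
      -- different tags.
      intro e
      apply hne
      rw [r2, r2'] at e
      simp only [ofList_cons, get_succ, get_zero, snd_cons, fst_cons] at e
      have t1 : ((out.get 0).drop (unary j)).fst.get 0 = tag := by
        rw [e1] at r1; simp [pick] at r1; simpa using r1.2.1
      have t2 : ((out.get 0).drop (unary j')).fst.get 0 = tag' := by
        rw [e1'] at r1'; simp [pick] at r1'; simpa using r1'.2.1
      have t3 : ((out.get 0).drop (unary j)).fst.get 0 = ((out.get 0).drop (unary j')).fst.get 0 := by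
        rw [t1, t2, r4, r4', e]
      rw [hget j hj, hget j' hj'] at t3
      rw [toList_map] at h4
      exact (h4.getElem_inj_iff (hi := by rw [List.length_map, hlen]; exact hj)
        (hj := by rw [List.length_map, hlen]; exact hj')).1 (by simpa using t3)
  · intro j hj
    have := pr_extract (Sim := Sim) (B := I) (X := X) (H := H) (κ := κ) (pp := pp) (crs := crs) (τ := τ) (a := inp κ [out]) (l := l)
      (fun o _ => o.get 3 = unary j)
    rw [this, hexec, pr_map]
    refine (pr_idxC ((out.get 1).toList.length + 1) j (by omega)).trans (pr_mono fun v _ h => ?_)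
    simpa [pick] using h
  · intro j hj z hz' hJ
    obtain ⟨e1, e2⟩ := hz z hz' j hJ
    have hacc := h3 ((out.get 0).drop (unary j)).fst (by rw [hget j hj]; exact List.getElem_mem _)
    by_cases hr : (fixedRelation T M msgLen).rel H κ pp (z.1.get 0) z.2.2
    · have hr' := hr
      obtain ⟨st, tag, m, i, csk, pth, r1, r2, -, r3, r5, r4⟩ := hr'
      have h5 : M.init.fn H (ofList [unary κ, out.get 1]) = st := by
        rw [e1] at r1; simp only [pick, ofList_cons, get_zero, fst_cons] at r1; exact (Val.cons.inj r1).1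
      by_cases h6 : (out.get 1).toList[i.toNat]? = some (T.pk H κ pp csk)
      · exact .inr ⟨i.toNat, (List.getElem?_eq_some_iff.1 h6).1, hr, by simpa [r2] using h6⟩
      · refine .inl (.inr ⟨st, ?_, ?_, ?_⟩)
        · rw [e1, toOption_root]
          simp only [pick, ofList_cons, get_succ, get_zero, snd_cons, fst_cons]
          exact ⟨by simpa [inp] using h5, by rwa [← h5]⟩
        · simpa [r2] using r5
        · simpa [r2, e1, pick] using h6
    · refine .inl (.inl ⟨?_, by simp [e2], hr⟩)
      simpa [ZkSnark.Accepts, e1, pick, inp] using hacc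

end

end
end Tumbling

namespace Tumbling
open Val

noncomputable section

open Tumbling.Comp
open scoped ENNReal

section
variable {𝓗 : HashModel} {T : TaggingScheme 𝓗} {M : MerkleTree T.pkLen} {msgLen : ℕ → ℕ}
  {S : ZkSnark} {Sim : Simulator} {dataFixed : Val}

variable (Sim) in
/-- A run of an adversary, followed by two runs of its continuation and of the extractor. -/
def twiceC (A I X : Code) (k k' : ℕ) (H : Hash) (v : Val) : Comp Val :=
  (Sim.setup.muted H (ofList [v.fst, v.get 1])).bind fun c =>
    (record Sim A H (ofList [v.fst, v.get 1, c.fst])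
      (.cons (ofList [v.fst, unary ((v.fst.toNat + 2) ^ k), c.snd]) (.cons .nil .nil))).bind fun r =>
    (extractC Sim I X k' H v.fst (v.get 1) c.fst c.snd (ofList [v.fst, r.fst]) r.snd.snd.fst).bind fun z =>
    (extractC Sim I X k' H v.fst (v.get 1) c.fst c.snd (ofList [v.fst, r.fst]) r.snd.snd.fst).bind fun z' =>
      ret (ofList [(z.get 2).get 1, (z'.get 2).get 1])

theorem PP.twiceC' {A I X : Code} (hA : A.PPT) (hI : I.PPT) (hX : X.PPT) (k k' : ℕ) : PP (twiceC Sim A I X k k') := by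
  have h1 : PP fun H v => Sim.setup.muted H (ofList [v.fst, v.get 1]) := PP.muted_comp Sim.setup_ppt
  have h2 : PP fun H w => record Sim A H (ofList [w.snd.fst, w.snd.get 1, w.fst.fst])
      (.cons (ofList [w.snd.fst, unary ((w.snd.fst.toNat + 2) ^ k), w.fst.snd]) (.cons .nil .nil)) := PP.record' Sim hA
  have h3 : PP fun H u => extractC Sim I X k' H u.snd.snd.fst (u.snd.snd.get 1) u.snd.fst.fst u.snd.fst.snd
      (ofList [u.snd.snd.fst, u.fst.fst]) u.fst.snd.snd.fst := PP.extractC' Sim hI hX k'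
  have h4 : PP fun H t => extractC Sim I X k' H t.snd.snd.snd.fst (t.snd.snd.snd.get 1) t.snd.snd.fst.fst t.snd.snd.fst.snd
      (ofList [t.snd.snd.snd.fst, t.snd.fst.fst]) t.snd.fst.snd.snd.fst := PP.extractC' Sim hI hX k'
  have h5 : PP fun H u => (extractC Sim I X k' H u.snd.snd.fst (u.snd.snd.get 1) u.snd.fst.fst u.snd.fst.snd
      (ofList [u.snd.snd.fst, u.fst.fst]) u.fst.snd.snd.fst).bind fun z =>
      (extractC Sim I X k' H u.snd.snd.fst (u.snd.snd.get 1) u.snd.fst.fst u.snd.fst.snd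
      (ofList [u.snd.snd.fst, u.fst.fst]) u.fst.snd.snd.fst).bind fun z' =>
      ret (ofList [(z.get 2).get 1, (z'.get 2).get 1]) := inferInstance
  have h6 : PP fun H w => (record Sim A H (ofList [w.snd.fst, w.snd.get 1, w.fst.fst])
      (.cons (ofList [w.snd.fst, unary ((w.snd.fst.toNat + 2) ^ k), w.fst.snd]) (.cons .nil .nil))).bind fun r =>
      (extractC Sim I X k' H w.snd.fst (w.snd.get 1) w.fst.fst w.fst.snd (ofList [w.snd.fst, r.fst]) r.snd.snd.fst).bind fun z =>
      (extractC Sim I X k' H w.snd.fst (w.snd.get 1) w.fst.fst w.fst.snd (ofList [w.snd.fst, r.fst]) r.snd.snd.fst).bind fun z' =>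
      ret (ofList [(z.get 2).get 1, (z'.get 2).get 1]) := PP.bind (hF := h2) (hK := h5)
  exact PP.bind (hF := h1) (hK := h6)

theorem Comp.ex_run_mute {α σ : Type} (O : σ → Val → PMF (Val × σ)) (c : Comp α) (s : σ) (F : α → ℝ≥0∞) :
    ex (c.mute.run O s) (fun y => F y.1) = ex c.distr F := by
  have h := ex_map (p := c.mute.run O s) (fun r => (r.1, r.2.1)) fun x => F x.1
  rw [run_map_exec, exec_mute, ex_map] at h
  exact h.symm

/-- After passing to simulated keys, each successful first stage contributes at least 1 to a
polynomial multiple of the failures plus a polynomial multiple of the collisions; taking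
expectations bounds the success probability by negligible quantities. -/
theorem noOneMoreRedeeming (dataFixed : Val) (hT : T.Secure) (hM : M.Secure 𝓗)
    (hZK : S.ZeroKnowledge 𝓗 (fixedRelation T M msgLen) Sim)
    (hSE : S.SimulationExtractable 𝓗 (fixedRelation T M msgLen) Sim) :
    (dtlFixed T M msgLen S dataFixed).NoOneMoreRedeeming 𝓗 := by
  intro A hA
  have hA' : PP fun H v => A.muted H (ofList [v.fst, ofList [(v.get 2).fst, (v.get 2).snd, v.get 1, dataFixed]]) :=
    PP.muted_comp hA
  -- The adversary has no oracles, so zero knowledge only exchanges the keys; it is needed since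
  -- extraction works with simulated keys.
  obtain ⟨ε₁, hε₁, h₁⟩ := zk_transfer hZK (F := fun H v => (A.muted H (ofList [v.fst, ofList [(v.get 2).fst,
    (v.get 2).snd, v.get 1, dataFixed]])).bind fun out => ret (test (OneMore M S H v.fst (v.get 2).snd out))) inferInstance
  obtain ⟨A', hA', hA'den⟩ := hA'
  have hI : PP fun H v => (idxC (((v.get 1).get 0).map fun _ => .nil)).bind fun j => ret (pick M H v.fst (v.get 1) j) := by
    unfold pick; infer_instance
  obtain ⟨I, hI, hIden⟩ := hI
  -- The extractability adversary: the first stage followed by the choice of one triple. Only the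
  -- first part of its transcript is shared by the two extractions.
  have hB : PP fun H v => (A'.den H v).bind fun o => I.den H (ofList [v.fst, o]) := by
    have h1 : PP A'.den := .of_code hA'
    have h2 : PP fun H w => I.den H (ofList [w.snd.fst, w.fst]) := PP.subst (.of_code hI) inferInstance
    infer_instance
  obtain ⟨B, hB, hBden⟩ := hB
  obtain ⟨X, hX, hSE⟩ := hSE.exists_extractor hB
  obtain ⟨ps, hps⟩ := exists_size_setup T S Sim
  obtain ⟨po, hpo⟩ := (PP.of_code hA').size
  obtain ⟨pb, hpb⟩ := hA'.bdd
  obtain ⟨k₁, hk₁⟩ := exists_pow_bound (pb.comp (2 * .X + 10 + ps))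
  obtain ⟨k₂, hk₂⟩ := exists_distr_simExtractC T Sim hB
  obtain ⟨k₃, hk₃⟩ := exists_distr_extractC Sim hI (2 * .X + 10 + po.comp (2 * .X + 10 + ps))
  have hG := PP.simExtractC' (Sim := Sim) hB hX k₂
  have h₂ := hM.negl_exG (T := T) (F := fun H v => (simExtractC Sim B X k₂ H v).bind fun r =>
    ret (ofList [(r.get 1).get 2, (r.get 3).get 0, T.keyGen.fn H (ofList [v.fst, v.get 1, (r.get 3).get 1]),
      (r.get 3).get 2])) inferInstance
  have h₃ := hT.2.1.negl (PP.twiceC' (Sim := Sim) hA' hI hX k₁ k₃)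
  -- P bounds both the size of the adversary's output and twice this size plus 1, the two quantities
  -- in the bound for a fixed first stage.
  set P : Polynomial ℕ := 2 * po.comp (2 * .X + 10 + ps) + 1 with hP
  refine Negl.negligible ((hε₁.add (((hSE.add h₂).poly_mul (2 * P)).add (h₃.poly_mul ((2 * P * P) ^ 2)))).mono fun κ => ?_)
  have hsz : ∀ H, ∀ pp ∈ (T.setup.dist H (inp κ [])).support, ∀ c ∈ (Sim.setup.dist H (inp κ [pp])).support,
      (inp κ [pp, c.fst]).size ≤ (2 * .X + 10 + ps : Polynomial ℕ).eval κ := by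
    intro H pp hpp c hc
    have := (hps H κ pp hpp).2 c hc
    have := size_fst_le c
    rw [size_inp]
    simp
    omega
  have hmute : ∀ H v, A'.den H v = ((A.den H (ofList [v.fst, ofList [(v.get 2).fst, (v.get 2).snd, v.get 1, dataFixed]]))).mute :=
    fun H v => by rw [hA'den]; rfl
  have hB' : ∀ (H : Hash) (pp c : Val) (F : Val × List Val × Val → ℝ≥0∞), ex (extract Sim B X H κ pp c.fst c.snd (inp κ [pp, c.fst]) []) F =
      ex ((A'.den H (inp κ [pp, c.fst])).run (ZkSnark.simOracle Sim H κ c.snd) []) fun y =>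
        ex (extract Sim I X H κ pp c.fst c.snd (inp κ [y.1]) y.2.2) F := fun H pp c F =>
    ex_extract_bind (f := fun o => inp κ [o]) (by rw [hBden]; simp [inp]) (hmute H _) F
  have hout : ∀ (H : Hash) (pp c : Val), pp ∈ (T.setup.dist H (inp κ [])).support → c ∈ (Sim.setup.dist H (inp κ [pp])).support →
      ∀ y ∈ ((A'.den H (inp κ [pp, c.fst])).run (ZkSnark.simOracle Sim H κ c.snd) []).support,
      y.1.size ≤ (po.comp (2 * .X + 10 + ps)).eval κ := by
    intro H pp c hpp hc y hy
    have h1 : (y.1, y.2.1) ∈ ((A'.den H (inp κ [pp, c.fst])).exec (ZkSnark.simOracle Sim H κ c.snd) []).support := by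
      rw [← run_map_exec, PMF.mem_support_map_iff]
      exact ⟨y, hy, rfl⟩
    rw [Polynomial.eval_comp]
    exact (hpo H _ _ (out_of_mem_support _ h1)).trans (eval_mono po (hsz H pp hpp c hc))
  have hcoll : ∀ H, ∀ pp ∈ (T.setup.dist H (inp κ [])).support,
      (ex (Sim.setup.dist H (inp κ [pp])) fun c =>
        ex ((A'.den H (inp κ [pp, c.fst])).run (ZkSnark.simOracle Sim H κ c.snd) []) fun y =>
        ex (extract Sim I X H κ pp c.fst c.snd (inp κ [y.1]) y.2.2) fun a =>
        pr (extract Sim I X H κ pp c.fst c.snd (inp κ [y.1]) y.2.2) fun a' => Collision T H κ pp (a.2.2.get 1) (a'.2.2.get 1)) =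
      pr (twiceC Sim A' I X k₁ k₃ H (inp κ [pp])).distr fun out => out.get 0 ∈ keySpace κ ∧ out.get 1 ∈ keySpace κ ∧
      out.get 0 ≠ out.get 1 ∧ T.pk H κ pp (out.get 0) = T.pk H κ pp (out.get 1) := by
    intro H pp hpp
    simp only [twiceC, inp, ofList_cons, ofList_nil, fst_cons, snd_cons, get_one, distr_bind, Code.distr_muted, pr_bind, toNat_unary]
    refine ex_congr fun c hc => ?_
    have h := distr_record Sim (B := A') (H := H) (κ := κ) (N := (κ + 2) ^ k₁) (τ := c.snd)
      (by simpa using hk₁ κ) (hpb H _ _ (hsz H pp hpp c hc)) []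
    simp only [recState, ofList_nil, inp, ofList_cons] at h
    rw [h, ex_map]
    refine ex_congr fun y hy => ?_
    have h' := hk₃ X H κ pp c.fst c.snd (inp κ [y.1]) y.2.2 (by
      have := hout H pp c hpp hc y hy
      rw [size_inp]
      simp only [ofList_cons, ofList_nil, size_cons, size_nil, Polynomial.eval_add, Polynomial.eval_mul,
        Polynomial.eval_X, Polynomial.eval_ofNat]
      omega)
    simp only [inp, ofList_cons, ofList_nil] at h'
    simp only [fst_cons, snd_cons, List.nil_append, h', ex_map, distr_ret]
    refine ex_congr fun a _ => ?_
    rw [pr_eq_ex]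
    refine ex_congr fun a' _ => ?_
    split
    next h =>
      rw [pr_pure_of]
      simpa only [ofList_cons, ofList_nil, get_succ, get_zero, snd_cons, fst_cons, Collision] using h
    next h =>
      rw [pr_pure_of_not]
      simpa only [ofList_cons, ofList_nil, get_succ, get_zero, snd_cons, fst_cons, Collision] using h
  have hmt : ∀ H, ∀ pp ∈ (T.setup.dist H (inp κ [])).support,
      (ex (Sim.setup.dist H (inp κ [pp])) fun c => pr (extract Sim B X H κ pp c.fst c.snd (inp κ [pp, c.fst]) [])
        (Misses T M msgLen S H κ pp c.fst.snd)) ≤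
      (ex (Sim.setup.dist H (inp κ [pp])) fun c => pr (extract Sim B X H κ pp c.fst c.snd (inp κ [pp, c.fst]) []) fun y =>
        S.Accepts H κ c.fst.snd (y.1.get 0) (y.1.get 1) ∧ y.1.get 0 ∉ y.2.1 ∧
          ¬ (fixedRelation T M msgLen).rel H κ pp (y.1.get 0) y.2.2) +
      pr ((simExtractC Sim B X k₂ H (inp κ [pp])).bind fun r =>
        ret (ofList [(r.get 1).get 2, (r.get 3).get 0, T.keyGen.fn H (ofList [unary κ, pp, (r.get 3).get 1]),
          (r.get 3).get 2])).distr (fun out =>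
        ∃ rt, M.root H κ (out.get 0).toList = some rt ∧ M.Accepts H κ (out.get 1) (out.get 2) rt (out.get 3) ∧
        (out.get 0).toList[(out.get 1).toNat]? ≠ some (out.get 2)) := by
    intro H pp hpp
    simp only [distr_bind, hk₂ X H κ pp hpp, distr_ret, pr_bind, ex_bind, ex_map, ← ex_add]
    refine ex_mono fun c _ => pr_or_le.trans (add_le_add le_rfl ?_)
    rw [pr_eq_ex]
    refine ex_mono fun y _ => ?_
    split
    next h =>
      rw [pr_pure_of]
      simpa only [ofList_cons, ofList_nil, get_succ, get_zero, snd_cons, fst_cons, TaggingScheme.pk, inp] using h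
    next => simp
  refine (oneMore_le A κ).trans (le_trans (le_of_eq ?_) ((h₁ κ).trans ?_))
  · refine exG_congr fun H _ pp _ => ex_congr fun crs _ => ?_
    rw [pr_exec_test, Code.muted, exec_mute, pr_map, ← Code.dist_eq]
    simp [inp]
  · rw [add_comm]
    refine add_le_add le_rfl ?_
    rw [← exG_add, ← exG_const_mul, ← exG_const_mul, ← exG_add]
    refine exG_mono fun H hH pp hpp => ?_
    have h5 := mul_le_mul_right (hmt H pp hpp) (((2 * P : Polynomial ℕ).eval κ : ℕ) : ℝ≥0∞)
    have h6 := mul_le_mul_right (hcoll H pp hpp).le ((((2 * P * P) ^ 2 : Polynomial ℕ).eval κ : ℕ) : ℝ≥0∞)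
    refine le_trans ?_ ((add_le_add h5 h6).trans (le_of_eq ?_))
    · rw [← ex_const_mul, ← ex_const_mul, ← ex_add]
      refine ex_mono fun c hc => ?_
      rw [pr_eq_ex (p := extract _ _ _ _ _ _ _ _ _ _), hB', ← ex_const_mul, ← ex_const_mul, ← ex_add]
      have h7 := Comp.ex_run_mute (ZkSnark.simOracle Sim H κ c.snd) (A.den H (ofList [(inp κ [pp, c.fst]).fst,
        ofList [((inp κ [pp, c.fst]).get 2).fst, ((inp κ [pp, c.fst]).get 2).snd, (inp κ [pp, c.fst]).get 1, dataFixed]])) []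
      rw [← hmute] at h7
      rw [pr_exec_test, Code.muted, exec_mute, pr_map, pr_eq_ex, ← h7]
      refine ex_mono fun y hy => ?_
      split
      swap
      · simp
      next h8 =>
      rw [← pr_eq_ex]
      refine (one_le_of_oneMore (I := I) (X := X) (T := T) (msgLen := msgLen) (κ := κ) (pp := pp) (crs := c.fst) (τ := c.snd)
        (Sim := Sim) (l := y.2.2) hIden (by simpa [inp] using h8)).trans ?_
      have h9 := hout H pp c hpp hc y hy
      have h10 : y.1.size ≤ P.eval κ := by
        rw [hP]; simp only [Polynomial.eval_add, Polynomial.eval_mul, Polynomial.eval_one, Polynomial.eval_ofNat]; omega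
      have h11 : 2 * y.1.size + 1 ≤ P.eval κ := by
        rw [hP]; simp only [Polynomial.eval_add, Polynomial.eval_mul, Polynomial.eval_one, Polynomial.eval_ofNat]; omega
      refine add_le_add (mul_le_mul' ?_ le_rfl) (mul_le_mul' ?_ le_rfl)
      · rw [Polynomial.eval_mul, Polynomial.eval_ofNat]
        exact_mod_cast Nat.mul_le_mul_left 2 h11
      · rw [Polynomial.eval_pow, Polynomial.eval_mul, Polynomial.eval_mul, Polynomial.eval_ofNat]
        exact_mod_cast Nat.pow_le_pow_left (Nat.mul_le_mul (Nat.mul_le_mul_left 2 h11) h10) 2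
    · simp [inp]

end

end
end Tumbling

/-! ### Unlinkability -/

namespace Tumbling
open Val

noncomputable section

open Tumbling.Comp
open scoped ENNReal

section
variable {𝓗 : HashModel} {T : TaggingScheme 𝓗} {M : MerkleTree T.pkLen} {msgLen : ℕ → ℕ}
  {S : ZkSnark} {Sim : Simulator} {dataFixed : Val} {α : Type}

/-! ## Public keys do not repeat -/

/-- A redemption creates no key and records only keys that exist. Hence a record with a challenge
key presupposes that the create oracle produced the same public key. -/
theorem redeemO_C {H : Hash} {κ : ℕ} {par m : Val} {s : OracleState} {cpks : List Val} {i : ℕ}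
    {y : Option (Val × Val) × OracleState}
    (hy : y ∈ ((dtlFixed T M msgLen S dataFixed).redeemO H κ par s cpks i m).support) :
    y.2.C = s.C ∧ ∀ r ∈ y.2.R, r ∈ s.R ∨ ∃ k ∈ s.C, k.1 = r.cpk := by
  have hb : ∀ {α β : Type} (p : PMF α) (f : α → PMF β) (b : β), b ∈ (p >>= f).support ↔
    ∃ a ∈ p.support, b ∈ (f a).support := fun p f b => PMF.mem_support_bind_iff p f b
  have hp : ∀ {α : Type} (a b : α), b ∈ (pure a : PMF α).support ↔ b = a := fun a b =>
    PMF.mem_support_pure_iff a b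
  simp only [DTL.redeemO] at hy
  split at hy
  swap
  · rw [hp] at hy; rw [hy]; exact ⟨rfl, fun r hr => .inl hr⟩
  next k st hk hst =>
  split at hy
  swap
  · rw [hp] at hy; rw [hy]; exact ⟨rfl, fun r hr => .inl hr⟩
  rw [hb] at hy
  obtain ⟨o, ho, hy⟩ := hy
  cases o with
  | none => simp only [hp] at hy; rw [hy]; exact ⟨rfl, fun r hr => .inl hr⟩
  | some o =>
    simp only [hp] at hy
    subst hy
    refine ⟨rfl, fun r hr => ?_⟩
    rcases List.mem_append.1 hr with hr | hr
    · exact .inl hr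
    · rw [List.mem_singleton.1 hr]
      exact .inr ⟨k, List.mem_of_find?_eq_some hk, rfl⟩

theorem pr_oracle_created_le {H : Hash} {κ : ℕ} {par q : Val} {x : OracleState} {P : Val → Prop}
    (hx : ¬ ∃ k ∈ x.C, P k.1) :
    pr ((dtlFixed T M msgLen S dataFixed).oracle H κ par x q) (fun y => ∃ k ∈ y.2.C, P k.1) ≤
      pr (sampleKey κ) fun k => P (T.pk H κ (par.get 2) k) := by
  match q with
  | .nil =>
    rw [DTL.oracle, pmf_pure_def, pr_pure_of_not (by exact hx)]; simp
  | .cons .nil data =>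
    simp only [DTL.oracle, DTL.createO, dtlFixed, pmf_bind_def, pmf_pure_def, PMF.bind_bind, PMF.pure_bind, pr_bind]
    rw [pr_eq_ex]
    refine ex_mono fun k _ => ?_
    split
    next h => exact pr_le_one
    next h =>
      rw [pr_pure_of_not]
      rintro ⟨k', hk', h'⟩
      rcases List.mem_append.1 hk' with h1 | h1
      · exact hx ⟨k', h1, h'⟩
      · rw [List.mem_singleton.1 h1] at h'
        exact h h'
  | .cons (.cons a b) q =>
    simp only [DTL.oracle, pmf_bind_def, pmf_pure_def]
    rw [pr_of_forall_not]
    · simp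
    · intro y hy
      rw [PMF.mem_support_bind_iff] at hy
      obtain ⟨z, hz, hy⟩ := hy
      rw [PMF.mem_support_pure_iff] at hy
      rw [hy, (redeemO_C hz).1]
      exact hx

/-- Each question samples at most one key, independently of the past, and at most m questions are
asked; so this is a union bound that holds for adaptive adversaries. -/
theorem pr_exec_created_le (c : Comp α) {H : Hash} {κ B m : ℕ} {par : Val} {x : OracleState} {P : Val → Prop}
    (hc : Bdd B m c) (hx : ¬ ∃ k ∈ x.C, P k.1) :
    pr (c.exec ((dtlFixed T M msgLen S dataFixed).oracle H κ par) x) (fun y => ∃ k ∈ y.2.C, P k.1) ≤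
      m * pr (sampleKey κ) fun k => P (T.pk H κ (par.get 2) k) := by
  induction c generalizing m x with
  | ret a => rw [exec_ret, pr_pure_of_not (by exact hx)]; simp
  | flip k ih =>
    rw [exec_flip, pr_bind]
    exact ex_le _ fun b _ => ih b (hc b) hx
  | query n q k ih =>
    match m, hc with
    | m + 1, hc =>
      rw [exec_query, pr_bind, Nat.cast_succ, add_mul, one_mul, add_comm]
      refine le_trans ?_ (add_le_add (pr_oracle_created_le (T := T) (M := M) (msgLen := msgLen) (S := S)
        (dataFixed := dataFixed) (q := q) hx) le_rfl)
      rw [pr_eq_ex (p := (dtlFixed T M msgLen S dataFixed).oracle H κ par x q), ← ex_const (p :=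
        (dtlFixed T M msgLen S dataFixed).oracle H κ par x q) (_ * _), ← ex_add]
      refine ex_mono fun y _ => ?_
      split
      next h => exact le_add_right pr_le_one
      next h => exact le_add_left (ih _ (hc.2.2 _) h)

/-- Redeemed keys are keys that were created. -/
theorem exists_created_of_redeemed {A : Code} {H : Hash} {κ B m : ℕ} {pp key vk a : Val} (hA : Bdd B m (A.den H a))
    {y : Val × OracleState} (hy : y ∈ (dtlExec T M msgLen dataFixed S A H κ pp key vk a).support) :
    ∀ r ∈ y.2.R, ∃ k ∈ y.2.C, k.1 = r.cpk := by
  refine inv_of_mem_support_exec (fun x : OracleState => ∀ r ∈ x.R, ∃ k ∈ x.C, k.1 = r.cpk) B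
    (fun x q hx _ y hy => ?_) (A.den H a) hA (x := ⟨[], []⟩) (by simp) hy
  match q with
  | .nil =>
    rw [DTL.oracle, pmf_pure_def, PMF.mem_support_pure_iff] at hy
    rw [hy]; exact hx
  | .cons .nil data =>
    simp only [DTL.oracle, DTL.createO, pmf_bind_def, pmf_pure_def, PMF.mem_support_bind_iff,
      PMF.mem_support_pure_iff] at hy
    obtain ⟨k, -, rfl⟩ := hy
    intro r hr
    obtain ⟨k', hk', h⟩ := hx r hr
    exact ⟨k', List.mem_append_left _ hk', h⟩
  | .cons (.cons a b) q =>
    simp only [DTL.oracle, pmf_bind_def, pmf_pure_def, PMF.mem_support_bind_iff] at hy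
    obtain ⟨z, hz, hy⟩ := hy
    rw [PMF.mem_support_pure_iff] at hy
    intro r hr
    rw [hy] at hr ⊢
    obtain ⟨h1, h2⟩ := redeemO_C hz
    simp only at hr ⊢
    rw [h1]
    rcases h2 r hr with h3 | h3
    · exact hx r h3
    · exact h3

/-- Two independent keys are equal with probability at most 2 ^ (-κ); if they differ and their
public keys agree, sampling them is a collision finder. -/
theorem pr_same_pk_negl (hT : T.CollisionResistant) : Negl fun κ => exG T κ fun H pp =>
    ex (sampleKey κ) fun k => pr (sampleKey κ) fun k' => T.pk H κ pp k' = T.pk H κ pp k := by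
  have hF : PP fun _ v => (keyC v.fst).bind fun k => (keyC v.fst).bind fun k' => ret (ofList [k, k']) := by
    have : PP fun _ w => keyC w.snd.fst := inferInstance
    infer_instance
  refine ((hT.negl hF).add Negl.half_pow).mono fun κ => ?_
  have h1 : (2⁻¹ : ℝ≥0∞) ^ κ ≥ exG T κ fun _ _ => ex (sampleKey κ) fun k => pr (sampleKey κ) (· = k) :=
    ex_le _ fun _ _ => ex_le _ fun _ _ => ex_le _ fun _ _ => pr_sampleKey_le κ _
  refine le_trans ?_ (add_le_add le_rfl h1)
  rw [← exG_add]
  refine exG_mono fun H _ pp _ => ?_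
  simp only [inp, ofList_cons, fst_cons, distr_bind, distr_keyC, toNat_unary, pr_bind, distr_ret]
  rw [← ex_add]
  refine ex_mono fun k hk => ?_
  rw [pr_eq_ex, pr_eq_ex, ← ex_add]
  refine ex_mono fun k' hk' => ?_
  split
  swap
  · simp
  next h =>
  by_cases hkk : k' = k
  · exact le_add_left (by rw [if_pos hkk])
  · refine le_add_right ?_
    rw [pr_pure_of]
    simp only [get_succ, get_zero, fst_cons, snd_cons]
    exact ⟨mem_keySpace_of_mem_support hk, mem_keySpace_of_mem_support hk', fun e => hkk e.symm, h.symm⟩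

end

end
end Tumbling

namespace Tumbling
open Val

noncomputable section

open Tumbling.Comp
open scoped ENNReal

section
variable {𝓗 : HashModel} {T : TaggingScheme 𝓗} {M : MerkleTree T.pkLen} {msgLen : ℕ → ℕ}
  {hl : PolyLength msgLen} {S : ZkSnark} {Sim : Simulator} {dataFixed : Val}

/-! ## Unlinkability -/

/-- The question for a redemption from a list of two keys. -/
def pairQ (p₀ p₁ m : Val) : Val := ofList [ofList [p₀, p₁], .nil, m]

variable (T M) in
/-- A redemption. -/
def redemption (S : ZkSnark) (H : Hash) (κ : ℕ) (pp key k q : Val) : PMF Val :=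
  (S.prove.dist H (inp κ [key, stmtF M H (unary κ) (entry T true H (unary κ) pp k) q,
    witF M H (unary κ) (entry T true H (unary κ) pp k) q])).map fun π => .cons (T.tag H κ pp k) π

variable (T M msgLen dataFixed) in
/-- The state of the first stage, the two public keys and the two redemptions. -/
def challenge (S : ZkSnark) (A : Code) (H : Hash) (κ : ℕ) (pp key crs : Val) : PMF Val :=
  (uniformBits (msgLen κ)).bind fun m =>
  (A.dist H (inp κ [ofList [crs.fst, crs.snd, pp, dataFixed], m])).bind fun a =>
  (sampleKey κ).bind fun k₀ => (sampleKey κ).bind fun k₁ =>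
  (redemption T M S H κ pp key k₀ (pairQ (T.pk H κ pp k₀) (T.pk H κ pp k₁) m)).bind fun r₀ =>
  (redemption T M S H κ pp key k₁ (pairQ (T.pk H κ pp k₀) (T.pk H κ pp k₁) m)).bind fun r₁ =>
  PMF.pure (ofList [a.get 2, T.pk H κ pp k₀, T.pk H κ pp k₁, r₀, r₁])

/-- The input of the second stage. -/
def secondArg (κV x b : Val) : Val :=
  if b = .nil then ofList [κV, x.get 0, x.get 1, x.get 2, x.get 3, x.get 4]
  else ofList [κV, x.get 0, x.get 1, x.get 2, x.get 4, x.get 3]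

/-- The length 2 = 2 ^ 1 is supported, so redemptions from a list of two honest keys never return ⊥.
-/
theorem root_pair (hM : M.Correct 𝓗) {H : Hash} {κ : ℕ} (hH : H ∈ (𝓗 κ).support) {p₀ p₁ : Val}
    (h₀ : p₀ ∈ bitStrings (T.pkLen κ)) (h₁ : p₁ ∈ bitStrings (T.pkLen κ)) :
    ∃ rt, M.root H κ [p₀, p₁] = some rt :=
  Option.isSome_iff_exists.1 ((hM κ H hH [p₀, p₁]).1 ⟨by simpa using M.two_pow_mem 1, by simp [h₀, h₁]⟩)

theorem redeem_pair (hM : M.Correct 𝓗) {H : Hash} {κ : ℕ} (hH : H ∈ (𝓗 κ).support) {par k p₀ p₁ m : Val}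
    (h₀ : p₀ ∈ bitStrings (T.pkLen κ)) (h₁ : p₁ ∈ bitStrings (T.pkLen κ))
    (hk : T.pk H κ (par.get 2) k ∈ [p₀, p₁]) :
    ((dtlFixed T M msgLen S dataFixed).redeem H κ par [p₀, p₁] k m).map redeemReply =
      redemption T M S H κ (par.get 2) (par.get 0) k (pairQ p₀ p₁ m) := by
  obtain ⟨rt, hrt⟩ := root_pair hM hH h₀ h₁
  rw [redeem_eq hk hrt, PMF.map_comp, redemption]
  have h2 : M.init.fn H (inp κ [ofList [p₀, p₁]]) = rt := (toOption_eq_some.1 hrt).1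
  rw [← h2]
  rfl

theorem ex_redeem_pair (hM : M.Correct 𝓗) {H : Hash} {κ : ℕ} (hH : H ∈ (𝓗 κ).support) {par k p₀ p₁ m : Val}
    (h₀ : p₀ ∈ bitStrings (T.pkLen κ)) (h₁ : p₁ ∈ bitStrings (T.pkLen κ))
    (hk : T.pk H κ (par.get 2) k ∈ [p₀, p₁]) (F : Val → ℝ≥0∞) :
    ex ((dtlFixed T M msgLen S dataFixed).redeem H κ par [p₀, p₁] k m) (fun o => F (redeemReply o)) =
      ex (redemption T M S H κ (par.get 2) (par.get 0) k (pairQ p₀ p₁ m)) F := by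
  rw [← redeem_pair hM hH h₀ h₁ hk, ex_map]

/-- The challenge keys are not stored in the oracles' state, and their redemptions always succeed;
so the challenge has a law of its own, before the second stage starts from empty oracles. -/
theorem unlink_eq (hM : M.Correct 𝓗) (A₁ A₂ : Code) (κ : ℕ) :
    (pr ((dtlFixed T M msgLen S dataFixed).unlinkGame 𝓗 A₁ A₂ κ) fun P => P) =
    exG T κ fun H pp => ex (S.setup.dist H (inp κ [pp])) fun crs =>
      ex (challenge T M msgLen dataFixed S A₁ H κ pp crs.fst crs) fun x => ex coin fun b =>
        pr (dtlExec T M msgLen dataFixed S A₂ H κ pp crs.fst crs.snd (secondArg (unary κ) x (ofBool b))) fun y =>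
          (b = true ↔ y.1 ≠ .nil) ∧ ¬ ∃ r ∈ y.2.R, r.cpk = x.get 1 ∨ r.cpk = x.get 2 := by
  have h0 : ∀ H κ, (dtlFixed T M msgLen S dataFixed).setup H κ = (T.setup.dist H (inp κ [])).bind fun pp =>
    (S.setup.dist H (inp κ [pp])).bind fun crs => PMF.pure (ofList [crs.fst, crs.snd, pp, dataFixed]) := fun _ _ => rfl
  have h1 : (dtlFixed T M msgLen S dataFixed).msgLen = msgLen := rfl
  have h2 : ∀ H κ par d, (dtlFixed T M msgLen S dataFixed).create H κ par d = (sampleKey κ).bind fun k =>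
    PMF.pure (T.pk H κ (par.get 2) k, k) := fun _ _ _ _ => rfl
  simp only [DTL.unlinkGame, h0, h1, h2, pmf_bind_def, pmf_pure_def, PMF.bind_bind, PMF.pure_bind, pr_bind, exG,
    Code.play_eq]
  refine ex_congr fun H hH => ex_congr fun pp hpp => ex_congr fun crs _ => ?_
  simp only [challenge, ex_bind, ex_pure]
  refine ex_congr fun m _ => ex_congr fun a _ => ex_congr fun k₀ hk₀ => ex_congr fun k₁ hk₁ => ?_
  have hm : ∀ k ∈ (sampleKey κ).support, T.pk H κ pp k ∈ bitStrings (T.pkLen κ) := fun k hk =>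
    T.keyGen_mem κ H hH pp hpp _ (mem_keySpace_of_mem_support hk)
  have e := fun k hk F => ex_redeem_pair (S := S) (dataFixed := dataFixed) (msgLen := msgLen) (k := k) (m := m)
    (par := ofList [crs.fst, crs.snd, pp, dataFixed]) hM hH (hm _ hk₀) (hm _ hk₁) hk F
  have e₀ := e k₀ (by simp)
  have e₁ := e k₁ (by simp)
  have hp : (ofList [crs.fst, crs.snd, pp, dataFixed]).get 2 = pp := by simp
  have hp' : (ofList [crs.fst, crs.snd, pp, dataFixed]).get 0 = crs.fst := by simp
  rw [hp, hp'] at e₀ e₁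
  rw [hp, ← e₀]
  refine ex_congr fun o₀ _ => ?_
  rw [← e₁]
  refine ex_congr fun o₁ _ => ex_congr fun b _ => ?_
  rw [dtlExec, ← run_map_exec, pr_map, pr_eq_ex (p := Comp.run _ _ _)]
  refine Eq.trans (ex_congr fun y _ => pr_pure _ _) ?_
  cases b <;> simp [secondArg, inp]

end

end
end Tumbling

namespace Tumbling
open Val

noncomputable section

open Tumbling.Comp
open scoped ENNReal

section
variable {𝓗 : HashModel} {T : TaggingScheme 𝓗} {M : MerkleTree T.pkLen} {msgLen : ℕ → ℕ}
  {hl : PolyLength msgLen} {S : ZkSnark} {Sim : Simulator} {dataFixed : Val}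

variable (T M) in
/-- A redemption with a proof from an oracle. -/
def redemptionC (d : ℕ) (H : Hash) (κV pp k q : Val) : Comp Val :=
  (queryC (unary ((κV.toNat + 2) ^ d)).size (ask M true H κV (entry T true H κV pp k) q)).bind fun r =>
    ret (.cons (T.tagEval.fn H (ofList [κV, pp, k])) r.fst)

instance PP.redemptionC' (d : ℕ) {f g h k : Hash → Val → Val} [hf : PolyFn f] [hg : PolyFn g] [hh : PolyFn h]
    [hk : PolyFn k] : PP fun H v => redemptionC T M d H (f H v) (g H v) (h H v) (k H v) := by
  refine PP.subst₄ (G := redemptionC T M d) ?_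
  unfold redemptionC
  infer_instance

instance PP.pairQ' {f g h : Hash → Val → Val} [hf : PolyFn f] [hg : PolyFn g] [hh : PolyFn h] :
    PolyFn fun H v => pairQ (f H v) (g H v) (h H v) := by
  unfold pairQ; infer_instance

instance PP.secondArg' {f g h : Hash → Val → Val} [hf : PolyFn f] [hg : PolyFn g] [hh : PolyFn h] :
    PolyFn fun H v => secondArg (f H v) (g H v) (h H v) := by
  unfold secondArg; infer_instance

variable (T M) in
/-- Two redemptions with proofs from an oracle. -/
def redemptionsC (d : ℕ) (H : Hash) (κV pp k₀ k₁ m a : Val) : Comp Val :=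
  (redemptionC T M d H κV pp k₀ (pairQ (T.keyGen.fn H (ofList [κV, pp, k₀]))
    (T.keyGen.fn H (ofList [κV, pp, k₁])) m)).bind fun r₀ =>
  (redemptionC T M d H κV pp k₁ (pairQ (T.keyGen.fn H (ofList [κV, pp, k₀]))
    (T.keyGen.fn H (ofList [κV, pp, k₁])) m)).bind fun r₁ =>
  ret (ofList [a.get 2, T.keyGen.fn H (ofList [κV, pp, k₀]), T.keyGen.fn H (ofList [κV, pp, k₁]), r₀, r₁])

theorem PP.redemptionsC' (d : ℕ) {f g h k l o : Hash → Val → Val} [hf : PolyFn f] [hg : PolyFn g] [hh : PolyFn h]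
    [hk : PolyFn k] [hl : PolyFn l] [ho : PolyFn o] :
    PP fun H v => redemptionsC T M d H (f H v) (g H v) (h H v) (k H v) (l H v) (o H v) := by
  have : PP fun H v => redemptionsC T M d H (v.get 0) (v.get 1) (v.get 2) (v.get 3) (v.get 4) (v.snd.get 4) := by
    unfold redemptionsC; infer_instance
  have := PP.subst (f := fun H v => ofList [f H v, g H v, h H v, k H v, l H v, o H v]) this inferInstance
  simpa using this

variable (T M hl dataFixed) in
/-- The challenge as a program with an oracle for proofs. -/
def challengeC (A : Code) (d : ℕ) (H : Hash) (v : Val) : Comp Val :=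
  (bitsC (hl.len H v.fst)).bind fun m =>
  (A.muted H (ofList [v.fst, ofList [(v.get 2).fst, (v.get 2).snd, v.get 1, dataFixed], m])).bind fun a =>
  (keyC v.fst).bind fun k₀ => (keyC v.fst).bind fun k₁ => redemptionsC T M d H v.fst (v.get 1) k₀ k₁ m a

theorem PP.challengeC' {A : Code} (hA : A.PPT) (d : ℕ) : PP (challengeC T M hl dataFixed A d) := by
  have h1 : PP fun H w => A.muted H (ofList [w.snd.fst, ofList [(w.snd.get 2).fst, (w.snd.get 2).snd, w.snd.get 1,
    dataFixed], w.fst]) := PP.muted_comp hA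
  have h2 : PP fun H w => redemptionsC T M d H w.snd.snd.snd.snd.fst (w.snd.snd.snd.snd.get 1) w.snd.fst w.fst
    w.snd.snd.snd.fst w.snd.snd.fst := PP.redemptionsC' d
  have h3 : PP fun H w => (keyC w.snd.snd.fst).bind fun k₀ => (keyC w.snd.snd.fst).bind fun k₁ =>
    redemptionsC T M d H w.snd.snd.fst (w.snd.snd.get 1) k₀ k₁ w.snd.fst w.fst :=
    PP.bind (hF := inferInstance) (hK := PP.bind (hF := inferInstance) (hK := h2))
  exact PP.bind (hF := inferInstance) (hK := PP.bind (hF := h1) (hK := h3))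

theorem PolyLength.len_toNat (hl : PolyLength msgLen) (H : Hash) (κ : ℕ) : (hl.len H (unary κ)).toNat = msgLen κ := by
  rw [hl.len_unary, toNat_unary]

theorem exec_redemptionC {O : Unit → Val → PMF (Val × Unit)} {d : ℕ} {H : Hash} {κ : ℕ} {pp key k q : Val}
    (hO : O () (ofList [stmtF M H (unary κ) (entry T true H (unary κ) pp k) q,
        witF M H (unary κ) (entry T true H (unary κ) pp k) q]) =
      (S.prove.dist H (inp κ [key, stmtF M H (unary κ) (entry T true H (unary κ) pp k) q,
        witF M H (unary κ) (entry T true H (unary κ) pp k) q])).map fun π => (ofList [π], ()))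
    (hN : ∀ π ∈ (S.prove.dist H (inp κ [key, stmtF M H (unary κ) (entry T true H (unary κ) pp k) q,
        witF M H (unary κ) (entry T true H (unary κ) pp k) q])).support, π.size ≤ (κ + 2) ^ d) :
    (redemptionC T M d H (unary κ) pp k q).exec O () = (redemption T M S H κ pp key k q).map fun r => (r, ()) := by
  simp only [redemptionC, queryC, exec_bind, exec_query, ask, hO, redemption, PMF.map_comp, PMF.bind_map, PMF.bind_bind,
    exec_ret, toNat_unary]
  rw [← PMF.bind_pure_comp]
  refine bind_congr_support fun π hπ => ?_
  have : (ofList [π]).size ≤ (unary ((κ + 2) ^ d)).size := by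
    have := hN π hπ
    have := Nat.one_le_pow d (κ + 2) (by omega)
    simp; omega
  simp only [Function.comp_def, fit, if_pos this, PMF.pure_bind]
  rfl

/-- In the challenge, too, the proofs come with honest witnesses and can be asked from the oracle of
the zero knowledge experiment. Public keys and message have known lengths, which bounds the question
by b. -/
theorem exec_challengeC {O : Unit → Val → PMF (Val × Unit)} (hM : M.Correct 𝓗) {A : Code} {b d : ℕ} {H : Hash} {κ : ℕ}
    {pp key crs : Val} (hH : H ∈ (𝓗 κ).support) (hs : pp ∈ (T.setup.dist H (inp κ [])).support)
    (hO : ∀ stmt wit, (fixedRelation T M msgLen).rel H κ pp stmt wit → O () (ofList [stmt, wit]) =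
      (S.prove.dist H (inp κ [key, stmt, wit])).map fun π => (ofList [π], ()))
    (hb : 8 * T.pkLen κ + 4 * msgLen κ + 20 ≤ b)
    (hN : ∀ k ∈ keySpace κ, ∀ q : Val, q.size ≤ b → Valid T M hl H (unary κ) (entry T true H (unary κ) pp k) q →
      ∀ π ∈ (S.prove.dist H (inp κ [key, stmtF M H (unary κ) (entry T true H (unary κ) pp k) q,
        witF M H (unary κ) (entry T true H (unary κ) pp k) q])).support, π.size ≤ (κ + 2) ^ d) :
    (challengeC T M hl dataFixed A d H (inp κ [pp, crs])).exec O () =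
      (challenge T M msgLen dataFixed S A H κ pp key crs).map fun x => (x, ()) := by
  have hA : ∀ v, (A.muted H v).exec O () = (A.dist H v).map fun a => (a, ()) := fun v => by
    rw [Code.muted, exec_mute, ← Code.dist_eq]
  simp only [challengeC, challenge, inp, ofList_cons, ofList_nil, fst_cons, snd_cons, get_one, get_two, exec_bind, exec_bitsC,
    exec_keyC, hA, PMF.bind_map, PMF.map_bind, Function.comp_def, toNat_unary, hl.len_toNat]
  refine bind_congr_support fun m hm => ?_
  congr 1; funext a
  refine bind_congr_support fun k₀ hk₀ => bind_congr_support fun k₁ hk₁ => ?_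
  rw [support_uniformBits] at hm
  replace hk₀ := mem_keySpace_of_mem_support hk₀
  replace hk₁ := mem_keySpace_of_mem_support hk₁
  have h₀ := T.keyGen_mem κ H hH pp hs _ hk₀
  have h₁ := T.keyGen_mem κ H hH pp hs _ hk₁
  obtain ⟨rt, hrt⟩ := root_pair hM hH h₀ h₁
  obtain ⟨hrt, hrt'⟩ := toOption_eq_some.1 hrt
  have hq : (pairQ (T.pk H κ pp k₀) (T.pk H κ pp k₁) m).size ≤ b := by
    have := size_of_mem_bitStrings h₀
    have := size_of_mem_bitStrings h₁
    have := size_of_mem_bitStrings hm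
    simp [pairQ]
    simp only [TaggingScheme.pk] at *
    omega
  have key : ∀ k ∈ keySpace κ, T.pk H κ pp k ∈ [T.pk H κ pp k₀, T.pk H κ pp k₁] →
      (redemptionC T M d H (unary κ) pp k (pairQ (T.pk H κ pp k₀) (T.pk H κ pp k₁) m)).exec O () =
        (redemption T M S H κ pp key k (pairQ (T.pk H κ pp k₀) (T.pk H κ pp k₁) m)).map fun r => (r, ()) := by
    intro k hk hmem
    have hv : Valid T M hl H (unary κ) (entry T true H (unary κ) pp k) (pairQ (T.pk H κ pp k₀) (T.pk H κ pp k₁) m) := by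
      refine ⟨hrt', ?_, ?_⟩
      · rw [hl.len_toNat]; exact hm
      · rw [PolyLength.len_toNat]; exact T.tagEval_mem κ H hH pp hs k hk
    refine exec_redemptionC (hO _ _ (rel_of_valid hM hH hk ?_ hv)) (hN k hk _ hq hv)
    simpa [pairQ, entry, TaggingScheme.pk, inp] using hmem
  have e₀ := key k₀ hk₀ (by simp)
  have e₁ := key k₁ hk₁ (by simp)
  simp only [TaggingScheme.pk, inp, ofList_cons, ofList_nil] at e₀ e₁ ⊢
  simp only [redemptionsC, exec_bind, ofList_cons, ofList_nil, e₀, e₁, Function.comp_def, exec_ret, PMF.map, PMF.bind_bind,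
    PMF.pure_bind, get_two]

end

end
end Tumbling

namespace Tumbling
open Val

noncomputable section

open Tumbling.Comp
open scoped ENNReal

section
variable {𝓗 : HashModel} {T : TaggingScheme 𝓗} {M : MerkleTree T.pkLen} {msgLen : ℕ → ℕ}
  {S : ZkSnark} {Sim : Simulator} {dataFixed : Val}

theorem size_get_le (v : Val) (i : ℕ) : (v.get i).size ≤ v.size := by
  induction i generalizing v with
  | zero => rw [get_zero]; exact size_fst_le v
  | succ i ih => rw [get_succ]; exact (ih _).trans (size_snd_le v)

theorem size_secondArg (κ : ℕ) (x b : Val) : (secondArg (unary κ) x b).size ≤ 2 * κ + 20 + 5 * x.size := by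
  have h := fun i => size_get_le x i
  have := h 0; have := h 1; have := h 2; have := h 3; have := h 4
  rw [secondArg]
  split <;>
  · simp only [ofList_cons, ofList_nil, size_cons, size_nil, size_unary]
    omega

variable (T M msgLen dataFixed) in
/-- The challenge is what a program computes with the oracle `O` for proofs, and bounds for the second stage. -/
structure ChallengeBound (hl : PolyLength msgLen) (A₁ A₂ : Code) (b d d₂ : ℕ) (S : ZkSnark) (H : Hash) (κ : ℕ)
    (pp key crs : Val) (O : Unit → Val → PMF (Val × Unit)) : Prop where
  exec : (challengeC T M hl dataFixed A₁ d H (inp κ [pp, crs])).exec O () =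
      (challenge T M msgLen dataFixed S A₁ H κ pp key crs).map fun x => (x, ())
  bdd : ∀ x ∈ (challenge T M msgLen dataFixed S A₁ H κ pp key crs).support, ∀ c,
    Bdd b b (A₂.den H (secondArg (unary κ) x c))
  rel : ∀ stmt wit, (fixedRelation T M msgLen).rel H κ pp stmt wit → O () (ofList [stmt, wit]) =
        (S.prove.dist H (inp κ [key, stmt, wit])).map fun π => (ofList [π], ())
  proof_le : ∀ k ∈ keySpace κ, ∀ q : Val, q.size ≤ b → Valid T M hl H (unary κ) (entry T true H (unary κ) pp k) q →
      ∀ π ∈ (S.prove.dist H (inp κ [key, stmtF M H (unary κ) (entry T true H (unary κ) pp k) q,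
        witF M H (unary κ) (entry T true H (unary κ) pp k) q])).support, π.size ≤ (κ + 2) ^ d₂

/-- There are two bounds, d for the proofs in the challenge and d₂ for those of the second stage:
the size of the challenge, and with it the running time of `A₂`, depends on d. -/
theorem exists_challengeBound (hl : PolyLength msgLen) (hM : M.Correct 𝓗) {A₁ A₂ : Code} (hA₁ : A₁.PPT)
    (hA₂ : A₂.PPT) : ∃ (b : Polynomial ℕ) (d d₂ : ℕ), (∀ κ, b.eval κ ≤ (κ + 2) ^ d₂) ∧
    ∀ κ, ∀ H ∈ (𝓗 κ).support, ∀ pp ∈ (T.setup.dist H (inp κ [])).support,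
      (∀ crs ∈ (S.setup.dist H (inp κ [pp])).support, ChallengeBound T M msgLen dataFixed hl A₁ A₂ (b.eval κ) d d₂
        S H κ pp crs.fst crs (S.proveOracle (fixedRelation T M msgLen) H κ pp crs)) ∧
      ∀ c ∈ (Sim.setup.dist H (inp κ [pp])).support, ChallengeBound T M msgLen dataFixed hl A₁ A₂ (b.eval κ) d d₂
        (simSnark S Sim) H κ pp c.snd c.fst (ZkSnark.simProveOracle (fixedRelation T M msgLen) Sim H κ pp c.snd) := by
  obtain ⟨pk, hpk⟩ := T.pkLen_poly.bound
  obtain ⟨pm, hpm⟩ := hl.bound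
  obtain ⟨ps, hps⟩ := exists_size_setup T S Sim
  obtain ⟨b₁, d, -, hb₁, -, hf₁⟩ := exists_fuel (T := T) M hl S Sim hA₁ (8 * pk + 4 * pm + 20)
  obtain ⟨px, hpx⟩ := (PP.challengeC' (T := T) (M := M) (hl := hl) (dataFixed := dataFixed) hA₁ d).size
  obtain ⟨b, d₂, hb, -, hbdd, hf₂⟩ := exists_fuel (T := T) M hl S Sim hA₂ (2 * .X + 20 + 5 * px.comp (2 * .X + 10 + ps))
  refine ⟨b, d, d₂, hb, fun κ H hH pp hpp => ?_⟩
  have main : ∀ (S' : ZkSnark) (crs key : Val) (O : Unit → Val → PMF (Val × Unit)), pp.size + crs.size ≤ ps.eval κ →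
      (∀ stmt wit, (fixedRelation T M msgLen).rel H κ pp stmt wit → O () (ofList [stmt, wit]) =
        (S'.prove.dist H (inp κ [key, stmt, wit])).map fun π => (ofList [π], ())) →
      (∀ k' ∈ keySpace κ, ∀ q : Val, q.size ≤ b₁.eval κ → Valid T M hl H (unary κ) (entry T true H (unary κ) pp k') q →
        ∀ π ∈ (S'.prove.dist H (inp κ [key, stmtF M H (unary κ) (entry T true H (unary κ) pp k') q,
        witF M H (unary κ) (entry T true H (unary κ) pp k') q])).support, π.size ≤ (κ + 2) ^ d) →
      (∀ k' ∈ keySpace κ, ∀ q : Val, q.size ≤ b.eval κ → Valid T M hl H (unary κ) (entry T true H (unary κ) pp k') q →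
        ∀ π ∈ (S'.prove.dist H (inp κ [key, stmtF M H (unary κ) (entry T true H (unary κ) pp k') q,
        witF M H (unary κ) (entry T true H (unary κ) pp k') q])).support, π.size ≤ (κ + 2) ^ d₂) →
      ChallengeBound T M msgLen dataFixed hl A₁ A₂ (b.eval κ) d d₂ S' H κ pp key crs O := by
    intro S' crs key O hsz hO h₁ h₂
    have e := exec_challengeC (A := A₁) (dataFixed := dataFixed) (crs := crs) hM hH hpp hO (b := b₁.eval κ) (by
      have := hpk κ; have := hpm κ; have := hb₁ κ
      simp only [Polynomial.eval_add, Polynomial.eval_mul, Polynomial.eval_ofNat] at this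
      omega) h₁
    refine ⟨e, fun x hx c => hbdd κ H _ ((size_secondArg κ x c).trans ?_), hO, h₂⟩
    have h3 : (x, ()) ∈ ((challengeC T M hl dataFixed A₁ d H (inp κ [pp, crs])).exec O ()).support := by
      rw [e, PMF.mem_support_map_iff]
      exact ⟨x, hx, rfl⟩
    have h4 := hpx H _ _ (out_of_mem_support _ h3)
    have h5 := eval_mono px (show (inp κ [pp, crs]).size ≤ 2 * κ + 10 + ps.eval κ by
      rw [size_inp]; simp; omega)
    simp only [Polynomial.eval_add, Polynomial.eval_mul, Polynomial.eval_ofNat, Polynomial.eval_X, Polynomial.eval_comp]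
    dsimp only at h4 h5
    omega
  refine ⟨fun crs hcrs => ?_, fun c hc => ?_⟩
  · exact main _ _ _ _ ((hps H κ pp hpp).1 crs hcrs) (fun _ _ => proveOracle_of_rel)
      (fun k' hk' q hq _ => (hf₁ κ H pp hpp).1 crs hcrs k' hk' q hq)
      (fun k' hk' q hq _ => (hf₂ κ H pp hpp).1 crs hcrs k' hk' q hq)
  · exact main _ _ _ _ (by have := (hps H κ pp hpp).2 c hc; have := size_fst_le c; omega)
      (fun _ _ => simProveOracle_of_rel)
      (fun k' hk' q hq hv => by rw [simSnark_prove]; exact (hf₁ κ H pp hpp).2 c hc _ q hq hv)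
      (fun k' hk' q hq hv => by rw [simSnark_prove]; exact (hf₂ κ H pp hpp).2 c hc _ q hq hv)

/-- The guess `o` for the bit `b` is right, or wrong. -/
def Hit (f : Bool) (b o : Val) : Prop :=
  match f with
  | true => b ≠ .nil ↔ o ≠ .nil
  | false => ¬ (b ≠ .nil ↔ o ≠ .nil)

instance PP.hit' (f : Bool) {g h : Hash → Val → Val} [hg : PolyFn g] [hh : PolyFn h] :
    PolyFn fun H v => test (Hit f (g H v) (h H v)) := by
  cases f <;> (unfold Hit; infer_instance)

variable (T M msgLen dataFixed) in
/-- The probability of a right, or wrong, guess. -/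
def prHit (f : Bool) (S : ZkSnark) (A₁ A₂ : Code) (H : Hash) (κ : ℕ) (pp key crs : Val) : ℝ≥0∞ :=
  ex (challenge T M msgLen dataFixed S A₁ H κ pp key crs) fun x => ex coin fun b =>
    pr (dtlExec T M msgLen dataFixed S A₂ H κ pp key crs.snd (secondArg (unary κ) x (ofBool b))) fun y =>
      Hit f (ofBool b) y.1

theorem exec_flipC {σ : Type} {O : σ → Val → PMF (Val × σ)} {s : σ} :
    flipC.exec O s = coin.map fun b => (ofBool b, s) := by
  simp [flipC]; rfl

/-- The proofs of the challenge and those of the redeem oracle are replaced in a single step, as one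
program asks for all of them. -/
theorem prHit_transfer (dataFixed : Val) (hl : PolyLength msgLen) (hM : M.Correct 𝓗)
    (hZK : S.ZeroKnowledge 𝓗 (fixedRelation T M msgLen) Sim) {A₁ A₂ : Code} (hA₁ : A₁.PPT) (hA₂ : A₂.PPT) (f : Bool) :
    ∃ ε, Negl ε ∧ ∀ κ,
    (exG T κ fun H pp => ex (S.setup.dist H (inp κ [pp])) fun crs =>
      prHit T M msgLen dataFixed f S A₁ A₂ H κ pp crs.fst crs) ≤
    (exG T κ fun H pp => ex (Sim.setup.dist H (inp κ [pp])) fun c =>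
      prHit T M msgLen dataFixed f (simSnark S Sim) A₁ A₂ H κ pp c.snd c.fst) + ε κ := by
  obtain ⟨b, d, d₂, hb, hC⟩ := exists_challengeBound (T := T) (M := M) (S := S) (Sim := Sim) (dataFixed := dataFixed)
    hl hM hA₁ hA₂
  have hF : PP fun H v => (challengeC T M hl dataFixed A₁ d H v).bind fun x => flipC.bind fun b =>
      (world T M hl true true A₂ H (secondArg v.fst x b) (world₀ v.fst (unary ((v.fst.toNat + 2) ^ d₂)) (v.get 1))).bind
        fun w => ret (test (Hit f b w.fst)) := by
    have h1 : PolyFn fun H w => world₀ w.snd.snd.fst (unary ((w.snd.snd.fst.toNat + 2) ^ d₂)) (w.snd.snd.get 1) := by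
      unfold world₀; infer_instance
    have h2 : PP fun H w => world T M hl true true A₂ H (secondArg w.snd.snd.fst w.snd.fst w.fst)
        (world₀ w.snd.snd.fst (unary ((w.snd.snd.fst.toNat + 2) ^ d₂)) (w.snd.snd.get 1)) :=
      PP.world' T M hl true true hA₂
    exact PP.bind (hF := PP.challengeC' hA₁ d) (hK := PP.bind (hF := inferInstance) (hK := PP.bind (hF := h2)
      (hK := inferInstance)))
  obtain ⟨ε, hε, h⟩ := zk_transfer hZK hF
  refine ⟨ε, hε, fun κ => ?_⟩
  have main : ∀ H ∈ (𝓗 κ).support, ∀ pp ∈ (T.setup.dist H (inp κ [])).support, ∀ (S' : ZkSnark) (crs key : Val)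
      (O : Unit → Val → PMF (Val × Unit)),
      ChallengeBound T M msgLen dataFixed hl A₁ A₂ (b.eval κ) d d₂ S' H κ pp key crs O →
      pr (((challengeC T M hl dataFixed A₁ d H (inp κ [pp, crs])).bind fun x => flipC.bind fun b =>
      (world T M hl true true A₂ H (secondArg (inp κ [pp, crs]).fst x b) (world₀ (inp κ [pp, crs]).fst
        (unary (((inp κ [pp, crs]).fst.toNat + 2) ^ d₂)) ((inp κ [pp, crs]).get 1))).bind
        fun w => ret (test (Hit f b w.fst))).exec O ()) (·.1 ≠ .nil) =
      prHit T M msgLen dataFixed f S' A₁ A₂ H κ pp key crs := by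
    intro H hH pp hpp S' crs key O h
    have e : ∀ x ∈ (challenge T M msgLen dataFixed S' A₁ H κ pp key crs).support, ∀ c, _ := fun x hx c =>
      exec_world_zk (hl := hl) (dataFixed := dataFixed) (vk := crs.snd) hM hH hpp h.rel (hb κ) h.proof_le (h.bdd x hx c)
    have h1 : (inp κ [pp, crs]).fst = unary κ := rfl
    have h2 : (inp κ [pp, crs]).get 1 = pp := rfl
    rw [exec_bind, h.exec, PMF.bind_map, pr_bind, prHit]
    refine ex_congr fun x hx => ?_
    rw [Function.comp_apply, exec_bind, exec_flipC, PMF.bind_map, pr_bind]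
    refine ex_congr fun c _ => ?_
    rw [Function.comp_apply, pr_exec_test, h1, h2, toNat_unary, e x hx, pr_map]
    rfl
  refine le_trans (le_of_eq ?_) ((h κ).trans (le_of_eq ?_))
  · exact exG_congr fun H hH pp hpp => ex_congr fun crs hcrs => (main H hH pp hpp S crs _ _ ((hC κ H hH pp hpp).1 crs hcrs)).symm
  · congr 1
    exact exG_congr fun H hH pp hpp => ex_congr fun c hc => main H hH pp hpp _ _ _ _ ((hC κ H hH pp hpp).2 c hc)

/-- The second stage never gets one of the two keys from the oracles. -/
theorem redeemed_negl (dataFixed : Val) (hl : PolyLength msgLen) (hT : T.CollisionResistant) (hM : M.Correct 𝓗)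
    {A₁ A₂ : Code} (hA₁ : A₁.PPT) (hA₂ : A₂.PPT) (Sim : Simulator) : Negl fun κ => exG T κ fun H pp =>
    ex (S.setup.dist H (inp κ [pp])) fun crs => ex (challenge T M msgLen dataFixed S A₁ H κ pp crs.fst crs) fun x =>
      ex coin fun b => pr (dtlExec T M msgLen dataFixed S A₂ H κ pp crs.fst crs.snd (secondArg (unary κ) x (ofBool b)))
        fun y => ∃ r ∈ y.2.R, r.cpk = x.get 1 ∨ r.cpk = x.get 2 := by
  obtain ⟨b, d, d₂, hb, hC⟩ := exists_challengeBound (T := T) (M := M) (S := S) (Sim := Sim) (dataFixed := dataFixed)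
    hl hM hA₁ hA₂
  -- One term for each challenge key, and b bounds the number of questions of the second stage.
  refine (((pr_same_pk_negl hT).add (pr_same_pk_negl hT)).poly_mul b).mono fun κ => ?_
  rw [← exG_add, ← exG_const_mul]
  refine exG_mono fun H hH pp hpp => ex_le _ fun crs hcrs => ?_
  have hB := ((hC κ H hH pp hpp).1 crs hcrs).bdd
  have h1 : ∀ x ∈ (challenge T M msgLen dataFixed S A₁ H κ pp crs.fst crs).support, (ex coin fun b =>
      pr (dtlExec T M msgLen dataFixed S A₂ H κ pp crs.fst crs.snd (secondArg (unary κ) x (ofBool b)))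
        fun y => ∃ r ∈ y.2.R, r.cpk = x.get 1 ∨ r.cpk = x.get 2) ≤
      (b.eval κ : ℕ) * (pr (sampleKey κ) (fun k => T.pk H κ pp k = x.get 1) + pr (sampleKey κ) fun k => T.pk H κ pp k = x.get 2) := by
    intro x hx
    refine ex_le _ fun c _ => ?_
    refine le_trans (pr_mono fun y hy h => ?_) (le_trans (pr_exec_created_le (T := T) (M := M) (msgLen := msgLen) (S := S)
      (dataFixed := dataFixed) (par := ofList [crs.fst, crs.snd, pp, dataFixed]) (x := ⟨[], []⟩)
      (P := fun p => p = x.get 1 ∨ p = x.get 2) (A₂.den H (secondArg (unary κ) x (ofBool c))) (hB x hx _) (by simp)) ?_)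
    · obtain ⟨r, hr, h⟩ := h
      obtain ⟨k, hk, hkr⟩ := exists_created_of_redeemed (hB x hx _) hy r hr
      exact ⟨k, hk, by rwa [hkr]⟩
    · exact mul_le_mul' le_rfl pr_or_le
  refine (ex_mono h1).trans ?_
  rw [ex_const_mul]
  refine mul_le_mul' le_rfl ?_
  simp only [challenge, ex_bind, ex_pure, ofList_cons, get_succ, get_zero, fst_cons, snd_cons, ex_const]
  simp only [ex_add, ex_const]
  exact le_rfl

end

end
end Tumbling

namespace Tumbling
open Val

noncomputable section

open Tumbling.Comp
open scoped ENNReal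

section
variable {𝓗 : HashModel} {T : TaggingScheme 𝓗} {M : MerkleTree T.pkLen} {msgLen : ℕ → ℕ}
  {hl : PolyLength msgLen} {S : ZkSnark} {Sim : Simulator} {dataFixed : Val}

variable (msgLen dataFixed) in
/-- Simulated keys with the trapdoor, the message, and the state of the first stage. -/
def firstStage (Sim : Simulator) (A : Code) (H : Hash) (κ : ℕ) (pp : Val) : PMF Val :=
  (Sim.setup.dist H (inp κ [pp])).bind fun c => (uniformBits (msgLen κ)).bind fun m =>
    (A.dist H (inp κ [ofList [c.fst.fst, c.fst.snd, pp, dataFixed], m])).map fun a => ofList [c, m, a.get 2]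

variable (hl dataFixed) in
def firstStageC (Sim : Simulator) (A : Code) (H : Hash) (v : Val) : Comp Val :=
  (Sim.setup.muted H (ofList [v.fst, v.get 1])).bind fun c => (bitsC (hl.len H v.fst)).bind fun m =>
    (A.muted H (ofList [v.fst, ofList [c.fst.fst, c.fst.snd, v.get 1, dataFixed], m])).bind fun a =>
      ret (ofList [c, m, a.get 2])

theorem PP.firstStageC' {A : Code} (hA : A.PPT) : PP (firstStageC hl dataFixed Sim A) := by
  have h1 : PP fun H v => Sim.setup.muted H (ofList [v.fst, v.get 1]) := PP.muted_comp Sim.setup_ppt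
  have h2 : PP fun H w => A.muted H (ofList [w.snd.snd.fst, ofList [w.snd.fst.fst.fst, w.snd.fst.fst.snd, w.snd.snd.get 1,
    dataFixed], w.fst]) := PP.muted_comp hA
  exact PP.bind (hF := h1) (hK := PP.bind (hF := inferInstance) (hK := PP.bind (hF := h2) (hK := inferInstance)))

theorem distr_firstStageC {A : Code} {H : Hash} {κ : ℕ} {pp : Val} {l : List Val} :
    (firstStageC hl dataFixed Sim A H (inp κ (pp :: l))).distr = firstStage msgLen dataFixed Sim A H κ pp := by
  simp only [firstStageC, inp, ofList_cons, fst_cons, snd_cons, get_one, distr_bind, Code.distr_muted, distr_bitsC,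
    hl.len_toNat, distr_ret]
  rfl

variable (M) in
/-- A redemption with the tag `t` and a simulated proof, where `y` is the result of the first stage. -/
def simReply (Sim : Simulator) (H : Hash) (κ : ℕ) (y p₀ p₁ t : Val) : PMF Val :=
  (Sim.prove.dist H (inp κ [(y.get 0).snd, ofList [M.init.fn H (inp κ [ofList [p₀, p₁]]), t, y.get 1]])).map fun π =>
    .cons t π

variable (M) in
/-- The challenge for two tags with their public keys. -/
def simChallenge (Sim : Simulator) (H : Hash) (κ : ℕ) (y s₀ s₁ : Val) : PMF Val :=
  (simReply M Sim H κ y s₀.snd s₁.snd s₀.fst).bind fun r₀ => (simReply M Sim H κ y s₀.snd s₁.snd s₁.fst).map fun r₁ =>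
    ofList [y.get 2, s₀.snd, s₁.snd, r₀, r₁]

variable (T M hl) in
/-- The second stage with simulated proofs. -/
def simSecond (Sim : Simulator) (A : Code) (H : Hash) (κ : ℕ) (pp τ a : Val) : PMF (Val × WState) :=
  (A.den H a).exec (worldO T M hl false H κ pp (simProver Sim H κ τ)) ⟨[], [], []⟩

variable (T M hl) in
-- With simulated proofs and erased secret keys, the experiment depends on the challenge keys only
-- through s₀ and s₁, each a tag with its public key.
def simHit (f : Bool) (Sim : Simulator) (A : Code) (H : Hash) (κ : ℕ) (pp y s₀ s₁ : Val) : ℝ≥0∞ :=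
  ex (simChallenge M Sim H κ y s₀ s₁) fun x => ex coin fun b =>
    pr (simSecond T M hl Sim A H κ pp (y.get 0).snd (secondArg (unary κ) x (ofBool b))) fun z => Hit f (ofBool b) z.1

variable (T) in
/-- A tag with its public key, either of a random key or random. -/
def slot (z : Bool) (H : Hash) (κ : ℕ) (pp : Val) : PMF Val :=
  match z with
  | false => (sampleKey κ).map fun k => .cons (T.tag H κ pp k) (T.pk H κ pp k)
  | true => (uniformBits (T.tagLen κ)).bind fun t => (uniformBits (T.pkLen κ)).map fun p => .cons t p

variable (T) in
def slotC (z : Bool) (H : Hash) (κV pp : Val) : Comp Val :=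
  match z with
  | false => (keyC κV).bind fun k => ret (.cons (T.tagEval.fn H (ofList [κV, pp, k])) (T.keyGen.fn H (ofList [κV, pp, k])))
  | true => (bitsC (T.tagLen_poly.len H κV)).bind fun t => (bitsC (T.pkLen_poly.len H κV)).bind fun p => ret (.cons t p)

instance PP.slotC' (z : Bool) {f g : Hash → Val → Val} [hf : PolyFn f] [hg : PolyFn g] :
    PP fun H v => slotC T z H (f H v) (g H v) := by
  refine PP.subst₂ (G := slotC T z) ?_
  cases z <;> (dsimp only [slotC]; infer_instance)

theorem distr_slotC {z : Bool} {H : Hash} {κ : ℕ} {pp : Val} :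
    (slotC T z H (unary κ) pp).distr = slot T z H κ pp := by
  cases z
  · simp only [slotC, slot, distr_bind, distr_keyC, toNat_unary, distr_ret]; rfl
  · simp only [slotC, slot, distr_bind, distr_bitsC, PolyLength.len_toNat, distr_ret]; rfl

theorem mem_of_mem_support_slot {z : Bool} {H : Hash} {κ : ℕ} {pp s : Val} (hH : H ∈ (𝓗 κ).support)
    (hpp : pp ∈ (T.setup.dist H (inp κ [])).support) (h : s ∈ (slot T z H κ pp).support) :
    s.fst ∈ bitStrings (T.tagLen κ) ∧ s.snd ∈ bitStrings (T.pkLen κ) := by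
  cases z
  · simp only [slot, PMF.mem_support_map_iff] at h
    obtain ⟨k, hk, rfl⟩ := h
    exact ⟨T.tagEval_mem κ H hH pp hpp k (mem_keySpace_of_mem_support hk),
      T.keyGen_mem κ H hH pp hpp k (mem_keySpace_of_mem_support hk)⟩
  · simp only [slot, PMF.mem_support_bind_iff, PMF.mem_support_map_iff, support_uniformBits] at h
    obtain ⟨t, ht, p, hp, rfl⟩ := h
    exact ⟨ht, hp⟩

/-- The simulator does not see witnesses, so the secret keys enter only through tag and public key,
and sampling a key becomes sampling a pair. -/
theorem exG_prHit_sim {A₁ A₂ : Code} (hA₂ : A₂.PPT) (f : Bool) (κ : ℕ) :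
    (exG T κ fun H pp => ex (Sim.setup.dist H (inp κ [pp])) fun c =>
      prHit T M msgLen dataFixed f (simSnark S Sim) A₁ A₂ H κ pp c.snd c.fst) =
    exG T κ fun H pp => ex (firstStage msgLen dataFixed Sim A₁ H κ pp) fun y => ex (slot T false H κ pp) fun s₀ =>
      ex (slot T false H κ pp) fun s₁ => simHit T M hl f Sim A₂ H κ pp y s₀ s₁ := by
  obtain ⟨pb, hpb⟩ := hA₂.bdd
  refine exG_congr fun H hH pp hpp => ?_
  have e : ∀ (c x : Val) (b : Bool),
      (pr (dtlExec T M msgLen dataFixed (simSnark S Sim) A₂ H κ pp c.snd c.fst.snd (secondArg (unary κ) x (ofBool b)))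
        fun y => Hit f (ofBool b) y.1) =
      pr (simSecond T M hl Sim A₂ H κ pp c.snd (secondArg (unary κ) x (ofBool b))) fun z => Hit f (ofBool b) z.1 := by
    intro c x b
    rw [simSecond, dtlExec_toWorld (S := simSnark S Sim) (key := c.snd) (vk := c.fst.snd) (dataFixed := dataFixed) hH hpp
      (fun k' _ q => by rw [simSnark_prove]; rfl) (hpb H _ _ le_rfl), pr_map]
  simp only [prHit, firstStage, slot, challenge, ex_bind, ex_map, ex_pure, e, simHit, simChallenge, simReply, redemption,
    simSnark_prove]
  rfl

end

end
end Tumbling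

namespace Tumbling
open Val

noncomputable section

open Tumbling.Comp
open scoped ENNReal

section
variable {𝓗 : HashModel} {T : TaggingScheme 𝓗} {M : MerkleTree T.pkLen} {msgLen : ℕ → ℕ}
  {hl : PolyLength msgLen} {S : ZkSnark} {Sim : Simulator} {dataFixed : Val}

variable (M) in
def simReplyC (Sim : Simulator) (H : Hash) (κV y p₀ p₁ t : Val) : Comp Val :=
  (Sim.prove.muted H (ofList [κV, (y.get 0).snd, ofList [M.init.fn H (ofList [κV, ofList [p₀, p₁]]), t, y.get 1]])).bind
    fun π => ret (.cons t π)

variable (M) in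
/-- The challenge with simulated proofs as a program. -/
def simChallengeC (Sim : Simulator) (H : Hash) (w : Val) : Comp Val :=
  (simReplyC M Sim H w.fst (w.get 2) (w.get 3).snd (w.get 4).snd (w.get 3).fst).bind fun r₀ =>
  (simReplyC M Sim H w.fst (w.get 2) (w.get 3).snd (w.get 4).snd (w.get 4).fst).bind fun r₁ =>
    ret (ofList [(w.get 2).get 2, (w.get 3).snd, (w.get 4).snd, r₀, r₁])

theorem PP.simChallengeC' : PP (simChallengeC M Sim) := by
  have h1 : PP fun H w => simReplyC M Sim H w.fst (w.get 2) (w.get 3).snd (w.get 4).snd (w.get 3).fst := by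
    have : PP fun H w => Sim.prove.muted H (ofList [w.fst, ((w.get 2).get 0).snd, ofList [M.init.fn H (ofList [w.fst,
      ofList [(w.get 3).snd, (w.get 4).snd]]), (w.get 3).fst, (w.get 2).get 1]]) := PP.muted_comp Sim.prove_ppt
    unfold simReplyC; infer_instance
  have h2 : PP fun H u => simReplyC M Sim H u.snd.fst (u.snd.get 2) (u.snd.get 3).snd (u.snd.get 4).snd (u.snd.get 4).fst := by
    have : PP fun H u => Sim.prove.muted H (ofList [u.snd.fst, ((u.snd.get 2).get 0).snd, ofList [M.init.fn H (ofList
      [u.snd.fst, ofList [(u.snd.get 3).snd, (u.snd.get 4).snd]]), (u.snd.get 4).fst, (u.snd.get 2).get 1]]) :=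
      PP.muted_comp Sim.prove_ppt
    unfold simReplyC; infer_instance
  exact PP.bind (hF := h1) (hK := PP.bind (hF := h2) (hK := inferInstance))

theorem distr_simChallengeC {H : Hash} {κ : ℕ} {pp y s₀ s₁ : Val} :
    (simChallengeC M Sim H (inp κ [pp, y, s₀, s₁])).distr = simChallenge M Sim H κ y s₀ s₁ := by
  simp only [simChallengeC, simReplyC, inp, ofList_cons, ofList_nil, fst_cons, snd_cons, get_succ, get_zero, distr_bind,
    Code.distr_muted, distr_ret, PMF.bind_bind, PMF.pure_bind, simChallenge, simReply, PMF.map, Function.comp_def]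

theorem distr_flipC : flipC.distr = coin.map ofBool := by simp [flipC]; rfl

/-- The trapdoor is part of the first stage's result, so the remaining experiment is a program
without an oracle and can serve as a distinguisher for pseudorandomness. The bounds on the pairs
hold for real and for random ones, so the same program works in every hybrid. -/
theorem exists_program_simHit {A₁ A₂ : Code} (hA₁ : A₁.PPT) (hA₂ : A₂.PPT) (f : Bool) :
    ∃ F : Hash → Val → Comp Val, PP F ∧ ∀ κ, ∀ H ∈ (𝓗 κ).support, ∀ pp ∈ (T.setup.dist H (inp κ [])).support,
      ∀ y ∈ (firstStage msgLen dataFixed Sim A₁ H κ pp).support, ∀ s₀ s₁ : Val,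
      s₀.fst ∈ bitStrings (T.tagLen κ) → s₀.snd ∈ bitStrings (T.pkLen κ) →
      s₁.fst ∈ bitStrings (T.tagLen κ) → s₁.snd ∈ bitStrings (T.pkLen κ) →
      pr (F H (inp κ [pp, y, s₀, s₁])).distr (· ≠ .nil) = simHit T M hl f Sim A₂ H κ pp y s₀ s₁ := by
  obtain ⟨pk, hpk⟩ := T.pkLen_poly.bound
  obtain ⟨pt, hpt⟩ := T.tagLen_poly.bound
  obtain ⟨ps, hps⟩ := exists_size_setup T ⟨Sim.setup, Sim.setup, T.keyGen, Sim.setup_ppt, Sim.setup_ppt, T.keyGen_ppt, T.keyGen_det⟩ Sim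
  obtain ⟨py, hpy⟩ := (PP.firstStageC' (hl := hl) (dataFixed := dataFixed) (Sim := Sim) hA₁).size
  obtain ⟨px, hpx⟩ := (PP.simChallengeC' (M := M) (Sim := Sim)).size
  set pa : Polynomial ℕ := 2 * .X + 20 + 5 * px.comp (2 * .X + 20 + ps + py.comp (2 * .X + 10 + ps) + 8 * pk + 8 * pt) with hpa
  obtain ⟨b, d, hb, -, hbdd, hf⟩ := exists_fuel (T := T) M hl ⟨Sim.setup, Sim.setup, T.keyGen, Sim.setup_ppt, Sim.setup_ppt,
    T.keyGen_ppt, T.keyGen_det⟩ Sim hA₂ pa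
  have hB : PP fun H v => world T M hl false false A₂ H (v.get 2) (world₀ v.fst (unary ((v.fst.toNat + 2) ^ d)) (v.get 1)) := by
    have : PolyFn fun H v => world₀ v.fst (unary ((v.fst.toNat + 2) ^ d)) (v.get 1) := by
      unfold world₀; infer_instance
    exact PP.world' T M hl false false hA₂
  obtain ⟨B, hB, hBden⟩ := hB
  obtain ⟨pb, hpb⟩ := hB.bdd
  obtain ⟨k, hk⟩ := exists_pow_bound (pb.comp (2 * .X + 10 + ps + pa))
  -- The transcript kept by `record` is not needed; its role is to answer the questions for
  -- simulated proofs.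
  refine ⟨fun H w => (simChallengeC M Sim H w).bind fun x => flipC.bind fun c => (record Sim B H
    (ofList [w.fst, w.get 1, secondArg w.fst x c]) (.cons (ofList [w.fst, unary ((w.fst.toNat + 2) ^ k),
      ((w.get 2).get 0).snd]) (.cons .nil .nil))).bind fun r => ret (test (Hit f c r.fst.fst)), ?_, ?_⟩
  · have h1 : PP fun H w => record Sim B H (ofList [w.snd.snd.fst, w.snd.snd.get 1, secondArg w.snd.snd.fst w.snd.fst w.fst])
      (.cons (ofList [w.snd.snd.fst, unary ((w.snd.snd.fst.toNat + 2) ^ k), ((w.snd.snd.get 2).get 0).snd])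
        (.cons .nil .nil)) := PP.record' Sim hB
    exact PP.bind (hF := PP.simChallengeC') (hK := PP.bind (hF := inferInstance) (hK := PP.bind (hF := h1)
      (hK := inferInstance)))
  intro κ H hH pp hpp y hy s₀ s₁ h₁ h₂ h₃ h₄
  have hsy : y.size ≤ py.eval (2 * κ + 10 + ps.eval κ) ∧ pp.size ≤ ps.eval κ ∧
      ∃ c ∈ (Sim.setup.dist H (inp κ [pp])).support, c = y.get 0 := by
    have hy' := hy
    simp only [firstStage, PMF.mem_support_bind_iff, PMF.mem_support_map_iff] at hy'
    obtain ⟨c, hc, m, -, a, -, rfl⟩ := hy'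
    have h5 := (hps H κ pp hpp).2 c hc
    refine ⟨?_, by omega, c, hc, by simp⟩
    rw [← distr_firstStageC (hl := hl) (l := [])] at hy
    refine (hpy H _ _ (out_of_mem_support_distr hy)).trans (eval_mono py ?_)
    rw [size_inp]; simp; omega
  obtain ⟨hy1, hpp1, c₀, hc₀, hc₁⟩ := hsy
  have hsz : ∀ x ∈ (simChallenge M Sim H κ y s₀ s₁).support, ∀ c, (secondArg (unary κ) x c).size ≤ pa.eval κ := by
    intro x hx c
    rw [← distr_simChallengeC (pp := pp)] at hx
    have h5 := hpx H _ _ (out_of_mem_support_distr hx)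
    have h6 := size_of_mem_bitStrings h₁
    have h7 := size_of_mem_bitStrings h₂
    have h8 := size_of_mem_bitStrings h₃
    have h9 := size_of_mem_bitStrings h₄
    have h10 := hpk κ
    have h11 := hpt κ
    have hs : ∀ s : Val, s.size ≤ s.fst.size + s.snd.size + 1 := fun s => by cases s <;> simp
    have h12 := hs s₀
    have h13 := hs s₁
    have h14 := eval_mono px (show (inp κ [pp, y, s₀, s₁]).size ≤ 2 * κ + 20 + ps.eval κ +
        py.eval (2 * κ + 10 + ps.eval κ) + 8 * pk.eval κ + 8 * pt.eval κ by
      rw [size_inp]; simp; omega)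
    have h15 := size_secondArg κ x c
    simp only [hpa, Polynomial.eval_add, Polynomial.eval_mul, Polynomial.eval_ofNat, Polynomial.eval_X, Polynomial.eval_comp]
    dsimp only at h14
    omega
  have hw1 : (inp κ [pp, y, s₀, s₁]).fst = unary κ := rfl
  have hw2 : (inp κ [pp, y, s₀, s₁]).get 1 = pp := rfl
  have hw3 : (inp κ [pp, y, s₀, s₁]).get 2 = y := rfl
  rw [distr_bind, distr_simChallengeC, pr_bind, simHit]
  refine ex_congr fun x hx => ?_
  rw [distr_bind, distr_flipC, PMF.bind_map, pr_bind]
  refine ex_congr fun c _ => ?_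
  simp only [Function.comp_apply, hw1, hw2, hw3, distr_bind, toNat_unary]
  have hb₂ := hbdd κ H _ (hsz x hx (ofBool c))
  have e₁ := distr_record Sim (τ := (y.get 0).snd) (κ := κ) (hk κ) (hpb H (inp κ [pp, secondArg (unary κ) x (ofBool c)])
    ((2 * .X + 10 + ps + pa : Polynomial ℕ).eval κ) (by
      have := hsz x hx (ofBool c)
      rw [size_inp]
      simp
      omega) |>.mono (by simp) le_rfl) []
  have e₂ := exec_world_se (T := T) (M := M) (hl := hl) (Sim := Sim) (keep := false) (pp := pp) (τ := (y.get 0).snd) (hb κ)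
    (fun e q hq hv => hc₁ ▸ (hf κ H pp hpp).2 c₀ hc₀ e q hq hv) hb₂ ⟨[], [], []⟩
  simp only [recState, ofList_nil, inp, ofList_cons] at e₁ ⊢
  rw [e₁, PMF.bind_map, pr_bind]
  have e₃ : B.den H ((unary κ).cons (pp.cons ((secondArg (unary κ) x (ofBool c)).cons nil))) =
      world T M hl false false A₂ H (secondArg (unary κ) x (ofBool c)) (WState.enc (ofList [unary κ, unary ((κ + 2) ^ d), pp])
        ⟨[], [], []⟩) := by
    rw [hBden]; simp [world₀, WState.enc]
  have e₄ := ex_map (p := (B.den H ((unary κ).cons (pp.cons ((secondArg (unary κ) x (ofBool c)).cons nil)))).run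
    (ZkSnark.simOracle Sim H κ (y.get 0).snd) []) (fun r => (r.1, r.2.1)) fun z =>
      pr (PMF.pure (test (Hit f (ofBool c) z.1.fst))) (· ≠ .nil)
  rw [run_map_exec, e₃] at e₄
  rw [e₃]
  refine Eq.trans ?_ (e₄.symm.trans ?_)
  · refine ex_congr fun z _ => ?_
    simp
  · rw [e₂, ex_map, simSecond, pr_eq_ex]
    refine ex_congr fun z _ => ?_
    by_cases h : Hit f (ofBool c) z.1 <;> simp [pr_pure, h]

end

end
end Tumbling

namespace Tumbling
open Val

noncomputable section

open Tumbling.Comp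
open scoped ENNReal

section
variable {𝓗 : HashModel} {T : TaggingScheme 𝓗} {M : MerkleTree T.pkLen} {msgLen : ℕ → ℕ}
  {hl : PolyLength msgLen} {S : ZkSnark} {Sim : Simulator} {dataFixed : Val}

/-- The second hypothesis is a lower bound on the success probability, stated additively to avoid
subtraction in `ℝ≥0∞`. -/
theorem Negl.negligible_abs_sub_half {e : ℕ → PMF Prop} {f : ℕ → ℝ≥0∞} (hf : Negl f)
    (h₁ : ∀ κ, (pr (e κ) fun P => P) ≤ 2⁻¹ + f κ) (h₂ : ∀ κ, 1 ≤ (pr (e κ) fun P => P) + (2⁻¹ + f κ)) :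
    Negligible fun κ => |prob (e κ) - 1 / 2| := by
  refine Asymptotics.SuperpolynomialDecay.trans_abs_le hf.2 fun κ => ?_
  have h3 : (2⁻¹ + f κ).toReal = 1 / 2 + (f κ).toReal := by
    rw [ENNReal.toReal_add (by simp) (hf.1 κ)]; simp
  have h4 : (2⁻¹ + f κ) ≠ ∞ := by simp [hf.1 κ]
  have h5 := ENNReal.toReal_mono h4 (h₁ κ)
  have h6 := ENNReal.toReal_mono (ENNReal.add_ne_top.2 ⟨pr_ne_top, h4⟩) (h₂ κ)
  rw [ENNReal.toReal_add pr_ne_top h4, ENNReal.toReal_one] at h6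
  rw [prob_eq, abs_abs, abs_of_nonneg (ENNReal.toReal_nonneg (a := f κ)), abs_le]
  constructor <;> linarith

variable (msgLen Sim dataFixed) in
/-- A tag with its public key can be replaced by random strings, in the presence of another pair. -/
theorem slot_transfer (hl : PolyLength msgLen) (hT : T.Pseudorandom) {A : Code} (hA : A.PPT) (z : Bool)
    {F : Hash → Val → Comp Val} (hF : PP F) : ∃ ε, Negl ε ∧ ∀ κ,
    (exG T κ fun H pp => ex (firstStage msgLen dataFixed Sim A H κ pp) fun y => ex (slot T false H κ pp) fun s =>
      ex (slot T z H κ pp) fun o => pr (F H (inp κ [pp, y, s, o])).distr (· ≠ .nil)) ≤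
    (exG T κ fun H pp => ex (firstStage msgLen dataFixed Sim A H κ pp) fun y => ex (slot T true H κ pp) fun s =>
      ex (slot T z H κ pp) fun o => pr (F H (inp κ [pp, y, s, o])).distr (· ≠ .nil)) + ε κ := by
  have h1 : PP fun H w => F H (ofList [w.snd.snd.fst, w.snd.snd.get 1, w.snd.fst, .cons (w.snd.snd.get 2) (w.snd.snd.get 3),
    w.fst]) := PP.subst hF inferInstance
  -- The distinguisher samples the simulated keys, the first stage and the other pair itself; only
  -- the pair s is its challenge.
  obtain ⟨ε, hε, h⟩ := hT.transfer (PP.bind (hF := PP.firstStageC' (hl := hl) (dataFixed := dataFixed) (Sim := Sim) hA)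
    (K := fun H v y => (slotC T z H v.fst (v.get 1)).bind fun o => F H (ofList [v.fst, v.get 1, y, .cons (v.get 2) (v.get 3), o]))
    (hK := PP.bind (hF := inferInstance) (hK := h1)))
  refine ⟨ε, hε, fun κ => ?_⟩
  have e : ∀ (H : Hash) (pp t p : Val), pr ((firstStageC hl dataFixed Sim A H (inp κ [pp, t, p])).bind fun y =>
      (slotC T z H (inp κ [pp, t, p]).fst ((inp κ [pp, t, p]).get 1)).bind fun o => F H (ofList [(inp κ [pp, t, p]).fst,
        (inp κ [pp, t, p]).get 1, y, .cons ((inp κ [pp, t, p]).get 2) ((inp κ [pp, t, p]).get 3), o])).distr (· ≠ .nil) =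
      ex (firstStage msgLen dataFixed Sim A H κ pp) fun y => ex (slot T z H κ pp) fun o =>
        pr (F H (inp κ [pp, y, .cons t p, o])).distr (· ≠ .nil) := by
    intro H pp t p
    have h1 : (inp κ [pp, t, p]).fst = unary κ := rfl
    have h2 : (inp κ [pp, t, p]).get 1 = pp := rfl
    have h3 : (inp κ [pp, t, p]).get 2 = t := rfl
    have h4 : (inp κ [pp, t, p]).get 3 = p := rfl
    simp only [h1, h2, h3, h4, distr_bind, distr_firstStageC, distr_slotC, pr_bind]
    rfl
  refine le_trans (le_of_eq ?_) ((h κ).trans (le_of_eq ?_))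
  · refine exG_congr fun H _ pp _ => ?_
    simp only [e]
    rw [ex_comm (p := sampleKey κ)]
    simp only [slot, ex_map]
  · congr 1
    refine exG_congr fun H _ pp _ => ?_
    simp only [e]
    rw [ex_congr (p := uniformBits (T.tagLen κ)) fun t _ => ex_comm (p := uniformBits (T.pkLen κ)) _ _,
      ex_comm (p := uniformBits (T.tagLen κ))]
    simp only [slot, ex_bind, ex_map]

/-- An observer cannot tell the order of two samples of the same distribution. -/
theorem ex_order {α β : Type} (ρ : PMF α) (K : α → α → PMF β) (P Q : β → Prop)
    (h : ∀ a b, pr (K a b) P + pr (K a b) Q = 1) :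
    (ex ρ fun r₀ => ex ρ fun r₁ => 2⁻¹ * pr (K r₁ r₀) P + 2⁻¹ * pr (K r₀ r₁) Q) = 2⁻¹ := by
  simp only [ex_add, ex_const_mul]
  rw [ex_comm (p := ρ), ← mul_add, ← ex_add]
  simp only [← ex_add, h, ex_const, mul_one]

/-- Random tags are independent of the public keys. For fixed public keys the two redemptions are
therefore independent samples of one distribution, and exchanging them changes nothing; the guess is
right, and wrong, with probability exactly 1/2. -/
theorem ex_simHit_random (f : Bool) (A : Code) (H : Hash) (κ : ℕ) (pp y : Val) :
    (ex (slot T true H κ pp) fun s₀ => ex (slot T true H κ pp) fun s₁ => simHit T M hl f Sim A H κ pp y s₀ s₁) = 2⁻¹ := by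
  -- The public keys are fixed, since both proofs refer to the root of both of them; only the tags
  -- and the proofs are exchanged.
  have key : ∀ p₀ p₁ : Val, (ex (uniformBits (T.tagLen κ)) fun t₀ => ex (uniformBits (T.tagLen κ)) fun t₁ =>
      simHit T M hl f Sim A H κ pp y (.cons t₀ p₀) (.cons t₁ p₁)) = 2⁻¹ := by
    intro p₀ p₁
    have h := ex_order ((uniformBits (T.tagLen κ)).bind fun t => simReply M Sim H κ y p₀ p₁ t)
      (fun r r' => simSecond T M hl Sim A H κ pp (y.get 0).snd (ofList [unary κ, y.get 2, p₀, p₁, r, r']))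
      (fun z => Hit f (ofBool true) z.1) (fun z => Hit f (ofBool false) z.1) (fun a b => by
        cases f
        · rw [add_comm]
          simpa [Hit] using pr_add_not (p := simSecond T M hl Sim A H κ pp (y.get 0).snd
            (ofList [unary κ, y.get 2, p₀, p₁, a, b])) (P := fun z => z.1 ≠ .nil)
        · simpa [Hit] using pr_add_not (p := simSecond T M hl Sim A H κ pp (y.get 0).snd
            (ofList [unary κ, y.get 2, p₀, p₁, a, b])) (P := fun z => z.1 ≠ .nil))
    rw [← h]
    simp only [ex_bind]
    refine ex_congr fun t₀ _ => ?_
    rw [ex_comm (p := simReply M Sim H κ y p₀ p₁ t₀)]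
    refine ex_congr fun t₁ _ => ?_
    simp only [simHit, simChallenge, ex_bind, ex_map, ex_coin, fst_cons, snd_cons]
    refine ex_congr fun r₀ _ => ex_congr fun r₁ _ => ?_
    simp [secondArg]
  simp only [slot, ex_bind, ex_map]
  rw [ex_comm (p := uniformBits (T.tagLen κ)), ex_congr fun p₀ _ => ex_congr fun t₀ _ =>
    ex_comm (p := uniformBits (T.tagLen κ)) _ _, ex_congr fun p₀ _ => ex_comm (p := uniformBits (T.tagLen κ)) _ _]
  simp only [key, ex_const]

/-- The hybrids are: honest proofs, simulated proofs, first pair random, both pairs random. The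
bound is needed for right guesses and for wrong ones, because the success probability has to be
bounded on both sides. -/
theorem prHit_le (dataFixed : Val) (hl : PolyLength msgLen) (hT : T.Pseudorandom) (hM : M.Correct 𝓗)
    (hZK : S.ZeroKnowledge 𝓗 (fixedRelation T M msgLen) Sim) {A₁ A₂ : Code} (hA₁ : A₁.PPT) (hA₂ : A₂.PPT) (f : Bool) :
    ∃ ε, Negl ε ∧ ∀ κ, (exG T κ fun H pp => ex (S.setup.dist H (inp κ [pp])) fun crs =>
      prHit T M msgLen dataFixed f S A₁ A₂ H κ pp crs.fst crs) ≤ 2⁻¹ + ε κ := by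
  obtain ⟨ε₁, hε₁, h₁⟩ := prHit_transfer dataFixed hl hM hZK hA₁ hA₂ f
  obtain ⟨F, hF, hFe⟩ := exists_program_simHit (T := T) (M := M) (hl := hl) (Sim := Sim) (dataFixed := dataFixed)
    hA₁ hA₂ f
  obtain ⟨ε₂, hε₂, h₂⟩ := slot_transfer msgLen Sim dataFixed hl hT hA₁ false hF
  -- The second pair is replaced by the same lemma with the places of the two pairs exchanged, the
  -- first pair being random already.
  obtain ⟨ε₃, hε₃, h₃⟩ := slot_transfer msgLen Sim dataFixed hl hT hA₁ true
    (F := fun H v => F H (ofList [v.fst, v.get 1, v.get 2, v.get 4, v.get 3])) (PP.subst hF inferInstance)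
  refine ⟨_, (hε₃.add hε₂).add hε₁, fun κ => ?_⟩
  have e : ∀ z z' : Bool, (exG T κ fun H pp => ex (firstStage msgLen dataFixed Sim A₁ H κ pp) fun y =>
      ex (slot T z H κ pp) fun s₀ => ex (slot T z' H κ pp) fun s₁ => simHit T M hl f Sim A₂ H κ pp y s₀ s₁) =
      exG T κ fun H pp => ex (firstStage msgLen dataFixed Sim A₁ H κ pp) fun y =>
      ex (slot T z H κ pp) fun s₀ => ex (slot T z' H κ pp) fun s₁ => pr (F H (inp κ [pp, y, s₀, s₁])).distr (· ≠ .nil) := by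
    intro z z'
    refine exG_congr fun H hH pp hpp => ex_congr fun y hy => ex_congr fun s₀ hs₀ => ex_congr fun s₁ hs₁ => ?_
    obtain ⟨a, b⟩ := mem_of_mem_support_slot hH hpp hs₀
    obtain ⟨c, d⟩ := mem_of_mem_support_slot hH hpp hs₁
    exact (hFe κ H hH pp hpp y hy s₀ s₁ a b c d).symm
  have e' : ∀ z : Bool, (exG T κ fun H pp => ex (firstStage msgLen dataFixed Sim A₁ H κ pp) fun y =>
      ex (slot T z H κ pp) fun s => ex (slot T true H κ pp) fun o => pr (F H (ofList [(inp κ [pp, y, s, o]).fst,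
        (inp κ [pp, y, s, o]).get 1, (inp κ [pp, y, s, o]).get 2, (inp κ [pp, y, s, o]).get 4,
        (inp κ [pp, y, s, o]).get 3])).distr (· ≠ .nil)) =
      exG T κ fun H pp => ex (firstStage msgLen dataFixed Sim A₁ H κ pp) fun y =>
      ex (slot T true H κ pp) fun s₀ => ex (slot T z H κ pp) fun s₁ => pr (F H (inp κ [pp, y, s₀, s₁])).distr (· ≠ .nil) := by
    intro z
    refine exG_congr fun H hH pp hpp => ex_congr fun y hy => ?_
    rw [ex_comm (p := slot T z H κ pp)]
    rfl
  have h4 := h₁ κ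
  rw [exG_prHit_sim (hl := hl) hA₂, e] at h4
  have h5 := h₃ κ
  rw [e', e', ← e true true] at h5
  simp only [ex_simHit_random, ex_const, exG] at h5
  refine h4.trans ?_
  rw [← add_assoc]
  refine add_le_add ((h₂ κ).trans ?_) le_rfl
  rw [← add_assoc]
  exact add_le_add h5 le_rfl

/-- Success implies a right guess, which gives the upper bound. Failure implies a wrong guess or a
redemption of a challenge key, which gives the lower bound. -/
theorem unlinkability (dataFixed : Val) (hl : PolyLength msgLen) (hT : T.Secure) (hM : M.Correct 𝓗)
    (hZK : S.ZeroKnowledge 𝓗 (fixedRelation T M msgLen) Sim) :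
    (dtlFixed T M msgLen S dataFixed).Unlinkability 𝓗 := by
  intro A₁ A₂ hA₁ hA₂
  obtain ⟨ε₁, hε₁, h₁⟩ := prHit_le dataFixed hl hT.2.2 hM hZK hA₁ hA₂ true
  obtain ⟨ε₂, hε₂, h₂⟩ := prHit_le dataFixed hl hT.2.2 hM hZK hA₁ hA₂ false
  have h₃ := redeemed_negl (S := S) dataFixed hl hT.2.1 hM hA₁ hA₂ Sim
  refine Negl.negligible_abs_sub_half (hε₁.add (hε₂.add h₃)) (fun κ => ?_) fun κ => ?_
  · refine le_trans ?_ ((h₁ κ).trans (add_le_add le_rfl (le_add_right le_rfl)))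
    rw [unlink_eq hM]
    refine exG_mono fun H _ pp _ => ex_mono fun crs _ => ex_mono fun x _ => ex_mono fun b _ => pr_mono fun y _ h => ?_
    cases b <;> simpa [Hit] using h.1
  · rw [unlink_eq hM]
    refine le_trans ?_ (add_le_add le_rfl (le_trans (add_le_add (h₂ κ) (le_refl (exG T κ fun H pp =>
      ex (S.setup.dist H (inp κ [pp])) fun crs => ex (challenge T M msgLen dataFixed S A₁ H κ pp crs.fst crs) fun x =>
      ex coin fun b => pr (dtlExec T M msgLen dataFixed S A₂ H κ pp crs.fst crs.snd (secondArg (unary κ) x (ofBool b)))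
        fun y => ∃ r ∈ y.2.R, r.cpk = x.get 1 ∨ r.cpk = x.get 2))) ?_))
    -- Writing 1 as an expectation allows the comparison to be made for each outcome of the
    -- challenge and of the bit.
    · have h5 : (1 : ℝ≥0∞) = exG T κ fun H pp => ex (S.setup.dist H (inp κ [pp])) fun crs =>
          ex (challenge T M msgLen dataFixed S A₁ H κ pp crs.fst crs) fun x => ex coin fun b => 1 := by
        simp [exG]
      refine h5.trans_le ?_
      simp only [prHit]
      simp only [← exG_add, ← ex_add]
      refine exG_mono fun H _ pp _ => ex_mono fun crs _ => ex_mono fun x _ => ex_mono fun b _ => ?_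
      rw [← pr_add_not (P := fun y : Val × OracleState => (b = true ↔ y.1 ≠ .nil) ∧ ¬ ∃ r ∈ y.2.R, r.cpk = x.get 1 ∨
        r.cpk = x.get 2)]
      refine add_le_add le_rfl (le_trans (pr_mono fun y _ h => ?_) pr_or_le)
      by_cases h7 : ∃ r ∈ y.2.R, r.cpk = x.get 1 ∨ r.cpk = x.get 2
      · exact .inr h7
      · refine .inl fun h8 => h ⟨?_, h7⟩
        cases b <;> simpa using h8
    · rw [add_assoc]
      exact add_le_add le_rfl (le_add_left le_rfl)

end

end
end Tumbling

theorem theorem1 (𝓗 : Tumbling.HashModel) (T : Tumbling.TaggingScheme 𝓗)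
    (M : Tumbling.MerkleTree T.pkLen) (S : Tumbling.ZkSnark)
    (msgLen : ℕ → ℕ) (hmsgLen : Tumbling.PolyLength msgLen) (dataFixed : Tumbling.Val)
    (hS : S.Secure 𝓗 (Tumbling.fixedRelation T M msgLen))
    (hM : M.Secure 𝓗) (hT : T.Secure) :
    (Tumbling.dtlFixed T M msgLen S dataFixed).Correct 𝓗 ∧
    (Tumbling.dtlFixed T M msgLen S dataFixed).NoOneMoreRedeeming 𝓗 ∧
    (Tumbling.dtlFixed T M msgLen S dataFixed).TheftPrevention 𝓗 ∧
    (Tumbling.dtlFixed T M msgLen S dataFixed).NonSlanderability 𝓗 ∧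
    (Tumbling.dtlFixed T M msgLen S dataFixed).Unlinkability 𝓗 := by
  obtain ⟨hC, Sim, hZK, hSE⟩ := hS
  exact ⟨Tumbling.correct hM.1 hC, Tumbling.noOneMoreRedeeming dataFixed hT hM hZK hSE,
    Tumbling.theftPrevention dataFixed hmsgLen hT hM hZK hSE, Tumbling.nonSlanderability dataFixed hmsgLen hT hM hZK hSE,
    Tumbling.unlinkability dataFixed hmsgLen hT hM.1 hZK⟩
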